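/- **Setting.** Let $M>0$, $|a|<1$, $\nu>0$, and put $\Delta_r=(r^2+a^2)(1+r^2)-2Mr$, $\Delta_\theta=1-a^2\cos^2\theta$, $\varrho^2=r^2+a^2\cos^2\theta$. Assume that $\Delta_r$ has a positive root, that $r_+$ is its largest root, and that $\Delta_r'(r_+)>0$. The Kerr–AdS metric $g$ (with $\Lambda=-3$, signature $(+,-,-,-)$) is given in Kerr-star coordinates $(t^\star,r,\theta,\phi^\star)$ by its dual metric $$\varrho^2g^{-1}=-\Delta_r(\partial_r+f_+\partial_{t^\star})^2-\Delta_\theta\partial_\theta^2-2(1-a^2)(\partial_r+f_+\partial_{t^\star})\big((r^2+a^2)\partial_{t^\star}+a\,\partial_{\phi^\star}\big)-\frac{(1-a^2)^2}{\Delta_\theta\sin^2\theta}\big(a\sin^2\theta\,\partial_{t^\star}+\partial_{\phi^\star}\big)^2 .$$ Here $f_+$ is a real function, smooth on $(r_+-\delta,\infty)$ for some $\delta>0$, such that $g^{-1}(dt^\star,dt^\star)>0$ for $r\ge r_+$ (the slices $t^\star=\text{const}$ are spacelike) and such that $f_+(r)=r^{-2}G(1/r)$ for large $r$ with $G$ smooth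 near $0$ and $G(0)=a^2-1$ (the slices meet the conformal boundary smoothly, and orthogonally for $r^{-2}g$); for instance $f_+(r)=(a^2-1)/(r^2+1)$. Let $X_0=(r_+,\infty)\times\mathbb S^2=\{t^\star=0,\ r>r_+\}$, let $h$ be the restriction of $-g$ to $TX_0$ and $dS_t$ its volume measure, and let $\|u\|_{\mathcal L^2(X_0)}^2=\int_{X_0}|u|^2\,r^{-1}dS_t$. Let $\mathcal H^1(X_0)$ be the space of $u\in\mathcal L^2(X_0)$ with $$\int_{X_0} r^2\,h^{-1}(\tilde d u,\tilde d\bar u)\,r^{-1}dS_t<\infty,\qquad \tilde d u=r^{\nu-3/2}\,d\big(r^{3/2-\nu}u\big),$$ derivatives being taken in the sense of distributions. For $\lambda\in\mathbb C$ let $$P(\lambda)u=e^{i\lambda t^\star}\varrho^2\big(\Box_g+\nu^2-\tfrac94\big)e^{-i\lambda t^\star}u .$$ If $\nu\in(0,1)$, fix a boundary operator, either $B=\gamma_-$ or $B=\gamma_++\beta\gamma_-$, where $$\gamma_-u=\lim_{r\to\infty}r^{3/2-\nu}u,\qquad \gamma_+u=\lim_{r\to\infty}r^{2\nu+1}\partial_r\big(r^{3/2-\nu}u\big)$$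 are limits in the sense of distributions on $\mathbb S^2$, and $\beta\in C^\infty(\mathbb S^2;\mathbb R)$ satisfies $\partial_{\phi^\star}\beta=0$. Let $\mathcal X(X_0)$ be the space of $u\in\mathcal H^1(X_0)$ with $P(0)u\in\mathcal L^2(X_0)$ and, if $\nu\in(0,1)$, $Bu=0$. For $k\in\mathbb Z$ let $\mathcal D'_k(X_0)$ be the space of distributions $u$ on $X_0$ with $\partial_{\phi^\star}u=iku$. **Proposition.** For each $k\in\mathbb Z$ there exist $C_0>0$ and $C>0$ such that for every $\lambda\in\mathbb C$ with $|\operatorname{Re}\lambda|>C_0$ and $\operatorname{Im}\lambda>0$, and every $u\in\mathcal X(X_0)\cap\mathcal D'_k(X_0)$, one has $P(\lambda)u\in\mathcal L^2(X_0)$ and $$\|u\|_{\mathcal L^2(X_0)}\le\frac{C}{|\lambda|\operatorname{Im}\lambda}\,\|P(\lambda)u\|_{\mathcal L^2(X_0)} .$$ -/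

import Mathlib

noncomputable section

namespace KerrAdS

open MeasureTheory Filter Topology
open scoped ContDiff

/-! ### The Kerr-AdS metric in Kerr-star coordinates, with cosmological constant `-3` -/

/-- `Δ_r = (r² + a²)(1 + r²) - 2Mr`. -/
def deltaR (a M r : ℝ) : ℝ := (r ^ 2 + a ^ 2) * (1 + r ^ 2) - 2 * M * r

/-- `Δ_θ = 1 - a² cos² θ`. -/
def deltaTheta (a θ : ℝ) : ℝ := 1 - a ^ 2 * Real.cos θ ^ 2

/-- `ϱ² = r² + a² cos² θ`. -/
def rhoSq (a r θ : ℝ) : ℝ := r ^ 2 + a ^ 2 * Real.cos θ ^ 2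

/-- The dual metric `g⁻¹` (signature `(+,-,-,-)`) in the coordinates `(t⋆, r, θ, φ⋆)`, indexed by
`0, 1, 2, 3`:
`ϱ² g⁻¹ = -Δ_r R² - Δ_θ ∂_θ² - 2(1-a²) R L - (1-a²)²/(Δ_θ sin² θ) Z²` (symmetric products), where
`R = ∂_r + f ∂_t⋆`, `L = (r²+a²) ∂_t⋆ + a ∂_φ⋆`, `Z = a sin² θ ∂_t⋆ + ∂_φ⋆`. -/
def gInv (a M : ℝ) (f : ℝ → ℝ) (r θ : ℝ) : Matrix (Fin 4) (Fin 4) ℝ :=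
  let R : Fin 4 → ℝ := ![f r, 1, 0, 0]
  let Θ : Fin 4 → ℝ := ![0, 0, 1, 0]
  let L : Fin 4 → ℝ := ![r ^ 2 + a ^ 2, 0, 0, a]
  let Z : Fin 4 → ℝ := ![a * Real.sin θ ^ 2, 0, 0, 1]
  (rhoSq a r θ)⁻¹ •
    (-(deltaR a M r • Matrix.vecMulVec R R)
      - deltaTheta a θ • Matrix.vecMulVec Θ Θ
      - (1 - a ^ 2) • (Matrix.vecMulVec R L + Matrix.vecMulVec L R)
      - ((1 - a ^ 2) ^ 2 / (deltaTheta a θ * Real.sin θ ^ 2)) • Matrix.vecMulVec Z Z)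

/-- The metric `g` itself, as a matrix in the coordinates `(t⋆, r, θ, φ⋆)`. -/
def gMat (a M : ℝ) (f : ℝ → ℝ) (r θ : ℝ) : Matrix (Fin 4) (Fin 4) ℝ := (gInv a M f r θ)⁻¹

/-- The induced Riemannian metric `h = -g` restricted to the tangent space of `{t⋆ = 0}`, in the
coordinates `(r, θ, φ⋆)`. -/
def hMat (a M : ℝ) (f : ℝ → ℝ) (r θ : ℝ) : Matrix (Fin 3) (Fin 3) ℝ :=
  -((gMat a M f r θ).submatrix Fin.succ Fin.succ)

/-- The parameters: black hole mass `M`, rotation `a`, horizon radius `rp = r_+`, Klein-Gordon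
parameter `ν`, and the function `f = f_+` that enters the definition of the time function `t⋆`. -/
structure Params where
  a : ℝ
  M : ℝ
  rp : ℝ
  ν : ℝ
  f : ℝ → ℝ
  M_pos : 0 < M
  abs_a_lt_one : |a| < 1
  ν_pos : 0 < ν
  /-- `r_+` is the largest positive root of `Δ_r`, and it is simple. -/
  rp_pos : 0 < rp
  rp_root : deltaR a M rp = 0
  rp_largest : ∀ r, deltaR a M r = 0 → r ≤ rp
  rp_simple : 0 < deriv (deltaR a M) rp
  /-- `f` is smooth across the event horizon. -/
  f_smooth : ∃ δ > 0, ContDiffOn ℝ ∞ f (Set.Ioi (rp - δ))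
  /-- In terms of `s = 1/r`, the one-form `f dr` is smooth up to the conformal boundary `s = 0`, and
  `{t⋆ = 0}` meets the conformal boundary orthogonally for `s² g`, that is
  `s⁻² g⁻¹(dt⋆, ds) → 0`. -/
  f_conformal : ∃ G : ℝ → ℝ, ContDiff ℝ ∞ G ∧ G 0 = a ^ 2 - 1 ∧ ∀ᶠ r in atTop, f r = G r⁻¹ / r ^ 2
  /-- `{t⋆ = 0}` is spacelike, including at the horizon: `g⁻¹(dt⋆, dt⋆) > 0`. -/
  f_spacelike : ∀ r, rp ≤ r → ∀ θ ∈ Set.Ioo 0 Real.pi, 0 < gInv a M f r θ 0 0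

/-! ### The exterior time slice `X_0 = (r_+, ∞) × S²`

It is identified with `{x ∈ ℝ³ : |x| > r_+}` through `(r, ω) ↦ r ω`; this gives it its smooth
structure, and `r = |x|`, while `θ` is the angle with the third axis.  The axis, where the
coordinate expressions degenerate, is a null set. -/

abbrev E3 : Type := EuclideanSpace ℝ (Fin 3)

/-- The polar angle `θ`. -/
def polar (x : E3) : ℝ := Real.arccos (x 2 / ‖x‖)

/-- Cylindrical radius `r sin θ`. -/
def cylRadius (x : E3) : ℝ := Real.sqrt (x 0 ^ 2 + x 1 ^ 2)

/-- The coordinate vector field `∂_r`. -/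
def vecR (x : E3) : E3 := ‖x‖⁻¹ • x

/-- The coordinate vector field `∂_θ`. -/
def vecTheta (x : E3) : E3 :=
  !₂[x 0 * x 2 / cylRadius x, x 1 * x 2 / cylRadius x, -cylRadius x]

/-- The coordinate vector field `Φ = ∂_φ⋆`. -/
def vecPhi (x : E3) : E3 := !₂[-x 1, x 0, 0]

/-- Lebesgue measure on `ℝ³` is `jac x · dr dθ dφ`, with `jac x = r² sin θ`. -/
def jac (x : E3) : ℝ := ‖x‖ ^ 2 * Real.sin (polar x)

/-- Test functions on an open set `Ω`: the space `C_c^∞(Ω; ℂ)`. -/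
structure IsTest (Ω : Set E3) (ψ : E3 → ℂ) : Prop where
  smooth : ContDiff ℝ ∞ ψ
  compact : HasCompactSupport ψ
  supp : tsupport ψ ⊆ Ω

/-- `du` is the distributional differential of the function `u` on `Ω`. -/
structure IsWeakDeriv (Ω : Set E3) (u : E3 → ℂ) (du : E3 → E3 →L[ℝ] ℂ) : Prop where
  locInt : LocallyIntegrableOn u Ω
  locInt_deriv : LocallyIntegrableOn du Ω
  byParts : ∀ ψ, IsTest Ω ψ → ∀ e : E3,
    ∫ x in Ω, u x * fderiv ℝ ψ x e = -∫ x in Ω, du x e * ψ x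

namespace Params

variable (p : Params)

/-- The exterior time slice. -/
def X : Set E3 := {x | p.rp < ‖x‖}

/-- `g⁻¹` at a point of the slice. -/
def gInvAt (x : E3) : Matrix (Fin 4) (Fin 4) ℝ := gInv p.a p.M p.f ‖x‖ (polar x)

/-- `g` at a point of the slice. -/
def gAt (x : E3) : Matrix (Fin 4) (Fin 4) ℝ := gMat p.a p.M p.f ‖x‖ (polar x)

/-- `h` at a point of the slice. -/
def hAt (x : E3) : Matrix (Fin 3) (Fin 3) ℝ := hMat p.a p.M p.f ‖x‖ (polar x)

/-- `ϱ²` at a point of the slice. -/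
def rhoSqAt (x : E3) : ℝ := rhoSq p.a ‖x‖ (polar x)

/-- The density of `|det g|^{1/2} dr dθ dφ⋆` with respect to Lebesgue measure on `ℝ³`. -/
def volDensity (x : E3) : ℝ := Real.sqrt |(p.gAt x).det| / jac x

/-- The measure `r⁻¹ dS_t` on `X_0`, where `dS_t = (det h)^{1/2} dr dθ dφ⋆` is the surface measure
that `g` induces on the slice. -/
def sliceMeasure : Measure E3 :=
  (volume.restrict p.X).withDensity
    fun x => ENNReal.ofReal (‖x‖⁻¹ * (Real.sqrt (p.hAt x).det / jac x))

/-- The space `𝓛²(X_0)`. -/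
def MemL2 (u : E3 → ℂ) : Prop := MemLp u 2 p.sliceMeasure

/-- The norm of `𝓛²(X_0)`, `(∫ |u|² r⁻¹ dS_t)^{1/2}`. -/
def normL2 (u : E3 → ℂ) : ℝ := (eLpNorm u 2 p.sliceMeasure).toReal

/-- The twisted derivative `∂̃_r u = r^{ν-3/2} ∂_r (r^{3/2-ν} u) = ∂_r u + (3/2-ν) u / r` at `x`, for
a function with value `c` and differential `L` at `x`. -/
def twistedR (c : ℂ) (L : E3 →L[ℝ] ℂ) (x : E3) : ℂ :=
  L (vecR x) + (((3 / 2 - p.ν) / ‖x‖ : ℝ) : ℂ) * c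

/-- The components of `d̃u = r^{ν-3/2} d (r^{3/2-ν} u)` in the coordinates `(r, θ, φ⋆)`. -/
def twistedD (c : ℂ) (L : E3 →L[ℝ] ℂ) (x : E3) : Fin 3 → ℂ :=
  ![p.twistedR c L x, L (vecTheta x), L (vecPhi x)]

/-- `h⁻¹(ξ, ξ̄)` at the point `x` of the slice. -/
def hInvForm (x : E3) (ξ : Fin 3 → ℂ) : ℝ :=
  (∑ i, ∑ j, (((p.hAt x)⁻¹ i j : ℝ) : ℂ) * ξ i * (starRingEnd ℂ) (ξ j)).re

/-- `u` belongs to the stationary energy space `𝓗¹(X_0)`, and `du` is its differential. -/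
structure MemH1 (u : E3 → ℂ) (du : E3 → E3 →L[ℝ] ℂ) : Prop where
  weakDeriv : IsWeakDeriv p.X u du
  memL2 : p.MemL2 u
  energy : ∫⁻ x, ENNReal.ofReal (‖x‖ ^ 2 * p.hInvForm x (p.twistedD (u x) (du x) x))
    ∂p.sliceMeasure < ⊤

/-- The components, in the coordinates `(t⋆, r, θ, φ⋆)`, of the differential of `e^{-iλt⋆} u` at
`t⋆ = 0`, for a function `u` with value `c` and differential `L` at `x`. -/
def stationaryD (l : ℂ) (c : ℂ) (L : E3 →L[ℝ] ℂ) (x : E3) : Fin 4 → ℂ :=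
  ![-Complex.I * l * c, L (vecR x), L (vecTheta x), L (vecPhi x)]

/-- `P(λ) u = F` in the sense of distributions on `X_0`, for a function `u` with a locally integrable
differential, where `P(λ) = e^{iλt⋆} ϱ² (□_g + ν² - 9/4) e^{-iλt⋆}` and
`□_g v = |g|^{-1/2} ∂_μ (|g|^{1/2} g^{μν} ∂_ν v)`.  The equation is multiplied by
`ϱ^{-2} |g|^{1/2} ψ` and the outer derivatives are moved to the test function `ψ`; the derivative
`∂_t⋆`, which acts as `-iλ`, becomes `iλ` when it is moved with a change of sign. -/
def IsP (l : ℂ) (u F : E3 → ℂ) : Prop :=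
  ∃ du, IsWeakDeriv p.X u du ∧ ∀ ψ, IsTest p.X ψ →
    ∫ x in p.X, (p.volDensity x : ℂ) *
        (-(∑ i, ∑ j, ((p.gInvAt x i j : ℝ) : ℂ) *
            stationaryD (-l) (ψ x) (fderiv ℝ ψ x) x i * stationaryD l (u x) (du x) x j)
          + ((p.ν ^ 2 - 9 / 4 : ℝ) : ℂ) * u x * ψ x)
      = ∫ x in p.X, ((p.volDensity x / p.rhoSqAt x : ℝ) : ℂ) * F x * ψ x

/-- `u ∈ 𝓓'_k(X_0)`: `(Φ - ik) u = 0` in the sense of distributions (the vector field `Φ` is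
divergence free). -/
def InMode (k : ℤ) (u : E3 → ℂ) : Prop :=
  ∀ ψ, IsTest p.X ψ →
    -∫ x in p.X, u x * fderiv ℝ ψ x (vecPhi x) = Complex.I * (k : ℂ) * ∫ x in p.X, u x * ψ x

/-! ### Boundary conditions at the conformal boundary `Y = S²` -/

/-- The filter of the essential limit `r → ∞` (functions of `r` matter only almost everywhere). -/
def essAtTop : Filter ℝ := atTop ⊓ ae (volume : Measure ℝ)

/-- The restriction of `r^{3/2-ν} u` to the sphere of radius `r`; its limit as `r → ∞` is
`γ_- u`. -/
def preTraceMinus (u : E3 → ℂ) (r : ℝ) (y : E3) : ℂ :=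
  ((r ^ (3 / 2 - p.ν) : ℝ) : ℂ) * u (r • y)

/-- The restriction of `r^{2ν+1} ∂_r (r^{3/2-ν} u)` to the sphere of radius `r`; its limit as
`r → ∞` is `γ_+ u`. -/
def preTracePlus (u : E3 → ℂ) (du : E3 → E3 →L[ℝ] ℂ) (r : ℝ) (y : E3) : ℂ :=
  ((r ^ (2 * p.ν + 1) * r ^ (3 / 2 - p.ν) : ℝ) : ℂ) * p.twistedR (u (r • y)) (du (r • y)) (r • y)

/-- The family `w r` of functions on the unit sphere tends to zero as distributions on `S²`, as
`r → ∞`. -/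
def TendsToZeroOnSphere (w : ℝ → E3 → ℂ) : Prop :=
  ∀ χ : E3 → ℂ, ContDiff ℝ ∞ χ →
    Tendsto (fun r => ∫ y : Metric.sphere (0 : E3) 1, w r y * χ y ∂(volume : Measure E3).toSphere)
      essAtTop (𝓝 0)

end Params

/-- The boundary operator: `B = γ_-` (Dirichlet) or `B = γ_+ + β γ_-` (Robin).  The Robin function
lives on the unit sphere and is given through an extension to `ℝ³`. -/
inductive BoundaryOp where
  | dirichlet : BoundaryOp
  | robin (β : E3 → ℝ) : BoundaryOp

/-- The Robin function is smooth, real and axisymmetric on the sphere. -/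
def BoundaryOp.Admissible : BoundaryOp → Prop
  | .dirichlet => True
  | .robin β => ContDiff ℝ ∞ β ∧ ∀ y ∈ Metric.sphere (0 : E3) 1, fderiv ℝ β y (vecPhi y) = 0

/-- The boundary condition `B u = 0`. -/
def BoundaryOp.Holds (p : Params) (u : E3 → ℂ) (du : E3 → E3 →L[ℝ] ℂ) : BoundaryOp → Prop
  | .dirichlet => Params.TendsToZeroOnSphere (p.preTraceMinus u)
  | .robin β => Params.TendsToZeroOnSphere
      fun r y => p.preTracePlus u du r y + (β y : ℂ) * p.preTraceMinus u r y

/-- The domain `𝓧(X_0)`: functions `u ∈ 𝓗¹(X_0)` with `P(0) u ∈ 𝓛²(X_0)` and, when `ν ∈ (0,1)`,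
`B u = 0`. -/
def Params.MemDomain (p : Params) (B : BoundaryOp) (u : E3 → ℂ) : Prop :=
  ∃ du, p.MemH1 u du ∧ (∃ F, p.MemL2 F ∧ p.IsP 0 u F) ∧ (p.ν < 1 → B.Holds p u du)

end KerrAdS

end

noncomputable section

namespace KerrAdS

open MeasureTheory Filter Topology Set Complex
open scoped ContDiff ComplexConjugate

/-! ### Weakly differentiable functions of one variable -/

lemma absolutelyContinuous_integral_complex {f : ℝ → ℂ} {a b : ℝ}
    (h : IntervalIntegrable f volume a b) :
    AbsolutelyContinuousOnInterval (fun x => ∫ v in a..x, f v) a b := by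
  have hre : IntervalIntegrable (fun x => (f x).re) volume a b :=
    ⟨h.1.re, h.2.re⟩
  have him : IntervalIntegrable (fun x => (f x).im) volume a b :=
    ⟨h.1.im, h.2.im⟩
  have h1 := hre.absolutelyContinuousOnInterval_intervalIntegral (c := a) left_mem_uIcc
  have h2 := him.absolutelyContinuousOnInterval_intervalIntegral (c := a) left_mem_uIcc
  have hc : ∀ z : ℂ, AbsolutelyContinuousOnInterval (fun _ : ℝ => z) a b := fun z =>
    LipschitzOnWith.absolutelyContinuousOnInterval (K := 0) (by
      intro x _ y _; simp)
  have h3 := (h1.smul (hc 1)).add (h2.smul (hc I))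
  rw [absolutelyContinuousOnInterval_iff] at h3 ⊢
  intro ε hε
  obtain ⟨δ, hδ, H⟩ := h3 ε hε
  refine ⟨δ, hδ, fun E hE hlt => ?_⟩
  have key : ∀ x ∈ uIcc a b, ∫ v in a..x, f v =
      ((fun x => ∫ v in a..x, (f v).re) • (fun _ : ℝ => (1 : ℂ))
        + (fun x => ∫ v in a..x, (f v).im) • fun _ : ℝ => I) x := by
    intro x hx
    have hf : IntervalIntegrable f volume a x := h.mono_set (uIcc_subset_uIcc_left hx)
    apply Complex.ext
    · have := reCLM.intervalIntegral_comp_comm hf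
      simp only [reCLM_apply] at this
      simp [this]
    · have := imCLM.intervalIntegral_comp_comm hf
      simp only [imCLM_apply] at this
      simp [this]
  have := H E hE hlt
  refine lt_of_eq_of_lt ?_ this
  refine Finset.sum_congr rfl fun i hi => ?_
  rw [← key _ (hE.1 i hi).1, ← key _ (hE.1 i hi).2]

/-- Integration by parts for functions that are integrals of integrable functions. -/
lemma integral_deriv_mul_of_primitive {P Q P' Q' : ℝ → ℂ} {a b : ℝ}
    (hP' : IntervalIntegrable P' volume a b) (hQ' : IntervalIntegrable Q' volume a b)
    (hP : ∀ x ∈ uIcc a b, P x = P a + ∫ v in a..x, P' v)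
    (hQ : ∀ x ∈ uIcc a b, Q x = Q a + ∫ v in a..x, Q' v) :
    IntervalIntegrable (fun x => P' x * Q x + P x * Q' x) volume a b ∧
    ∫ x in a..b, (P' x * Q x + P x * Q' x) = P b * Q b - P a * Q a := by
  have hc : ∀ z : ℂ, AbsolutelyContinuousOnInterval (fun _ : ℝ => z) a b := fun z =>
    LipschitzOnWith.absolutelyContinuousOnInterval (K := 0) (by
      intro x _ y _; simp)
  set p : ℝ → ℂ := fun x => P a + ∫ v in a..x, P' v with hp
  set q : ℝ → ℂ := fun x => Q a + ∫ v in a..x, Q' v with hq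
  have hpa : AbsolutelyContinuousOnInterval p a b :=
    (hc (P a)).add (absolutelyContinuous_integral_complex hP')
  have hqa : AbsolutelyContinuousOnInterval q a b :=
    (hc (Q a)).add (absolutelyContinuous_integral_complex hQ')
  have hint0 : IntervalIntegrable (fun x => P' x * q x + p x * Q' x) volume a b :=
    (hP'.mul_continuousOn hqa.continuousOn).add (hQ'.continuousOn_mul hpa.continuousOn)
  have hint : IntervalIntegrable (fun x => P' x * Q x + P x * Q' x) volume a b := by
    refine hint0.congr fun x hx => ?_
    have hx' := uIoc_subset_uIcc hx
    simp only [hP x hx', hQ x hx', hp, hq]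
  refine ⟨hint, ?_⟩
  have hac : AbsolutelyContinuousOnInterval
      ((fun x => p x * q x) - fun x => ∫ v in a..x, (P' v * q v + p v * Q' v)) a b :=
    (hpa.smul hqa).sub (absolutelyContinuous_integral_complex hint0)
  obtain ⟨C, hC⟩ := hac.const_of_ae_hasDerivAt_zero (by
    filter_upwards [hP'.ae_hasDerivAt_integral, hQ'.ae_hasDerivAt_integral,
      hint0.ae_hasDerivAt_integral] with x h1 h2 h3 hx
    have d1 := (h1 hx a left_mem_uIcc).const_add (P a)
    have d2 := (h2 hx a left_mem_uIcc).const_add (Q a)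
    have d3 := h3 hx a left_mem_uIcc
    exact ((d1.mul d2).sub d3).congr_deriv (by simp [hp, hq]))
  have e1 := hC a left_mem_uIcc
  have e2 := hC b right_mem_uIcc
  simp only [Pi.sub_apply, intervalIntegral.integral_same, sub_zero] at e1 e2
  have e3 : ∫ x in a..b, (P' x * Q x + P x * Q' x) = ∫ x in a..b, (P' x * q x + p x * Q' x) := by
    refine intervalIntegral.integral_congr fun x hx => ?_
    simp only [hP x hx, hQ x hx, hp, hq]
  rw [e3]
  have pa : p a = P a := by simp [hp]
  have qa : q a = Q a := by simp [hq]
  have pb : p b = P b := (hP b right_mem_uIcc).symm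
  have qb : q b = Q b := (hQ b right_mem_uIcc).symm
  rw [← pb, ← qb, ← pa, ← qa, e1, ← e2]
  ring

/-- `A'` is the distributional derivative of `A` on `(c, ∞)`. -/
structure WeakDeriv1 (c : ℝ) (A A' : ℝ → ℂ) : Prop where
  locInt : LocallyIntegrableOn A (Ioi c)
  locInt_deriv : LocallyIntegrableOn A' (Ioi c)
  byParts : ∀ g : ℝ → ℝ, ContDiff ℝ ∞ g → HasCompactSupport g → tsupport g ⊆ Ioi c →
    ∫ r in Ioi c, deriv g r • A r = - ∫ r in Ioi c, g r • A' r

lemma LocallyIntegrableOn.intervalIntegrable_Ioi {c : ℝ} {A : ℝ → ℂ}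
    (h : LocallyIntegrableOn A (Ioi c)) {x y : ℝ} (hx : c < x) (hy : c < y) :
    IntervalIntegrable A volume x y := by
  rw [intervalIntegrable_iff']
  refine h.integrableOn_compact_subset ?_ isCompact_uIcc
  intro z hz
  exact lt_of_lt_of_le (lt_min hx hy) hz.1

lemma exists_Icc_of_tsupport {F : Type*} [Zero F] {c : ℝ} {g : ℝ → F} (hg : HasCompactSupport g)
    (hs : tsupport g ⊆ Ioi c) : ∃ x y, c < x ∧ x < y ∧ tsupport g ⊆ Ioo x y := by
  by_cases hne : (tsupport g).Nonempty
  · obtain ⟨m, hm, hm'⟩ := hg.isCompact.exists_isLeast hne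
    obtain ⟨M, hM, hM'⟩ := hg.isCompact.exists_isGreatest hne
    have h1 : c < m := hs hm
    refine ⟨(c + m) / 2, M + 1, by linarith, ?_, fun z hz => ?_⟩
    · have := hm' hM
      linarith
    · have a1 := hm' hz
      have a2 := hM' hz
      constructor <;> linarith
  · rw [not_nonempty_iff_eq_empty] at hne
    exact ⟨c + 1, c + 2, by linarith, by linarith, by simp [hne]⟩

lemma setIntegral_Ioi_eq_interval {c x y : ℝ} {h : ℝ → ℂ} (hx : c < x) (hxy : x < y)
    (hh : ∀ r, r ∉ Ioo x y → h r = 0) : ∫ r in Ioi c, h r = ∫ r in x..y, h r := by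
  rw [intervalIntegral.integral_of_le hxy.le]
  refine setIntegral_eq_of_subset_of_forall_sdiff_eq_zero measurableSet_Ioi ?_ ?_
  · intro z hz
    exact hx.trans hz.1
  · intro z hz
    exact hh z fun h => hz.2 ⟨h.1, h.2.le⟩

/-- Absolutely continuous representative. -/
lemma WeakDeriv1.exists_primitive {c : ℝ} {A A' : ℝ → ℂ} (h : WeakDeriv1 c A A') :
    ∃ B : ℝ → ℂ, (∀ᵐ r, r ∈ Ioi c → A r = B r) ∧
      ∀ x y, c < x → c < y → B y - B x = ∫ r in x..y, A' r := by
  set a := c + 1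
  have ha : c < a := by simp [a]
  set P : ℝ → ℂ := fun r => ∫ v in a..r, A' v with hPdef
  have hP : ∀ x y, c < x → c < y → P y - P x = ∫ r in x..y, A' r := by
    intro x y hx hy
    exact intervalIntegral.integral_interval_sub_left
      (LocallyIntegrableOn.intervalIntegrable_Ioi h.locInt_deriv ha hy)
      (LocallyIntegrableOn.intervalIntegrable_Ioi h.locInt_deriv ha hx)
  have hPc : ContinuousOn P (Ioi c) := by
    intro z hz
    have hz : c < z := hz
    have hi := LocallyIntegrableOn.intervalIntegrable_Ioi h.locInt_deriv
      (x := min a ((c + z) / 2)) (y := max a (z + 1)) (by simp only [lt_min_iff]; constructor <;> linarith)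
        (by simp only [lt_max_iff]; left; exact ha)
    have := intervalIntegral.continuousOn_primitive_interval' hi (a := a)
      ⟨by simp, by simp⟩
    refine (this.continuousAt ?_).continuousWithinAt
    rw [uIcc_of_le (by simp)]
    refine Icc_mem_nhds ?_ ?_
    · simp only [min_lt_iff]; right; linarith
    · simp
  have hPloc : LocallyIntegrableOn P (Ioi c) := hPc.locallyIntegrableOn measurableSet_Ioi
  -- the difference is weakly constant
  have hD : ∀ g : ℝ → ℝ, ContDiff ℝ ∞ g → HasCompactSupport g → tsupport g ⊆ Ioi c →
      ∫ r in Ioi c, deriv g r • (A r - P r) = 0 := by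
    intro g hg hgc hgs
    obtain ⟨x, y, hx, hxy, hs⟩ := exists_Icc_of_tsupport hgc hgs
    have hg0 : ∀ r, r ∉ Ioo x y → g r = 0 := fun r hr => by
      by_contra hne
      exact hr (hs (subset_tsupport _ hne))
    have hg0' : ∀ r, r ∉ Ioo x y → deriv g r = 0 := fun r hr => by
      by_contra hne
      exact hr (hs (support_deriv_subset hne))
    have hgd : Differentiable ℝ g := hg.differentiable (by simp)
    have hgdc : Continuous (deriv g) := hg.continuous_deriv (by simp)
    have hi : ∀ (Q : ℝ → ℂ), LocallyIntegrableOn Q (Ioi c) → ∀ k : ℝ → ℝ, Continuous k →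
        IntervalIntegrable (fun r => k r • Q r) volume x y := by
      intro Q hQ k hk
      exact (LocallyIntegrableOn.intervalIntegrable_Ioi hQ hx (hx.trans hxy)).continuousOn_smul hk.continuousOn
    have e1 : ∫ r in Ioi c, deriv g r • (A r - P r) =
        ∫ r in x..y, deriv g r • (A r - P r) :=
      setIntegral_Ioi_eq_interval hx hxy fun r hr => by simp [hg0' r hr]
    have e2 := h.byParts g hg hgc hgs
    rw [setIntegral_Ioi_eq_interval hx hxy fun r hr => by simp [hg0' r hr],
      setIntegral_Ioi_eq_interval hx hxy fun r hr => by simp [hg0 r hr]] at e2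
    have e3 := integral_deriv_mul_of_primitive (P := fun r => (g r : ℂ)) (Q := P)
      (P' := fun r => ((deriv g r : ℝ) : ℂ)) (Q' := A') (a := x) (b := y)
      ((continuous_ofReal.comp hgdc).intervalIntegrable _ _)
      (LocallyIntegrableOn.intervalIntegrable_Ioi h.locInt_deriv hx (hx.trans hxy))
      (fun z _ => by
        rw [intervalIntegral.integral_ofReal, intervalIntegral.integral_deriv_eq_sub
          (fun _ _ => hgd.differentiableAt) (hgdc.intervalIntegrable _ _)]
        push_cast; ring)
      (fun z hz => by
        rw [uIcc_of_le hxy.le] at hz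
        rw [← hP x z hx (hx.trans_le hz.1)]; ring)
    have e4 := e3.2
    rw [hg0 x (by simp), hg0 y (by simp)] at e4
    simp only [ofReal_zero, zero_mul, sub_zero] at e4
    rw [e1]
    simp only [smul_sub]
    rw [intervalIntegral.integral_sub (hi A h.locInt _ hgdc) (hi P hPloc _ hgdc), e2]
    have e5 : ∫ r in x..y, (((deriv g r : ℝ) : ℂ) * P r + (g r : ℂ) * A' r) =
      (∫ r in x..y, deriv g r • P r) + ∫ r in x..y, g r • A' r := by
      rw [← intervalIntegral.integral_add (hi P hPloc _ hgdc) (hi A' h.locInt_deriv _ hg.continuous)]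
      simp
    rw [e5] at e4
    linear_combination -e4
  -- hence constant
  let bump : ContDiffBump (c + 2) := ⟨1 / 2, 1, by norm_num, by norm_num⟩
  set g0 : ℝ → ℝ := bump.normed volume with hg0
  have hg0c : ContDiff ℝ ∞ g0 := bump.contDiff_normed
  have hg0s : HasCompactSupport g0 := bump.hasCompactSupport_normed
  have hg0int : ∫ r, g0 r = 1 := bump.integral_normed
  have hg0t : tsupport g0 ⊆ Ioi c := by
    rw [hg0, bump.tsupport_normed_eq]
    intro z hz
    rw [Real.closedBall_eq_Icc] at hz
    have : bump.rOut = 1 := rfl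
    rw [this] at hz
    have := hz.1
    simp only [mem_Ioi]
    linarith
  have hAP : LocallyIntegrableOn (fun r => A r - P r) (Ioi c) := h.locInt.sub hPloc
  have hint : ∀ g : ℝ → ℝ, Continuous g → HasCompactSupport g → tsupport g ⊆ Ioi c →
      IntegrableOn (fun r => g r • (A r - P r)) (Ioi c) := by
    intro g hg hgc hgs
    have h1 : IntegrableOn (fun r => g r • (A r - P r)) (tsupport g) :=
      (hAP.integrableOn_compact_subset hgs hgc).continuousOn_smul hg.continuousOn hgc
    refine (h1.integrable_of_forall_notMem_eq_zero ?_).integrableOn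
    intro r hr
    simp [image_eq_zero_of_notMem_tsupport hr]
  have h2 : ∃ k : ℂ, ∀ᵐ r, r ∈ Ioi c → A r - P r - k = 0 := by
    set k : ℂ := ∫ r in Ioi c, g0 r • (A r - P r) with hk
    refine ⟨k, isOpen_Ioi.ae_eq_zero_of_integral_contDiff_smul_eq_zero
      (hAP.sub (locallyIntegrableOn_const k)) fun φ hφ hφc hφs => ?_⟩
    set I : ℝ := ∫ r, φ r with hI
    set ψ : ℝ → ℝ := fun r => φ r - I * g0 r with hψ
    have hψc : ContDiff ℝ ∞ ψ := hφ.sub (contDiff_const.mul hg0c)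
    have hφint : Integrable φ := hφ.continuous.integrable_of_hasCompactSupport hφc
    have hg0i : Integrable g0 := hg0c.continuous.integrable_of_hasCompactSupport hg0s
    have hψi : Integrable ψ := hφint.sub (hg0i.const_mul I)
    have hψ0 : ∫ r, ψ r = 0 := by
      rw [hψ, integral_sub hφint (hg0i.const_mul I), integral_const_mul, hg0int]; ring
    have hψs : HasCompactSupport ψ := hφc.sub hg0s.mul_left
    have hψt : tsupport ψ ⊆ Ioi c := by
      refine (tsupport_sub _ _).trans (union_subset hφs ?_)
      exact (closure_mono (Function.support_const_smul_subset I g0)).trans hg0t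
    obtain ⟨x, y, hx, hxy, hs⟩ := exists_Icc_of_tsupport hψs hψt
    have hz : ∀ r, r ∉ Ioo x y → ψ r = 0 := fun r hr =>
      image_eq_zero_of_notMem_tsupport fun h => hr (hs h)
    set G : ℝ → ℝ := fun r => ∫ v in x..r, ψ v with hG
    have hGd : ∀ r, HasDerivAt G (ψ r) r := fun r =>
      intervalIntegral.integral_hasDerivAt_right (hψi.intervalIntegrable)
        hψc.continuous.stronglyMeasurable.stronglyMeasurableAtFilter hψc.continuous.continuousAt
    have hGder : deriv G = ψ := funext fun r => (hGd r).deriv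
    have hGc : ContDiff ℝ ∞ G := by
      rw [contDiff_infty_iff_deriv, hGder]
      exact ⟨fun r => (hGd r).differentiableAt, hψc⟩
    have hG0 : ∀ r, r ∉ Icc x y → G r = 0 := by
      intro r hr
      by_cases hrx : r < x
      · refine (intervalIntegral.integral_congr (g := fun _ => (0 : ℝ)) fun v hv => ?_).trans (by simp)
        rw [uIcc_of_ge hrx.le] at hv
        exact hz v fun h => absurd h.1 (not_lt.2 hv.2)
      · have hry : y < r := by
          by_contra hle
          exact hr ⟨not_lt.1 hrx, not_lt.1 hle⟩
        rw [← hψ0, hG]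
        simp only
        rw [intervalIntegral.integral_of_le (hxy.trans hry).le]
        refine setIntegral_eq_integral_of_forall_compl_eq_zero fun v hv => hz v fun h => hv ?_
        exact ⟨h.1, (h.2.trans hry).le⟩
    have hGt : tsupport G ⊆ Icc x y :=
      closure_minimal (fun r hr => by
        by_contra hn
        exact hr (hG0 r hn)) isClosed_Icc
    have hGs : HasCompactSupport G := isCompact_Icc.of_isClosed_subset (isClosed_tsupport _) hGt
    have e := hD G hGc hGs (hGt.trans fun r hr => hx.trans_le hr.1)
    rw [hGder] at e
    have e1 : ∫ r in Ioi c, ψ r • (A r - P r) =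
        (∫ r in Ioi c, φ r • (A r - P r)) - I • k := by
      have hi2 : IntegrableOn (fun r => I • (g0 r • (A r - P r))) (Ioi c) :=
        (hint g0 hg0c.continuous hg0s hg0t).smul I
      rw [hk, ← integral_smul, ← integral_sub (hint φ hφ.continuous hφc hφs) hi2]
      refine integral_congr_ae (.of_forall fun r => ?_)
      simp only [hψ, sub_smul, smul_smul]
    have hI2 : I = ∫ r in Ioi c, φ r :=
      (setIntegral_eq_integral_of_forall_compl_eq_zero fun r hr =>
        image_eq_zero_of_notMem_tsupport fun h => hr (hφs h)).symm
    have e2 : ∫ r, φ r • (A r - P r - k) = ∫ r in Ioi c, φ r • (A r - P r - k) :=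
      (setIntegral_eq_integral_of_forall_compl_eq_zero fun r hr => by
        rw [image_eq_zero_of_notMem_tsupport fun h => hr (hφs h), zero_smul]).symm
    rw [e2]
    simp only [smul_sub _ _ k]
    rw [integral_sub (hint φ hφ.continuous hφc hφs) (hφint.integrableOn.smul_const k),
      integral_smul_const, ← hI2]
    rw [e1] at e
    exact e
  obtain ⟨k, hk⟩ := h2
  refine ⟨fun r => P r + k, ?_, fun x y hx hy => ?_⟩
  · filter_upwards [hk] with r hr hrc
    linear_combination hr hrc
  · rw [← hP x y hx hy]; ring

/-- Product rule for weakly differentiable functions, integrated against a test function. -/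
lemma WeakDeriv1.integral_product {c : ℝ} {A A' B B' : ℝ → ℂ} (hA : WeakDeriv1 c A A')
    (hB : WeakDeriv1 c B B') {χ : ℝ → ℝ} (hχ : ContDiff ℝ 1 χ) (hχc : HasCompactSupport χ)
    (hχs : tsupport χ ⊆ Ioi c) :
    ∫ r in Ioi c, (χ r • (A' r * B r + A r * B' r) + deriv χ r • (A r * B r)) = 0 := by
  obtain ⟨P, hPe, hP⟩ := hA.exists_primitive
  obtain ⟨Q, hQe, hQ⟩ := hB.exists_primitive
  obtain ⟨x, y, hx, hxy, hs⟩ := exists_Icc_of_tsupport hχc hχs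
  have hy := hx.trans hxy
  have hz : ∀ r, r ∉ Ioo x y → χ r = 0 := fun r hr =>
    image_eq_zero_of_notMem_tsupport fun h => hr (hs h)
  have hz' : ∀ r, r ∉ Ioo x y → deriv χ r = 0 := fun r hr => by
    by_contra hne
    exact hr (hs (support_deriv_subset hne))
  have hχd : Differentiable ℝ χ := hχ.differentiable (by simp)
  have hχdc : Continuous (deriv χ) := hχ.continuous_deriv (by simp)
  have hP1 : ∀ z ∈ uIcc x y, P z = P x + ∫ v in x..z, A' v := fun z hz => by
    rw [uIcc_of_le hxy.le] at hz
    rw [← hP x z hx (hx.trans_le hz.1)]; ring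
  have hQ1 : ∀ z ∈ uIcc x y, Q z = Q x + ∫ v in x..z, B' v := fun z hz => by
    rw [uIcc_of_le hxy.le] at hz
    rw [← hQ x z hx (hx.trans_le hz.1)]; ring
  have hA'i := LocallyIntegrableOn.intervalIntegrable_Ioi hA.locInt_deriv hx hy
  have hB'i := LocallyIntegrableOn.intervalIntegrable_Ioi hB.locInt_deriv hx hy
  have h1 := integral_deriv_mul_of_primitive hA'i hB'i hP1 hQ1
  have hPQ : ∀ z ∈ uIcc x y, P z * Q z = P x * Q x + ∫ v in x..z, (A' v * Q v + P v * B' v) := by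
    intro z hz
    have hsub : uIcc x z ⊆ uIcc x y := uIcc_subset_uIcc_left hz
    rw [(integral_deriv_mul_of_primitive (hA'i.mono_set hsub) (hB'i.mono_set hsub)
      (fun w hw => hP1 w (hsub hw)) (fun w hw => hQ1 w (hsub hw))).2]
    ring
  have h2 := integral_deriv_mul_of_primitive (P := fun r => (χ r : ℂ)) (Q := fun r => P r * Q r)
      (P' := fun r => ((deriv χ r : ℝ) : ℂ)) (a := x) (b := y)
      ((continuous_ofReal.comp hχdc).intervalIntegrable _ _) h1.1
      (fun z _ => by
        rw [intervalIntegral.integral_ofReal, intervalIntegral.integral_deriv_eq_sub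
          (fun _ _ => hχd.differentiableAt) (hχdc.intervalIntegrable _ _)]
        push_cast; ring) hPQ
  have h3 := h2.2
  rw [hz x (by simp), hz y (by simp)] at h3
  simp only [ofReal_zero, zero_mul, sub_zero] at h3
  rw [← h3, setIntegral_Ioi_eq_interval hx hxy fun r hr => by simp [hz r hr, hz' r hr]]
  refine intervalIntegral.integral_congr_ae ?_
  filter_upwards [hPe, hQe] with r h1 h2 hr
  rw [uIoc_of_le hxy.le] at hr
  rw [h1 (hx.trans hr.1), h2 (hx.trans hr.1)]
  simp only [real_smul]
  ring

lemma WeakDeriv1.star {c : ℝ} {A A' : ℝ → ℂ} (h : WeakDeriv1 c A A') :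
    WeakDeriv1 c (fun r => conj (A r)) (fun r => conj (A' r)) := by
  have hl : ∀ {Q : ℝ → ℂ}, LocallyIntegrableOn Q (Ioi c) →
      LocallyIntegrableOn (fun r => conj (Q r)) (Ioi c) := by
    intro Q hQ r hr
    obtain ⟨s, hs, hi⟩ := hQ r hr
    exact ⟨s, hs, (conjCLE : ℂ →L[ℝ] ℂ).integrable_comp hi⟩
  refine ⟨hl h.locInt, hl h.locInt_deriv, fun g h1 h2 h3 => ?_⟩
  have := congrArg conj (h.byParts g h1 h2 h3)
  rw [map_neg, ← integral_conj, ← integral_conj] at this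
  simpa [real_smul] using this

lemma WeakDeriv1.add {c : ℝ} {A A' B B' : ℝ → ℂ} (hA : WeakDeriv1 c A A')
    (hB : WeakDeriv1 c B B') : WeakDeriv1 c (fun r => A r + B r) (fun r => A' r + B' r) := by
  have hint : ∀ {Q : ℝ → ℂ}, LocallyIntegrableOn Q (Ioi c) → ∀ g : ℝ → ℝ, Continuous g →
      HasCompactSupport g → tsupport g ⊆ Ioi c → IntegrableOn (fun r => g r • Q r) (Ioi c) := by
    intro Q hQ g hg hgc hgs
    have h1 : IntegrableOn (fun r => g r • Q r) (tsupport g) :=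
      (hQ.integrableOn_compact_subset hgs hgc).continuousOn_smul hg.continuousOn hgc
    refine (h1.integrable_of_forall_notMem_eq_zero ?_).integrableOn
    intro r hr
    simp [image_eq_zero_of_notMem_tsupport hr]
  refine ⟨hA.locInt.add hB.locInt, hA.locInt_deriv.add hB.locInt_deriv, fun g h1 h2 h3 => ?_⟩
  have hd := h1.continuous_deriv (by simp)
  have hdt : tsupport (deriv g) ⊆ Ioi c := (closure_minimal support_deriv_subset
    (isClosed_tsupport _)).trans h3
  simp only [smul_add]
  rw [integral_add (hint hA.locInt _ hd h2.deriv hdt) (hint hB.locInt _ hd h2.deriv hdt),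
    integral_add (hint hA.locInt_deriv _ h1.continuous h2 h3)
      (hint hB.locInt_deriv _ h1.continuous h2 h3), hA.byParts g h1 h2 h3, hB.byParts g h1 h2 h3]
  ring

/-! ### Polynomials on the unit sphere -/

/-- The unit sphere. -/
abbrev S2 : Type := Metric.sphere (0 : E3) 1

/-- The surface measure of the unit sphere. -/
abbrev sphereMeasure : Measure S2 := (volume : Measure E3).toSphere

/-- The generator of the rotations about the `i`-th axis. -/
def rot (i : Fin 3) (x : E3) : E3 :=
  ![!₂[0, -x 2, x 1], !₂[x 2, 0, -x 0], !₂[-x 1, x 0, 0]] i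

lemma rot_two (x : E3) : rot 2 x = vecPhi x := rfl

/-- Derivative along the rotations about the `i`-th axis. -/
def rotD (i : Fin 3) (φ : E3 → ℝ) (y : E3) : ℝ := fderiv ℝ φ y (rot i y)

/-- Multiplication by a coordinate. -/
def mulCoord (a : Fin 3) : (E3 → ℝ) →ₗ[ℝ] (E3 → ℝ) where
  toFun f := fun x => x a * f x
  map_add' f g := by ext x; simp [mul_add]
  map_smul' k f := by ext x; simp; ring

/-- Polynomial functions of degree at most `n`. -/
def polySpace : ℕ → Submodule ℝ (E3 → ℝ)
  | 0 => Submodule.span ℝ {fun _ => 1}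
  | n + 1 => polySpace n ⊔ ⨆ a : Fin 3, (polySpace n).map (mulCoord a)

lemma polySpace_induction {p : ℕ → (E3 → ℝ) → Prop}
    (h0 : p 0 (fun _ => 1)) (hz : ∀ n, p n 0)
    (hadd : ∀ n f g, p n f → p n g → p n (fun x => f x + g x))
    (hsmul : ∀ n (k : ℝ) f, p n f → p n (fun x => k * f x))
    (hle : ∀ n f, f ∈ polySpace n → p n f → p (n + 1) f)
    (hmul : ∀ n (a : Fin 3) f, f ∈ polySpace n → p n f → p (n + 1) (fun x => x a * f x)) :
    ∀ n, ∀ f ∈ polySpace n, p n f := by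
  let Q : ∀ n, Submodule ℝ (E3 → ℝ) := fun n =>
    { carrier := {f | p n f}
      add_mem' := fun hf hg => hadd n _ _ hf hg
      zero_mem' := hz n
      smul_mem' := fun k f hf => hsmul n k f hf }
  intro n
  induction n with
  | zero =>
    have : polySpace 0 ≤ Q 0 := Submodule.span_le.2 (by
      rintro _ rfl
      exact h0)
    exact fun f hf => this hf
  | succ n ih =>
    have : polySpace (n + 1) ≤ Q (n + 1) := by
      refine sup_le (fun f hf => hle n f hf (ih f hf)) (iSup_le fun a => ?_)
      rintro _ ⟨f, hf, rfl⟩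
      exact hmul n a f hf (ih f hf)
    exact fun f hf => this hf

lemma polySpace_le_succ (n : ℕ) : polySpace n ≤ polySpace (n + 1) := le_sup_left

lemma polySpace_mono : Monotone polySpace := monotone_nat_of_le_succ polySpace_le_succ

lemma mulCoord_mem {n : ℕ} {f : E3 → ℝ} (hf : f ∈ polySpace n) (a : Fin 3) :
    (fun x => x a * f x) ∈ polySpace (n + 1) := by
  refine Submodule.mem_sup_right (Submodule.mem_iSup_of_mem a ?_)
  exact ⟨f, hf, rfl⟩

instance (n : ℕ) : FiniteDimensional ℝ (polySpace n) := by
  induction n with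
  | zero => exact FiniteDimensional.span_of_finite ℝ (finite_singleton _)
  | succ n ih =>
    have : FiniteDimensional ℝ (⨆ a : Fin 3, (polySpace n).map (mulCoord a) : Submodule ℝ (E3 → ℝ)) :=
      Submodule.finiteDimensional_iSup _
    exact Submodule.finiteDimensional_sup _ _

lemma contDiff_coord (a : Fin 3) : ContDiff ℝ ∞ (fun x : E3 => x a) :=
  (EuclideanSpace.proj a : E3 →L[ℝ] ℝ).contDiff

lemma fderiv_coord (a : Fin 3) (x v : E3) : fderiv ℝ (fun x : E3 => x a) x v = v a := by
  have : (fun x : E3 => x a) = (EuclideanSpace.proj a : E3 →L[ℝ] ℝ) := rfl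
  rw [this, ContinuousLinearMap.fderiv]
  rfl

lemma contDiff_of_mem_polySpace : ∀ n, ∀ f ∈ polySpace n, ContDiff ℝ ∞ f :=
  polySpace_induction (p := fun _ f => ContDiff ℝ ∞ f) contDiff_const (fun _ => contDiff_const)
    (fun _ _ _ hf hg => hf.add hg) (fun _ _ _ hf => contDiff_const.mul hf) (fun _ _ _ h => h)
    (fun _ a _ _ hf => (contDiff_coord a).mul hf)

lemma rotD_mul (i : Fin 3) {f g : E3 → ℝ} (hf : ContDiff ℝ ∞ f) (hg : ContDiff ℝ ∞ g) (y : E3) :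
    rotD i (fun x => f x * g x) y = f y * rotD i g y + g y * rotD i f y := by
  unfold rotD
  rw [fderiv_fun_mul (hf.differentiable (by simp)).differentiableAt
    (hg.differentiable (by simp)).differentiableAt]
  simp

lemma rotD_add (i : Fin 3) {f g : E3 → ℝ} (hf : ContDiff ℝ ∞ f) (hg : ContDiff ℝ ∞ g) (y : E3) :
    rotD i (fun x => f x + g x) y = rotD i f y + rotD i g y := by
  unfold rotD
  rw [fderiv_fun_add (hf.differentiable (by simp)).differentiableAt
    (hg.differentiable (by simp)).differentiableAt]
  simp

lemma rotD_const (i : Fin 3) (k : ℝ) (y : E3) : rotD i (fun _ => k) y = 0 := by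
  simp [rotD]

lemma rotD_mem : ∀ n, ∀ f ∈ polySpace n, ∀ i, rotD i f ∈ polySpace n := by
  have key := polySpace_induction
    (p := fun n f => ContDiff ℝ ∞ f ∧ ∀ i, rotD i f ∈ polySpace n)
    ⟨contDiff_const, fun i => by
      have : rotD i (fun _ => 1) = 0 := funext fun y => rotD_const i 1 y
      rw [this]; exact zero_mem _⟩
    (fun n => ⟨contDiff_const, fun i => by
      have : rotD i 0 = 0 := funext fun y => rotD_const i 0 y
      rw [this]; exact zero_mem _⟩)
    (fun n f g hf hg => ⟨hf.1.add hg.1, fun i => by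
      have : rotD i (fun x => f x + g x) = rotD i f + rotD i g :=
        funext fun y => rotD_add i hf.1 hg.1 y
      rw [this]; exact add_mem (hf.2 i) (hg.2 i)⟩)
    (fun n k f hf => ⟨contDiff_const.mul hf.1, fun i => by
      have : rotD i (fun x => k * f x) = k • rotD i f := funext fun y => by
        rw [rotD_mul i contDiff_const hf.1, rotD_const]; simp
      rw [this]; exact Submodule.smul_mem _ _ (hf.2 i)⟩)
    (fun n f _ hf => ⟨hf.1, fun i => polySpace_le_succ n (hf.2 i)⟩)
    (fun n a f hfm hf => ⟨(contDiff_coord a).mul hf.1, fun i => by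
      have : rotD i (fun x => x a * f x) =
          (fun x => x a * rotD i f x) + fun x => f x * (rot i x) a := funext fun y => by
        rw [rotD_mul i (contDiff_coord a) hf.1]
        simp [rotD, fderiv_coord]
      rw [this]
      refine add_mem (mulCoord_mem (hf.2 i) a) ?_
      have h1 : ∀ b : Fin 3, (fun x : E3 => f x * x b) ∈ polySpace (n + 1) := fun b => by
        simpa only [mul_comm] using mulCoord_mem hfm b
      have h2 : ∀ b : Fin 3, (fun x : E3 => f x * -x b) ∈ polySpace (n + 1) := fun b => by
        have := neg_mem (h1 b)
        simpa only [Pi.neg_def, mul_neg] using this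
      have h3 : (fun x : E3 => f x * 0) ∈ polySpace (n + 1) := by
        simp only [mul_zero]; exact zero_mem _
      fin_cases i <;> fin_cases a <;> simp only [rot] <;>
        first | exact h3 | exact h1 _ | exact h2 _⟩)
  exact fun n f hf i => (key n f hf).2 i

lemma mul_mem_polySpace (m : ℕ) (f : E3 → ℝ) (hf : f ∈ polySpace m) :
    ∀ n, ∀ g ∈ polySpace n, (fun x => g x * f x) ∈ polySpace (m + n) :=
  polySpace_induction (p := fun n g => (fun x => g x * f x) ∈ polySpace (m + n))
    (by simpa using hf) (fun n => by simp only [Pi.zero_apply, zero_mul]; exact zero_mem _)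
    (fun n g h hg hh => by
      simp only [add_mul]; exact add_mem hg hh)
    (fun n k g hg => by
      simp only [mul_assoc]; exact Submodule.smul_mem _ k hg)
    (fun n g _ hg => polySpace_le_succ _ hg)
    (fun n a g _ hg => by
      have := mulCoord_mem hg a
      simp only [← mul_assoc] at this
      exact this)

/-- Restriction of polynomials to the sphere. -/
def polyRestrict (n : ℕ) : polySpace n →ₗ[ℝ] C(S2, ℝ) where
  toFun f := ⟨fun y => f.1 y, (contDiff_of_mem_polySpace n f.1 f.2).continuous.comp
    continuous_subtype_val⟩
  map_add' _ _ := rfl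
  map_smul' _ _ := rfl

/-- The algebra of polynomials on the sphere. -/
def polyAlgebra : Subalgebra ℝ C(S2, ℝ) where
  carrier := {g | ∃ n, ∃ f ∈ polySpace n, ∀ y : S2, g y = f y}
  mul_mem' := by
    rintro g h ⟨n, f, hf, hg⟩ ⟨m, k, hk, hh⟩
    exact ⟨_, _, mul_mem_polySpace m k hk n f hf, fun y => by simp [hg, hh]⟩
  add_mem' := by
    rintro g h ⟨n, f, hf, hg⟩ ⟨m, k, hk, hh⟩
    exact ⟨max n m, f + k, add_mem (polySpace_mono (le_max_left _ _) hf)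
      (polySpace_mono (le_max_right _ _) hk), fun y => by simp [hg, hh]⟩
  algebraMap_mem' k := ⟨0, fun _ => k * 1, Submodule.smul_mem (polySpace 0) k
    (Submodule.subset_span rfl), fun y => by simp⟩

lemma polyAlgebra_dense : polyAlgebra.topologicalClosure = ⊤ := by
  refine ContinuousMap.subalgebra_topologicalClosure_eq_top_of_separatesPoints _ ?_
  intro x y hxy
  have : ∃ a, x.1 a ≠ y.1 a := by
    by_contra! h
    exact hxy (Subtype.ext (by ext a; exact h a))
  obtain ⟨a, ha⟩ := this
  refine ⟨fun z => z.1 a, ⟨⟨fun z : S2 => z.1 a, ((contDiff_coord a).continuous.comp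
    continuous_subtype_val)⟩, ⟨1, fun z => z a * 1, mulCoord_mem (n := 0)
      (Submodule.subset_span rfl) a, fun z => by simp⟩, rfl⟩, ha⟩

/-- Polynomials of degree at most `n` in `L²` of the sphere. -/
def polyL2 (n : ℕ) : Submodule ℝ (Lp ℝ 2 sphereMeasure) :=
  LinearMap.range ((ContinuousMap.toLp 2 sphereMeasure ℝ : C(S2, ℝ) →L[ℝ] _).toLinearMap ∘ₗ
    polyRestrict n)

instance (n : ℕ) : FiniteDimensional ℝ (polyL2 n) := by
  unfold polyL2; infer_instance

lemma polyL2_mono : Monotone polyL2 := by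
  intro m n h
  rintro _ ⟨f, rfl⟩
  exact ⟨⟨f.1, polySpace_mono h f.2⟩, rfl⟩

lemma polyL2_dense : ⊤ ≤ (⨆ n, polyL2 n).topologicalClosure := by
  have h1 := ContinuousMap.toLp_denseRange (α := S2) ℝ sphereMeasure ℝ (p := 2) (by simp)
  have h2 : Dense (polyAlgebra : Set C(S2, ℝ)) := by
    have := polyAlgebra_dense
    rw [dense_iff_closure_eq, ← Subalgebra.topologicalClosure_coe, this]
    rfl
  have h3 := h1.dense_image (ContinuousMap.toLp 2 sphereMeasure ℝ : C(S2, ℝ) →L[ℝ] _).continuous h2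
  intro x _
  refine closure_mono ?_ (h3 x)
  rintro _ ⟨g, ⟨n, f, hf, hg⟩, rfl⟩
  refine Submodule.mem_iSup_of_mem n ⟨⟨f, hf⟩, ?_⟩
  have : polyRestrict n ⟨f, hf⟩ = g := by
    ext y
    exact (hg y).symm
  rw [LinearMap.comp_apply, this]
  rfl

/-- The dimension of the space of polynomials of degree at most `n` on the sphere. -/
abbrev angDim (n : ℕ) : ℕ := Module.finrank ℝ (polyL2 n)

/-- An orthonormal basis of the space of polynomials on the sphere. -/
def angBasis (n : ℕ) : OrthonormalBasis (Fin (angDim n)) ℝ (polyL2 n) :=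
  stdOrthonormalBasis ℝ (polyL2 n)

lemma exists_angFun (n : ℕ) (j : Fin (angDim n)) : ∃ f ∈ polySpace n,
    ((angBasis n j : Lp ℝ 2 sphereMeasure) : S2 → ℝ) =ᵐ[sphereMeasure] fun y => f y := by
  obtain ⟨f, hf⟩ := (angBasis n j).2
  refine ⟨f.1, f.2, ?_⟩
  rw [← hf]
  exact ContinuousMap.coeFn_toLp sphereMeasure (polyRestrict n f)

/-- Polynomials that represent the orthonormal basis. -/
def angFun (n : ℕ) (j : Fin (angDim n)) : E3 → ℝ := (exists_angFun n j).choose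

lemma angFun_mem (n : ℕ) (j : Fin (angDim n)) : angFun n j ∈ polySpace n :=
  (exists_angFun n j).choose_spec.1

lemma angFun_ae (n : ℕ) (j : Fin (angDim n)) :
    ((angBasis n j : Lp ℝ 2 sphereMeasure) : S2 → ℝ) =ᵐ[sphereMeasure] fun y => angFun n j y :=
  (exists_angFun n j).choose_spec.2

lemma angFun_contDiff (n : ℕ) (j : Fin (angDim n)) : ContDiff ℝ ∞ (angFun n j) :=
  contDiff_of_mem_polySpace n _ (angFun_mem n j)

lemma memLp_sphere_of_continuous {φ : E3 → ℝ} (hφ : Continuous φ) :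
    MemLp (fun y : S2 => φ y) 2 sphereMeasure := by
  have hc : Continuous fun y : S2 => φ y := hφ.comp continuous_subtype_val
  obtain ⟨C, hC⟩ := isCompact_univ.exists_bound_of_continuousOn hc.continuousOn
  exact MemLp.of_bound hc.aestronglyMeasurable C (.of_forall fun y => hC y (mem_univ _))

lemma inner_angBasis (n : ℕ) (j : Fin (angDim n)) {g : S2 → ℝ} (hg : MemLp g 2 sphereMeasure) :
    inner ℝ (angBasis n j : Lp ℝ 2 sphereMeasure) (hg.toLp g) =
      ∫ y, g y * angFun n j y ∂sphereMeasure := by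
  rw [L2.inner_def]
  refine integral_congr_ae ?_
  filter_upwards [angFun_ae n j, hg.coeFn_toLp] with y h1 h2
  simp only [h1, h2]
  simp

lemma inner_toLp {g h : S2 → ℝ} (hg : MemLp g 2 sphereMeasure) (hh : MemLp h 2 sphereMeasure) :
    inner ℝ (hg.toLp g) (hh.toLp h) = ∫ y, g y * h y ∂sphereMeasure := by
  rw [L2.inner_def]
  refine integral_congr_ae ?_
  filter_upwards [hh.coeFn_toLp, hg.coeFn_toLp] with y h1 h2
  simp only [h1, h2]
  simp [mul_comm]

lemma starProjection_polyL2 (n : ℕ) (x : Lp ℝ 2 sphereMeasure) :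
    (polyL2 n).starProjection x =
      ∑ j, (inner ℝ (angBasis n j : Lp ℝ 2 sphereMeasure) x) • (angBasis n j : Lp ℝ 2 sphereMeasure) := by
  have h := (angBasis n).sum_repr' ((polyL2 n).orthogonalProjectionOnto x)
  have h2 := congrArg (Subtype.val) h
  rw [Submodule.starProjection_apply, ← h2]
  simp only [AddSubmonoidClass.coe_finsetSum, Submodule.coe_smul]
  refine Finset.sum_congr rfl fun j _ => ?_
  congr 1
  rw [Submodule.coe_inner, ← Submodule.starProjection_apply]
  have h3 := Submodule.inner_starProjection_left_eq_right (polyL2 n) (angBasis n j : Lp ℝ 2 sphereMeasure) x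
  rw [← h3, Submodule.starProjection_eq_self_iff.2 (angBasis n j).2]

lemma tendsto_sum_angFun_real {g h : S2 → ℝ} (hg : MemLp g 2 sphereMeasure)
    (hh : MemLp h 2 sphereMeasure) :
    Tendsto (fun n => ∑ j, (∫ y, g y * angFun n j y ∂sphereMeasure) *
      (∫ y, h y * angFun n j y ∂sphereMeasure)) atTop (𝓝 (∫ y, g y * h y ∂sphereMeasure)) := by
  have h1 := Submodule.starProjection_tendsto_self polyL2 polyL2_mono (hg.toLp g) polyL2_dense
  have h2 := h1.inner (tendsto_const_nhds (x := hh.toLp h)) (𝕜 := ℝ)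
  rw [inner_toLp hg hh] at h2
  refine h2.congr fun n => ?_
  rw [starProjection_polyL2, sum_inner]
  refine Finset.sum_congr rfl fun j _ => ?_
  rw [inner_smul_left, inner_angBasis, inner_angBasis]
  simp

lemma sum_sq_angFun_le_real (n : ℕ) {g : S2 → ℝ} (hg : MemLp g 2 sphereMeasure) :
    ∑ j, (∫ y, g y * angFun n j y ∂sphereMeasure) ^ 2 ≤ ∫ y, g y ^ 2 ∂sphereMeasure := by
  have ho : Orthonormal ℝ fun j => (angBasis n j : Lp ℝ 2 sphereMeasure) :=
    (angBasis n).orthonormal.comp_linearIsometry (polyL2 n).subtypeₗᵢ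
  have := ho.sum_inner_products_le (hg.toLp g) (s := Finset.univ)
  rw [← real_inner_self_eq_norm_sq, inner_toLp hg hg] at this
  simp only [inner_angBasis, Real.norm_eq_abs, sq_abs] at this
  simpa only [sq] using this

lemma rotD_angFun (n : ℕ) (i : Fin 3) (j : Fin (angDim n)) :
    ∀ᵐ y : S2 ∂sphereMeasure, rotD i (angFun n j) y =
      ∑ l, (∫ z : S2, rotD i (angFun n j) z * angFun n l z ∂sphereMeasure) * angFun n l y := by
  have hm := rotD_mem n _ (angFun_mem n j) i
  have hL := memLp_sphere_of_continuous (contDiff_of_mem_polySpace n _ hm).continuous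
  have hin : hL.toLp _ ∈ polyL2 n := ⟨⟨_, hm⟩, rfl⟩
  have h1 := starProjection_polyL2 n (hL.toLp _)
  rw [Submodule.starProjection_eq_self_iff.2 hin] at h1
  have h2 : ((hL.toLp _ : Lp ℝ 2 sphereMeasure) : S2 → ℝ) =ᵐ[sphereMeasure]
      fun y => ∑ l, (∫ z : S2, rotD i (angFun n j) z * angFun n l z ∂sphereMeasure) *
        angFun n l y := by
    rw [h1]
    have h3 : ∀ᵐ y ∂sphereMeasure, ∀ l,
        ((inner ℝ (angBasis n l : Lp ℝ 2 sphereMeasure) (hL.toLp _) •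
          (angBasis n l : Lp ℝ 2 sphereMeasure) : Lp ℝ 2 sphereMeasure) : S2 → ℝ) y =
        (∫ z : S2, rotD i (angFun n j) z * angFun n l z ∂sphereMeasure) * angFun n l y := by
      rw [ae_all_iff]
      intro l
      filter_upwards [Lp.coeFn_smul (inner ℝ (angBasis n l : Lp ℝ 2 sphereMeasure) (hL.toLp _))
        (angBasis n l : Lp ℝ 2 sphereMeasure), angFun_ae n l] with y h4 h5
      rw [h4, Pi.smul_apply, h5, inner_angBasis, smul_eq_mul]
    filter_upwards [Lp.coeFn_finsetSum (μ := sphereMeasure) Finset.univ fun l =>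
      inner ℝ (angBasis n l : Lp ℝ 2 sphereMeasure) (hL.toLp _) •
          (angBasis n l : Lp ℝ 2 sphereMeasure), h3] with y h6 h7
    rw [h6, Finset.sum_apply]
    exact Finset.sum_congr rfl fun l _ => h7 l
  filter_upwards [h2, hL.coeFn_toLp] with y h3 h4
  rw [← h4, h3]

/-- The coefficients of a complex function with respect to the polynomials `angFun n j`. -/
def angCoef (n : ℕ) (g : S2 → ℂ) (j : Fin (angDim n)) : ℂ :=
  ∫ y, g y * (angFun n j y : ℂ) ∂sphereMeasure

lemma integrable_mul_of_memLp {φ : S2 → ℝ} (hφ : MemLp φ 2 sphereMeasure) {g : S2 → ℂ}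
    (hg : MemLp g 2 sphereMeasure) : Integrable (fun y => g y * (φ y : ℂ)) sphereMeasure :=
  hg.integrable_mul hφ.ofReal

lemma angCoef_eq (n : ℕ) {g : S2 → ℂ} (hg : MemLp g 2 sphereMeasure) (j : Fin (angDim n)) :
    angCoef n g j = ((∫ y, (g y).re * angFun n j y ∂sphereMeasure : ℝ) : ℂ) +
      I * ((∫ y, (g y).im * angFun n j y ∂sphereMeasure : ℝ) : ℂ) := by
  have hi := integrable_mul_of_memLp (memLp_sphere_of_continuous (angFun_contDiff n j).continuous) hg
  have h1 := reCLM.integral_comp_comm hi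
  have h2 := imCLM.integral_comp_comm hi
  simp only [reCLM_apply, imCLM_apply, mul_re, ofReal_re,
    ofReal_im, mul_zero, sub_zero, mul_im, zero_add] at h1 h2
  unfold angCoef
  rw [h1, h2, mul_comm I]
  exact (re_add_im _).symm

/-- Parseval's identity. -/
lemma tendsto_sum_angCoef {g h : S2 → ℂ} (hg : MemLp g 2 sphereMeasure)
    (hh : MemLp h 2 sphereMeasure) :
    Tendsto (fun n => ∑ j, angCoef n g j * conj (angCoef n h j)) atTop
      (𝓝 (∫ y, g y * conj (h y) ∂sphereMeasure)) := by
  have t1 := tendsto_sum_angFun_real hg.re hh.re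
  have t2 := tendsto_sum_angFun_real hg.im hh.im
  have t3 := tendsto_sum_angFun_real hg.im hh.re
  have t4 := tendsto_sum_angFun_real hg.re hh.im
  have c : ∀ {u : ℕ → ℝ} {l : ℝ}, Tendsto u atTop (𝓝 l) →
      Tendsto (fun n => (u n : ℂ)) atTop (𝓝 (l : ℂ)) := fun h =>
    (continuous_ofReal.tendsto _).comp h
  have t := ((c (t1.add t2))).add ((c (t3.sub t4)).const_mul I)
  have hlim : ∫ y, g y * conj (h y) ∂sphereMeasure =
      (((∫ y, (g y).re * (h y).re ∂sphereMeasure) + ∫ y, (g y).im * (h y).im ∂sphereMeasure : ℝ) : ℂ)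
      + I * (((∫ y, (g y).im * (h y).re ∂sphereMeasure) -
        ∫ y, (g y).re * (h y).im ∂sphereMeasure : ℝ) : ℂ) := by
    have hi : Integrable (fun y => g y * conj (h y)) sphereMeasure :=
      hg.integrable_mul hh.star
    have h1 := reCLM.integral_comp_comm hi
    have h2 := imCLM.integral_comp_comm hi
    have i1 : Integrable (fun y => (g y).re * (h y).re) sphereMeasure := hg.re.integrable_mul hh.re
    have i2 : Integrable (fun y => (g y).im * (h y).im) sphereMeasure := hg.im.integrable_mul hh.im
    have i3 : Integrable (fun y => (g y).im * (h y).re) sphereMeasure := hg.im.integrable_mul hh.re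
    have i4 : Integrable (fun y => (g y).re * (h y).im) sphereMeasure := hg.re.integrable_mul hh.im
    rw [← integral_add i1 i2, ← integral_sub i3 i4, mul_comm I,
      ← re_add_im (∫ y, g y * conj (h y) ∂sphereMeasure)]
    simp only [reCLM_apply, imCLM_apply] at h1 h2
    rw [← h1, ← h2]
    congr 3
    · ext y; simp
    · congr 1; ext y; simp; ring
  rw [hlim]
  refine t.congr fun n => ?_
  rw [← Finset.sum_add_distrib, ← Finset.sum_sub_distrib]
  push_cast
  rw [Finset.mul_sum, ← Finset.sum_add_distrib]
  refine Finset.sum_congr rfl fun j _ => ?_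
  rw [angCoef_eq n hg, angCoef_eq n hh]
  simp only [map_add, map_mul, conj_ofReal, conj_I, RCLike.re_to_complex,
    RCLike.im_to_complex]
  linear_combination ((∫ y, (g y).im * angFun n j y ∂sphereMeasure : ℝ) *
    (∫ y, (h y).im * angFun n j y ∂sphereMeasure : ℝ) : ℂ) * I_sq

/-- Bessel's inequality. -/
lemma sum_sq_angCoef_le (n : ℕ) {g : S2 → ℂ} (hg : MemLp g 2 sphereMeasure) :
    ∑ j, ‖angCoef n g j‖ ^ 2 ≤ ∫ y, ‖g y‖ ^ 2 ∂sphereMeasure := by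
  have h1 := sum_sq_angFun_le_real n hg.re
  have h2 := sum_sq_angFun_le_real n hg.im
  have h3 : ∫ y, ‖g y‖ ^ 2 ∂sphereMeasure =
      (∫ y, (g y).re ^ 2 ∂sphereMeasure) + ∫ y, (g y).im ^ 2 ∂sphereMeasure := by
    have i1 : Integrable (fun y => (g y).re ^ 2) sphereMeasure := hg.re.integrable_sq
    have i2 : Integrable (fun y => (g y).im ^ 2) sphereMeasure := hg.im.integrable_sq
    rw [← integral_add i1 i2]
    congr 1; ext y
    rw [Complex.sq_norm, normSq_apply]; ring
  rw [h3]
  refine le_trans (le_of_eq ?_) (add_le_add h1 h2)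
  rw [← Finset.sum_add_distrib]
  refine Finset.sum_congr rfl fun j _ => ?_
  rw [angCoef_eq n hg, Complex.sq_norm, normSq_apply]
  simp
  ring

/-! ### Polar coordinates -/

/-- The measure `dr dσ` on `(c, ∞) × S²`. -/
def polMeasure (c : ℝ) : Measure (ℝ × S2) := (volume.restrict (Ioi c)).prod sphereMeasure

/-- Polar coordinates. -/
def pol (z : ℝ × S2) : E3 := z.1 • (z.2 : E3)

lemma continuous_pol : Continuous pol :=
  continuous_fst.smul (continuous_subtype_val.comp continuous_snd)

lemma norm_pol {z : ℝ × S2} (hz : 0 ≤ z.1) : ‖pol z‖ = z.1 := by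
  have : ‖(z.2 : E3)‖ = 1 := by simp
  rw [pol, norm_smul, this, mul_one, Real.norm_of_nonneg hz]

lemma lintegral_pol {c : ℝ} (hc : 0 < c) {f : E3 → ENNReal} (hf : Measurable f) :
    ∫⁻ x in {x : E3 | c < ‖x‖}, f x = ∫⁻ z, ENNReal.ofReal (z.1 ^ 2) * f (pol z) ∂polMeasure c := by
  have hm : MeasurableSet {x : E3 | c < ‖x‖} := measurableSet_lt measurable_const measurable_norm
  set F : E3 → ENNReal := {x : E3 | c < ‖x‖}.indicator f with hF
  have hFm : Measurable F := hf.indicator hm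
  have h1 : ∫⁻ x in {x : E3 | c < ‖x‖}, f x = ∫⁻ x, F x := (lintegral_indicator hm f).symm
  have h2 : ∫⁻ x, F x = ∫⁻ x in ({0}ᶜ : Set E3), F x := by
    rw [restrict_compl_singleton]
  have h3 : ∫⁻ x in ({0}ᶜ : Set E3), F x =
      ∫⁻ x : ({0}ᶜ : Set E3), F x ∂((volume : Measure E3).comap (↑)) :=
    (lintegral_subtype_comap (measurableSet_singleton _).compl F).symm
  have hmp := (volume : Measure E3).measurePreserving_homeomorphUnitSphereProd
  have h4 : ∫⁻ x : ({0}ᶜ : Set E3), F x ∂((volume : Measure E3).comap (↑)) =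
      ∫⁻ w : S2 × Ioi (0 : ℝ), F (w.2.1 • w.1.1)
        ∂((volume : Measure E3).toSphere.prod (Measure.volumeIoiPow (Module.finrank ℝ E3 - 1))) := by
    rw [← hmp.lintegral_comp_emb (Homeomorph.measurableEmbedding _)]
    refine lintegral_congr fun x => ?_
    congr 1
    have hx : ‖x.1‖ ≠ 0 := norm_ne_zero_iff.2 x.2
    simp [smul_smul, hx]
  have hdim : Module.finrank ℝ E3 - 1 = 2 := by simp
  rw [h1, h2, h3, h4, hdim]
  have hg : Measurable fun w : S2 × Ioi (0 : ℝ) => F (w.2.1 • w.1.1) := by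
    refine hFm.comp ?_
    exact (measurable_subtype_coe.comp measurable_snd).smul
      (measurable_subtype_coe.comp measurable_fst)
  rw [lintegral_prod_symm _ hg.aemeasurable, Measure.volumeIoiPow,
    lintegral_withDensity_eq_lintegral_mul₀
      ((measurable_subtype_coe.pow_const 2).ennreal_ofReal).aemeasurable]
  swap
  · exact (hg.lintegral_prod_left').aemeasurable
  have hgp : Measurable fun z : ℝ × S2 => F (z.1 • z.2.1) := hFm.comp continuous_pol.measurable
  have hG : Measurable fun r : ℝ => ∫⁻ y : S2, F (r • y.1) ∂sphereMeasure :=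
    hgp.lintegral_prod_right'
  simp only [Pi.mul_apply]
  rw [lintegral_subtype_comap (measurableSet_Ioi) fun r : ℝ =>
    ENNReal.ofReal (r ^ 2) * ∫⁻ y : S2, F (r • y.1) ∂sphereMeasure]
  rw [polMeasure, lintegral_prod _ (by
    refine AEMeasurable.mul ?_ ?_
    · exact (measurable_fst.pow_const 2).ennreal_ofReal.aemeasurable
    · exact (hf.comp continuous_pol.measurable).aemeasurable)]
  have hsub : ∀ r : ℝ, 0 < r → ENNReal.ofReal (r ^ 2) * ∫⁻ y : S2, F (r • y.1) ∂sphereMeasure =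
      (Ioi c).indicator (fun r => ∫⁻ y : S2, ENNReal.ofReal (r ^ 2) * f (pol (r, y)) ∂sphereMeasure) r := by
    intro r hr
    have hn : ∀ y : S2, ‖r • y.1‖ = r := fun y => norm_pol (z := (r, y)) hr.le
    by_cases hrc : c < r
    · rw [indicator_of_mem (by exact hrc), lintegral_const_mul']
      · congr 1
        refine lintegral_congr fun y => ?_
        rw [hF, indicator_of_mem (by simpa [hn y] using hrc)]
        rfl
      · simp
    · rw [indicator_of_notMem (by exact hrc)]
      have : ∀ y : S2, F (r • y.1) = 0 := fun y => by
        rw [hF, indicator_of_notMem]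
        simpa [hn y] using hrc
      simp [this]
  rw [setLIntegral_congr_fun measurableSet_Ioi fun r hr => hsub r hr,
    setLIntegral_indicator measurableSet_Ioi, inter_eq_left.2 (Ioi_subset_Ioi hc.le)]

/-- Polar coordinates as a change of measure. -/
lemma map_pol {c : ℝ} (hc : 0 < c) :
    Measure.map pol ((polMeasure c).withDensity fun z => ENNReal.ofReal (z.1 ^ 2)) =
      volume.restrict {x : E3 | c < ‖x‖} := by
  refine Measure.ext fun s hs => ?_
  have h := lintegral_pol hc (measurable_one.indicator hs)
  rw [Measure.map_apply continuous_pol.measurable hs,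
    withDensity_apply _ (continuous_pol.measurable hs)]
  rw [lintegral_indicator_one hs] at h
  rw [h, ← lintegral_indicator (continuous_pol.measurable hs)]
  refine lintegral_congr fun z => ?_
  by_cases hz : pol z ∈ s
  · rw [indicator_of_mem (by exact hz), indicator_of_mem hz]; simp
  · rw [indicator_of_notMem (by exact hz), indicator_of_notMem hz]; simp

lemma ae_fst_mem (c : ℝ) : ∀ᵐ z ∂polMeasure c, c < z.1 := by
  have : ∀ᵐ r ∂(volume.restrict (Ioi c)), c < r := ae_restrict_mem measurableSet_Ioi
  exact Measure.quasiMeasurePreserving_fst.ae this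

lemma polMeasure_ac {c : ℝ} (hc : 0 < c) :
    polMeasure c ≪ (polMeasure c).withDensity fun z => ENNReal.ofReal (z.1 ^ 2) := by
  refine withDensity_absolutelyContinuous' (by fun_prop) ?_
  filter_upwards [ae_fst_mem c] with z hz
  have : 0 < z.1 := hc.trans hz
  simp [this.ne']

lemma quasiMeasurePreserving_pol {c : ℝ} (hc : 0 < c) :
    Measure.QuasiMeasurePreserving pol (polMeasure c) (volume.restrict {x : E3 | c < ‖x‖}) := by
  refine ⟨continuous_pol.measurable, ?_⟩
  rw [← map_pol hc]
  exact (polMeasure_ac hc).map continuous_pol.measurable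

lemma integral_pol {c : ℝ} (hc : 0 < c) {f : E3 → ℂ}
    (hf : AEStronglyMeasurable f (volume.restrict {x : E3 | c < ‖x‖})) :
    ∫ x in {x : E3 | c < ‖x‖}, f x = ∫ z, ((z.1 ^ 2 : ℝ) : ℂ) * f (pol z) ∂polMeasure c := by
  rw [← map_pol hc] at hf ⊢
  rw [integral_map continuous_pol.measurable.aemeasurable hf,
    integral_withDensity_eq_integral_toReal_smul (by fun_prop) (by simp)]
  refine integral_congr_ae ?_
  filter_upwards with z
  rw [ENNReal.toReal_ofReal (by positivity), real_smul]

/-- Integrability on the shells `[x, y] × S²`, `c < x < y`. -/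
def LocInt (c : ℝ) (H : ℝ × S2 → ℂ) : Prop :=
  ∀ x y, c < x → x < y → Integrable H ((volume.restrict (Icc x y)).prod sphereMeasure)

lemma shell_eq_restrict {c x y : ℝ} (hx : c < x) :
    (volume.restrict (Icc x y)).prod sphereMeasure =
      (polMeasure c).restrict (Icc x y ×ˢ (univ : Set S2)) := by
  rw [polMeasure, ← Measure.prod_restrict, Measure.restrict_restrict measurableSet_Icc,
    inter_eq_left.2 (show Icc x y ⊆ Ioi c from fun r hr => hx.trans_le hr.1), Measure.restrict_univ]

lemma LocInt.of_memLp {c : ℝ} {H : ℝ × S2 → ℂ} (h : MemLp H 2 (polMeasure c)) : LocInt c H := by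
  intro x y hx _
  have : MemLp H 2 ((volume.restrict (Icc x y)).prod sphereMeasure) := by
    rw [shell_eq_restrict hx]; exact h.restrict _
  exact this.integrable (by norm_num)

lemma LocInt.add {c : ℝ} {H K : ℝ × S2 → ℂ} (hH : LocInt c H) (hK : LocInt c K) :
    LocInt c (fun z => H z + K z) := fun x y hx hy => (hH x y hx hy).add (hK x y hx hy)

lemma LocInt.mul {c : ℝ} {H k : ℝ × S2 → ℂ} (hH : LocInt c H)
    (hk : ContinuousOn k (Ioi c ×ˢ univ)) : LocInt c (fun z => k z * H z) := by
  intro x y hx hy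
  have hsub : Icc x y ×ˢ (univ : Set S2) ⊆ Ioi c ×ˢ univ :=
    prod_mono (fun r hr => hx.trans_le hr.1) le_rfl
  have h := hH x y hx hy
  obtain ⟨C, hC⟩ := (isCompact_Icc.prod isCompact_univ).exists_bound_of_continuousOn (hk.mono hsub)
  have hm : MeasurableSet (Icc x y ×ˢ (univ : Set S2)) := measurableSet_Icc.prod MeasurableSet.univ
  rw [shell_eq_restrict hx] at h ⊢
  exact h.bdd_mul ((hk.mono hsub).aestronglyMeasurable hm) ((ae_restrict_mem hm).mono fun z hz => hC z hz)

/-- The integrals over the spheres. -/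
def fib (H : ℝ × S2 → ℂ) (r : ℝ) : ℂ := ∫ y, H (r, y) ∂sphereMeasure

lemma LocInt.locallyIntegrableOn_fib {c : ℝ} {H : ℝ × S2 → ℂ} (hH : LocInt c H) :
    LocallyIntegrableOn (fib H) (Ioi c) := by
  rw [locallyIntegrableOn_iff (isOpen_Ioi.isLocallyClosed)]
  intro K hK hKc
  by_cases hne : K.Nonempty
  · obtain ⟨m, hm, hm'⟩ := hKc.exists_isLeast hne
    obtain ⟨M, hM, hM'⟩ := hKc.exists_isGreatest hne
    have := (hH m (M + 1) (hK hm) (by linarith [hm' hM])).integral_prod_left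
    exact IntegrableOn.mono_set (t := Icc m (M + 1)) this fun r hr => ⟨hm' hr, by linarith [hM' hr]⟩
  · rw [not_nonempty_iff_eq_empty.1 hne]; exact integrableOn_empty

lemma LocInt.integrable_mul {c : ℝ} {H : ℝ × S2 → ℂ} (hH : LocInt c H) {g : ℝ → ℝ}
    (hg : Continuous g) (hgc : HasCompactSupport g) (hgs : tsupport g ⊆ Ioi c) :
    Integrable (fun z => (g z.1 : ℂ) * H z) (polMeasure c) := by
  obtain ⟨x, y, hx, hxy, hs⟩ := exists_Icc_of_tsupport hgc hgs
  have h1 : LocInt c (fun z => (g z.1 : ℂ) * H z) :=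
    hH.mul (continuous_ofReal.comp (hg.comp continuous_fst)).continuousOn
  have h2 := h1 x y hx hxy
  rw [shell_eq_restrict hx] at h2
  refine IntegrableOn.integrable_of_forall_notMem_eq_zero h2 fun z hz => ?_
  rw [image_eq_zero_of_notMem_tsupport fun h => hz ⟨Ioo_subset_Icc_self (hs h), mem_univ _⟩]
  simp

lemma LocInt.integral_mul {c : ℝ} {H : ℝ × S2 → ℂ} (hH : LocInt c H) {g : ℝ → ℝ}
    (hg : Continuous g) (hgc : HasCompactSupport g) (hgs : tsupport g ⊆ Ioi c) :
    ∫ z, (g z.1 : ℂ) * H z ∂polMeasure c = ∫ r in Ioi c, g r • fib H r := by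
  have h := hH.integrable_mul hg hgc hgs
  rw [polMeasure] at h ⊢
  rw [integral_prod _ h]
  refine integral_congr_ae (.of_forall fun r => ?_)
  simp only [fib, real_smul, integral_const_mul]

lemma weakDeriv1_fib {c : ℝ} {A A' : ℝ × S2 → ℂ} (hA : LocInt c A) (hA' : LocInt c A')
    (h : ∀ g : ℝ → ℝ, ContDiff ℝ ∞ g → HasCompactSupport g → tsupport g ⊆ Ioi c →
      ∫ z, ((deriv g z.1 : ℝ) : ℂ) * A z ∂polMeasure c = -∫ z, (g z.1 : ℂ) * A' z ∂polMeasure c) :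
    WeakDeriv1 c (fib A) (fib A') := by
  refine ⟨hA.locallyIntegrableOn_fib, hA'.locallyIntegrableOn_fib, fun g h1 h2 h3 => ?_⟩
  have hd := h1.continuous_deriv (by simp)
  have hdt : tsupport (deriv g) ⊆ Ioi c := (closure_minimal support_deriv_subset
    (isClosed_tsupport _)).trans h3
  rw [← hA.integral_mul hd h2.deriv hdt, ← hA'.integral_mul h1.continuous h2 h3]
  exact h g h1 h2 h3

lemma fib_ae_eq_zero {c : ℝ} {A : ℝ × S2 → ℂ} (hA : LocInt c A)
    (h : ∀ g : ℝ → ℝ, ContDiff ℝ ∞ g → HasCompactSupport g → tsupport g ⊆ Ioi c →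
      ∫ z, (g z.1 : ℂ) * A z ∂polMeasure c = 0) : ∀ᵐ r, r ∈ Ioi c → fib A r = 0 := by
  refine isOpen_Ioi.ae_eq_zero_of_integral_contDiff_smul_eq_zero hA.locallyIntegrableOn_fib fun g h1 h2 h3 => ?_
  rw [← h g h1 h2 h3, hA.integral_mul h1.continuous h2 h3]
  exact (setIntegral_eq_integral_of_forall_compl_eq_zero fun r hr => by
    rw [image_eq_zero_of_notMem_tsupport fun h => hr (h3 h), zero_smul]).symm

/-! ### Test functions in polar coordinates -/

/-- The exterior of the ball of radius `c`. -/
abbrev ext (c : ℝ) : Set E3 := {x | c < ‖x‖}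

lemma isOpen_ext (c : ℝ) : IsOpen (ext c) := isOpen_lt continuous_const continuous_norm

lemma ne_zero_of_mem_ext {c : ℝ} (hc : 0 < c) {x : E3} (hx : x ∈ ext c) : x ≠ 0 :=
  norm_pos_iff.1 (hc.trans hx)

/-- The function `g(|x|) Φ(x)`. -/
def radialTest (g : ℝ → ℝ) (Φ : E3 → ℝ) (x : E3) : ℂ := ((g ‖x‖ * Φ x : ℝ) : ℂ)

lemma contDiffAt_norm_comp {g : ℝ → ℝ} (hg : ContDiff ℝ ∞ g) {x : E3} (hx : x ≠ 0) :
    ContDiffAt ℝ ∞ (fun x : E3 => g ‖x‖) x :=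
  hg.contDiffAt.comp x (contDiffAt_norm ℝ hx)

lemma contDiff_mul_of_tsupport {Ω : Set E3} (hΩ : IsOpen Ω) {ψ Φ : E3 → ℂ} (hψ : IsTest Ω ψ)
    (hΦ : ContDiffOn ℝ ∞ Φ Ω) : IsTest Ω (fun x => Φ x * ψ x) := by
  have hs : tsupport (fun x => Φ x * ψ x) ⊆ tsupport ψ :=
    closure_mono fun x hx => right_ne_zero_of_mul hx
  refine ⟨?_, hψ.compact.mul_left, hs.trans hψ.supp⟩
  rw [contDiff_iff_contDiffAt]
  intro x
  by_cases hx : x ∈ Ω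
  · exact (hΦ.contDiffAt (hΩ.mem_nhds hx)).mul hψ.smooth.contDiffAt
  · have hx' : x ∉ tsupport ψ := fun h => hx (hψ.supp h)
    have : (fun x => Φ x * ψ x) =ᶠ[𝓝 x] fun _ => 0 := by
      filter_upwards [(isClosed_tsupport ψ).isOpen_compl.mem_nhds hx'] with y hy
      rw [image_eq_zero_of_notMem_tsupport hy, mul_zero]
    exact contDiffAt_const.congr_of_eventuallyEq this

lemma isTest_radial {c : ℝ} (hc : 0 < c) {g : ℝ → ℝ} (hg : ContDiff ℝ ∞ g)
    (hgc : HasCompactSupport g) (hgs : tsupport g ⊆ Ioi c) :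
    IsTest (ext c) (fun x => (g ‖x‖ : ℂ)) := by
  obtain ⟨a, b, ha, hab, hs⟩ := exists_Icc_of_tsupport hgc hgs
  have hts : tsupport (fun x : E3 => (g ‖x‖ : ℂ)) ⊆ (fun x : E3 => ‖x‖) ⁻¹' tsupport g := by
    refine closure_minimal (fun x hx => subset_tsupport g ?_)
      ((isClosed_tsupport g).preimage continuous_norm)
    exact fun h => hx (by simp [h])
  have hsub : (fun x : E3 => ‖x‖) ⁻¹' tsupport g ⊆ ext c := fun x hx => hgs hx
  refine ⟨?_, ?_, hts.trans hsub⟩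
  · rw [contDiff_iff_contDiffAt]
    intro x
    by_cases hx : x = 0
    · have : (fun x : E3 => (g ‖x‖ : ℂ)) =ᶠ[𝓝 x] fun _ => 0 := by
        have h0 : x ∉ tsupport (fun x : E3 => (g ‖x‖ : ℂ)) := fun h => by
          have h2 : c < ‖x‖ := hsub (hts h)
          rw [hx, norm_zero] at h2
          linarith
        filter_upwards [(isClosed_tsupport _).isOpen_compl.mem_nhds h0] with y hy
        exact image_eq_zero_of_notMem_tsupport (f := fun x : E3 => (g ‖x‖ : ℂ)) hy
      exact contDiffAt_const.congr_of_eventuallyEq this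
    · exact ofRealCLM.contDiff.contDiffAt.comp x (contDiffAt_norm_comp hg hx)
  · refine (isCompact_closedBall (0 : E3) b).of_isClosed_subset (isClosed_tsupport _) ?_
    intro x hx
    simpa using (hs (hts hx)).2.le

lemma isTest_radialTest {c : ℝ} (hc : 0 < c) {g : ℝ → ℝ} (hg : ContDiff ℝ ∞ g)
    (hgc : HasCompactSupport g) (hgs : tsupport g ⊆ Ioi c) {Φ : E3 → ℝ}
    (hΦ : ContDiffOn ℝ ∞ Φ (ext c)) : IsTest (ext c) (radialTest g Φ) := by
  have := contDiff_mul_of_tsupport (isOpen_ext c) (isTest_radial hc hg hgc hgs)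
    (Φ := fun x => (Φ x : ℂ)) (ofRealCLM.contDiff.comp_contDiffOn hΦ)
  convert this using 1
  ext x
  simp [radialTest, mul_comm]

lemma fderiv_norm_comp {g : ℝ → ℝ} {x : E3} (hg : DifferentiableAt ℝ g ‖x‖) (hx : x ≠ 0)
    (v : E3) :
    fderiv ℝ (fun x : E3 => g ‖x‖) x v = deriv g ‖x‖ * (inner ℝ x v / ‖x‖) := by
  have h1 : HasFDerivAt (fun x : E3 => ‖x‖) (‖x‖⁻¹ • innerSL ℝ x) x := by
    have h2 := ((hasStrictFDerivAt_norm_sq x).hasFDerivAt).sqrt (by positivity)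
    have h3 : (fun x : E3 => Real.sqrt (‖x‖ ^ 2)) = fun x => ‖x‖ := by
      ext y; exact Real.sqrt_sq (norm_nonneg _)
    rw [h3, Real.sqrt_sq (norm_nonneg _)] at h2
    refine h2.congr_fderiv ?_
    have : ‖x‖ ≠ 0 := norm_ne_zero_iff.2 hx
    ext w
    simp only [smul_apply, smul_eq_mul, nsmul_eq_mul]
    push_cast
    field_simp
  have h2 := hg.hasDerivAt.comp_hasFDerivAt x h1
  have h3 : (fun x : E3 => g ‖x‖) = g ∘ fun x : E3 => ‖x‖ := rfl
  rw [h3, h2.fderiv]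
  simp only [smul_apply, smul_eq_mul, innerSL_apply_apply]
  ring

lemma fderiv_radialTest {c : ℝ} (hc : 0 < c) {g : ℝ → ℝ} (hg : ContDiff ℝ ∞ g) {Φ : E3 → ℝ}
    (hΦ : ContDiffOn ℝ ∞ Φ (ext c)) {x : E3} (hx : x ∈ ext c) (v : E3) :
    fderiv ℝ (radialTest g Φ) x v =
      ((deriv g ‖x‖ * (inner ℝ x v / ‖x‖) * Φ x + g ‖x‖ * fderiv ℝ Φ x v : ℝ) : ℂ) := by
  have hx0 := ne_zero_of_mem_ext hc hx
  have hgd : DifferentiableAt ℝ (fun x : E3 => g ‖x‖) x :=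
    (contDiffAt_norm_comp hg hx0).differentiableAt (by simp)
  have hΦd : DifferentiableAt ℝ Φ x :=
    (hΦ.contDiffAt ((isOpen_ext c).mem_nhds hx)).differentiableAt (by simp)
  have h1 : fderiv ℝ (radialTest g Φ) x = ofRealCLM.comp
      (fderiv ℝ (fun x => g ‖x‖ * Φ x) x) := by
    have := (ofRealCLM.hasFDerivAt.comp x (hgd.mul hΦd).hasFDerivAt).fderiv
    exact this
  rw [h1, fderiv_fun_mul hgd hΦd]
  simp only [ContinuousLinearMap.comp_apply, ofRealCLM_apply, add_apply, smul_apply,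
    smul_eq_mul]
  rw [fderiv_norm_comp (hg.differentiable (by simp)).differentiableAt hx0]
  push_cast
  ring

/-- The extension of a function on the sphere that is constant on rays. -/
def rayExt (φ : E3 → ℝ) (x : E3) : ℝ := φ (‖x‖⁻¹ • x)

lemma rayExt_pol (φ : E3 → ℝ) {z : ℝ × S2} (hz : 0 < z.1) : rayExt φ (pol z) = φ z.2 := by
  rw [rayExt, norm_pol hz.le, pol, smul_smul, inv_mul_cancel₀ hz.ne', one_smul]

lemma contDiffAt_rayExt {φ : E3 → ℝ} (hφ : ContDiff ℝ ∞ φ) {x : E3} (hx : x ≠ 0) :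
    ContDiffAt ℝ ∞ (rayExt φ) x := by
  have h1 : ContDiffAt ℝ ∞ (fun x : E3 => ‖x‖⁻¹) x :=
    (contDiffAt_norm ℝ hx).inv (norm_ne_zero_iff.2 hx)
  have h2 : ContDiffAt ℝ ∞ (fun x : E3 => ‖x‖⁻¹ • x) x := h1.smul contDiffAt_id
  exact hφ.contDiffAt.comp x h2

lemma contDiffOn_rayExt {c : ℝ} (hc : 0 < c) {φ : E3 → ℝ} (hφ : ContDiff ℝ ∞ φ) :
    ContDiffOn ℝ ∞ (rayExt φ) (ext c) := fun _ hx =>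
  (contDiffAt_rayExt hφ (ne_zero_of_mem_ext hc hx)).contDiffWithinAt

lemma inner_rot (i : Fin 3) (x : E3) : inner ℝ x (rot i x) = (0 : ℝ) := by
  fin_cases i <;> simp [rot, PiLp.inner_apply, Fin.sum_univ_three] <;> ring

lemma rot_smul (i : Fin 3) (k : ℝ) (x : E3) : rot i (k • x) = k • rot i x := by
  fin_cases i <;> ext a <;> fin_cases a <;> simp [rot]

lemma fderiv_rayExt {φ : E3 → ℝ} (hφ : ContDiff ℝ ∞ φ) {x : E3} (hx : x ≠ 0) (v : E3) :
    fderiv ℝ (rayExt φ) x v =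
      fderiv ℝ φ (‖x‖⁻¹ • x) (‖x‖⁻¹ • v - (inner ℝ x v / ‖x‖ ^ 3) • x) := by
  have hn : ‖x‖ ≠ 0 := norm_ne_zero_iff.2 hx
  have h1 : DifferentiableAt ℝ (fun x : E3 => ‖x‖⁻¹) x :=
    ((contDiffAt_norm ℝ hx (n := 1)).inv hn).differentiableAt (by simp)
  have h2 : fderiv ℝ (fun x : E3 => ‖x‖⁻¹) x v = -(inner ℝ x v / ‖x‖ ^ 3) := by
    have h3 : DifferentiableAt ℝ (fun x : E3 => ‖x‖) x :=
      (contDiffAt_norm ℝ hx (n := 1)).differentiableAt (by simp)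
    have h4 := fderiv_norm_comp (g := fun r => r) differentiableAt_id hx v
    have h5 := ((hasDerivAt_inv hn).comp_hasFDerivAt x h3.hasFDerivAt).fderiv
    have h6 : (fun x : E3 => ‖x‖⁻¹) = Inv.inv ∘ fun x : E3 => ‖x‖ := rfl
    rw [h6, h5]
    simp only [smul_apply, h4, smul_eq_mul, deriv_id'']
    field_simp
  have h3 : HasFDerivAt (fun x : E3 => ‖x‖⁻¹ • x) _ x := h1.hasFDerivAt.smul (hasFDerivAt_id x)
  have h4 := HasFDerivAt.comp (f := fun x : E3 => ‖x‖⁻¹ • x) x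
    ((hφ.differentiable (by simp)) (‖x‖⁻¹ • x)).hasFDerivAt h3
  have h5 : rayExt φ = φ ∘ fun x : E3 => ‖x‖⁻¹ • x := rfl
  rw [h5, h4.fderiv]
  simp only [ContinuousLinearMap.comp_apply, add_apply, smul_apply,
    ContinuousLinearMap.smulRight_apply, h2]
  congr 1
  simp [sub_eq_add_neg]

lemma fderiv_rayExt_vecR {φ : E3 → ℝ} (hφ : ContDiff ℝ ∞ φ) {x : E3} (hx : x ≠ 0) :
    fderiv ℝ (rayExt φ) x (vecR x) = 0 := by
  have hn : ‖x‖ ≠ 0 := norm_ne_zero_iff.2 hx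
  rw [fderiv_rayExt hφ hx]
  have : ‖x‖⁻¹ • vecR x - (inner ℝ x (vecR x) / ‖x‖ ^ 3) • x = 0 := by
    rw [vecR, inner_smul_right, real_inner_self_eq_norm_sq, smul_smul, ← sub_smul]
    have : ‖x‖⁻¹ * ‖x‖⁻¹ - ‖x‖⁻¹ * ‖x‖ ^ 2 / ‖x‖ ^ 3 = 0 := by field_simp; ring
    rw [this, zero_smul]
  rw [this, map_zero]

lemma fderiv_rayExt_rot {φ : E3 → ℝ} (hφ : ContDiff ℝ ∞ φ) {z : ℝ × S2} (hz : 0 < z.1)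
    (i : Fin 3) : fderiv ℝ (rayExt φ) (pol z) (rot i (pol z)) = rotD i φ z.2 := by
  have hx : pol z ≠ 0 := by
    rw [← norm_ne_zero_iff, norm_pol hz.le]; exact hz.ne'
  rw [fderiv_rayExt hφ hx, inner_rot, norm_pol hz.le]
  simp only [zero_div, zero_smul, sub_zero]
  rw [pol, rot_smul, smul_smul, smul_smul, inv_mul_cancel₀ hz.ne', one_smul, one_smul, rotD]

/-! ### Integration by parts along divergence free vector fields -/

/-- The standard basis vector. -/
abbrev basisVec (a : Fin 3) : E3 := EuclideanSpace.single a 1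

lemma clm_apply_eq_sum {F : Type*} [NormedAddCommGroup F] [NormedSpace ℝ F] (L : E3 →L[ℝ] F)
    (v : E3) : L v = ∑ a, v a • L (basisVec a) := by
  have h : v = ∑ a, v a • basisVec a := by
    ext b
    simp [Finset.sum_apply, Pi.single_apply]
  conv_lhs => rw [h]
  simp

lemma integrableOn_mul_test {Ω : Set E3} {w φ : E3 → ℂ}
    (hw : LocallyIntegrableOn w Ω) (hφ : Continuous φ) (hφc : HasCompactSupport φ)
    (hφs : tsupport φ ⊆ Ω) : IntegrableOn (fun x => w x * φ x) Ω := by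
  have h1 : IntegrableOn (fun x => w x * φ x) (tsupport φ) :=
    (hw.integrableOn_compact_subset hφs hφc).mul_continuousOn hφ.continuousOn hφc
  refine (h1.integrable_of_forall_notMem_eq_zero ?_).integrableOn
  intro x hx
  simp [image_eq_zero_of_notMem_tsupport hx]

lemma IsWeakDeriv.locInt_apply {Ω : Set E3} {u : E3 → ℂ} {du : E3 → E3 →L[ℝ] ℂ}
    (h : IsWeakDeriv Ω u du) (e : E3) : LocallyIntegrableOn (fun x => du x e) Ω := by
  intro x hx
  obtain ⟨s, hs, hi⟩ := h.locInt_deriv x hx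
  exact ⟨s, hs, (ContinuousLinearMap.apply ℝ ℂ e).integrable_comp hi⟩

lemma IsTest.fderiv_apply {Ω : Set E3} {ψ : E3 → ℂ} (h : IsTest Ω ψ) (e : E3) :
    Continuous (fun x => fderiv ℝ ψ x e) ∧ HasCompactSupport (fun x => fderiv ℝ ψ x e) ∧
      tsupport (fun x => fderiv ℝ ψ x e) ⊆ Ω := by
  have hs : tsupport (fun x => fderiv ℝ ψ x e) ⊆ tsupport ψ := by
    refine closure_minimal (fun x hx => ?_) (isClosed_tsupport _)
    by_contra hn
    have : x ∉ Function.support (fderiv ℝ ψ) := fun h => hn (support_fderiv_subset ℝ h)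
    rw [Function.notMem_support] at this
    exact hx (by simp [this])
  refine ⟨(h.smooth.continuous_fderiv (by simp)).clm_apply continuous_const, ?_, hs.trans h.supp⟩
  exact h.compact.isCompact.of_isClosed_subset (isClosed_tsupport _) hs

lemma IsWeakDeriv.byParts_field {Ω : Set E3} (hΩ : IsOpen Ω) {u : E3 → ℂ} {du : E3 → E3 →L[ℝ] ℂ}
    (h : IsWeakDeriv Ω u du) {V : E3 → E3} (hV : ∀ a, ContDiffOn ℝ ∞ (fun x => V x a) Ω)
    (hdiv : ∀ x ∈ Ω, ∑ a, fderiv ℝ (fun x => V x a) x (basisVec a) = 0) {ψ : E3 → ℂ}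
    (hψ : IsTest Ω ψ) :
    ∫ x in Ω, u x * fderiv ℝ ψ x (V x) = -∫ x in Ω, du x (V x) * ψ x := by
  have ht : ∀ a, IsTest Ω (fun x => (V x a : ℂ) * ψ x) := fun a =>
    contDiff_mul_of_tsupport hΩ hψ (ofRealCLM.contDiff.comp_contDiffOn (hV a))
  have h1 : ∀ a, IntegrableOn (fun x => u x *
      fderiv ℝ (fun x => (V x a : ℂ) * ψ x) x (basisVec a)) Ω := fun a => by
    obtain ⟨c1, c2, c3⟩ := (ht a).fderiv_apply (basisVec a)
    exact integrableOn_mul_test h.locInt c1 c2 c3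
  have h2 : ∀ a, IntegrableOn (fun x => du x (basisVec a) * ((V x a : ℂ) * ψ x)) Ω := fun a =>
    integrableOn_mul_test (h.locInt_apply _) (ht a).smooth.continuous (ht a).compact (ht a).supp
  have h3 := Finset.sum_congr (rfl : (Finset.univ : Finset (Fin 3)) = _)
    fun a _ => h.byParts _ (ht a) (basisVec a)
  rw [Finset.sum_neg_distrib, ← integral_finsetSum _ (fun a _ => h1 a),
    ← integral_finsetSum _ (fun a _ => h2 a)] at h3
  have e1 : ∫ x in Ω, u x * fderiv ℝ ψ x (V x) = ∫ x in Ω, ∑ a, u x *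
      fderiv ℝ (fun x => (V x a : ℂ) * ψ x) x (basisVec a) := by
    refine setIntegral_congr_fun hΩ.measurableSet fun x hx => ?_
    have hd : ∀ a, fderiv ℝ (fun x => (V x a : ℂ) * ψ x) x (basisVec a) =
        (V x a : ℂ) * fderiv ℝ ψ x (basisVec a) +
          ψ x * (fderiv ℝ (fun x => V x a) x (basisVec a) : ℝ) := fun a => by
      have d1 : DifferentiableAt ℝ (fun x => V x a) x :=
        ((hV a).contDiffAt (hΩ.mem_nhds hx)).differentiableAt (by simp)
      have d2 := ofRealCLM.hasFDerivAt.comp x d1.hasFDerivAt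
      have d3 : HasFDerivAt (fun x => (V x a : ℂ)) _ x := d2
      rw [fderiv_fun_mul d3.differentiableAt (hψ.smooth.differentiable (by simp)).differentiableAt,
        d3.fderiv]
      simp
    simp only [hd]
    rw [clm_apply_eq_sum, ← Finset.mul_sum, Finset.sum_add_distrib, ← Finset.mul_sum]
    have := hdiv x hx
    rw [← ofReal_sum, this]
    simp
  have e2 : ∫ x in Ω, du x (V x) * ψ x =
      ∫ x in Ω, ∑ a, du x (basisVec a) * ((V x a : ℂ) * ψ x) := by
    refine setIntegral_congr_fun hΩ.measurableSet fun x _ => ?_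
    simp only
    rw [clm_apply_eq_sum, Finset.sum_mul]
    refine Finset.sum_congr rfl fun a _ => ?_
    rw [real_smul]; ring
  rw [e1, e2, h3]

lemma contDiff_rot (i a : Fin 3) : ContDiff ℝ ∞ (fun x : E3 => rot i x a) := by
  fin_cases i <;> fin_cases a <;> simp [rot] <;>
    first | exact contDiff_const | exact contDiff_coord _ | exact (contDiff_coord _).neg

lemma div_rot (i : Fin 3) (x : E3) :
    ∑ a, fderiv ℝ (fun x => rot i x a) x (basisVec a) = 0 := by
  rw [Fin.sum_univ_three]
  fin_cases i <;> simp [rot, fderiv_coord]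

lemma contDiffOn_radialField {c : ℝ} (hc : 0 < c) (a : Fin 3) :
    ContDiffOn ℝ ∞ (fun x : E3 => ((‖x‖ ^ 3)⁻¹ • x) a) (ext c) := by
  intro x hx
  have hx0 := ne_zero_of_mem_ext hc hx
  have h1 : ContDiffAt ℝ ∞ (fun x : E3 => (‖x‖ ^ 3)⁻¹) x :=
    ((contDiffAt_norm ℝ hx0).pow 3).inv (pow_ne_zero _ (norm_ne_zero_iff.2 hx0))
  exact (h1.mul (contDiff_coord a).contDiffAt).contDiffWithinAt

lemma div_radialField {x : E3} (hx : x ≠ 0) :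
    ∑ a, fderiv ℝ (fun x : E3 => ((‖x‖ ^ 3)⁻¹ • x) a) x (basisVec a) = 0 := by
  have hn : ‖x‖ ≠ 0 := norm_ne_zero_iff.2 hx
  have h1 : HasDerivAt (fun r : ℝ => (r ^ 3)⁻¹) (-(3 * ‖x‖ ^ 2) / (‖x‖ ^ 3) ^ 2) ‖x‖ := by
    exact ((hasDerivAt_pow 3 ‖x‖).inv (pow_ne_zero _ hn)).congr_deriv (by simp)
  have h2 : ∀ v, fderiv ℝ (fun x : E3 => (‖x‖ ^ 3)⁻¹) x v =
      -(3 * ‖x‖ ^ 2) / (‖x‖ ^ 3) ^ 2 * (inner ℝ x v / ‖x‖) := fun v => by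
    rw [← h1.deriv]
    exact fderiv_norm_comp (g := fun r : ℝ => (r ^ 3)⁻¹) h1.differentiableAt hx v
  have h3 : DifferentiableAt ℝ (fun x : E3 => (‖x‖ ^ 3)⁻¹) x :=
    (((contDiffAt_norm ℝ hx (n := 1)).pow 3).inv (pow_ne_zero _ hn)).differentiableAt (by simp)
  have h4 : ∀ a, fderiv ℝ (fun x : E3 => ((‖x‖ ^ 3)⁻¹ • x) a) x (basisVec a) =
      (‖x‖ ^ 3)⁻¹ + x a * (-(3 * ‖x‖ ^ 2) / (‖x‖ ^ 3) ^ 2 * (x a / ‖x‖)) := fun a => by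
    have : (fun x : E3 => ((‖x‖ ^ 3)⁻¹ • x) a) = fun x : E3 => (‖x‖ ^ 3)⁻¹ * x a := rfl
    rw [this, fderiv_fun_mul h3 ((contDiff_coord a).differentiable (by simp)).differentiableAt]
    simp only [add_apply, smul_apply, smul_eq_mul, h2, fderiv_coord]
    simp [EuclideanSpace.inner_single_right]
  simp only [h4]
  rw [Finset.sum_add_distrib]
  have h5 : ∑ a, x a * (-(3 * ‖x‖ ^ 2) / (‖x‖ ^ 3) ^ 2 * (x a / ‖x‖)) =
      -(3 * ‖x‖ ^ 2) / (‖x‖ ^ 3) ^ 2 / ‖x‖ * ‖x‖ ^ 2 := by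
    rw [EuclideanSpace.real_norm_sq_eq x, Finset.mul_sum]
    refine Finset.sum_congr rfl fun a _ => ?_
    ring
  rw [h5]
  simp only [Finset.sum_const, Finset.card_univ, Fintype.card_fin, nsmul_eq_mul]
  field_simp
  norm_num

lemma IsWeakDeriv.ae_eq {Ω : Set E3} (hΩ : IsOpen Ω) {u : E3 → ℂ} {du dv : E3 → E3 →L[ℝ] ℂ}
    (h : IsWeakDeriv Ω u du) (h' : IsWeakDeriv Ω u dv) : ∀ᵐ x, x ∈ Ω → du x = dv x := by
  have key : ∀ a, ∀ᵐ x, x ∈ Ω → du x (basisVec a) - dv x (basisVec a) = 0 := by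
    intro a
    refine hΩ.ae_eq_zero_of_integral_contDiff_smul_eq_zero
      ((h.locInt_apply _).sub (h'.locInt_apply _)) fun g hg hgc hgs => ?_
    have hs : tsupport (fun x => (g x : ℂ)) ⊆ tsupport g :=
      closure_mono fun x hx => by
        intro h0
        exact hx (by simp [h0])
    have ht : IsTest Ω (fun x => (g x : ℂ)) :=
      ⟨ofRealCLM.contDiff.comp hg, hgc.isCompact.of_isClosed_subset (isClosed_tsupport _) hs,
        hs.trans hgs⟩
    have e1 := h.byParts _ ht (basisVec a)
    have e2 := h'.byParts _ ht (basisVec a)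
    have i1 := integrableOn_mul_test (h.locInt_apply (basisVec a)) ht.smooth.continuous ht.compact ht.supp
    have i2 := integrableOn_mul_test (h'.locInt_apply (basisVec a)) ht.smooth.continuous ht.compact ht.supp
    have e3 : ∫ x, g x • (du x (basisVec a) - dv x (basisVec a)) =
        ∫ x in Ω, (du x (basisVec a) * (g x : ℂ) - dv x (basisVec a) * (g x : ℂ)) := by
      rw [← setIntegral_eq_integral_of_forall_compl_eq_zero (s := Ω)]
      · refine integral_congr_ae (.of_forall fun x => ?_)
        simp only [real_smul]; ring
      · intro x hx
        rw [image_eq_zero_of_notMem_tsupport fun h => hx (hgs h), zero_smul]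
    rw [e3, integral_sub i1 i2]
    linear_combination e1 - e2
  filter_upwards [ae_all_iff.2 key] with x hx hxΩ
  ext v
  rw [clm_apply_eq_sum, clm_apply_eq_sum (dv x)]
  refine Finset.sum_congr rfl fun a _ => ?_
  rw [sub_eq_zero.1 (hx a hxΩ)]

lemma isWeakDeriv_const (c : ℝ) : IsWeakDeriv (ext c) (fun _ => 1) (fun _ => 0) := by
  refine ⟨locallyIntegrableOn_const _, locallyIntegrableOn_const _, fun ψ hψ e => ?_⟩
  obtain ⟨c1, c2, c3⟩ := hψ.fderiv_apply e
  have h := integral_mul_fderiv_eq_neg_fderiv_mul_of_integrable (μ := (volume : Measure E3))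
    (f := fun _ : E3 => (1 : ℂ)) (g := ψ) (v := e) (by simp)
    (by simpa using c1.integrable_of_hasCompactSupport c2)
    (by simpa using hψ.smooth.continuous.integrable_of_hasCompactSupport hψ.compact)
    (by simp) (fun x _ => (hψ.smooth.differentiable (by simp)).differentiableAt)
  rw [setIntegral_eq_integral_of_forall_compl_eq_zero fun x hx => by
    rw [image_eq_zero_of_notMem_tsupport fun h => hx (c3 h), mul_zero]]
  simpa using h

/-- The radial derivative in polar coordinates. -/
def radD (du : E3 → E3 →L[ℝ] ℂ) (z : ℝ × S2) : ℂ := du (pol z) z.2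

/-- The derivatives along rotations in polar coordinates. -/
def angD (i : Fin 3) (du : E3 → E3 →L[ℝ] ℂ) (z : ℝ × S2) : ℂ := du (pol z) (rot i (pol z))

lemma vecR_pol {z : ℝ × S2} (hz : 0 < z.1) : vecR (pol z) = z.2 := by
  rw [vecR, norm_pol hz.le, pol, smul_smul, inv_mul_cancel₀ hz.ne', one_smul]

lemma aesm_clm_apply {Ω : Set E3} {du : E3 → E3 →L[ℝ] ℂ}
    (h : AEStronglyMeasurable du (volume.restrict Ω)) {V : E3 → E3}
    (hV : AEStronglyMeasurable V (volume.restrict Ω)) :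
    AEStronglyMeasurable (fun x => du x (V x)) (volume.restrict Ω) :=
  (ContinuousLinearMap.apply ℝ ℂ).aestronglyMeasurable_comp₂ hV h

lemma continuous_rot (i : Fin 3) : Continuous (rot i) := by
  refine (PiLp.continuous_toLp 2 _).comp (continuous_pi fun a => (contDiff_rot i a).continuous)

lemma IsWeakDeriv.byParts_pol {c : ℝ} (hc : 0 < c) {u : E3 → ℂ} {du : E3 → E3 →L[ℝ] ℂ}
    (h : IsWeakDeriv (ext c) u du) {V : E3 → E3} (hVc : ContinuousOn V (ext c))
    (hV : ∀ a, ContDiffOn ℝ ∞ (fun x => V x a) (ext c))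
    (hdiv : ∀ x ∈ ext c, ∑ a, fderiv ℝ (fun x => V x a) x (basisVec a) = 0) {ψ : E3 → ℂ}
    (hψ : IsTest (ext c) ψ) :
    ∫ z, ((z.1 ^ 2 : ℝ) : ℂ) * (u (pol z) * fderiv ℝ ψ (pol z) (V (pol z))) ∂polMeasure c =
      -∫ z, ((z.1 ^ 2 : ℝ) : ℂ) * (du (pol z) (V (pol z)) * ψ (pol z)) ∂polMeasure c := by
  have h1 := h.byParts_field (isOpen_ext c) hV hdiv hψ
  have hVm := hVc.aestronglyMeasurable (μ := (volume : Measure E3)) (isOpen_ext c).measurableSet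
  rw [integral_pol hc, integral_pol hc] at h1
  · exact h1
  · exact (aesm_clm_apply (LocallyIntegrableOn.aestronglyMeasurable h.locInt_deriv) hVm).mul hψ.smooth.continuous.aestronglyMeasurable
  · exact (LocallyIntegrableOn.aestronglyMeasurable h.locInt).mul (aesm_clm_apply
      (hψ.smooth.continuous_fderiv (by simp)).aestronglyMeasurable hVm)

lemma IsWeakDeriv.byParts_radial {c : ℝ} (hc : 0 < c) {u : E3 → ℂ} {du : E3 → E3 →L[ℝ] ℂ}
    (h : IsWeakDeriv (ext c) u du) {ψ : E3 → ℂ} (hψ : IsTest (ext c) ψ) :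
    ∫ z, u (pol z) * fderiv ℝ ψ (pol z) z.2 ∂polMeasure c =
      -∫ z, radD du z * ψ (pol z) ∂polMeasure c := by
  have h1 := h.byParts_pol hc (V := fun x => (‖x‖ ^ 3)⁻¹ • x)
    (fun x hx => by
      have hx0 := ne_zero_of_mem_ext hc hx
      have : ContinuousAt (fun x : E3 => (‖x‖ ^ 3)⁻¹) x :=
        (continuous_norm.continuousAt.pow 3).inv₀ (pow_ne_zero _ (norm_ne_zero_iff.2 hx0))
      exact (this.smul continuousAt_id).continuousWithinAt)
    (contDiffOn_radialField hc)
    (fun x hx => div_radialField (ne_zero_of_mem_ext hc hx)) hψ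
  have e : ∀ z : ℝ × S2, c < z.1 → ∀ L : E3 →L[ℝ] ℂ,
      L ((‖pol z‖ ^ 3)⁻¹ • pol z) = ((z.1 ^ 2)⁻¹ : ℝ) * L z.2 := fun z hz L => by
    have hz0 : 0 < z.1 := hc.trans hz
    rw [norm_pol hz0.le, map_smul, pol, map_smul, smul_smul, real_smul]
    congr 2
    field_simp
  refine Eq.trans (integral_congr_ae ?_) (h1.trans (congrArg Neg.neg (integral_congr_ae ?_)))
  · filter_upwards [ae_fst_mem c] with z hz
    have hz0 : (z.1 : ℂ) ≠ 0 := by exact_mod_cast (hc.trans hz).ne'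
    rw [e z hz]
    push_cast
    field_simp
  · filter_upwards [ae_fst_mem c] with z hz
    have hz0 : (z.1 : ℂ) ≠ 0 := by exact_mod_cast (hc.trans hz).ne'
    rw [e z hz, radD]
    push_cast
    field_simp

lemma IsWeakDeriv.byParts_rot {c : ℝ} (hc : 0 < c) {u : E3 → ℂ} {du : E3 → E3 →L[ℝ] ℂ}
    (h : IsWeakDeriv (ext c) u du) (i : Fin 3) {ψ : E3 → ℂ} (hψ : IsTest (ext c) ψ) :
    ∫ z, ((z.1 ^ 2 : ℝ) : ℂ) * (u (pol z) * fderiv ℝ ψ (pol z) (rot i (pol z))) ∂polMeasure c =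
      -∫ z, ((z.1 ^ 2 : ℝ) : ℂ) * (angD i du z * ψ (pol z)) ∂polMeasure c :=
  h.byParts_pol hc (continuous_rot i).continuousOn (fun a => (contDiff_rot i a).contDiffOn)
    (fun x _ => div_rot i x) hψ

lemma radialTest_pol {c : ℝ} (hc : 0 < c) (g : ℝ → ℝ) (Φ : E3 → ℝ) {z : ℝ × S2} (hz : c < z.1) :
    radialTest g Φ (pol z) = (g z.1 : ℂ) * (Φ (pol z) : ℂ) := by
  rw [radialTest, norm_pol (hc.trans hz).le]; push_cast; rfl

lemma pol_mem_ext {c : ℝ} (hc : 0 < c) {z : ℝ × S2} (hz : c < z.1) : pol z ∈ ext c := by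
  show c < ‖pol z‖
  rwa [norm_pol (hc.trans hz).le]

lemma inner_pol_snd {z : ℝ × S2} : inner ℝ (pol z) (z.2 : E3) = z.1 := by
  have : ‖(z.2 : E3)‖ = 1 := by simp
  rw [pol, inner_smul_left, real_inner_self_eq_norm_sq, this]; simp

lemma fderiv_radialTest_snd {c : ℝ} (hc : 0 < c) {g : ℝ → ℝ} (hg : ContDiff ℝ ∞ g) {Φ : E3 → ℝ}
    (hΦ : ContDiffOn ℝ ∞ Φ (ext c)) {z : ℝ × S2} (hz : c < z.1) :
    fderiv ℝ (radialTest g Φ) (pol z) z.2 =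
      ((deriv g z.1 : ℝ) : ℂ) * (Φ (pol z) : ℂ) + (g z.1 : ℂ) * (fderiv ℝ Φ (pol z) z.2 : ℝ) := by
  rw [fderiv_radialTest hc hg hΦ (pol_mem_ext hc hz), norm_pol (hc.trans hz).le, inner_pol_snd,
    div_self (hc.trans hz).ne']
  push_cast; ring

lemma fderiv_radialTest_rot {c : ℝ} (hc : 0 < c) {g : ℝ → ℝ} (hg : ContDiff ℝ ∞ g) {Φ : E3 → ℝ}
    (hΦ : ContDiffOn ℝ ∞ Φ (ext c)) {z : ℝ × S2} (hz : c < z.1) (i : Fin 3) :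
    fderiv ℝ (radialTest g Φ) (pol z) (rot i (pol z)) =
      (g z.1 : ℂ) * (fderiv ℝ Φ (pol z) (rot i (pol z)) : ℝ) := by
  rw [fderiv_radialTest hc hg hΦ (pol_mem_ext hc hz), norm_pol (hc.trans hz).le, inner_rot]
  push_cast; ring

lemma continuousOn_comp_pol {c : ℝ} (hc : 0 < c) {F : Type*} [TopologicalSpace F] {Φ : E3 → F}
    (hΦ : ContinuousOn Φ (ext c)) : ContinuousOn (fun z => Φ (pol z)) (Ioi c ×ˢ univ) :=
  hΦ.comp continuous_pol.continuousOn fun _ hz => pol_mem_ext hc hz.1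

lemma continuousOn_radial_deriv {c : ℝ} (hc : 0 < c) {Φ : E3 → ℝ}
    (hΦ : ContDiffOn ℝ ∞ Φ (ext c)) :
    ContinuousOn (fun z : ℝ × S2 => fderiv ℝ Φ (pol z) z.2) (Ioi c ×ˢ univ) := by
  have h1 : ContinuousOn (fderiv ℝ Φ) (ext c) :=
    hΦ.continuousOn_fderiv_of_isOpen (isOpen_ext c) (by simp)
  exact (continuousOn_comp_pol hc h1).clm_apply
    (continuous_subtype_val.comp continuous_snd).continuousOn

/-- Spherical means of `u` against a smooth function are weakly differentiable. -/
lemma IsWeakDeriv.weakDeriv1 {c : ℝ} (hc : 0 < c) {u : E3 → ℂ} {du : E3 → E3 →L[ℝ] ℂ}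
    (h : IsWeakDeriv (ext c) u du) (hu : LocInt c fun z => u (pol z)) (hur : LocInt c (radD du))
    {Φ : E3 → ℝ} (hΦ : ContDiffOn ℝ ∞ Φ (ext c)) :
    WeakDeriv1 c (fib fun z => (Φ (pol z) : ℂ) * u (pol z))
      (fib fun z => (Φ (pol z) : ℂ) * radD du z + ((fderiv ℝ Φ (pol z) z.2 : ℝ) : ℂ) * u (pol z)) := by
  have k1 : ContinuousOn (fun z => (Φ (pol z) : ℂ)) (Ioi c ×ˢ univ) :=
    continuous_ofReal.comp_continuousOn (continuousOn_comp_pol hc hΦ.continuousOn)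
  have k2 : ContinuousOn (fun z : ℝ × S2 => ((fderiv ℝ Φ (pol z) z.2 : ℝ) : ℂ)) (Ioi c ×ˢ univ) :=
    continuous_ofReal.comp_continuousOn (continuousOn_radial_deriv hc hΦ)
  refine weakDeriv1_fib (hu.mul k1) ((hur.mul k1).add (hu.mul k2)) fun g h1 h2 h3 => ?_
  have ht := isTest_radialTest hc h1 h2 h3 hΦ
  have e := h.byParts_radial hc ht
  have hd := h1.continuous_deriv (by simp)
  have hdt : tsupport (deriv g) ⊆ Ioi c := (closure_minimal support_deriv_subset
    (isClosed_tsupport _)).trans h3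
  have e1 : ∫ z, u (pol z) * fderiv ℝ (radialTest g Φ) (pol z) z.2 ∂polMeasure c =
      ∫ z, ((deriv g z.1 : ℝ) : ℂ) * ((Φ (pol z) : ℂ) * u (pol z)) ∂polMeasure c +
      ∫ z, (g z.1 : ℂ) * (((fderiv ℝ Φ (pol z) z.2 : ℝ) : ℂ) * u (pol z)) ∂polMeasure c := by
    rw [← integral_add ((hu.mul k1).integrable_mul hd h2.deriv hdt)
      ((hu.mul k2).integrable_mul h1.continuous h2 h3)]
    refine integral_congr_ae ?_
    filter_upwards [ae_fst_mem c] with z hz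
    rw [fderiv_radialTest_snd hc h1 hΦ hz]; ring
  have e2 : ∫ z, radD du z * radialTest g Φ (pol z) ∂polMeasure c =
      ∫ z, (g z.1 : ℂ) * ((Φ (pol z) : ℂ) * radD du z) ∂polMeasure c := by
    refine integral_congr_ae ?_
    filter_upwards [ae_fst_mem c] with z hz
    rw [radialTest_pol hc g Φ hz]; ring
  have e3 : ∫ z, (g z.1 : ℂ) * ((Φ (pol z) : ℂ) * radD du z +
        ((fderiv ℝ Φ (pol z) z.2 : ℝ) : ℂ) * u (pol z)) ∂polMeasure c =
      ∫ z, (g z.1 : ℂ) * ((Φ (pol z) : ℂ) * radD du z) ∂polMeasure c +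
      ∫ z, (g z.1 : ℂ) * (((fderiv ℝ Φ (pol z) z.2 : ℝ) : ℂ) * u (pol z)) ∂polMeasure c := by
    rw [← integral_add ((hur.mul k1).integrable_mul h1.continuous h2 h3)
      ((hu.mul k2).integrable_mul h1.continuous h2 h3)]
    simp only [mul_add]
  rw [e1, e2] at e
  rw [e3]
  linear_combination e

lemma continuousOn_comp_snd {c : ℝ} {φ : E3 → ℝ} (hφ : Continuous φ) :
    ContinuousOn (fun z : ℝ × S2 => (φ z.2 : ℂ)) (Ioi c ×ˢ univ) :=
  (continuous_ofReal.comp (hφ.comp (continuous_subtype_val.comp continuous_snd))).continuousOn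

lemma continuous_rotD (i : Fin 3) {φ : E3 → ℝ} (hφ : ContDiff ℝ ∞ φ) : Continuous (rotD i φ) :=
  (hφ.continuous_fderiv (by simp)).clm_apply (continuous_rot i)

/-- Integration by parts on almost every sphere. -/
lemma IsWeakDeriv.fib_rot {c : ℝ} (hc : 0 < c) {u : E3 → ℂ} {du : E3 → E3 →L[ℝ] ℂ}
    (h : IsWeakDeriv (ext c) u du) (hu : LocInt c fun z => u (pol z)) (i : Fin 3)
    (hui : LocInt c (angD i du)) {φ : E3 → ℝ} (hφ : ContDiff ℝ ∞ φ) :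
    ∀ᵐ r, r ∈ Ioi c → fib (fun z => (φ z.2 : ℂ) * angD i du z + (rotD i φ z.2 : ℂ) * u (pol z)) r = 0 := by
  have k1 := continuousOn_comp_snd (c := c) hφ.continuous
  have k2 := continuousOn_comp_snd (c := c) (continuous_rotD i hφ)
  refine fib_ae_eq_zero ((hui.mul k1).add (hu.mul k2)) fun g h1 h2 h3 => ?_
  have hG : ContDiffOn ℝ ∞ (fun x : E3 => (‖x‖ ^ 2)⁻¹ * rayExt φ x) (ext c) := fun x hx => by
    have hx0 := ne_zero_of_mem_ext hc hx
    refine ContDiffAt.contDiffWithinAt (ContDiffAt.mul ?_ (contDiffAt_rayExt hφ hx0))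
    exact ((contDiffAt_norm ℝ hx0).pow 2).inv (pow_ne_zero _ (norm_ne_zero_iff.2 hx0))
  have hd : ∀ z : ℝ × S2, c < z.1 →
      fderiv ℝ (fun x : E3 => (‖x‖ ^ 2)⁻¹ * rayExt φ x) (pol z) (rot i (pol z)) =
        (z.1 ^ 2)⁻¹ * rotD i φ z.2 := fun z hz => by
    have hz0 := hc.trans hz
    have hx0 := ne_zero_of_mem_ext hc (pol_mem_ext hc hz)
    have hn : ‖pol z‖ ≠ 0 := norm_ne_zero_iff.2 hx0
    have d1 : DifferentiableAt ℝ (fun x : E3 => (‖x‖ ^ 2)⁻¹) (pol z) :=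
      (((contDiffAt_norm ℝ hx0 (n := 1)).pow 2).inv (pow_ne_zero _ hn)).differentiableAt (by simp)
    have d2 : DifferentiableAt ℝ (rayExt φ) (pol z) :=
      (contDiffAt_rayExt hφ hx0).differentiableAt (by simp)
    have d3 : DifferentiableAt ℝ (fun r : ℝ => (r ^ 2)⁻¹) ‖pol z‖ :=
      ((differentiableAt_id.pow 2).inv (pow_ne_zero _ hn))
    rw [fderiv_fun_mul d1 d2]
    simp only [add_apply, smul_apply, smul_eq_mul]
    rw [fderiv_rayExt_rot hφ hz0, fderiv_norm_comp (g := fun r : ℝ => (r ^ 2)⁻¹) d3 hx0, inner_rot,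
      norm_pol hz0.le]
    ring
  have e := h.byParts_rot hc i (isTest_radialTest hc h1 h2 h3 hG)
  have e1 : ∫ z, ((z.1 ^ 2 : ℝ) : ℂ) * (u (pol z) * fderiv ℝ (radialTest g
      fun x : E3 => (‖x‖ ^ 2)⁻¹ * rayExt φ x) (pol z) (rot i (pol z))) ∂polMeasure c =
      ∫ z, (g z.1 : ℂ) * ((rotD i φ z.2 : ℂ) * u (pol z)) ∂polMeasure c := by
    refine integral_congr_ae ?_
    filter_upwards [ae_fst_mem c] with z hz
    have hz0 : (z.1 : ℂ) ≠ 0 := by exact_mod_cast (hc.trans hz).ne'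
    rw [fderiv_radialTest_rot hc h1 hG hz, hd z hz]
    push_cast
    field_simp
  have e2 : ∫ z, ((z.1 ^ 2 : ℝ) : ℂ) * (angD i du z * radialTest g
      (fun x : E3 => (‖x‖ ^ 2)⁻¹ * rayExt φ x) (pol z)) ∂polMeasure c =
      ∫ z, (g z.1 : ℂ) * ((φ z.2 : ℂ) * angD i du z) ∂polMeasure c := by
    refine integral_congr_ae ?_
    filter_upwards [ae_fst_mem c] with z hz
    have hz0 : (z.1 : ℂ) ≠ 0 := by exact_mod_cast (hc.trans hz).ne'
    rw [radialTest_pol hc g _ hz, rayExt_pol φ (hc.trans hz), norm_pol (hc.trans hz).le]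
    push_cast
    field_simp
  rw [e1, e2] at e
  simp only [mul_add]
  rw [integral_add ((hui.mul k1).integrable_mul h1.continuous h2 h3)
    ((hu.mul k2).integrable_mul h1.continuous h2 h3), e]
  ring

lemma LocInt.const {c : ℝ} (k : ℂ) : LocInt c fun _ => k := fun _ _ _ _ => integrable_const k

lemma integral_rotD (i : Fin 3) {φ : E3 → ℝ} (hφ : ContDiff ℝ ∞ φ) :
    ∫ y : S2, rotD i φ y ∂sphereMeasure = 0 := by
  have h := (isWeakDeriv_const 1).fib_rot one_pos (LocInt.const 1) i (LocInt.const 0) hφ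
  have h2 : ∀ᵐ r ∂(volume.restrict (Ioi (1 : ℝ))),
      ∫ y : S2, (rotD i φ y : ℂ) ∂sphereMeasure = 0 := by
    rw [ae_restrict_iff' measurableSet_Ioi]
    filter_upwards [h] with r hr hr1
    simpa [fib, angD] using hr hr1
  have hne : NeBot (ae (volume.restrict (Ioi (1 : ℝ)))) := by
    rw [ae_neBot]; intro h0
    have := congrArg (fun m => m univ) h0
    simp at this
  obtain ⟨r, hr⟩ := h2.exists
  rw [integral_complex_ofReal] at hr
  exact_mod_cast hr

/-! ### Angular coefficients -/

/-- The measure `dr` on `(c, ∞)`. -/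
abbrev radMeasure (c : ℝ) : Measure ℝ := volume.restrict (Ioi c)

/-- The angular coefficient of a function on `(c, ∞) × S²`. -/
def coef (n : ℕ) (j : Fin (angDim n)) (H : ℝ × S2 → ℂ) : ℝ → ℂ :=
  fib fun z => (angFun n j z.2 : ℂ) * H z

lemma coef_eq (n : ℕ) (j : Fin (angDim n)) (H : ℝ × S2 → ℂ) (r : ℝ) :
    coef n j H r = angCoef n (fun y => H (r, y)) j := by
  simp only [coef, fib, angCoef, mul_comm]

lemma coef_radial_mul (n : ℕ) (j : Fin (angDim n)) (k : ℝ → ℂ) (H : ℝ × S2 → ℂ) (r : ℝ) :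
    coef n j (fun z => k z.1 * H z) r = k r * coef n j H r := by
  simp only [coef, fib]
  rw [← integral_const_mul]
  congr 1; ext y; ring

lemma ae_memLp_slice {c : ℝ} {H : ℝ × S2 → ℂ} (h : MemLp H 2 (polMeasure c)) :
    ∀ᵐ r ∂radMeasure c, MemLp (fun y => H (r, y)) 2 sphereMeasure := by
  have h1 : ∀ᵐ r ∂radMeasure c, AEStronglyMeasurable (fun y => H (r, y)) sphereMeasure :=
    h.1.prodMk_left
  have h2 : Integrable (fun z => ‖H z‖ ^ 2) (polMeasure c) := h.integrable_norm_pow (by norm_num)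
  have h3 : ∀ᵐ r ∂radMeasure c, Integrable (fun y => ‖H (r, y)‖ ^ 2) sphereMeasure :=
    h2.prod_right_ae
  filter_upwards [h1, h3] with r h4 h5
  exact (memLp_two_iff_integrable_sq_norm h4).2 h5

lemma integrable_slice_sq {c : ℝ} {H : ℝ × S2 → ℂ} (h : MemLp H 2 (polMeasure c)) :
    Integrable (fun r => ∫ y, ‖H (r, y)‖ ^ 2 ∂sphereMeasure) (radMeasure c) := by
  have h2 : Integrable (fun z => ‖H z‖ ^ 2) (polMeasure c) := h.integrable_norm_pow (by norm_num)
  exact h2.integral_prod_left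

lemma aesm_coef {c : ℝ} {H : ℝ × S2 → ℂ} (h : AEStronglyMeasurable H (polMeasure c)) (n : ℕ)
    (j : Fin (angDim n)) : AEStronglyMeasurable (coef n j H) (radMeasure c) := by
  have h1 : AEStronglyMeasurable (fun z : ℝ × S2 => (angFun n j z.2 : ℂ) * H z) (polMeasure c) :=
    (continuous_ofReal.comp ((angFun_contDiff n j).continuous.comp
      (continuous_subtype_val.comp continuous_snd))).aestronglyMeasurable.mul h
  exact h1.integral_prod_right'

lemma sum_sq_coef_le {c : ℝ} {H : ℝ × S2 → ℂ} (h : MemLp H 2 (polMeasure c)) (n : ℕ) :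
    ∀ᵐ r ∂radMeasure c, ∑ j, ‖coef n j H r‖ ^ 2 ≤ ∫ y, ‖H (r, y)‖ ^ 2 ∂sphereMeasure := by
  filter_upwards [ae_memLp_slice h] with r hr
  simp only [coef_eq]
  exact sum_sq_angCoef_le n hr

lemma memLp_coef {c : ℝ} {H : ℝ × S2 → ℂ} (h : MemLp H 2 (polMeasure c)) (n : ℕ)
    (j : Fin (angDim n)) : MemLp (coef n j H) 2 (radMeasure c) := by
  rw [memLp_two_iff_integrable_sq_norm (aesm_coef h.1 n j)]
  refine (integrable_slice_sq h).mono' ((aesm_coef h.1 n j).norm.pow 2) ?_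
  filter_upwards [sum_sq_coef_le h n] with r hr
  rw [Real.norm_of_nonneg (by positivity)]
  exact (Finset.single_le_sum (f := fun j => ‖coef n j H r‖ ^ 2) (fun _ _ => by positivity)
    (Finset.mem_univ j)).trans hr

lemma integrable_coef_mul {c : ℝ} {H G : ℝ × S2 → ℂ} (hH : MemLp H 2 (polMeasure c))
    (hG : MemLp G 2 (polMeasure c)) (n : ℕ) (j : Fin (angDim n)) :
    Integrable (fun r => coef n j H r * conj (coef n j G r)) (radMeasure c) :=
  (memLp_coef hH n j).integrable_mul (memLp_coef hG n j).star

/-- Parseval's identity, integrated in the radial variable. -/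
lemma tendsto_integral_sum_coef {c : ℝ} {H G : ℝ × S2 → ℂ} (hH : MemLp H 2 (polMeasure c))
    (hG : MemLp G 2 (polMeasure c)) :
    Tendsto (fun n => ∫ r in Ioi c, ∑ j, coef n j H r * conj (coef n j G r)) atTop
      (𝓝 (∫ z, H z * conj (G z) ∂polMeasure c)) := by
  have hi : Integrable (fun z => H z * conj (G z)) (polMeasure c) :=
    hH.integrable_mul hG.star
  have e : ∫ z, H z * conj (G z) ∂polMeasure c =
      ∫ r in Ioi c, ∫ y, H (r, y) * conj (G (r, y)) ∂sphereMeasure :=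
    integral_prod _ hi
  rw [e]
  refine tendsto_integral_of_dominated_convergence
    (fun r => (∫ y, ‖H (r, y)‖ ^ 2 ∂sphereMeasure) + ∫ y, ‖G (r, y)‖ ^ 2 ∂sphereMeasure)
    (fun n => (integrable_finsetSum _ fun j _ => integrable_coef_mul hH hG n j).1)
    ((integrable_slice_sq hH).add (integrable_slice_sq hG)) (fun n => ?_) ?_
  · filter_upwards [sum_sq_coef_le hH n, sum_sq_coef_le hG n] with r h1 h2
    have h3 := add_le_add h1 h2
    rw [← Finset.sum_add_distrib] at h3
    refine (norm_sum_le _ _).trans ((Finset.sum_le_sum fun j _ => ?_).trans h3)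
    rw [norm_mul, RCLike.norm_conj]
    nlinarith [sq_nonneg (‖coef n j H r‖ - ‖coef n j G r‖), norm_nonneg (coef n j H r),
      norm_nonneg (coef n j G r)]
  · filter_upwards [ae_memLp_slice hH, ae_memLp_slice hG] with r h1 h2
    simp only [coef_eq]
    exact tendsto_sum_angCoef h1 h2

/-- The matrix of the rotation generators. -/
def rotMatrix (n : ℕ) (i : Fin 3) (l j : Fin (angDim n)) : ℝ :=
  ∫ z : S2, rotD i (angFun n j) z * angFun n l z ∂sphereMeasure

lemma rotMatrix_antisymm (n : ℕ) (i : Fin 3) (l j : Fin (angDim n)) :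
    rotMatrix n i l j = -rotMatrix n i j l := by
  have h := integral_rotD i ((angFun_contDiff n l).mul (angFun_contDiff n j))
  have hi : ∀ {f g : E3 → ℝ}, Continuous f → Continuous g →
      Integrable (fun y : S2 => f y * g y) sphereMeasure := fun hf hg =>
    (memLp_sphere_of_continuous hf).integrable_mul (memLp_sphere_of_continuous hg)
  have e : ∫ y : S2, rotD i (fun x => angFun n l x * angFun n j x) y ∂sphereMeasure =
      rotMatrix n i l j + rotMatrix n i j l := by
    rw [rotMatrix, rotMatrix, ← integral_add
      (hi (continuous_rotD i (angFun_contDiff n j)) (angFun_contDiff n l).continuous)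
      (hi (continuous_rotD i (angFun_contDiff n l)) (angFun_contDiff n j).continuous)]
    congr 1; ext y
    rw [rotD_mul i (angFun_contDiff n l) (angFun_contDiff n j)]
    ring
  have h' : ∫ y : S2, rotD i (fun x => angFun n l x * angFun n j x) y ∂sphereMeasure = 0 := h
  linarith

lemma fib_rotD_eq {H : ℝ × S2 → ℂ} {r : ℝ} (h : MemLp (fun y => H (r, y)) 2 sphereMeasure) (n : ℕ)
    (i : Fin 3) (j : Fin (angDim n)) :
    fib (fun z => (rotD i (angFun n j) z.2 : ℂ) * H z) r =
      ∑ l, (rotMatrix n i l j : ℂ) * coef n l H r := by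
  have e1 : fib (fun z => (rotD i (angFun n j) z.2 : ℂ) * H z) r =
      ∫ y : S2, ∑ l, (rotMatrix n i l j : ℂ) * ((angFun n l y : ℂ) * H (r, y)) ∂sphereMeasure := by
    refine integral_congr_ae ?_
    filter_upwards [rotD_angFun n i j] with y hy
    rw [hy]
    push_cast
    rw [Finset.sum_mul]
    refine Finset.sum_congr rfl fun l _ => ?_
    rw [rotMatrix]; ring
  rw [e1, integral_finsetSum]
  · refine Finset.sum_congr rfl fun l _ => ?_
    rw [integral_const_mul]
    rfl
  · intro l _
    refine Integrable.const_mul ?_ _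
    have := integrable_mul_of_memLp (memLp_sphere_of_continuous (angFun_contDiff n l).continuous) h
    simpa only [mul_comm] using this

/-- Duality between the derivatives along rotations of `u` and of the angular test functions. -/
lemma sum_fib_rotD_mul {c : ℝ} (hc : 0 < c) {u : E3 → ℂ} {du : E3 → E3 →L[ℝ] ℂ}
    (h : IsWeakDeriv (ext c) u du) (hu : MemLp (fun z => u (pol z)) 2 (polMeasure c)) (i : Fin 3)
    (hui : MemLp (angD i du) 2 (polMeasure c)) {H : ℝ × S2 → ℂ} (hH : MemLp H 2 (polMeasure c))
    (n : ℕ) :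
    ∀ᵐ r ∂radMeasure c, ∑ j, fib (fun z => (rotD i (angFun n j) z.2 : ℂ) * H z) r *
        conj (coef n j (fun z => u (pol z)) r) =
      ∑ l, coef n l H r * conj (coef n l (angD i du) r) := by
  have h1 : ∀ᵐ r ∂radMeasure c, ∀ j, fib (fun z => (angFun n j z.2 : ℂ) * angD i du z +
      (rotD i (angFun n j) z.2 : ℂ) * u (pol z)) r = 0 := by
    rw [ae_all_iff]
    intro j
    rw [ae_restrict_iff' measurableSet_Ioi]
    exact h.fib_rot hc (LocInt.of_memLp hu) i (LocInt.of_memLp hui) (angFun_contDiff n j)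
  filter_upwards [h1, ae_memLp_slice hu, ae_memLp_slice hui, ae_memLp_slice hH] with r h2 h3 h4 h5
  have hi : ∀ {φ : E3 → ℝ} {K : ℝ × S2 → ℂ}, Continuous φ →
      MemLp (fun y => K (r, y)) 2 sphereMeasure →
      Integrable (fun y : S2 => (φ y : ℂ) * K (r, y)) sphereMeasure := fun hφ hK => by
    have := integrable_mul_of_memLp (memLp_sphere_of_continuous hφ) hK
    simpa only [mul_comm] using this
  have h6 : ∀ l, coef n l (angD i du) r =
      ∑ j, (rotMatrix n i l j : ℂ) * coef n j (fun z => u (pol z)) r := by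
    intro l
    have h7 : coef n l (angD i du) r +
        fib (fun z => (rotD i (angFun n l) z.2 : ℂ) * u (pol z)) r = 0 := by
      rw [← h2 l, coef, fib, fib, ← integral_add]
      · rfl
      · exact hi (angFun_contDiff n l).continuous h4
      · exact hi (K := fun z => u (pol z)) (continuous_rotD i (angFun_contDiff n l)) h3
    rw [fib_rotD_eq h3] at h7
    rw [eq_neg_of_add_eq_zero_left h7, ← Finset.sum_neg_distrib]
    refine Finset.sum_congr rfl fun j _ => ?_
    rw [rotMatrix_antisymm n i l j]; push_cast; ring
  simp only [h6, fib_rotD_eq h5, map_sum, map_mul, conj_ofReal, Finset.sum_mul,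
    Finset.mul_sum]
  rw [Finset.sum_comm]
  refine Finset.sum_congr rfl fun l _ => Finset.sum_congr rfl fun j _ => ?_
  ring

/-! ### The quadratic identity, mode by mode -/

lemma exists_bound_deriv_smoothTransition :
    ∃ C, 0 ≤ C ∧ ∀ x, |deriv Real.smoothTransition x| ≤ C := by
  have hc : Continuous (deriv Real.smoothTransition) :=
    (Real.smoothTransition.contDiff (n := 1)).continuous_deriv le_rfl
  obtain ⟨C, hC⟩ := isCompact_Icc.exists_bound_of_continuousOn (s := Icc (0 : ℝ) 1) hc.continuousOn
  refine ⟨C, (norm_nonneg _).trans (hC 0 (by simp)), fun x => ?_⟩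
  by_cases hx : x ∈ Icc (0 : ℝ) 1
  · exact hC x hx
  · have h0 : deriv Real.smoothTransition x = 0 := by
      rw [mem_Icc, not_and_or, not_le, not_le] at hx
      rcases hx with hx | hx
      · have : Real.smoothTransition =ᶠ[𝓝 x] fun _ => 0 := by
          filter_upwards [Iio_mem_nhds hx] with y hy
          exact Real.smoothTransition.zero_of_nonpos hy.le
        rw [this.deriv_eq]; simp
      · have : Real.smoothTransition =ᶠ[𝓝 x] fun _ => 1 := by
          filter_upwards [Ioi_mem_nhds hx] with y hy
          exact Real.smoothTransition.one_of_one_le (le_of_lt hy)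
        rw [this.deriv_eq]; simp
    rw [h0, abs_zero]
    exact (norm_nonneg _).trans (hC 0 (by simp))

/-- A smooth cutoff, `1` for `r ≤ N` and `0` for `r ≥ 2N`. -/
def cutAtInfinity (N : ℕ) (r : ℝ) : ℝ := Real.smoothTransition (2 - r / N)

lemma contDiff_cutAtInfinity (N : ℕ) : ContDiff ℝ ∞ (cutAtInfinity N) :=
  Real.smoothTransition.contDiff.comp (contDiff_const.sub (contDiff_id.div_const _))

lemma cutAtInfinity_of_le {N : ℕ} (hN : 0 < N) {r : ℝ} (hr : r ≤ N) : cutAtInfinity N r = 1 := by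
  have hN' : (0 : ℝ) < N := by exact_mod_cast hN
  refine Real.smoothTransition.one_of_one_le ?_
  have : r / N ≤ 1 := (div_le_one hN').2 hr
  linarith

lemma cutAtInfinity_of_ge {N : ℕ} (hN : 0 < N) {r : ℝ} (hr : 2 * N ≤ r) : cutAtInfinity N r = 0 := by
  have hN' : (0 : ℝ) < N := by exact_mod_cast hN
  refine Real.smoothTransition.zero_of_nonpos ?_
  have : 2 ≤ r / N := (le_div_iff₀ hN').2 hr
  linarith

lemma cutAtInfinity_mem (N : ℕ) (r : ℝ) : 0 ≤ cutAtInfinity N r ∧ cutAtInfinity N r ≤ 1 :=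
  ⟨Real.smoothTransition.nonneg _, Real.smoothTransition.le_one _⟩

lemma deriv_cutAtInfinity (N : ℕ) (r : ℝ) :
    deriv (cutAtInfinity N) r = -(deriv Real.smoothTransition (2 - r / N) / N) := by
  have h1 : HasDerivAt Real.smoothTransition (deriv Real.smoothTransition (2 - r / N)) (2 - r / N) :=
    ((Real.smoothTransition.contDiff (n := 1)).differentiable one_ne_zero _).hasDerivAt
  have h2 : HasDerivAt (fun r : ℝ => 2 - r / N) (-(1 / (N : ℝ))) r := by
    simpa using ((hasDerivAt_id r).div_const (N : ℝ)).const_sub 2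
  have := (h1.comp r h2).deriv
  rw [show cutAtInfinity N = Real.smoothTransition ∘ fun r : ℝ => 2 - r / N from rfl, this]
  ring

lemma deriv_cutAtInfinity_eq_zero {N : ℕ} (hN : 0 < N) {r : ℝ} (hr : r ∉ Icc (N : ℝ) (2 * N)) :
    deriv (cutAtInfinity N) r = 0 := by
  rw [mem_Icc, not_and_or, not_le, not_le] at hr
  rcases hr with hr | hr
  · have : cutAtInfinity N =ᶠ[𝓝 r] fun _ => 1 := by
      filter_upwards [Iio_mem_nhds hr] with y hy
      exact cutAtInfinity_of_le hN (le_of_lt hy)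
    rw [this.deriv_eq]; simp
  · have : cutAtInfinity N =ᶠ[𝓝 r] fun _ => 0 := by
      filter_upwards [Ioi_mem_nhds hr] with y hy
      exact cutAtInfinity_of_ge hN (le_of_lt hy)
    rw [this.deriv_eq]; simp

lemma WeakDeriv1.congr {c : ℝ} {A A' A₁ A₁' : ℝ → ℂ} (h : WeakDeriv1 c A A')
    (hA : ∀ᵐ r ∂radMeasure c, A r = A₁ r) (hA' : ∀ᵐ r ∂radMeasure c, A' r = A₁' r) :
    WeakDeriv1 c A₁ A₁' := by
  have key : ∀ {f g : ℝ → ℂ}, LocallyIntegrableOn f (Ioi c) → (∀ᵐ r ∂radMeasure c, f r = g r) →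
      LocallyIntegrableOn g (Ioi c) := by
    intro f g hf hfg
    rw [locallyIntegrableOn_iff (isOpen_Ioi.isLocallyClosed)] at hf ⊢
    intro k hk hkc
    refine (hf k hk hkc).congr ?_
    exact ae_restrict_of_ae_restrict_of_subset hk hfg
  refine ⟨key h.locInt hA, key h.locInt_deriv hA', fun g h1 h2 h3 => ?_⟩
  have e1 : ∫ r in Ioi c, deriv g r • A₁ r = ∫ r in Ioi c, deriv g r • A r :=
    integral_congr_ae (by filter_upwards [hA] with r hr; rw [hr])
  have e2 : ∫ r in Ioi c, g r • A₁' r = ∫ r in Ioi c, g r • A' r :=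
    integral_congr_ae (by filter_upwards [hA'] with r hr; rw [hr])
  rw [e1, e2]
  exact h.byParts g h1 h2 h3

lemma IsWeakDeriv.weakDeriv1_coef {c : ℝ} (hc : 0 < c) {u : E3 → ℂ} {du : E3 → E3 →L[ℝ] ℂ}
    (h : IsWeakDeriv (ext c) u du) (hu : LocInt c fun z => u (pol z)) (hur : LocInt c (radD du))
    (n : ℕ) (j : Fin (angDim n)) :
    WeakDeriv1 c (coef n j fun z => u (pol z)) (coef n j (radD du)) := by
  have h1 := h.weakDeriv1 hc hu hur (contDiffOn_rayExt hc (angFun_contDiff n j))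
  refine h1.congr ?_ ?_
  · filter_upwards [ae_restrict_mem measurableSet_Ioi] with r hr
    simp only [coef, fib]
    congr 1; ext y
    rw [rayExt_pol (z := (r, y)) _ (hc.trans hr)]
  · filter_upwards [ae_restrict_mem measurableSet_Ioi] with r hr
    simp only [coef, fib]
    congr 1; ext y
    have hr' : 0 < r := hc.trans hr
    have h2 : fderiv ℝ (rayExt (angFun n j)) (pol (r, y)) y = 0 := by
      have := fderiv_rayExt_vecR (angFun_contDiff n j) (ne_zero_of_mem_ext hc (pol_mem_ext hc (z := (r, y)) hr))
      rwa [vecR_pol (z := (r, y)) hr'] at this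
    rw [rayExt_pol (z := (r, y)) _ hr', h2]
    simp

lemma coef_add {n : ℕ} {j : Fin (angDim n)} {H K : ℝ × S2 → ℂ} {r : ℝ}
    (hH : MemLp (fun y => H (r, y)) 2 sphereMeasure) (hK : MemLp (fun y => K (r, y)) 2 sphereMeasure) :
    coef n j (fun z => H z + K z) r = coef n j H r + coef n j K r := by
  simp only [coef_eq, angCoef]
  rw [← integral_add (integrable_mul_of_memLp
    (memLp_sphere_of_continuous (angFun_contDiff n j).continuous) hH) (integrable_mul_of_memLp
    (memLp_sphere_of_continuous (angFun_contDiff n j).continuous) hK)]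
  congr 1; ext y; ring

lemma coef_congr {n : ℕ} {j : Fin (angDim n)} {H K : ℝ × S2 → ℂ} {c : ℝ}
    (h : ∀ᵐ z ∂polMeasure c, H z = K z) : ∀ᵐ r ∂radMeasure c, coef n j H r = coef n j K r := by
  have : ∀ᵐ r ∂radMeasure c, ∀ᵐ y ∂sphereMeasure, H (r, y) = K (r, y) :=
    Measure.ae_ae_of_ae_prod h
  filter_upwards [this] with r hr
  simp only [coef, fib]
  refine integral_congr_ae ?_
  filter_upwards [hr] with y hy
  rw [hy]

/-- The twisted radial derivative `r² (∂_r u + κ u / r)`. -/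
def twistRad (κ : ℝ) (u : E3 → ℂ) (du : E3 → E3 →L[ℝ] ℂ) (z : ℝ × S2) : ℂ :=
  ((z.1 ^ 2 : ℝ) : ℂ) * (radD du z + ((κ / z.1 : ℝ) : ℂ) * u (pol z))

lemma radD_eq_twistRad {κ : ℝ} {u : E3 → ℂ} {du : E3 → E3 →L[ℝ] ℂ} {z : ℝ × S2} (hz : 0 < z.1) :
    radD du z = (((z.1 ^ 2)⁻¹ : ℝ) : ℂ) * twistRad κ u du z - ((κ / z.1 : ℝ) : ℂ) * u (pol z) := by
  have : (z.1 : ℂ) ≠ 0 := by exact_mod_cast hz.ne'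
  simp only [twistRad]; push_cast; field_simp; ring

lemma coef_radD {c : ℝ} (hc : 0 < c) {κ : ℝ} {u : E3 → ℂ} {du : E3 → E3 →L[ℝ] ℂ}
    (hu : MemLp (fun z => u (pol z)) 2 (polMeasure c))
    (hD : MemLp (twistRad κ u du) 2 (polMeasure c)) (n : ℕ) (j : Fin (angDim n)) :
    ∀ᵐ r ∂radMeasure c, coef n j (radD du) r = (((r ^ 2)⁻¹ : ℝ) : ℂ) * coef n j (twistRad κ u du) r -
      ((κ / r : ℝ) : ℂ) * coef n j (fun z => u (pol z)) r := by
  filter_upwards [ae_memLp_slice hu, ae_memLp_slice hD, ae_restrict_mem measurableSet_Ioi]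
    with r h1 h2 hr
  have e : coef n j (radD du) r = coef n j (fun z => (((z.1 ^ 2)⁻¹ : ℝ) : ℂ) * twistRad κ u du z +
      ((-(κ / z.1) : ℝ) : ℂ) * u (pol z)) r := by
    simp only [coef, fib]
    congr 1; ext y
    rw [radD_eq_twistRad (κ := κ) (u := u) (z := (r, y)) (hc.trans hr)]
    push_cast; ring
  have m1 : MemLp (fun y => (((r ^ 2)⁻¹ : ℝ) : ℂ) * twistRad κ u du (r, y)) 2 sphereMeasure :=
    h2.const_mul _
  have m2 : MemLp (fun y => ((-(κ / r) : ℝ) : ℂ) * u (pol (r, y))) 2 sphereMeasure :=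
    h1.const_mul _
  have e1 : coef n j (fun z => (((z.1 ^ 2)⁻¹ : ℝ) : ℂ) * twistRad κ u du z) r =
      (((r ^ 2)⁻¹ : ℝ) : ℂ) * coef n j (twistRad κ u du) r :=
    coef_radial_mul n j (fun r => (((r ^ 2)⁻¹ : ℝ) : ℂ)) _ r
  have e2 : coef n j (fun z => ((-(κ / z.1) : ℝ) : ℂ) * u (pol z)) r =
      ((-(κ / r) : ℝ) : ℂ) * coef n j (fun z => u (pol z)) r :=
    coef_radial_mul n j (fun r => ((-(κ / r) : ℝ) : ℂ)) _ r
  rw [e, coef_add (n := n) (j := j) m1 m2, e1, e2, ofReal_neg]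
  ring

lemma continuousOn_radial {c : ℝ} {k : ℝ → ℝ} (hk : ContinuousOn k (Ioi c)) :
    ContinuousOn (fun z : ℝ × S2 => (k z.1 : ℂ)) (Ioi c ×ˢ univ) :=
  continuous_ofReal.comp_continuousOn
    (hk.comp continuous_fst.continuousOn fun _ hz => hz.1)

lemma locInt_radD {c : ℝ} (hc : 0 < c) {κ : ℝ} {u : E3 → ℂ} {du : E3 → E3 →L[ℝ] ℂ}
    (hu : MemLp (fun z => u (pol z)) 2 (polMeasure c))
    (hD : MemLp (twistRad κ u du) 2 (polMeasure c)) : LocInt c (radD du) := by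
  have k1 : ContinuousOn (fun r : ℝ => (r ^ 2)⁻¹) (Ioi c) :=
    ContinuousOn.inv₀ (by fun_prop) fun r hr => pow_ne_zero _ (hc.trans hr).ne'
  have k2 : ContinuousOn (fun r : ℝ => -(κ / r)) (Ioi c) :=
    (continuousOn_const.div continuousOn_id fun r hr => (hc.trans hr).ne').neg
  have h1 := (LocInt.of_memLp hD).mul (continuousOn_radial k1)
  have h2 := (LocInt.of_memLp hu).mul (continuousOn_radial k2)
  intro x y hx hxy
  refine ((h1.add h2) x y hx hxy).congr ?_
  rw [shell_eq_restrict hx]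
  filter_upwards [ae_restrict_mem (measurableSet_Icc.prod MeasurableSet.univ)] with z hz
  rw [radD_eq_twistRad (κ := κ) (u := u) (z := z) (hc.trans (hx.trans_le hz.1.1))]
  push_cast; ring

section

/-- A weak equation `∂_r H₁ = H₀ + w Y + κ H₁ / r - ∑ X_i H_i` for a function `u` with square
integrable derivatives, with fluxes `H₁ ū` that vanish at infinity. -/
structure WeakSystem (c κ : ℝ) (u : E3 → ℂ) (du : E3 → E3 →L[ℝ] ℂ) (w : ℝ → ℝ)
    (H₁ H₀ Y : ℝ × S2 → ℂ) (Ha : Fin 3 → ℝ × S2 → ℂ) : Prop where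
  pos : 0 < c
  weakDeriv : IsWeakDeriv (ext c) u du
  memLp_u : MemLp (fun z => u (pol z)) 2 (polMeasure c)
  memLp_rad : MemLp (twistRad κ u du) 2 (polMeasure c)
  memLp_ang : ∀ i, MemLp (angD i du) 2 (polMeasure c)
  memLp_wu : MemLp (fun z => (w z.1 : ℂ) * u (pol z)) 2 (polMeasure c)
  memLp_flux : MemLp (fun z => (((z.1 ^ 2)⁻¹ : ℝ) : ℂ) * H₁ z) 2 (polMeasure c)
  memLp_zero : MemLp H₀ 2 (polMeasure c)
  memLp_Y : MemLp Y 2 (polMeasure c)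
  memLp_Ha : ∀ i, MemLp (Ha i) 2 (polMeasure c)
  weak : ∀ n j, WeakDeriv1 c (coef n j H₁) fun r => coef n j H₀ r + (w r : ℂ) * coef n j Y r +
    ((κ / r : ℝ) : ℂ) * coef n j H₁ r +
    ∑ i, fib (fun z => (rotD i (angFun n j) z.2 : ℂ) * Ha i z) r
  flux : ∀ n j, Tendsto (fun N : ℕ => (N : ℝ)⁻¹ *
    ∫ r in Icc (N : ℝ) (2 * N), ‖coef n j H₁ r‖ * ‖coef n j (fun z => u (pol z)) r‖) atTop (𝓝 0)

/-- A smooth cutoff near `c` that equals `1` near infinity. -/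
structure IsCutoff (c : ℝ) (χ : ℝ → ℝ) : Prop where
  smooth : ContDiff ℝ ∞ χ
  nonneg : ∀ r, 0 ≤ χ r
  le_one : ∀ r, χ r ≤ 1
  eq_one : ∃ R, ∀ r ≥ R, χ r = 1
  eq_zero : ∃ b > c, ∀ r ≤ b, χ r = 0

lemma IsCutoff.deriv_eq_zero {c : ℝ} {χ : ℝ → ℝ} (h : IsCutoff c χ) :
    ∃ R, ∀ r, r > R → deriv χ r = 0 := by
  obtain ⟨R, hR⟩ := h.eq_one
  refine ⟨R, fun r hr => ?_⟩
  have : χ =ᶠ[𝓝 r] fun _ => 1 := by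
    filter_upwards [Ioi_mem_nhds hr] with y hy
    exact hR y (le_of_lt hy)
  rw [this.deriv_eq]; simp

lemma IsCutoff.continuous_deriv {c : ℝ} {χ : ℝ → ℝ} (h : IsCutoff c χ) : Continuous (deriv χ) :=
  (h.smooth.of_le (m := 1) (by exact_mod_cast le_top)).continuous_deriv le_rfl

lemma IsCutoff.deriv_bound {c : ℝ} {χ : ℝ → ℝ} (h : IsCutoff c χ) :
    ∃ C, ∀ r, c < r → |deriv χ r| * r ^ 2 ≤ C := by
  obtain ⟨R, hR⟩ := h.deriv_eq_zero
  have hc : ContinuousOn (fun r => deriv χ r * r ^ 2) (Icc c R) :=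
    (h.continuous_deriv.mul (by fun_prop)).continuousOn
  obtain ⟨C, hC⟩ := isCompact_Icc.exists_bound_of_continuousOn hc
  refine ⟨max C 0, fun r hr => ?_⟩
  by_cases hrR : r ≤ R
  · have := hC r ⟨hr.le, hrR⟩
    rw [Real.norm_eq_abs, abs_mul, abs_of_nonneg (sq_nonneg r)] at this
    exact this.trans (le_max_left _ _)
  · rw [hR r (not_le.1 hrR)]; simp

lemma memLp_radial_mul {c : ℝ} {k : ℝ → ℝ} (hk : ContinuousOn k (Ioi c)) {C : ℝ}
    (hC : ∀ r, c < r → |k r| ≤ C) {H : ℝ × S2 → ℂ} (hH : MemLp H 2 (polMeasure c)) :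
    MemLp (fun z => (k z.1 : ℂ) * H z) 2 (polMeasure c) := by
  have hm : AEStronglyMeasurable (fun z : ℝ × S2 => (k z.1 : ℂ)) (polMeasure c) := by
    have h1 : AEStronglyMeasurable k (radMeasure c) := hk.aestronglyMeasurable measurableSet_Ioi
    exact continuous_ofReal.comp_aestronglyMeasurable h1.comp_fst
  refine MemLp.of_le_mul (c := C) hH (hm.mul hH.1) ?_
  filter_upwards [ae_fst_mem c] with z hz
  rw [norm_mul, norm_real, Real.norm_eq_abs]
  exact mul_le_mul_of_nonneg_right (hC _ hz) (norm_nonneg _)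

variable {c κ : ℝ} {u : E3 → ℂ} {du : E3 → E3 →L[ℝ] ℂ} {w : ℝ → ℝ}
    {H₁ H₀ Y : ℝ × S2 → ℂ} {Ha : Fin 3 → ℝ × S2 → ℂ}

/-- The bulk term in the `j`-th mode. -/
def modeBulk (κ : ℝ) (u : E3 → ℂ) (du : E3 → E3 →L[ℝ] ℂ) (w : ℝ → ℝ)
    (H₁ H₀ Y : ℝ × S2 → ℂ) (Ha : Fin 3 → ℝ × S2 → ℂ) (n : ℕ) (j : Fin (angDim n)) (r : ℝ) : ℂ :=
  coef n j (fun z => (((z.1 ^ 2)⁻¹ : ℝ) : ℂ) * H₁ z) r *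
      conj (coef n j (twistRad κ u du) r) +
    coef n j H₀ r * conj (coef n j (fun z => u (pol z)) r) +
    coef n j Y r * conj (coef n j (fun z => (w z.1 : ℂ) * u (pol z)) r) +
    ∑ i, fib (fun z => (rotD i (angFun n j) z.2 : ℂ) * Ha i z) r *
      conj (coef n j (fun z => u (pol z)) r)

lemma WeakSystem.integrable_rot (h : WeakSystem c κ u du w H₁ H₀ Y Ha) (n : ℕ)
    (j : Fin (angDim n)) (i : Fin 3) :
    Integrable (fun r => fib (fun z => (rotD i (angFun n j) z.2 : ℂ) * Ha i z) r *
      conj (coef n j (fun z => u (pol z)) r)) (radMeasure c) := by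
  have h1 : Integrable (fun r => (∑ l, (rotMatrix n i l j : ℂ) * coef n l (Ha i) r) *
      conj (coef n j (fun z => u (pol z)) r)) (radMeasure c) := by
    simp only [Finset.sum_mul]
    refine integrable_finsetSum _ fun l _ => ?_
    have h2 : Integrable (fun r => coef n l (Ha i) r *
        conj (coef n j (fun z => u (pol z)) r)) (radMeasure c) :=
      (memLp_coef (h.memLp_Ha i) n l).integrable_mul (memLp_coef h.memLp_u n j).star
    have h3 := h2.const_mul (rotMatrix n i l j : ℂ)
    simpa only [mul_assoc] using h3
  refine h1.congr ?_
  filter_upwards [ae_memLp_slice (h.memLp_Ha i)] with r hr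
  rw [fib_rotD_eq hr]

lemma WeakSystem.integrable_modeBulk (h : WeakSystem c κ u du w H₁ H₀ Y Ha) (n : ℕ)
    (j : Fin (angDim n)) : Integrable (modeBulk κ u du w H₁ H₀ Y Ha n j) (radMeasure c) :=
  (((integrable_coef_mul h.memLp_flux h.memLp_rad n j).add
    (integrable_coef_mul h.memLp_zero h.memLp_u n j)).add
    (integrable_coef_mul h.memLp_Y h.memLp_wu n j)).add
    (integrable_finsetSum _ fun i _ => h.integrable_rot n j i)

lemma WeakSystem.modeBulk_eq (h : WeakSystem c κ u du w H₁ H₀ Y Ha) (n : ℕ) (j : Fin (angDim n)) :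
    ∀ᵐ r ∂radMeasure c, (coef n j H₀ r + (w r : ℂ) * coef n j Y r +
        ((κ / r : ℝ) : ℂ) * coef n j H₁ r +
        ∑ i, fib (fun z => (rotD i (angFun n j) z.2 : ℂ) * Ha i z) r) *
          conj (coef n j (fun z => u (pol z)) r) +
        coef n j H₁ r * conj (coef n j (radD du) r) =
      modeBulk κ u du w H₁ H₀ Y Ha n j r := by
  filter_upwards [coef_radD h.pos h.memLp_u h.memLp_rad n j] with r h1
  have e1 : coef n j (fun z => (((z.1 ^ 2)⁻¹ : ℝ) : ℂ) * H₁ z) r =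
      (((r ^ 2)⁻¹ : ℝ) : ℂ) * coef n j H₁ r :=
    coef_radial_mul n j (fun r => (((r ^ 2)⁻¹ : ℝ) : ℂ)) _ r
  have e2 : coef n j (fun z => (w z.1 : ℂ) * u (pol z)) r =
      (w r : ℂ) * coef n j (fun z => u (pol z)) r :=
    coef_radial_mul n j (fun r => (w r : ℂ)) _ r
  rw [modeBulk, e1, e2, h1, ← Finset.sum_mul]
  simp only [map_sub, map_mul, conj_ofReal]
  ring

lemma WeakSystem.mode_identity (h : WeakSystem c κ u du w H₁ H₀ Y Ha) {χ : ℝ → ℝ}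
    (hχ : IsCutoff c χ) (n : ℕ) (j : Fin (angDim n)) :
    ∫ r in Ioi c, ((χ r : ℂ) * modeBulk κ u du w H₁ H₀ Y Ha n j r +
      ((deriv χ r : ℝ) : ℂ) * (coef n j H₁ r * conj (coef n j (fun z => u (pol z)) r))) = 0 := by
  set U := coef n j fun z => u (pol z) with hU
  set A := coef n j H₁ with hA
  set G := modeBulk κ u du w H₁ H₀ Y Ha n j with hG
  have hGi : Integrable G (radMeasure c) := h.integrable_modeBulk n j
  have hUd := (h.weakDeriv.weakDeriv1_coef h.pos (LocInt.of_memLp h.memLp_u)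
    (locInt_radD h.pos h.memLp_u h.memLp_rad) n j).star
  obtain ⟨R, hR⟩ := hχ.deriv_eq_zero
  obtain ⟨b, hb, hb0⟩ := hχ.eq_zero
  obtain ⟨Cχ, hCχ⟩ := hχ.deriv_bound
  obtain ⟨C, hC0, hC⟩ := exists_bound_deriv_smoothTransition
  have hAi : LocallyIntegrableOn A (Ioi c) := (h.weak n j).locInt
  have hX : MemLp (coef n j fun z => (((z.1 ^ 2)⁻¹ : ℝ) : ℂ) * H₁ z) 2 (radMeasure c) :=
    memLp_coef h.memLp_flux n j
  have hXA : ∀ r, coef n j (fun z => (((z.1 ^ 2)⁻¹ : ℝ) : ℂ) * H₁ z) r =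
      (((r ^ 2)⁻¹ : ℝ) : ℂ) * A r := fun r =>
    coef_radial_mul n j (fun r => (((r ^ 2)⁻¹ : ℝ) : ℂ)) _ r
  have hXU : Integrable (fun r => coef n j (fun z => (((z.1 ^ 2)⁻¹ : ℝ) : ℂ) * H₁ z) r *
      conj (U r)) (radMeasure c) :=
    hX.integrable_mul (memLp_coef h.memLp_u n j).star
  have hχA : Integrable (fun r => ((deriv χ r : ℝ) : ℂ) * (A r * conj (U r)))
      (radMeasure c) := by
    have h1 : Integrable (fun r => ((deriv χ r * r ^ 2 : ℝ) : ℂ) *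
        (coef n j (fun z => (((z.1 ^ 2)⁻¹ : ℝ) : ℂ) * H₁ z) r * conj (U r)))
        (radMeasure c) := by
      refine hXU.bdd_mul (c := Cχ) ?_ ?_
      · exact (continuous_ofReal.comp
          (hχ.continuous_deriv.mul (by fun_prop))).aestronglyMeasurable
      · filter_upwards [ae_restrict_mem measurableSet_Ioi] with r hr
        rw [norm_real, Real.norm_eq_abs, abs_mul, abs_of_nonneg (sq_nonneg r)]
        exact hCχ r hr
    refine h1.congr ?_
    filter_upwards [ae_restrict_mem measurableSet_Ioi] with r hr
    have hr0 : (r : ℂ) ≠ 0 := by exact_mod_cast (h.pos.trans hr).ne'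
    rw [hXA]; push_cast; field_simp
  have hAU : ∀ N : ℕ, 0 < N → c < N → Integrable
      (fun r => ‖A r‖ * ‖U r‖) (volume.restrict (Icc (N : ℝ) (2 * N))) := by
    intro N hN hcN
    have hN' : (0 : ℝ) < N := by exact_mod_cast hN
    have h1 : Integrable (fun r => ((r ^ 2 : ℝ) : ℂ) * (coef n j (fun z => (((z.1 ^ 2)⁻¹ : ℝ) : ℂ)
        * H₁ z) r * conj (U r))) (volume.restrict (Icc (N : ℝ) (2 * N))) := by
      refine Integrable.bdd_mul (c := (2 * N) ^ 2) ?_ ?_ ?_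
      · exact hXU.mono_measure (Measure.restrict_mono (fun r hr => hcN.trans_le hr.1) le_rfl)
      · exact (continuous_ofReal.comp (by fun_prop)).aestronglyMeasurable
      · filter_upwards [ae_restrict_mem measurableSet_Icc] with r hr
        rw [norm_real, Real.norm_of_nonneg (by positivity)]
        exact pow_le_pow_left₀ (hN'.le.trans hr.1) hr.2 2
    refine h1.norm.congr ?_
    filter_upwards [ae_restrict_mem measurableSet_Icc] with r hr
    have hr0 : r ≠ 0 := (hN'.trans_le hr.1).ne'
    rw [hXA, norm_mul, norm_mul, norm_mul, norm_real, norm_real, RCLike.norm_conj,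
      Real.norm_of_nonneg (by positivity), Real.norm_of_nonneg (by positivity)]
    field_simp
  -- the identity with a cutoff at infinity
  have key : ∀ᶠ N : ℕ in atTop, ∫ r in Ioi c, ((cutAtInfinity N r : ℂ) *
      ((χ r : ℂ) * G r + ((deriv χ r : ℝ) : ℂ) * (A r * conj (U r)))) =
      -∫ r in Ioi c, ((deriv (cutAtInfinity N) r * χ r : ℝ) : ℂ) * (A r * conj (U r)) := by
    filter_upwards [eventually_gt_atTop 0, eventually_gt_atTop ⌈c⌉₊] with N hN hcN
    have hcN' : c < N := Nat.lt_of_ceil_lt hcN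
    have hN' : (0 : ℝ) < N := by exact_mod_cast hN
    have hd : ∀ r, HasDerivAt (fun r => χ r * cutAtInfinity N r)
        (deriv χ r * cutAtInfinity N r + χ r * deriv (cutAtInfinity N) r) r := fun r =>
      ((hχ.smooth.differentiable (by simp)) r).hasDerivAt.mul
        (((contDiff_cutAtInfinity N).differentiable (by simp)) r).hasDerivAt
    have hcs : ∀ r, r ∉ Icc b (2 * N) → χ r * cutAtInfinity N r = 0 := by
      intro r hr
      rw [mem_Icc, not_and_or, not_le, not_le] at hr
      rcases hr with hr | hr
      · rw [hb0 r hr.le, zero_mul]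
      · rw [cutAtInfinity_of_ge hN hr.le, mul_zero]
    have hts : tsupport (fun r => χ r * cutAtInfinity N r) ⊆ Icc b (2 * N) :=
      closure_minimal (fun r hr => by
        by_contra hh; exact hr (hcs r hh)) isClosed_Icc
    have hip := (h.weak n j).integral_product hUd (χ := fun r => χ r * cutAtInfinity N r)
      ((hχ.smooth.mul (contDiff_cutAtInfinity N)).of_le (by exact_mod_cast le_top))
      (HasCompactSupport.intro isCompact_Icc hcs)
      (fun r hr => hb.trans_le (hts hr).1)
    have e1 : ∫ r in Ioi c, ((cutAtInfinity N r : ℂ) *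
        ((χ r : ℂ) * G r + ((deriv χ r : ℝ) : ℂ) * (A r * conj (U r))) +
        ((deriv (cutAtInfinity N) r * χ r : ℝ) : ℂ) * (A r * conj (U r))) = 0 := by
      rw [← hip]
      refine integral_congr_ae ?_
      filter_upwards [h.modeBulk_eq n j] with r hr
      rw [(hd r).deriv, hG, ← hr]
      simp only [real_smul]
      push_cast; ring
    rw [integral_add] at e1
    · exact eq_neg_of_add_eq_zero_left e1
    · refine Integrable.bdd_mul (c := 1) ?_ ?_ ?_
      · refine (hGi.bdd_mul (c := 1) ?_ ?_).add hχA
        · exact (continuous_ofReal.comp hχ.smooth.continuous).aestronglyMeasurable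
        · refine Eventually.of_forall fun r => ?_
          rw [norm_real, Real.norm_of_nonneg (hχ.nonneg r)]
          exact hχ.le_one r
      · exact (continuous_ofReal.comp
          (contDiff_cutAtInfinity N).continuous).aestronglyMeasurable
      · refine Eventually.of_forall fun r => ?_
        rw [norm_real, Real.norm_of_nonneg (cutAtInfinity_mem N r).1]
        exact (cutAtInfinity_mem N r).2
    · have h1 : Integrable (fun r => ((deriv (cutAtInfinity N) r * χ r : ℝ) : ℂ) *
          (A r * conj (U r))) (volume.restrict (Icc (N : ℝ) (2 * N))) := by
        refine Integrable.bdd_mul (c := C / N) ?_ ?_ ?_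
        · refine (integrable_norm_iff ?_).1 ?_
          · have h2 : Icc (N : ℝ) (2 * N) ⊆ Ioi c := fun r hr => hcN'.trans_le hr.1
            exact ((hAi.aestronglyMeasurable).mul (hUd.locInt.aestronglyMeasurable)).mono_measure
              (Measure.restrict_mono h2 le_rfl)
          · refine (hAU N hN hcN').congr (.of_forall fun r => ?_)
            simp only [norm_mul, RCLike.norm_conj]
        · exact (continuous_ofReal.comp
            ((((contDiff_cutAtInfinity N).of_le (m := 1) (by exact_mod_cast le_top)).continuous_deriv
              le_rfl).mul hχ.smooth.continuous)).aestronglyMeasurable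
        · refine Eventually.of_forall fun r => ?_
          rw [norm_real, Real.norm_eq_abs, abs_mul, deriv_cutAtInfinity, abs_neg, abs_div,
            abs_of_pos hN', abs_of_nonneg (hχ.nonneg r)]
          calc |deriv Real.smoothTransition (2 - r / N)| / N * χ r ≤
              |deriv Real.smoothTransition (2 - r / N)| / N * 1 := by
                gcongr; exact hχ.le_one r
            _ ≤ C / N := by rw [mul_one]; gcongr; exact hC _
      have h2 : IntegrableOn (fun r => ((deriv (cutAtInfinity N) r * χ r : ℝ) : ℂ) *
          (A r * conj (U r))) univ := by
        refine IntegrableOn.of_forall_sdiff_eq_zero (s := Icc (N : ℝ) (2 * N)) h1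
          MeasurableSet.univ fun r hr => ?_
        rw [deriv_cutAtInfinity_eq_zero hN hr.2]; simp
      exact h2.mono_set (subset_univ _)
  have lim1 : Tendsto (fun N : ℕ => ∫ r in Ioi c, ((cutAtInfinity N r : ℂ) *
      ((χ r : ℂ) * G r + ((deriv χ r : ℝ) : ℂ) * (A r * conj (U r))))) atTop
      (𝓝 (∫ r in Ioi c, ((χ r : ℂ) * G r + ((deriv χ r : ℝ) : ℂ) * (A r * conj (U r))))) := by
    have hint : Integrable (fun r => (χ r : ℂ) * G r + ((deriv χ r : ℝ) : ℂ) *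
        (A r * conj (U r))) (radMeasure c) := by
      refine (hGi.bdd_mul (c := 1) ?_ ?_).add hχA
      · exact (continuous_ofReal.comp hχ.smooth.continuous).aestronglyMeasurable
      · refine Eventually.of_forall fun r => ?_
        rw [norm_real, Real.norm_of_nonneg (hχ.nonneg r)]
        exact hχ.le_one r
    refine tendsto_integral_of_dominated_convergence _ (fun N => ?_) hint.norm (fun N => ?_) ?_
    · exact (continuous_ofReal.comp
        (contDiff_cutAtInfinity N).continuous).aestronglyMeasurable.mul hint.1
    · refine Eventually.of_forall fun r => ?_
      rw [norm_mul, norm_real, Real.norm_of_nonneg (cutAtInfinity_mem N r).1]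
      exact mul_le_of_le_one_left (norm_nonneg _) (cutAtInfinity_mem N r).2
    · refine Eventually.of_forall fun r => ?_
      refine tendsto_const_nhds.congr' ?_
      filter_upwards [eventually_gt_atTop 0, eventually_ge_atTop ⌈r⌉₊] with N hN hr
      rw [cutAtInfinity_of_le hN (Nat.ceil_le.1 hr)]; simp
  have lim2 : Tendsto (fun N : ℕ => -∫ r in Ioi c, ((deriv (cutAtInfinity N) r * χ r : ℝ) : ℂ) *
      (A r * conj (U r))) atTop (𝓝 0) := by
    have h0 := (h.flux n j).const_mul C
    rw [mul_zero] at h0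
    refine squeeze_zero_norm' ?_ h0
    filter_upwards [eventually_gt_atTop 0, eventually_gt_atTop ⌈c⌉₊] with N hN hcN
    have hcN' : c < N := Nat.lt_of_ceil_lt hcN
    have hN' : (0 : ℝ) < N := by exact_mod_cast hN
    have e2 : ∫ r in Ioi c, ((deriv (cutAtInfinity N) r * χ r : ℝ) : ℂ) * (A r * conj (U r))
        = ∫ r in Icc (N : ℝ) (2 * N),
          ((deriv (cutAtInfinity N) r * χ r : ℝ) : ℂ) * (A r * conj (U r)) := by
      refine setIntegral_eq_of_subset_of_forall_sdiff_eq_zero measurableSet_Ioi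
        (fun r hr => hcN'.trans_le hr.1) fun r hr => ?_
      rw [deriv_cutAtInfinity_eq_zero hN hr.2]; simp
    rw [norm_neg, e2]
    calc ‖∫ r in Icc (N : ℝ) (2 * N),
          ((deriv (cutAtInfinity N) r * χ r : ℝ) : ℂ) * (A r * conj (U r))‖
        ≤ ∫ r in Icc (N : ℝ) (2 * N), (C * (N : ℝ)⁻¹) * (‖A r‖ * ‖U r‖) := by
          refine norm_integral_le_of_norm_le ((hAU N hN hcN').const_mul _)
            (.of_forall fun r => ?_)
          rw [norm_mul, norm_mul, RCLike.norm_conj]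
          refine mul_le_mul_of_nonneg_right ?_ (by positivity)
          rw [norm_real, Real.norm_eq_abs, abs_mul, deriv_cutAtInfinity, abs_neg, abs_div,
            abs_of_pos hN', abs_of_nonneg (hχ.nonneg r)]
          calc |deriv Real.smoothTransition (2 - r / N)| / N * χ r ≤
              |deriv Real.smoothTransition (2 - r / N)| / N * 1 := by
                gcongr; exact hχ.le_one r
            _ ≤ C * (N : ℝ)⁻¹ := by rw [mul_one, div_eq_mul_inv]; gcongr; exact hC _
      _ = C * ((N : ℝ)⁻¹ * ∫ r in Icc (N : ℝ) (2 * N), ‖A r‖ * ‖U r‖) := by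
          rw [integral_const_mul, mul_assoc]
  exact tendsto_nhds_unique lim1 (lim2.congr' (key.mono fun N hN => hN.symm))

lemma coef_mul_radial (n : ℕ) (j : Fin (angDim n)) (k : ℝ → ℝ) (H : ℝ × S2 → ℂ) :
    coef n j (fun z => (k z.1 : ℂ) * H z) = fun r => (k r : ℂ) * coef n j H r :=
  funext fun r => coef_radial_mul n j (fun r => (k r : ℂ)) H r

lemma integral_add_five {α : Type*} [MeasurableSpace α] {μ : Measure α} {f₁ f₂ f₃ f₄ f₅ : α → ℂ}
    (h₁ : Integrable f₁ μ) (h₂ : Integrable f₂ μ) (h₃ : Integrable f₃ μ) (h₄ : Integrable f₄ μ)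
    (h₅ : Integrable f₅ μ) :
    ∫ x, f₁ x ∂μ + ∫ x, f₂ x ∂μ + ∫ x, f₃ x ∂μ + ∫ x, f₄ x ∂μ + ∫ x, f₅ x ∂μ =
      ∫ x, (f₁ x + f₂ x + f₃ x + f₄ x + f₅ x) ∂μ := by
  have i₂ : Integrable (fun x => f₁ x + f₂ x) μ := h₁.add h₂
  have i₃ : Integrable (fun x => f₁ x + f₂ x + f₃ x) μ := i₂.add h₃
  have i₄ : Integrable (fun x => f₁ x + f₂ x + f₃ x + f₄ x) μ := i₃.add h₄
  rw [integral_add i₄ h₅, integral_add i₃ h₄, integral_add i₂ h₃, integral_add h₁ h₂]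

/-- The quadratic form of a weak equation, as a density. -/
def quadBulk (κ : ℝ) (u : E3 → ℂ) (du : E3 → E3 →L[ℝ] ℂ) (w : ℝ → ℝ) (H₁ H₀ Y : ℝ × S2 → ℂ)
    (Ha : Fin 3 → ℝ × S2 → ℂ) (z : ℝ × S2) : ℂ :=
  (((z.1 ^ 2)⁻¹ : ℝ) : ℂ) * H₁ z * conj (twistRad κ u du z) +
    H₀ z * conj (u (pol z)) + Y z * conj ((w z.1 : ℂ) * u (pol z)) +
    ∑ i, Ha i z * conj (angD i du z)

/-- The quadratic identity: the weak equation may be tested against `u` itself. -/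
lemma WeakSystem.identity (h : WeakSystem c κ u du w H₁ H₀ Y Ha) {χ : ℝ → ℝ} (hχ : IsCutoff c χ) :
    Integrable (fun z => (χ z.1 : ℂ) * quadBulk κ u du w H₁ H₀ Y Ha z +
      ((deriv χ z.1 : ℝ) : ℂ) * (H₁ z * conj (u (pol z)))) (polMeasure c) ∧
    ∫ z, ((χ z.1 : ℂ) * quadBulk κ u du w H₁ H₀ Y Ha z +
      ((deriv χ z.1 : ℝ) : ℂ) * (H₁ z * conj (u (pol z)))) ∂polMeasure c = 0 := by
  obtain ⟨Cχ, hCχ⟩ := hχ.deriv_bound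
  have hχb : ∀ {H : ℝ × S2 → ℂ}, MemLp H 2 (polMeasure c) →
      MemLp (fun z => (χ z.1 : ℂ) * H z) 2 (polMeasure c) := fun hH =>
    memLp_radial_mul hχ.smooth.continuous.continuousOn (C := 1) (fun r _ => by
      rw [abs_of_nonneg (hχ.nonneg r)]; exact hχ.le_one r) hH
  have hd : MemLp (fun z => ((deriv χ z.1 * z.1 ^ 2 : ℝ) : ℂ) * ((((z.1 ^ 2)⁻¹ : ℝ) : ℂ) * H₁ z)) 2
      (polMeasure c) :=
    memLp_radial_mul (k := fun r => deriv χ r * r ^ 2)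
      (hχ.continuous_deriv.mul (by fun_prop)).continuousOn (C := Cχ) (fun r hr => by
      rw [abs_mul, abs_of_nonneg (sq_nonneg r)]; exact hCχ r hr) h.memLp_flux
  have hpair : ∀ {H G : ℝ × S2 → ℂ}, MemLp H 2 (polMeasure c) → MemLp G 2 (polMeasure c) →
      Integrable (fun z => H z * conj (G z)) (polMeasure c) := fun hH hG =>
    hH.integrable_mul hG.star
  have t1 := tendsto_integral_sum_coef (hχb h.memLp_flux) h.memLp_rad
  have t2 := tendsto_integral_sum_coef (hχb h.memLp_zero) h.memLp_u
  have t3 := tendsto_integral_sum_coef (hχb h.memLp_Y) h.memLp_wu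
  have t4 := fun i => tendsto_integral_sum_coef (hχb (h.memLp_Ha i)) (h.memLp_ang i)
  have t5 := tendsto_integral_sum_coef hd h.memLp_u
  have t := (((t1.add t2).add t3).add (tendsto_finsetSum Finset.univ fun i _ => t4 i)).add t5
  have e : ∀ n, (∫ r in Ioi c, ∑ j, coef n j (fun z => (χ z.1 : ℂ) * ((((z.1 ^ 2)⁻¹ : ℝ) : ℂ) * H₁ z))
        r * conj (coef n j (twistRad κ u du) r)) +
      (∫ r in Ioi c, ∑ j, coef n j (fun z => (χ z.1 : ℂ) * H₀ z) r *
        conj (coef n j (fun z => u (pol z)) r)) +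
      (∫ r in Ioi c, ∑ j, coef n j (fun z => (χ z.1 : ℂ) * Y z) r *
        conj (coef n j (fun z => (w z.1 : ℂ) * u (pol z)) r)) +
      (∑ i, ∫ r in Ioi c, ∑ j, coef n j (fun z => (χ z.1 : ℂ) * Ha i z) r *
        conj (coef n j (angD i du) r)) +
      (∫ r in Ioi c, ∑ j, coef n j (fun z => ((deriv χ z.1 * z.1 ^ 2 : ℝ) : ℂ) *
        ((((z.1 ^ 2)⁻¹ : ℝ) : ℂ) * H₁ z)) r * conj (coef n j (fun z => u (pol z)) r)) = 0 := by
    intro n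
    have hs : ∀ {H G : ℝ × S2 → ℂ}, MemLp H 2 (polMeasure c) → MemLp G 2 (polMeasure c) →
        Integrable (fun r => ∑ j, coef n j H r * conj (coef n j G r)) (radMeasure c) :=
      fun hH hG => integrable_finsetSum _ fun j _ => integrable_coef_mul hH hG n j
    rw [← integral_finsetSum _ fun i _ => hs (hχb (h.memLp_Ha i)) (h.memLp_ang i),
      integral_add_five (hs (hχb h.memLp_flux) h.memLp_rad) (hs (hχb h.memLp_zero) h.memLp_u)
        (hs (hχb h.memLp_Y) h.memLp_wu)
        (integrable_finsetSum _ fun i _ => hs (hχb (h.memLp_Ha i)) (h.memLp_ang i))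
        (hs hd h.memLp_u)]
    have hm : ∀ j, Integrable (fun r => (χ r : ℂ) * modeBulk κ u du w H₁ H₀ Y Ha n j r +
        ((deriv χ r : ℝ) : ℂ) * (coef n j H₁ r * conj (coef n j (fun z => u (pol z)) r)))
        (radMeasure c) := by
      intro j
      refine Integrable.add ((h.integrable_modeBulk n j).bdd_mul (c := 1) ?_ ?_) ?_
      · exact (continuous_ofReal.comp hχ.smooth.continuous).aestronglyMeasurable
      · refine Eventually.of_forall fun r => ?_
        rw [norm_real, Real.norm_of_nonneg (hχ.nonneg r)]
        exact hχ.le_one r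
      · refine (integrable_coef_mul hd h.memLp_u n j).congr ?_
        filter_upwards [ae_restrict_mem measurableSet_Ioi] with r hr
        have hr0 : (r : ℂ) ≠ 0 := by exact_mod_cast (h.pos.trans hr).ne'
        rw [coef_mul_radial n j (fun r => deriv χ r * r ^ 2),
          coef_mul_radial n j (fun r => (r ^ 2)⁻¹)]
        push_cast; field_simp
    have e0 : ∫ r in Ioi c, ∑ j, ((χ r : ℂ) * modeBulk κ u du w H₁ H₀ Y Ha n j r +
        ((deriv χ r : ℝ) : ℂ) * (coef n j H₁ r * conj (coef n j (fun z => u (pol z)) r))) = 0 := by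
      rw [integral_finsetSum _ fun j _ => hm j]
      exact Finset.sum_eq_zero fun j _ => h.mode_identity hχ n j
    rw [← e0]
    have hrot : ∀ᵐ r ∂radMeasure c, ∀ i, ∑ j, fib (fun z => (rotD i (angFun n j) z.2 : ℂ) * Ha i z) r *
        conj (coef n j (fun z => u (pol z)) r) =
        ∑ l, coef n l (Ha i) r * conj (coef n l (angD i du) r) := by
      rw [ae_all_iff]
      exact fun i => sum_fib_rotD_mul h.pos h.weakDeriv h.memLp_u i (h.memLp_ang i) (h.memLp_Ha i) n
    refine integral_congr_ae ?_
    filter_upwards [ae_restrict_mem measurableSet_Ioi, hrot] with r hr hrr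
    have hr0 : (r : ℂ) ≠ 0 := by exact_mod_cast (h.pos.trans hr).ne'
    have e1 : ∑ j, ((deriv χ r : ℝ) : ℂ) * (coef n j H₁ r * conj (coef n j (fun z => u (pol z)) r))
        = ∑ j, coef n j (fun z => ((deriv χ z.1 * z.1 ^ 2 : ℝ) : ℂ) *
        ((((z.1 ^ 2)⁻¹ : ℝ) : ℂ) * H₁ z)) r * conj (coef n j (fun z => u (pol z)) r) := by
      refine Finset.sum_congr rfl fun j _ => ?_
      rw [coef_mul_radial n j (fun r => deriv χ r * r ^ 2), coef_mul_radial n j (fun r => (r ^ 2)⁻¹)]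
      push_cast; field_simp
    rw [Finset.sum_add_distrib, e1]
    congr 1
    simp only [modeBulk, mul_add, Finset.sum_add_distrib, coef_mul_radial n _ χ, mul_assoc]
    congr 1
    simp only [← Finset.mul_sum]
    simp only [← hrr]
    congr 1
    exact Finset.sum_comm
  have t' := tendsto_nhds_unique (tendsto_const_nhds.congr fun n => (e n).symm) t
  have i1 := hpair (hχb h.memLp_flux) h.memLp_rad
  have i2 := hpair (hχb h.memLp_zero) h.memLp_u
  have i3 := hpair (hχb h.memLp_Y) h.memLp_wu
  have i4 := fun i => hpair (hχb (h.memLp_Ha i)) (h.memLp_ang i)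
  have i5 := hpair hd h.memLp_u
  have i4' := integrable_finsetSum Finset.univ fun i _ => i4 i
  rw [← integral_finsetSum _ fun i _ => i4 i, integral_add_five i1 i2 i3 i4' i5] at t'
  have hi := (((i1.add i2).add i3).add i4').add i5
  have key : ∀ {f g : ℝ × S2 → ℂ}, Integrable f (polMeasure c) → 0 = ∫ z, f z ∂polMeasure c →
      f =ᵐ[polMeasure c] g → Integrable g (polMeasure c) ∧ ∫ z, g z ∂polMeasure c = 0 :=
    fun hf h0 he => ⟨hf.congr he, (integral_congr_ae he).symm.trans h0.symm⟩
  refine key hi t' ?_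
  filter_upwards [ae_fst_mem c] with z hz
  have hr0 : (z.1 : ℂ) ≠ 0 := by exact_mod_cast (h.pos.trans hz).ne'
  have e5 : ((deriv χ z.1 : ℝ) : ℂ) * (H₁ z * conj (u (pol z))) =
      ((deriv χ z.1 * z.1 ^ 2 : ℝ) : ℂ) * ((((z.1 ^ 2)⁻¹ : ℝ) : ℂ) * H₁ z) *
        conj (u (pol z)) := by
    push_cast; field_simp
  rw [e5]
  simp only [quadBulk, Pi.add_apply, mul_add, Finset.mul_sum, mul_assoc]

end

/-! ### Behaviour at infinity -/

lemma sq_integral_mul_norm_le {α : Type*} [MeasurableSpace α] {μ : Measure α} {f g : α → ℂ}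
    (hf : MemLp f 2 μ) (hg : MemLp g 2 μ) :
    (∫ x, ‖f x‖ * ‖g x‖ ∂μ) ^ 2 ≤ (∫ x, ‖f x‖ ^ 2 ∂μ) * ∫ x, ‖g x‖ ^ 2 ∂μ := by
  have h := integral_mul_norm_le_Lp_mul_Lq (μ := μ) (f := f) (g := g) (p := 2) (q := 2)
    (by constructor <;> norm_num) (by simpa using hf) (by simpa using hg)
  simp only [Real.rpow_two] at h
  rw [← Real.sqrt_eq_rpow, ← Real.sqrt_eq_rpow] at h
  have h0 : 0 ≤ ∫ x, ‖f x‖ * ‖g x‖ ∂μ := integral_nonneg fun x => by positivity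
  have h1 : 0 ≤ ∫ x, ‖f x‖ ^ 2 ∂μ := integral_nonneg fun x => by positivity
  have h2 : 0 ≤ ∫ x, ‖g x‖ ^ 2 ∂μ := integral_nonneg fun x => by positivity
  calc _ ≤ (√(∫ x, ‖f x‖ ^ 2 ∂μ) * √(∫ x, ‖g x‖ ^ 2 ∂μ)) ^ 2 := pow_le_pow_left₀ h0 h 2
    _ = _ := by rw [mul_pow, Real.sq_sqrt h1, Real.sq_sqrt h2]

lemma tendsto_tail {c : ℝ} {f : ℝ → ℝ} (hf : Integrable f (radMeasure c)) :
    Tendsto (fun N : ℕ => ∫ r in Ioi (N : ℝ), f r) atTop (𝓝 0) := by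
  have h := tendsto_setIntegral_of_antitone (μ := volume) (f := f) (s := fun N : ℕ => Ioi (N : ℝ))
    (fun _ => measurableSet_Ioi)
    (fun a b hab => Ioi_subset_Ioi (by exact_mod_cast hab))
    ⟨⌈c⌉₊, IntegrableOn.mono_set (t := Ioi c) hf (Ioi_subset_Ioi (Nat.le_ceil c))⟩
  have h0 : ⋂ N : ℕ, Ioi (N : ℝ) = ∅ := by
    ext r; simp only [mem_iInter, mem_Ioi, mem_empty_iff_false, iff_false, not_forall, not_lt]
    exact exists_nat_ge r
  rwa [h0, setIntegral_empty] at h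

lemma contDiffOn_norm_rpow {c : ℝ} (hc : 0 < c) (κ : ℝ) :
    ContDiffOn ℝ ∞ (fun x : E3 => ‖x‖ ^ κ) (ext c) := by
  intro x hx
  have hx0 := ne_zero_of_mem_ext hc hx
  exact ((contDiffAt_norm ℝ hx0).rpow_const_of_ne (norm_ne_zero_iff.2 hx0)).contDiffWithinAt

section

variable {c κ ν : ℝ} {u : E3 → ℂ} {du : E3 → E3 →L[ℝ] ℂ}

lemma IsWeakDeriv.weakDeriv1_rpow_coef (hc : 0 < c) (h : IsWeakDeriv (ext c) u du)
    (hu : MemLp (fun z => u (pol z)) 2 (polMeasure c))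
    (hD : MemLp (twistRad κ u du) 2 (polMeasure c)) (n : ℕ) (j : Fin (angDim n)) :
    WeakDeriv1 c (fun r => ((r ^ κ : ℝ) : ℂ) * coef n j (fun z => u (pol z)) r)
      (fun r => ((r ^ (κ - 2) : ℝ) : ℂ) * coef n j (twistRad κ u du) r) := by
  have hΦ : ContDiffOn ℝ ∞ (fun x : E3 => ‖x‖ ^ κ * rayExt (angFun n j) x) (ext c) :=
    (contDiffOn_norm_rpow hc κ).mul (contDiffOn_rayExt hc (angFun_contDiff n j))
  have h1 := h.weakDeriv1 hc (LocInt.of_memLp hu) (locInt_radD hc hu hD) hΦ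
  refine h1.congr ?_ ?_
  · filter_upwards [ae_restrict_mem measurableSet_Ioi] with r hr
    have hr' : 0 < r := hc.trans hr
    rw [← coef_radial_mul n j (fun r => ((r ^ κ : ℝ) : ℂ))]
    simp only [coef, fib]
    congr 1; ext y
    rw [rayExt_pol (z := (r, y)) _ hr', norm_pol (z := (r, y)) hr'.le]
    push_cast; ring
  · filter_upwards [ae_restrict_mem measurableSet_Ioi] with r hr
    have hr' : 0 < r := hc.trans hr
    rw [← coef_radial_mul n j (fun r => ((r ^ (κ - 2) : ℝ) : ℂ))]
    simp only [coef, fib]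
    congr 1; ext y
    have hx0 : pol (r, y) ≠ 0 := ne_zero_of_mem_ext hc (pol_mem_ext hc (z := (r, y)) hr)
    have h2 : fderiv ℝ (rayExt (angFun n j)) (pol (r, y)) y = 0 := by
      have := fderiv_rayExt_vecR (angFun_contDiff n j) hx0
      rwa [vecR_pol (z := (r, y)) hr'] at this
    have hn : ‖pol (r, y)‖ = r := norm_pol (z := (r, y)) hr'.le
    have h3 : fderiv ℝ (fun x : E3 => ‖x‖ ^ κ * rayExt (angFun n j) x) (pol (r, y)) y =
        κ * r ^ (κ - 1) * angFun n j y := by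
      have d1 : DifferentiableAt ℝ (fun x : E3 => ‖x‖ ^ κ) (pol (r, y)) :=
        (((contDiffAt_norm ℝ hx0).rpow_const_of_ne (norm_ne_zero_iff.2 hx0)) :
          ContDiffAt ℝ 1 _ _).differentiableAt one_ne_zero
      have d2 : DifferentiableAt ℝ (rayExt (angFun n j)) (pol (r, y)) :=
        (contDiffAt_rayExt (angFun_contDiff n j) hx0).differentiableAt (by simp)
      have d3 : HasDerivAt (fun r : ℝ => r ^ κ) (κ * r ^ (κ - 1)) r :=
        Real.hasDerivAt_rpow_const (Or.inl hr'.ne')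
      rw [fderiv_fun_mul d1 d2]
      simp only [_root_.add_apply, _root_.smul_apply, h2, smul_eq_mul,
        mul_zero, zero_add]
      rw [fderiv_norm_comp (g := fun r => r ^ κ) (by rw [hn]; exact d3.differentiableAt) hx0, hn,
        d3.deriv, rayExt_pol (z := (r, y)) _ hr', inner_pol_snd (z := (r, y)), div_self hr'.ne']
      ring
    rw [h3, rayExt_pol (z := (r, y)) _ hr', hn, radD_eq_twistRad (κ := κ) (u := u) (z := (r, y)) hr']
    have e1 : r ^ (κ - 2) = r ^ κ * (r ^ 2)⁻¹ := by
      rw [Real.rpow_sub hr', Real.rpow_two, div_eq_mul_inv]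
    have e2 : r ^ (κ - 1) = r ^ κ * r⁻¹ := by
      rw [Real.rpow_sub hr', Real.rpow_one, div_eq_mul_inv]
    rw [e1, e2]
    push_cast; ring

/-- A mode of `r^κ u` has a limit at the conformal boundary, with a rate. -/
lemma exists_trace (hν : 0 < ν) (hκ : κ = 3 / 2 - ν) (hc : 0 < c) (h : IsWeakDeriv (ext c) u du)
    (hu : MemLp (fun z => u (pol z)) 2 (polMeasure c))
    (hD : MemLp (twistRad κ u du) 2 (polMeasure c)) (n : ℕ) (j : Fin (angDim n)) :
    ∃ (B : ℝ → ℂ) (ℓ : ℂ),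
      (∀ᵐ r, r ∈ Ioi c → ((r ^ κ : ℝ) : ℂ) * coef n j (fun z => u (pol z)) r = B r) ∧
      ∀ x, c < x → ‖B x - ℓ‖ ^ 2 ≤
        x ^ (-(2 * ν)) / (2 * ν) * ∫ r in Ioi x, ‖coef n j (twistRad κ u du) r‖ ^ 2 := by
  obtain ⟨B, hB, hB'⟩ := (h.weakDeriv1_rpow_coef hc hu hD n j).exists_primitive
  set D := coef n j (twistRad κ u du) with hDdef
  have hDL : MemLp D 2 (radMeasure c) := memLp_coef hD n j
  have hmono : ∀ {x : ℝ}, c ≤ x → MemLp D 2 (radMeasure x) := fun hx =>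
    hDL.mono_measure (Measure.restrict_mono (Ioi_subset_Ioi hx) le_rfl)
  have hexp : ∀ r : ℝ, 0 < r → ‖((r ^ (κ - 2) : ℝ) : ℂ)‖ ^ 2 = r ^ (-1 - 2 * ν) := by
    intro r hr
    rw [norm_real, Real.norm_of_nonneg (by positivity), ← Real.rpow_natCast,
      ← Real.rpow_mul hr.le]
    congr 1; rw [hκ]; push_cast; ring
  have hpow : ∀ {x : ℝ}, 0 < x → MemLp (fun r => ((r ^ (κ - 2) : ℝ) : ℂ)) 2 (radMeasure x) := by
    intro x hx
    have hm : AEStronglyMeasurable (fun r : ℝ => ((r ^ (κ - 2) : ℝ) : ℂ)) (radMeasure x) :=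
      (measurable_ofReal.comp (measurable_id.pow_const _)).aestronglyMeasurable
    rw [memLp_two_iff_integrable_sq_norm hm]
    refine ((integrableOn_Ioi_rpow_iff (s := -1 - 2 * ν) hx).2 (by linarith)).congr ?_
    filter_upwards [ae_restrict_mem measurableSet_Ioi] with r hr
    exact (hexp r (hx.trans hr)).symm
  have hint : ∀ {x : ℝ}, c < x → IntegrableOn (fun r => ((r ^ (κ - 2) : ℝ) : ℂ) * D r) (Ioi x) :=
    fun hx => (hpow (hc.trans hx)).integrable_mul (hmono hx.le)
  refine ⟨B, B (c + 1) + ∫ r in Ioi (c + 1), ((r ^ (κ - 2) : ℝ) : ℂ) * D r, hB, fun x hx => ?_⟩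
  have hx0 : 0 < x := hc.trans hx
  have e1 : B x - (B (c + 1) + ∫ r in Ioi (c + 1), ((r ^ (κ - 2) : ℝ) : ℂ) * D r) =
      -∫ r in Ioi x, ((r ^ (κ - 2) : ℝ) : ℂ) * D r := by
    have e2 := hB' (c + 1) x (by linarith) hx
    have e3 := intervalIntegral.integral_Ioi_sub_Ioi' (hint (x := c + 1) (by linarith)) (hint hx)
    rw [← e3] at e2
    linear_combination e2
  rw [e1, norm_neg]
  calc _ ≤ (∫ r in Ioi x, ‖((r ^ (κ - 2) : ℝ) : ℂ)‖ * ‖D r‖) ^ 2 := by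
        refine pow_le_pow_left₀ (norm_nonneg _) ?_ 2
        refine (norm_integral_le_integral_norm _).trans (le_of_eq ?_)
        simp only [norm_mul]
    _ ≤ _ := sq_integral_mul_norm_le (hpow hx0) (hmono hx.le)
    _ = _ := by
        congr 1
        rw [setIntegral_congr_fun (g := fun r => r ^ (-1 - 2 * ν)) measurableSet_Ioi
          fun r hr => hexp r (hx0.trans hr), integral_Ioi_rpow_of_lt (by linarith) hx0]
        rw [show -1 - 2 * ν + 1 = -(2 * ν) by ring]
        rw [neg_div_neg_eq]

/-- The limit vanishes if `ν ≥ 1`, by square integrability. -/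
lemma trace_eq_zero_of_one_le (hν : 1 ≤ ν) (hκ : κ = 3 / 2 - ν) (hc : 0 < c)
    (hu : MemLp (fun z => u (pol z)) 2 (polMeasure c))
    {n : ℕ} {j : Fin (angDim n)} {B : ℝ → ℂ} {ℓ : ℂ}
    (hB : ∀ᵐ r, r ∈ Ioi c → ((r ^ κ : ℝ) : ℂ) * coef n j (fun z => u (pol z)) r = B r)
    (hℓ : Tendsto B atTop (𝓝 ℓ)) : ℓ = 0 := by
  by_contra h0
  have h1 : ∀ᶠ x in atTop, ‖ℓ‖ / 2 < ‖B x‖ :=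
    hℓ.norm.eventually (lt_mem_nhds (half_lt_self (norm_pos_iff.2 h0)))
  obtain ⟨R, hR⟩ := eventually_atTop.1 (h1.and (eventually_gt_atTop c))
  have hRc : c < R := (hR R le_rfl).2
  have hR0 : 0 < R := hc.trans hRc
  have hU : Integrable (fun r => ‖coef n j (fun z => u (pol z)) r‖ ^ 2) (radMeasure c) :=
    (memLp_coef hu n j).integrable_norm_pow (by norm_num)
  have hU' := hU.mono_measure (Measure.restrict_mono (Ioi_subset_Ioi hRc.le) le_rfl)
  have h2 : IntegrableOn (fun r : ℝ => r ^ (-2 * κ)) (Ioi R) := by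
    refine ((hU'.const_mul (4 / ‖ℓ‖ ^ 2))).mono'
      (measurable_id.pow_const _).aestronglyMeasurable ?_
    filter_upwards [ae_restrict_mem measurableSet_Ioi, ae_restrict_of_ae hB] with r hr hBr
    have hr0 : 0 < r := hR0.trans hr
    have h3 := (hR r (le_of_lt hr)).1
    rw [← hBr (hRc.trans hr), norm_mul, norm_real, Real.norm_of_nonneg (by positivity)] at h3
    rw [Real.norm_of_nonneg (by positivity)]
    have e : r ^ (-2 * κ) * (r ^ κ * r ^ κ) = 1 := by
      rw [← Real.rpow_add hr0, ← Real.rpow_add hr0, show -2 * κ + (κ + κ) = 0 by ring,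
        Real.rpow_zero]
    have hℓ0 : 0 < ‖ℓ‖ := norm_pos_iff.2 h0
    have h4 : (‖ℓ‖ / 2) ^ 2 ≤ (r ^ κ * ‖coef n j (fun z => u (pol z)) r‖) ^ 2 :=
      pow_le_pow_left₀ (by positivity) h3.le 2
    have h5 := mul_le_mul_of_nonneg_left h4 (by positivity : 0 ≤ r ^ (-2 * κ))
    have h6 : r ^ (-2 * κ) * (r ^ κ * ‖coef n j (fun z => u (pol z)) r‖) ^ 2 =
        ‖coef n j (fun z => u (pol z)) r‖ ^ 2 := by
      linear_combination (‖coef n j (fun z => u (pol z)) r‖ ^ 2) * e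
    rw [h6] at h5
    rw [div_mul_eq_mul_div, le_div_iff₀ (by positivity)]
    nlinarith
  have h3 := (integrableOn_Ioi_rpow_iff hR0).1 h2
  rw [hκ] at h3
  linarith

lemma tendsto_trace (hν : 0 < ν) {B : ℝ → ℂ} {ℓ : ℂ} {D : ℝ → ℂ} (hc : 0 < c)
    (hD : MemLp D 2 (radMeasure c)) (hB : ∀ x, c < x → ‖B x - ℓ‖ ^ 2 ≤
        x ^ (-(2 * ν)) / (2 * ν) * ∫ r in Ioi x, ‖D r‖ ^ 2) : Tendsto B atTop (𝓝 ℓ) := by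
  have h0 : Tendsto (fun x : ℝ => x ^ (-(2 * ν)) / (2 * ν) * ∫ r in Ioi c, ‖D r‖ ^ 2) atTop (𝓝 0) := by
    have := ((tendsto_rpow_neg_atTop (y := 2 * ν) (by linarith)).div_const (2 * ν)).mul_const
      (∫ r in Ioi c, ‖D r‖ ^ 2)
    simpa using this
  have hDi : IntegrableOn (fun r => ‖D r‖ ^ 2) (Ioi c) := hD.integrable_norm_pow (by norm_num)
  have h1 : Tendsto (fun x => ‖B x - ℓ‖ ^ 2) atTop (𝓝 0) := by
    refine squeeze_zero' (.of_forall fun x => by positivity) ?_ h0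
    filter_upwards [eventually_gt_atTop c] with x hx
    refine (hB x hx).trans (mul_le_mul_of_nonneg_left ?_ ?_)
    · exact setIntegral_mono_set hDi (.of_forall fun r => by positivity)
        (Ioi_subset_Ioi hx.le).eventuallyLE
    · have : 0 < x := hc.trans hx
      positivity
  have h2 : Tendsto (fun x => ‖B x - ℓ‖) atTop (𝓝 0) := by
    have := (Real.continuous_sqrt.tendsto 0).comp h1
    simpa [Function.comp_def, Real.sqrt_sq] using this
  exact tendsto_iff_norm_sub_tendsto_zero.2 h2

instance : NeBot Params.essAtTop := by
  refine Filter.inf_neBot_iff.2 fun s hs t ht => ?_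
  obtain ⟨R, hR⟩ := mem_atTop_sets.1 hs
  by_contra h
  have h1 : Ioi R ⊆ tᶜ := fun x hx hxt => h ⟨x, hR x (le_of_lt hx), hxt⟩
  have h2 : (volume : Measure ℝ) (Ioi R) = 0 := measure_mono_null h1 ht
  simp at h2

lemma trace_eq_zero_of_tendsto {n : ℕ} {j : Fin (angDim n)} {B : ℝ → ℂ} {ℓ : ℂ}
    (hB : ∀ᵐ r, r ∈ Ioi c → ((r ^ κ : ℝ) : ℂ) * coef n j (fun z => u (pol z)) r = B r)
    (hℓ : Tendsto B atTop (𝓝 ℓ))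
    (h : Tendsto (fun r => ((r ^ κ : ℝ) : ℂ) * coef n j (fun z => u (pol z)) r) Params.essAtTop
      (𝓝 0)) : ℓ = 0 := by
  refine tendsto_nhds_unique (l := Params.essAtTop) (hℓ.mono_left inf_le_left) (h.congr' ?_)
  have h1 : ∀ᶠ r in Params.essAtTop, c < r :=
    (eventually_gt_atTop c).filter_mono inf_le_left
  have h2 : ∀ᶠ r in Params.essAtTop, r ∈ Ioi c →
      ((r ^ κ : ℝ) : ℂ) * coef n j (fun z => u (pol z)) r = B r := hB.filter_mono inf_le_right
  filter_upwards [h1, h2] with r h3 h4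
  exact h4 h3

lemma tendsto_average_of_le {F g : ℝ → ℝ} (hF : ∀ r, 0 ≤ F r) (hg0 : ∀ r, 0 ≤ g r)
    (hg : Integrable g (radMeasure c)) (h : ∀ ε > 0, ∀ᶠ N : ℕ in atTop,
      ∀ᵐ r ∂volume.restrict (Icc (N : ℝ) (2 * N)), F r ≤ N * g r + ε) :
    Tendsto (fun N : ℕ => (N : ℝ)⁻¹ * ∫ r in Icc (N : ℝ) (2 * N), F r) atTop (𝓝 0) := by
  rw [Metric.tendsto_nhds]
  intro ε hε
  filter_upwards [h (ε / 2) (half_pos hε), (tendsto_tail hg).eventually_lt_const (half_pos hε),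
    eventually_gt_atTop 0, eventually_gt_atTop ⌈c⌉₊] with N h1 h2 hN hcN
  have hcN' : c < N := Nat.lt_of_ceil_lt hcN
  have hN' : (0 : ℝ) < N := by exact_mod_cast hN
  have ig : Integrable g (volume.restrict (Icc (N : ℝ) (2 * N))) :=
    hg.mono_measure (Measure.restrict_mono (fun r hr => hcN'.trans_le hr.1) le_rfl)
  have h3 := integral_mono_of_nonneg (Eventually.of_forall hF)
    ((ig.const_mul (N : ℝ)).add (integrable_const (ε / 2))) h1
  have h4 : ∫ r in Icc (N : ℝ) (2 * N), g r ≤ ∫ r in Ioi (N : ℝ), g r := by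
    rw [← integral_Ici_eq_integral_Ioi]
    exact setIntegral_mono_set (IntegrableOn.mono_set (t := Ioi c) hg fun r hr => hcN'.trans_le hr)
      (Eventually.of_forall hg0) (Icc_subset_Ici_self).eventuallyLE
  simp only [Pi.add_apply] at h3
  rw [integral_add (ig.const_mul _) (integrable_const _), integral_const_mul, setIntegral_const,
    measureReal_def, Real.volume_Icc, ENNReal.toReal_ofReal (by linarith), smul_eq_mul] at h3
  rw [Real.dist_eq, sub_zero, abs_of_nonneg (mul_nonneg (by positivity) (integral_nonneg hF)),
    inv_mul_lt_iff₀ hN']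
  nlinarith

/-- The flux of a mode with vanishing limit. -/
lemma flux_of_trace_zero (hν : 0 < ν) (hκ : κ = 3 / 2 - ν) (hc : 0 < c)
    (h : IsWeakDeriv (ext c) u du) (hu : MemLp (fun z => u (pol z)) 2 (polMeasure c))
    (hD : MemLp (twistRad κ u du) 2 (polMeasure c)) {n : ℕ} {j : Fin (angDim n)}
    (h0 : ∀ (B : ℝ → ℂ) (ℓ : ℂ),
      (∀ᵐ r, r ∈ Ioi c → ((r ^ κ : ℝ) : ℂ) * coef n j (fun z => u (pol z)) r = B r) →
      Tendsto B atTop (𝓝 ℓ) → ℓ = 0) {A : ℝ → ℂ} {C : ℝ} (hA : ∀ᵐ r ∂radMeasure c,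
      ‖A r‖ ≤ C * (r ^ 2 * ‖coef n j (twistRad κ u du) r‖ + r * ‖coef n j (fun z => u (pol z)) r‖))
    (hC : 0 ≤ C) :
    Tendsto (fun N : ℕ => (N : ℝ)⁻¹ *
      ∫ r in Icc (N : ℝ) (2 * N), ‖A r‖ * ‖coef n j (fun z => u (pol z)) r‖) atTop (𝓝 0) := by
  obtain ⟨B, ℓ, hB, hBℓ⟩ := exists_trace hν hκ hc h hu hD n j
  have hDL : MemLp (coef n j (twistRad κ u du)) 2 (radMeasure c) := memLp_coef hD n j
  have hUL : MemLp (coef n j fun z => u (pol z)) 2 (radMeasure c) := memLp_coef hu n j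
  obtain rfl := h0 B ℓ hB (tendsto_trace hν hc hDL hBℓ)
  set D := coef n j (twistRad κ u du)
  set U := coef n j fun z => u (pol z)
  have hDi : Integrable (fun r => ‖D r‖ ^ 2) (radMeasure c) := hDL.integrable_norm_pow (by norm_num)
  have hUi : Integrable (fun r => ‖U r‖ ^ 2) (radMeasure c) := hUL.integrable_norm_pow (by norm_num)
  have hU : ∀ᵐ r ∂radMeasure c, r ^ 3 * ‖U r‖ ^ 2 ≤ (2 * ν)⁻¹ * ∫ t in Ioi r, ‖D t‖ ^ 2 := by
    filter_upwards [ae_restrict_of_ae hB, ae_restrict_mem measurableSet_Ioi] with r h1 hr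
    have hr0 : 0 < r := hc.trans hr
    have h2 := hBℓ r hr
    rw [sub_zero, ← h1 hr, norm_mul, norm_real, Real.norm_of_nonneg (by positivity),
      mul_pow] at h2
    have e : r ^ (2 * ν) * (r ^ κ) ^ 2 = r ^ 3 := by
      rw [← Real.rpow_natCast (r ^ κ), ← Real.rpow_mul hr0.le, ← Real.rpow_add hr0,
        ← Real.rpow_natCast r 3]
      congr 1; rw [hκ]; push_cast; ring
    have e' : r ^ (2 * ν) * r ^ (-(2 * ν)) = 1 := by
      rw [← Real.rpow_add hr0]; simp
    have h3 := mul_le_mul_of_nonneg_left h2 (by positivity : 0 ≤ r ^ (2 * ν))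
    calc r ^ 3 * ‖U r‖ ^ 2 = r ^ (2 * ν) * ((r ^ κ) ^ 2 * ‖U r‖ ^ 2) := by rw [← e]; ring
      _ ≤ _ := h3
      _ = (r ^ (2 * ν) * r ^ (-(2 * ν))) * ((2 * ν)⁻¹ * ∫ t in Ioi r, ‖D t‖ ^ 2) := by ring
      _ = _ := by rw [e', one_mul]
  refine tendsto_average_of_le (fun r => by positivity)
    (g := fun r => C * (‖D r‖ ^ 2 + 2 * ‖U r‖ ^ 2)) (fun r => by positivity)
    ((hDi.add (hUi.const_mul 2)).const_mul C) fun ε hε => ?_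
  have hlim := ((tendsto_tail hDi).mul_const (2 * ν)⁻¹).const_mul C
  rw [zero_mul, mul_zero] at hlim
  filter_upwards [eventually_gt_atTop 0, eventually_gt_atTop ⌈c⌉₊, hlim.eventually_lt_const hε]
    with N hN hcN hlt
  have hcN' : c < N := Nat.lt_of_ceil_lt hcN
  have hN' : (0 : ℝ) < N := by exact_mod_cast hN
  set δ := ∫ r in Ioi (N : ℝ), ‖D r‖ ^ 2
  have hle : volume.restrict (Icc (N : ℝ) (2 * N)) ≤ radMeasure c :=
    Measure.restrict_mono (fun r hr => hcN'.trans_le hr.1) le_rfl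
  filter_upwards [ae_mono hle hA, ae_mono hle hU, ae_restrict_mem measurableSet_Icc]
    with r h1 h2 hr
  have hr0 : 0 < r := hN'.trans_le hr.1
  have h3 : ∫ t in Ioi r, ‖D t‖ ^ 2 ≤ δ :=
    setIntegral_mono_set (IntegrableOn.mono_set (t := Ioi c) hDi (Ioi_subset_Ioi hcN'.le))
      (.of_forall fun r => by positivity) (Ioi_subset_Ioi hr.1).eventuallyLE
  have hν' : 0 < (2 * ν)⁻¹ := by positivity
  have h4 : r ^ 3 * ‖U r‖ ^ 2 ≤ δ * (2 * ν)⁻¹ := by nlinarith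
  have h5 : r ^ 2 * ‖D r‖ * ‖U r‖ ≤ N * ‖D r‖ ^ 2 + δ * (2 * ν)⁻¹ := by
    have h6 : r ^ 2 * ‖D r‖ * ‖U r‖ ≤ (r * ‖D r‖ ^ 2 + r ^ 3 * ‖U r‖ ^ 2) / 2 := by
      nlinarith [mul_nonneg hr0.le (sq_nonneg (‖D r‖ - r * ‖U r‖))]
    have h7 : r * ‖D r‖ ^ 2 ≤ 2 * N * ‖D r‖ ^ 2 :=
      mul_le_mul_of_nonneg_right hr.2 (by positivity)
    have h8 : 0 ≤ r ^ 3 * ‖U r‖ ^ 2 := by positivity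
    linarith
  have h6 : r * ‖U r‖ * ‖U r‖ ≤ 2 * N * ‖U r‖ ^ 2 := by
    have : r * ‖U r‖ ^ 2 ≤ 2 * N * ‖U r‖ ^ 2 := mul_le_mul_of_nonneg_right hr.2 (by positivity)
    linarith
  calc ‖A r‖ * ‖U r‖ ≤ C * (r ^ 2 * ‖D r‖ + r * ‖U r‖) * ‖U r‖ :=
        mul_le_mul_of_nonneg_right h1 (norm_nonneg _)
    _ = C * (r ^ 2 * ‖D r‖ * ‖U r‖ + r * ‖U r‖ * ‖U r‖) := by ring
    _ ≤ C * (N * ‖D r‖ ^ 2 + δ * (2 * ν)⁻¹ + 2 * N * ‖U r‖ ^ 2) :=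
        mul_le_mul_of_nonneg_left (add_le_add h5 h6) hC
    _ ≤ _ := by linarith

/-- A mode of `u` is `O(r^{-κ})`, with a constant controlled by the mode. -/
lemma exists_coef_bound (hν : 0 < ν) (hκ : κ = 3 / 2 - ν) (hc : 0 < c) :
    ∃ K, 0 ≤ K ∧ ∀ {u : E3 → ℂ} {du : E3 → E3 →L[ℝ] ℂ}, IsWeakDeriv (ext c) u du →
      MemLp (fun z => u (pol z)) 2 (polMeasure c) → MemLp (twistRad κ u du) 2 (polMeasure c) →
      ∀ n (j : Fin (angDim n)), ∀ᵐ r, r ∈ Ioi (c + 1) →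
        r ^ (2 * κ) * ‖coef n j (fun z => u (pol z)) r‖ ^ 2 ≤
          K * ((∫ r in Ioi c, ‖coef n j (fun z => u (pol z)) r‖ ^ 2) +
            ∫ r in Ioi c, ‖coef n j (twistRad κ u du) r‖ ^ 2) := by
  obtain ⟨K₁, hK₁⟩ := (isCompact_Icc (a := c + 1) (b := c + 2)).exists_bound_of_continuousOn
    (f := fun r : ℝ => r ^ (2 * κ)) (ContinuousOn.rpow_const continuousOn_id fun r hr =>
      Or.inl (ne_of_gt ((by linarith : 0 < c + 1).trans_le hr.1)))
  set K₂ := (c + 1) ^ (-(2 * ν)) / (2 * ν) with hK₂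
  have hc1 : 0 < c + 1 := by linarith
  have hK₂0 : 0 ≤ K₂ := by positivity
  have hK₁0 : 0 ≤ K₁ := (norm_nonneg _).trans (hK₁ (c + 1) ⟨le_rfl, by linarith⟩)
  refine ⟨4 * K₁ + 8 * K₂, by positivity, fun {u du} h hu hD n j => ?_⟩
  obtain ⟨B, ℓ, hB, hBℓ⟩ := exists_trace hν hκ hc h hu hD n j
  have hDL : MemLp (coef n j (twistRad κ u du)) 2 (radMeasure c) := memLp_coef hD n j
  have hUL : MemLp (coef n j fun z => u (pol z)) 2 (radMeasure c) := memLp_coef hu n j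
  set D := coef n j (twistRad κ u du)
  set U := coef n j fun z => u (pol z)
  have hDi : Integrable (fun r => ‖D r‖ ^ 2) (radMeasure c) := hDL.integrable_norm_pow (by norm_num)
  have hUi : Integrable (fun r => ‖U r‖ ^ 2) (radMeasure c) := hUL.integrable_norm_pow (by norm_num)
  set ID := ∫ r in Ioi c, ‖D r‖ ^ 2
  set IU := ∫ r in Ioi c, ‖U r‖ ^ 2
  have hID : 0 ≤ ID := integral_nonneg fun r => by positivity
  have hUB : ∀ r, 0 < r → ((r ^ κ : ℝ) : ℂ) * U r = B r → ‖B r‖ ^ 2 = r ^ (2 * κ) * ‖U r‖ ^ 2 := by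
    intro r hr e
    rw [← e, norm_mul, norm_real, Real.norm_of_nonneg (by positivity), mul_pow,
      ← Real.rpow_natCast (r ^ κ), ← Real.rpow_mul hr.le]
    congr 2; push_cast; ring
  have hbd : ∀ x, c + 1 ≤ x → ‖B x - ℓ‖ ^ 2 ≤ K₂ * ID := by
    intro x hx
    have hcx : c < x := by linarith
    refine (hBℓ x hcx).trans (mul_le_mul ?_ ?_ (integral_nonneg fun r => by positivity) hK₂0)
    · rw [hK₂]
      exact div_le_div_of_nonneg_right
        (Real.rpow_le_rpow_of_nonpos hc1 hx (by linarith : -(2 * ν) ≤ 0)) (by positivity)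
    · exact setIntegral_mono_set hDi (.of_forall fun r => by positivity)
        (Ioi_subset_Ioi hcx.le).eventuallyLE
  have hdiff : ∀ x y, c + 1 ≤ x → c + 1 ≤ y → ‖B x‖ ^ 2 ≤ 2 * ‖B y‖ ^ 2 + 8 * (K₂ * ID) := by
    intro x y hx hy
    have h1 := hbd x hx
    have h2 := hbd y hy
    have h3 : ‖B x‖ ≤ ‖B y‖ + (‖B x - ℓ‖ + ‖B y - ℓ‖) := by
      calc ‖B x‖ = ‖B y + ((B x - ℓ) - (B y - ℓ))‖ := by congr 1; ring
        _ ≤ _ := (norm_add_le _ _).trans (add_le_add_right (norm_sub_le _ _) _)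
    have h4 := pow_le_pow_left₀ (norm_nonneg _) h3 2
    nlinarith [sq_nonneg (‖B y‖ - (‖B x - ℓ‖ + ‖B y - ℓ‖)), sq_nonneg (‖B x - ℓ‖ - ‖B y - ℓ‖)]
  have hsub : Icc (c + 1) (c + 2) ⊆ Ioi c := fun r hr => lt_of_lt_of_le (by linarith) hr.1
  have hle : volume.restrict (Icc (c + 1) (c + 2)) ≤ radMeasure c :=
    Measure.restrict_mono hsub le_rfl
  have hall : ∀ x, c + 1 ≤ x → ‖B x‖ ^ 2 ≤ (4 * K₁ + 8 * K₂) * (IU + ID) := by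
    intro x hx
    have h1 : ∀ᵐ y ∂volume.restrict (Icc (c + 1) (c + 2)),
        ‖B x‖ ^ 2 ≤ 2 * K₁ * ‖U y‖ ^ 2 + 8 * (K₂ * ID) := by
      filter_upwards [ae_restrict_of_ae hB, ae_restrict_mem measurableSet_Icc] with y hy hyI
      have h2 := hdiff x y hx hyI.1
      rw [hUB y (hc1.trans_le hyI.1) (hy (hsub hyI))] at h2
      have h3 := mul_le_mul_of_nonneg_right ((le_abs_self _).trans (hK₁ y hyI)) (sq_nonneg ‖U y‖)
      linarith
    have iU := (hUi.mono_measure hle).const_mul (2 * K₁)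
    have iR : Integrable (fun y => 2 * K₁ * ‖U y‖ ^ 2 + 8 * (K₂ * ID))
        (volume.restrict (Icc (c + 1) (c + 2))) := iU.add (integrable_const _)
    have h2 := integral_mono_ae (integrable_const _) iR h1
    have h3 : ∫ y in Icc (c + 1) (c + 2), (2 * K₁ * ‖U y‖ ^ 2 + 8 * (K₂ * ID)) =
        2 * K₁ * (∫ y in Icc (c + 1) (c + 2), ‖U y‖ ^ 2) + 8 * (K₂ * ID) := by
      rw [integral_add iU (integrable_const _), integral_const_mul, setIntegral_const,
        measureReal_def, Real.volume_Icc, ENNReal.toReal_ofReal (by linarith), smul_eq_mul]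
      ring
    rw [h3, setIntegral_const, measureReal_def, Real.volume_Icc, ENNReal.toReal_ofReal (by linarith),
      smul_eq_mul] at h2
    have h4 : ∫ y in Icc (c + 1) (c + 2), ‖U y‖ ^ 2 ≤ IU :=
      setIntegral_mono_set hUi (.of_forall fun r => by positivity) hsub.eventuallyLE
    have hIU : 0 ≤ IU := integral_nonneg fun r => by positivity
    nlinarith [mul_nonneg hK₁0 hIU, mul_nonneg hK₁0 hID, mul_nonneg hK₂0 hIU,
      mul_le_mul_of_nonneg_left h4 hK₁0]
  filter_upwards [hB] with r hr hrc
  have hr0 : 0 < r := hc1.trans hrc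
  rw [← hUB r hr0 (hr (by have := mem_Ioi.1 hrc; simp; linarith))]
  exact hall r (le_of_lt hrc)

/-- Spheres: `∫ |u(r, y)|² dy = O(r^{-2κ})`. -/
lemma exists_sphere_bound (hν : 0 < ν) (hκ : κ = 3 / 2 - ν) (hc : 0 < c)
    (h : IsWeakDeriv (ext c) u du) (hu : MemLp (fun z => u (pol z)) 2 (polMeasure c))
    (hD : MemLp (twistRad κ u du) 2 (polMeasure c)) :
    ∃ K, 0 ≤ K ∧ ∀ᵐ r, r ∈ Ioi (c + 1) →
      r ^ (2 * κ) * ∫ y, ‖u (pol (r, y))‖ ^ 2 ∂sphereMeasure ≤ K := by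
  obtain ⟨K, hK, hKb⟩ := exists_coef_bound hν hκ hc
  set IU := ∫ r in Ioi c, ∫ y, ‖u (pol (r, y))‖ ^ 2 ∂sphereMeasure
  set ID := ∫ r in Ioi c, ∫ y, ‖twistRad κ u du (r, y)‖ ^ 2 ∂sphereMeasure
  have hsum : ∀ {H : ℝ × S2 → ℂ}, MemLp H 2 (polMeasure c) → ∀ n,
      ∑ j, ∫ r in Ioi c, ‖coef n j H r‖ ^ 2 ≤
        ∫ r in Ioi c, ∫ y, ‖H (r, y)‖ ^ 2 ∂sphereMeasure := by
    intro H hH n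
    have hi : ∀ j, Integrable (fun r => ‖coef n j H r‖ ^ 2) (radMeasure c) := fun j =>
      (memLp_coef hH n j).integrable_norm_pow (by norm_num)
    rw [← integral_finsetSum _ fun j _ => hi j]
    exact integral_mono_ae (integrable_finsetSum _ fun j _ => hi j) (integrable_slice_sq hH)
      (sum_sq_coef_le hH n)
  have hIU : 0 ≤ IU := integral_nonneg fun r => integral_nonneg fun y => by positivity
  have hID : 0 ≤ ID := integral_nonneg fun r => integral_nonneg fun y => by positivity
  refine ⟨K * (IU + ID), by positivity, ?_⟩
  have h1 : ∀ᵐ r, ∀ n, ∀ j : Fin (angDim n), r ∈ Ioi (c + 1) →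
        r ^ (2 * κ) * ‖coef n j (fun z => u (pol z)) r‖ ^ 2 ≤
          K * ((∫ r in Ioi c, ‖coef n j (fun z => u (pol z)) r‖ ^ 2) +
            ∫ r in Ioi c, ‖coef n j (twistRad κ u du) r‖ ^ 2) := by
    rw [ae_all_iff]; intro n; rw [ae_all_iff]; intro j
    exact hKb h hu hD n j
  have h2 := (ae_restrict_iff' measurableSet_Ioi).1 (ae_memLp_slice hu)
  filter_upwards [h1, h2] with r hr hs hrc
  have hs' := hs (by have := mem_Ioi.1 hrc; simp; linarith)
  have hr0 : 0 < r := lt_trans (by linarith) hrc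
  have t := tendsto_sum_angCoef hs' hs'
  have t1 : Tendsto (fun n => ∑ j, ‖coef n j (fun z => u (pol z)) r‖ ^ 2) atTop
      (𝓝 (∫ y, ‖u (pol (r, y))‖ ^ 2 ∂sphereMeasure)) := by
    have t2 := (continuous_re.tendsto _).comp t
    have e1 : (∫ y, u (pol (r, y)) * conj (u (pol (r, y))) ∂sphereMeasure).re =
        ∫ y, ‖u (pol (r, y))‖ ^ 2 ∂sphereMeasure := by
      have : ∀ y : S2, u (pol (r, y)) * conj (u (pol (r, y))) =
          ((‖u (pol (r, y))‖ ^ 2 : ℝ) : ℂ) := fun y => by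
        rw [mul_conj, normSq_eq_norm_sq]
      simp only [this, integral_complex_ofReal, ofReal_re]
    rw [e1] at t2
    refine t2.congr fun n => ?_
    simp only [Function.comp, re_sum, coef_eq]
    refine Finset.sum_congr rfl fun j _ => ?_
    rw [mul_conj, normSq_eq_norm_sq, ofReal_re]
  refine le_of_tendsto (t1.const_mul (r ^ (2 * κ))) (.of_forall fun n => ?_)
  rw [Finset.mul_sum]
  refine (Finset.sum_le_sum fun j _ => hr n j hrc).trans ?_
  rw [← Finset.mul_sum, Finset.sum_add_distrib]
  exact mul_le_mul_of_nonneg_left (add_le_add (hsum hu n) (hsum hD n)) hK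

/-- The function `r^{1-2ν} u` is square integrable. -/
lemma memLp_weight (hν : 0 < ν) (hκ : κ = 3 / 2 - ν) (hc : 0 < c)
    (h : IsWeakDeriv (ext c) u du) (hu : MemLp (fun z => u (pol z)) 2 (polMeasure c))
    (hD : MemLp (twistRad κ u du) 2 (polMeasure c)) :
    MemLp (fun z => ((z.1 ^ (1 - 2 * ν) : ℝ) : ℂ) * u (pol z)) 2 (polMeasure c) := by
  obtain ⟨K, hK, hKb⟩ := exists_sphere_bound hν hκ hc h hu hD
  have hc1 : 0 < c + 1 := by linarith
  have hw : Measurable fun z : ℝ × S2 => ((z.1 ^ (1 - 2 * ν) : ℝ) : ℂ) :=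
    measurable_ofReal.comp (measurable_fst.pow_const _)
  have hm := hw.aestronglyMeasurable (μ := polMeasure c) |>.mul hu.1
  have hu2 : Integrable (fun z => ‖u (pol z)‖ ^ 2) (polMeasure c) := hu.integrable_norm_pow (by norm_num)
  have hm' : AEStronglyMeasurable (fun z : ℝ × S2 => ‖((z.1 ^ (1 - 2 * ν) : ℝ) : ℂ) * u (pol z)‖ ^ 2)
      (polMeasure c) := hm.norm.pow 2
  have hn : ∀ z : ℝ × S2, 0 < z.1 → ‖((z.1 ^ (1 - 2 * ν) : ℝ) : ℂ) * u (pol z)‖ ^ 2 =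
      z.1 ^ (2 - 4 * ν) * ‖u (pol z)‖ ^ 2 := by
    intro z hz
    rw [norm_mul, norm_real, Real.norm_of_nonneg (by positivity), mul_pow,
      ← Real.rpow_natCast (z.1 ^ _), ← Real.rpow_mul hz.le]
    congr 2; push_cast; ring
  refine (memLp_two_iff_integrable_sq_norm hm).2 ?_
  refine (integrable_prod_iff hm').2 ⟨?_, ?_⟩
  · have h1 : ∀ᵐ r ∂radMeasure c, Integrable (fun y => ‖u (pol (r, y))‖ ^ 2) sphereMeasure :=
      hu2.prod_right_ae
    filter_upwards [h1, ae_restrict_mem measurableSet_Ioi] with r hr hrc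
    refine (hr.const_mul (r ^ (2 - 4 * ν))).congr (.of_forall fun y => ?_)
    exact (hn (r, y) (hc.trans hrc)).symm
  · have hbig : IntegrableOn (fun r : ℝ => K * r ^ (-1 - 2 * ν)) (Ioi (c + 1)) :=
      ((integrableOn_Ioi_rpow_iff hc1).2 (by linarith)).const_mul K
    obtain ⟨K₁, hK₁⟩ := (isCompact_Icc (a := c) (b := c + 1)).exists_bound_of_continuousOn
      (f := fun r : ℝ => r ^ (2 - 4 * ν)) (ContinuousOn.rpow_const continuousOn_id fun r hr =>
        Or.inl (ne_of_gt (hc.trans_le hr.1)))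
    have hK₁0 : 0 ≤ K₁ := (norm_nonneg _).trans (hK₁ c ⟨le_rfl, by linarith⟩)
    have hs := integrable_slice_sq hu
    have hdom : Integrable (fun r => (Ioi (c + 1)).indicator (fun r : ℝ => K * r ^ (-1 - 2 * ν)) r +
        K₁ * ∫ y, ‖u (pol (r, y))‖ ^ 2 ∂sphereMeasure) (radMeasure c) :=
      ((integrable_indicator_iff measurableSet_Ioi).2 hbig).mono_measure Measure.restrict_le_self
        |>.add (hs.const_mul K₁)
    refine hdom.mono' hm'.norm.integral_prod_right' ?_
    filter_upwards [ae_restrict_of_ae hKb, ae_restrict_mem measurableSet_Ioi] with r hr hrc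
    have hr0 : 0 < r := hc.trans hrc
    have hI : 0 ≤ ∫ y, ‖u (pol (r, y))‖ ^ 2 ∂sphereMeasure := integral_nonneg fun y => by positivity
    have e : ∫ y, ‖‖((r ^ (1 - 2 * ν) : ℝ) : ℂ) * u (pol (r, y))‖ ^ 2‖ ∂sphereMeasure =
        r ^ (2 - 4 * ν) * ∫ y, ‖u (pol (r, y))‖ ^ 2 ∂sphereMeasure := by
      rw [← integral_const_mul]
      congr 1; ext y
      rw [Real.norm_of_nonneg (by positivity)]
      exact hn (r, y) hr0
    rw [e, Real.norm_of_nonneg (by positivity)]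
    by_cases hrc1 : r ∈ Ioi (c + 1)
    · rw [indicator_of_mem hrc1]
      have h3 := mul_le_mul_of_nonneg_left (hr hrc1) (by positivity : 0 ≤ r ^ (-1 - 2 * ν))
      have e2 : r ^ (-1 - 2 * ν) * r ^ (2 * κ) = r ^ (2 - 4 * ν) := by
        rw [← Real.rpow_add hr0]; congr 1; rw [hκ]; ring
      rw [← mul_assoc, e2] at h3
      have h4 : 0 ≤ K₁ * ∫ y, ‖u (pol (r, y))‖ ^ 2 ∂sphereMeasure := mul_nonneg hK₁0 hI
      linarith
    · rw [indicator_of_notMem hrc1, zero_add]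
      exact mul_le_mul_of_nonneg_right ((le_abs_self _).trans
        (hK₁ r ⟨le_of_lt hrc, not_lt.1 hrc1⟩)) hI

/-- The flux of a mode, under a boundary condition on the twisted derivative. -/
lemma flux_of_tendsto (hν : 0 < ν) (hκ : κ = 3 / 2 - ν) (hc : 0 < c)
    (h : IsWeakDeriv (ext c) u du) (hu : MemLp (fun z => u (pol z)) 2 (polMeasure c))
    (hD : MemLp (twistRad κ u du) 2 (polMeasure c)) {n : ℕ} {j : Fin (angDim n)}
    {A G : ℝ → ℂ} {C : ℝ} (hA : ∀ᵐ r ∂radMeasure c,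
      ‖A r‖ ≤ C * (r ^ 4 * ‖G r‖ + r * ‖coef n j (fun z => u (pol z)) r‖)) (hC : 0 ≤ C)
    (hG : Tendsto (fun r => ((r ^ (2 * ν + 1 + κ) : ℝ) : ℂ) * G r) Params.essAtTop (𝓝 0)) :
    Tendsto (fun N : ℕ => (N : ℝ)⁻¹ *
      ∫ r in Icc (N : ℝ) (2 * N), ‖A r‖ * ‖coef n j (fun z => u (pol z)) r‖) atTop (𝓝 0) := by
  obtain ⟨K, hK, hKb⟩ := exists_coef_bound hν hκ hc
  have hKb' := hKb h hu hD n j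
  set K₁ := K * ((∫ r in Ioi c, ‖coef n j (fun z => u (pol z)) r‖ ^ 2) +
            ∫ r in Ioi c, ‖coef n j (twistRad κ u du) r‖ ^ 2) with hK₁
  have hUL : MemLp (coef n j fun z => u (pol z)) 2 (radMeasure c) := memLp_coef hu n j
  set U := coef n j fun z => u (pol z)
  have hUi : Integrable (fun r => ‖U r‖ ^ 2) (radMeasure c) := hUL.integrable_norm_pow (by norm_num)
  have hK₁0 : 0 ≤ K₁ := mul_nonneg hK (add_nonneg (integral_nonneg fun r => by positivity)
    (integral_nonneg fun r => by positivity))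
  refine tendsto_average_of_le (fun r => by positivity) (g := fun r => C * (2 * ‖U r‖ ^ 2))
    (fun r => by positivity) ((hUi.const_mul 2).const_mul C) fun ε hε => ?_
  obtain ⟨e, he0, he⟩ : ∃ e > 0, C * (e * √K₁) ≤ ε := by
    refine ⟨ε / (C * √K₁ + 1), by positivity, ?_⟩
    rw [div_mul_eq_mul_div, ← mul_div_assoc, div_le_iff₀ (by positivity)]
    linarith
  have hGe : ∀ᶠ r in Params.essAtTop, ‖((r ^ (2 * ν + 1 + κ) : ℝ) : ℂ) * G r‖ < e := by
    have := (Metric.tendsto_nhds.1 hG) e he0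
    simpa using this
  rw [Params.essAtTop, Filter.eventually_inf] at hGe
  obtain ⟨s, hs, t, ht, hst⟩ := hGe
  obtain ⟨R, hR⟩ := mem_atTop_sets.1 hs
  filter_upwards [eventually_ge_atTop ⌈R⌉₊, eventually_gt_atTop ⌈c + 1⌉₊] with N hNR hNc
  replace hNR : R ≤ N := Nat.ceil_le.1 hNR
  replace hNc : c + 1 < N := Nat.lt_of_ceil_lt hNc
  have hN' : (0 : ℝ) < N := by linarith
  have hle : volume.restrict (Icc (N : ℝ) (2 * N)) ≤ radMeasure c :=
    Measure.restrict_mono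
      (fun r (hr : r ∈ Icc (N : ℝ) (2 * N)) => (by linarith : c < N).trans_le hr.1) le_rfl
  filter_upwards [ae_mono hle hA, ae_restrict_of_ae hKb', ae_restrict_mem measurableSet_Icc,
    ae_restrict_of_ae ht] with r h1 h2 hr hrt
  have hr0 : 0 < r := hN'.trans_le hr.1
  have h3 : ‖((r ^ (2 * ν + 1 + κ) : ℝ) : ℂ) * G r‖ < e :=
    hst r ⟨hR r (hNR.trans hr.1), hrt⟩
  rw [norm_mul, norm_real, Real.norm_of_nonneg (by positivity)] at h3
  have h4 : r ^ κ * ‖U r‖ ≤ √K₁ := by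
    refine Real.le_sqrt_of_sq_le ?_
    refine le_trans (le_of_eq ?_) (h2 (lt_of_lt_of_le hNc hr.1))
    rw [mul_pow, ← Real.rpow_natCast (r ^ κ), ← Real.rpow_mul hr0.le]
    congr 2; push_cast; ring
  have e4 : r ^ (2 * ν + 1 + κ) * r ^ κ = r ^ 4 := by
    rw [← Real.rpow_add hr0, ← Real.rpow_natCast r 4]; congr 1; rw [hκ]; push_cast; ring
  have h5 : r ^ 4 * ‖G r‖ * ‖U r‖ ≤ e * √K₁ := by
    calc r ^ 4 * ‖G r‖ * ‖U r‖ = (r ^ (2 * ν + 1 + κ) * ‖G r‖) * (r ^ κ * ‖U r‖) := by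
          rw [← e4]; ring
      _ ≤ e * √K₁ := mul_le_mul h3.le h4 (by positivity) he0.le
  have h6 : r * ‖U r‖ * ‖U r‖ ≤ 2 * N * ‖U r‖ ^ 2 := by
    have : r * ‖U r‖ ^ 2 ≤ 2 * N * ‖U r‖ ^ 2 := mul_le_mul_of_nonneg_right hr.2 (by positivity)
    linarith
  calc ‖A r‖ * ‖U r‖ ≤ C * (r ^ 4 * ‖G r‖ + r * ‖U r‖) * ‖U r‖ :=
        mul_le_mul_of_nonneg_right h1 (norm_nonneg _)
    _ = C * (r ^ 4 * ‖G r‖ * ‖U r‖ + r * ‖U r‖ * ‖U r‖) := by ring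
    _ ≤ C * (e * √K₁ + 2 * N * ‖U r‖ ^ 2) := mul_le_mul_of_nonneg_left (add_le_add h5 h6) hC
    _ ≤ _ := by linarith

end

/-! ### Algebra of the metric -/

lemma gInv_bilin (a M : ℝ) (f : ℝ → ℝ) (r θ : ℝ) (α β : Fin 4 → ℂ) :
    ∑ i, ∑ j, ((gInv a M f r θ i j : ℝ) : ℂ) * α i * β j =
      ((rhoSq a r θ)⁻¹ : ℝ) * (-((deltaR a M r : ℝ) * (f r * α 0 + α 1) * (f r * β 0 + β 1))
        - (deltaTheta a θ : ℝ) * α 2 * β 2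
        - ((1 - a ^ 2 : ℝ) : ℂ) * ((f r * α 0 + α 1) * ((r ^ 2 + a ^ 2 : ℝ) * β 0 + a * β 3) +
          ((r ^ 2 + a ^ 2 : ℝ) * α 0 + a * α 3) * (f r * β 0 + β 1))
        - (((1 - a ^ 2) ^ 2 / (deltaTheta a θ * Real.sin θ ^ 2) : ℝ) : ℂ) *
          (((a * Real.sin θ ^ 2 : ℝ) : ℂ) * α 0 + α 3) *
          (((a * Real.sin θ ^ 2 : ℝ) : ℂ) * β 0 + β 3)) := by
  simp only [gInv, Fin.sum_univ_four, Matrix.smul_apply, Matrix.sub_apply, Matrix.neg_apply,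
    Matrix.add_apply, Matrix.vecMulVec_apply, smul_eq_mul, Matrix.cons_val_zero,
    Matrix.cons_val_one, Matrix.cons_val]
  push_cast
  ring

lemma gInv_symm (a M : ℝ) (f : ℝ → ℝ) (r θ : ℝ) (i j : Fin 4) :
    gInv a M f r θ i j = gInv a M f r θ j i := by
  simp only [gInv, Matrix.smul_apply, Matrix.sub_apply, Matrix.neg_apply,
    Matrix.add_apply, Matrix.vecMulVec_apply, smul_eq_mul]
  ring

lemma det_gInv (a M : ℝ) (f : ℝ → ℝ) (r θ : ℝ) (hs : Real.sin θ ≠ 0) (hΔ : deltaTheta a θ ≠ 0)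
    (hr : rhoSq a r θ ≠ 0) :
    (gInv a M f r θ).det =
      -((1 - a ^ 2) ^ 4 / (Real.sin θ ^ 2 * rhoSq a r θ ^ 2)) := by
  have hc : Real.cos θ ^ 2 = 1 - Real.sin θ ^ 2 := by
    rw [← Real.sin_sq_add_cos_sq θ]; ring
  have hrho : rhoSq a r θ = r ^ 2 + a ^ 2 - a ^ 2 * Real.sin θ ^ 2 := by
    rw [rhoSq, hc]; ring
  have e : gInv a M f r θ = (rhoSq a r θ)⁻¹ •
    !![-(deltaR a M r * f r ^ 2) - 2 * (1 - a ^ 2) * f r * (r ^ 2 + a ^ 2) -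
        (1 - a ^ 2) ^ 2 / (deltaTheta a θ * Real.sin θ ^ 2) * a ^ 2 * Real.sin θ ^ 4,
      -(deltaR a M r * f r) - (1 - a ^ 2) * (r ^ 2 + a ^ 2), 0,
      -((1 - a ^ 2) * f r * a) - (1 - a ^ 2) ^ 2 / (deltaTheta a θ * Real.sin θ ^ 2) * a *
        Real.sin θ ^ 2;
      -(deltaR a M r * f r) - (1 - a ^ 2) * (r ^ 2 + a ^ 2), -deltaR a M r, 0, -((1 - a ^ 2) * a);
      0, 0, -deltaTheta a θ, 0;
      -((1 - a ^ 2) * f r * a) - (1 - a ^ 2) ^ 2 / (deltaTheta a θ * Real.sin θ ^ 2) * a *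
        Real.sin θ ^ 2, -((1 - a ^ 2) * a), 0,
        -((1 - a ^ 2) ^ 2 / (deltaTheta a θ * Real.sin θ ^ 2))] := by
    rw [gInv]
    congr 1
    ext i j
    fin_cases i <;> fin_cases j <;>
      simp [Matrix.vecMulVec_apply] <;> ring
  rw [e, Matrix.det_smul, Fintype.card_fin]
  have hdet : ∀ A B C D E F G : ℝ, Matrix.det !![A, B, 0, C; B, D, 0, E; 0, 0, F, 0; C, E, 0, G] =
      F * (A * (D * G - E ^ 2) - B * (B * G - E * C) + C * (B * E - D * C)) := by
    intro A B C D E F G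
    simp [Matrix.det_succ_row_zero, Fin.sum_univ_succ, Fin.succAbove]
    ring
  rw [hdet]
  rw [hrho] at hr ⊢
  set Δ := deltaTheta a θ
  set s := Real.sin θ
  field_simp
  ring

section Schur

variable {G : Matrix (Fin 4) (Fin 4) ℝ}

/-- The Schur complement formula for the inverse of a spatial block. -/
lemma inv_spatial_block (hG : IsUnit G.det) (h0 : G 0 0 ≠ 0) :
    (-(G⁻¹.submatrix Fin.succ Fin.succ))⁻¹ =
      Matrix.of fun i j : Fin 3 => -G i.succ j.succ + G i.succ 0 * G 0 j.succ / G 0 0 := by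
  refine Matrix.inv_eq_left_inv ?_
  have hmul : G * G⁻¹ = 1 := Matrix.mul_nonsing_inv G hG
  ext i j
  have h1 : ∑ k, G i.succ k * G⁻¹ k j.succ = (1 : Matrix (Fin 4) (Fin 4) ℝ) i.succ j.succ := by
    rw [← hmul, Matrix.mul_apply]
  have h2 : ∑ k, G 0 k * G⁻¹ k j.succ = (1 : Matrix (Fin 4) (Fin 4) ℝ) 0 j.succ := by
    rw [← hmul, Matrix.mul_apply]
  rw [Fin.sum_univ_succ] at h1 h2
  have e0 : (1 : Matrix (Fin 4) (Fin 4) ℝ) 0 j.succ = 0 := by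
    rw [Matrix.one_apply_ne (Fin.succ_ne_zero j).symm]
  have e1 : (1 : Matrix (Fin 4) (Fin 4) ℝ) i.succ j.succ = (1 : Matrix (Fin 3) (Fin 3) ℝ) i j := by
    simp [Matrix.one_apply]
  rw [e0] at h2
  rw [e1] at h1
  rw [Matrix.mul_apply, ← h1]
  simp only [Matrix.of_apply, Matrix.neg_apply, Matrix.submatrix_apply]
  have e2 : ∑ k : Fin 3, (-G i.succ k.succ + G i.succ 0 * G 0 k.succ / G 0 0) * -G⁻¹ k.succ j.succ =
      (∑ k : Fin 3, G i.succ k.succ * G⁻¹ k.succ j.succ) -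
        G i.succ 0 / G 0 0 * ∑ k : Fin 3, G 0 k.succ * G⁻¹ k.succ j.succ := by
    rw [Finset.mul_sum, ← Finset.sum_sub_distrib]
    refine Finset.sum_congr rfl fun k _ => ?_
    ring
  rw [e2, eq_neg_of_add_eq_zero_right h2]
  field_simp
  ring

lemma det_spatial_block (hG : IsUnit G.det) :
    (-(G⁻¹.submatrix Fin.succ Fin.succ)).det = -(G 0 0 / G.det) := by
  have hinv : IsUnit G⁻¹.det := by
    rw [Matrix.det_nonsing_inv]; exact hG.ringInverse
  have h1 : G 0 0 = Ring.inverse (G⁻¹.det) * (G⁻¹.submatrix Fin.succ Fin.succ).det := by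
    have h2 : G = (G⁻¹)⁻¹ := (Matrix.nonsing_inv_nonsing_inv G hG).symm
    conv_lhs => rw [h2, Matrix.inv_def]
    rw [Matrix.smul_apply, Matrix.adjugate_fin_succ_eq_det_submatrix]
    simp
  have h3 : G⁻¹.det = (G.det)⁻¹ := by rw [Matrix.det_nonsing_inv, Ring.inverse_eq_inv']
  rw [h3, Ring.inverse_eq_inv', inv_inv] at h1
  rw [Matrix.det_neg, Fintype.card_fin, h1]
  have := hG.ne_zero
  field_simp

end Schur

/-! ### Radial bounds -/

lemma exists_bound_of_eventually {c : ℝ} {g : ℝ → ℝ} (hg : ContinuousOn g (Ici c))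
    (h : ∃ C, ∀ᶠ r in atTop, |g r| ≤ C) : ∃ C, 0 < C ∧ ∀ r, c ≤ r → |g r| ≤ C := by
  obtain ⟨C, hC⟩ := h
  obtain ⟨R, hR⟩ := eventually_atTop.1 hC
  obtain ⟨C', hC'⟩ := isCompact_Icc.exists_bound_of_continuousOn
    (hg.mono (Icc_subset_Ici_self : Icc c R ⊆ _))
  refine ⟨max C C' ⊔ 1, lt_of_lt_of_le one_pos le_sup_right, fun r hr => ?_⟩
  by_cases h : r ≤ R
  · exact (hC' r ⟨hr, h⟩).trans ((le_max_right _ _).trans le_sup_left)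
  · exact (hR r (not_le.1 h).le).trans ((le_max_left _ _).trans le_sup_left)

lemma exists_linear_bound {e : ℝ → ℝ} (he : ContDiff ℝ ∞ e) (h0 : e 0 = 0) :
    ∃ C, ∀ t ∈ Icc (0 : ℝ) 1, |e t| ≤ C * t ∧ |deriv e t| ≤ C := by
  have hc : Continuous (deriv e) := he.continuous_deriv (by simp)
  obtain ⟨C, hC⟩ := isCompact_Icc.exists_bound_of_continuousOn (s := Icc (0 : ℝ) 1) hc.continuousOn
  refine ⟨C, fun t ht => ⟨?_, hC t ht⟩⟩
  have := (convex_Icc (0 : ℝ) 1).norm_image_sub_le_of_norm_deriv_le (f := e)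
    (fun x _ => he.differentiable (by simp) x) hC (left_mem_Icc.2 zero_le_one) ht
  rw [h0, sub_zero, sub_zero, Real.norm_eq_abs, Real.norm_eq_abs, abs_of_nonneg ht.1] at this
  exact this

namespace Params

variable (p : Params)

/-- `1 - a²`. -/
def m : ℝ := 1 - p.a ^ 2

/-- `Δ_r`. -/
def D (r : ℝ) : ℝ := deltaR p.a p.M r

/-- `Δ_r f + (1 - a²)(r² + a²)`. -/
def E (r : ℝ) : ℝ := p.D r * p.f r + p.m * (r ^ 2 + p.a ^ 2)

lemma sq_a_lt_one : p.a ^ 2 < 1 := (sq_lt_one_iff_abs_lt_one _).2 p.abs_a_lt_one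

lemma m_pos : 0 < p.m := sub_pos.2 p.sq_a_lt_one

lemma m_le_one : p.m ≤ 1 := by rw [m]; nlinarith [sq_nonneg p.a]

lemma continuous_D : Continuous p.D := by
  unfold D deltaR; fun_prop

lemma contDiff_D : ContDiff ℝ ∞ p.D := by
  unfold D deltaR; fun_prop

lemma hasDerivAt_D (r : ℝ) :
    HasDerivAt p.D (2 * r * (1 + r ^ 2) + (r ^ 2 + p.a ^ 2) * (2 * r) - 2 * p.M) r := by
  have h1 : HasDerivAt (fun r : ℝ => r ^ 2) (2 * r) r := by simpa using hasDerivAt_pow 2 r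
  have h := ((h1.add_const (p.a ^ 2)).mul (h1.const_add 1)).sub ((hasDerivAt_id r).const_mul (2 * p.M))
  simp only [mul_one] at h
  exact h

/-- The quotient `Δ_r / (r - r_+)`. -/
lemma D_eq (r : ℝ) : p.D r = (r - p.rp) * (r ^ 3 + p.rp * r ^ 2 + (p.rp ^ 2 + 1 + p.a ^ 2) * r +
    (p.rp ^ 3 + (1 + p.a ^ 2) * p.rp - 2 * p.M)) := by
  have h := p.rp_root
  simp only [D, deltaR] at h ⊢
  linear_combination h

lemma simple_root : 0 < 4 * p.rp ^ 3 + 2 * (1 + p.a ^ 2) * p.rp - 2 * p.M := by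
  have h := p.rp_simple
  rw [show deltaR p.a p.M = p.D from rfl, (p.hasDerivAt_D p.rp).deriv] at h
  linarith

lemma sq_le_D {r : ℝ} (hr : p.rp ≤ r) : (r ^ 2 - p.rp ^ 2) ^ 2 ≤ p.D r := by
  rw [p.D_eq]
  have h := p.simple_root
  have h0 := p.rp_pos
  have : (r ^ 2 - p.rp ^ 2) ^ 2 = (r - p.rp) * ((r - p.rp) * (r + p.rp) ^ 2) := by ring
  rw [this]
  refine mul_le_mul_of_nonneg_left ?_ (by linarith)
  nlinarith [mul_nonneg (by positivity : 0 ≤ 2 * p.rp ^ 2 + 1 + p.a ^ 2) (sub_nonneg.2 hr)]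

lemma D_pos {r : ℝ} (hr : p.rp < r) : 0 < p.D r := by
  refine lt_of_lt_of_le ?_ (p.sq_le_D hr.le)
  have h0 := p.rp_pos
  have : 0 < r ^ 2 - p.rp ^ 2 := by nlinarith
  positivity

lemma D_nonneg {r : ℝ} (hr : p.rp ≤ r) : 0 ≤ p.D r := (sq_nonneg _).trans (p.sq_le_D hr)

lemma exists_D_le : ∃ C, 0 < C ∧ ∀ r, p.rp ≤ r → p.D r ≤ C * (r ^ 3 * (r - p.rp)) := by
  have h0 := p.rp_pos
  set b := (1 + p.a ^ 2) / p.rp ^ 2 with hb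
  have hb0 : 0 < b := by positivity
  have hb1 : 1 + p.a ^ 2 = b * p.rp ^ 2 := by rw [hb]; field_simp
  refine ⟨4 + 2 * b, by positivity, fun r hr => ?_⟩
  rw [p.D_eq]
  have hr0 : 0 < r := h0.trans_le hr
  have h1 : p.rp ^ 2 ≤ r ^ 2 := pow_le_pow_left₀ h0.le hr 2
  have h2 : p.rp ^ 3 ≤ r ^ 3 := pow_le_pow_left₀ h0.le hr 3
  have h3 : p.rp * r ^ 2 ≤ r ^ 3 := by nlinarith [mul_nonneg (sub_nonneg.2 hr) (sq_nonneg r)]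
  have h4 : p.rp ^ 2 * r ≤ r ^ 3 := by nlinarith
  have h5 : (1 + p.a ^ 2) * r ≤ b * r ^ 3 := by
    rw [hb1, mul_assoc]; exact mul_le_mul_of_nonneg_left h4 hb0.le
  have h6 : (1 + p.a ^ 2) * p.rp ≤ b * r ^ 3 := by
    rw [hb1, mul_assoc]; refine mul_le_mul_of_nonneg_left ?_ hb0.le
    calc p.rp ^ 2 * p.rp = p.rp ^ 3 := by ring
      _ ≤ _ := h2
  have h7 := p.M_pos
  calc _ ≤ (r - p.rp) * ((4 + 2 * b) * r ^ 3) := by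
        refine mul_le_mul_of_nonneg_left ?_ (by linarith)
        nlinarith
    _ = _ := by ring

lemma exists_D_le_pow : ∃ C, 0 < C ∧ ∀ r, p.rp ≤ r → p.D r ≤ C * r ^ 4 := by
  obtain ⟨C, hC, h⟩ := p.exists_D_le
  refine ⟨C, hC, fun r hr => (h r hr).trans (mul_le_mul_of_nonneg_left ?_ hC.le)⟩
  have h0 := p.rp_pos
  have hr0 : 0 < r := h0.trans_le hr
  calc r ^ 3 * (r - p.rp) ≤ r ^ 3 * r := mul_le_mul_of_nonneg_left (by linarith) (by positivity)
    _ = r ^ 4 := by ring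

lemma exists_contDiffOn_f : ∃ b, 0 < b ∧ b < p.rp ∧ ContDiffOn ℝ ∞ p.f (Ioi b) := by
  obtain ⟨δ, hδ, h⟩ := p.f_smooth
  have h0 := p.rp_pos
  refine ⟨max (p.rp - δ) (p.rp / 2), lt_of_lt_of_le (by linarith) (le_max_right _ _),
    max_lt (by linarith) (by linarith), h.mono (Ioi_subset_Ioi (le_max_left _ _))⟩

lemma contDiffAt_f {r : ℝ} (hr : p.rp ≤ r) : ContDiffAt ℝ ∞ p.f r := by
  obtain ⟨b, _, hb, h⟩ := p.exists_contDiffOn_f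
  exact h.contDiffAt (Ioi_mem_nhds (hb.trans_le hr))

lemma continuousOn_f : ContinuousOn p.f (Ici p.rp) := fun _ hr =>
  (p.contDiffAt_f hr).continuousAt.continuousWithinAt

lemma contDiffAt_E {r : ℝ} (hr : p.rp ≤ r) : ContDiffAt ℝ ∞ p.E r :=
  (p.contDiff_D.contDiffAt.mul (p.contDiffAt_f hr)).add (by fun_prop)

lemma continuousOn_E : ContinuousOn p.E (Ici p.rp) := fun _ hr =>
  (p.contDiffAt_E hr).continuousAt.continuousWithinAt

lemma continuousOn_deriv_E : ContinuousOn (deriv p.E) (Ici p.rp) := by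
  intro r hr
  have h1 : ContDiffAt ℝ ∞ (fderiv ℝ p.E) r :=
    (p.contDiffAt_E hr).fderiv_right (m := ∞) (by simp)
  have h2 : deriv p.E = fun x => fderiv ℝ p.E x 1 := by ext x; rw [fderiv_apply_one_eq_deriv]
  rw [h2]
  exact (h1.continuousAt.clm_apply continuousAt_const).continuousWithinAt

/-- The coefficient of `r⁴` in `Δ_r`, as a function of `1/r`. -/
def dPoly (t : ℝ) : ℝ := (1 + p.a ^ 2 * t ^ 2) * (t ^ 2 + 1) - 2 * p.M * t ^ 3

lemma D_eq_dPoly {r : ℝ} (hr : r ≠ 0) : p.D r = r ^ 4 * p.dPoly r⁻¹ := by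
  simp only [D, deltaR, dPoly]; field_simp

lemma contDiff_dPoly : ContDiff ℝ ∞ p.dPoly := by unfold dPoly; fun_prop

lemma exists_f_le : ∃ C, 0 < C ∧ ∀ r, p.rp ≤ r → |p.f r| * r ^ 2 ≤ C := by
  obtain ⟨G, hG, _, h⟩ := p.f_conformal
  obtain ⟨C, hC⟩ := isCompact_Icc.exists_bound_of_continuousOn (s := Icc (0 : ℝ) 1)
    hG.continuous.continuousOn
  obtain ⟨C', hC', h'⟩ := exists_bound_of_eventually (g := fun r => p.f r * r ^ 2)
    (p.continuousOn_f.mul (by fun_prop)) ⟨C, by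
      filter_upwards [h, eventually_ge_atTop 1] with r hr hr1
      have hr0 : r ≠ 0 := by linarith
      have e : p.f r * r ^ 2 = G r⁻¹ := by rw [hr]; field_simp
      rw [e]
      exact hC _ ⟨by positivity, inv_le_one_of_one_le₀ hr1⟩⟩
  refine ⟨C', hC', fun r hr => ?_⟩
  have := h' r hr
  rwa [abs_mul, abs_of_nonneg (sq_nonneg r)] at this

lemma exists_E_le : ∃ C, 0 < C ∧ ∀ r, p.rp ≤ r → |p.E r| ≤ C * r ∧ |deriv p.E r| ≤ C := by
  obtain ⟨G, hG, hG0, h⟩ := p.f_conformal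
  set e : ℝ → ℝ := fun t => p.dPoly t * G t + p.m * (1 + p.a ^ 2 * t ^ 2) with he
  have hes : ContDiff ℝ ∞ e := (p.contDiff_dPoly.mul hG).add (by fun_prop)
  have he0 : e 0 = 0 := by simp only [he, dPoly, m, hG0]; ring
  obtain ⟨C, hC⟩ := exists_linear_bound hes he0
  have h0 := p.rp_pos
  have hev : ∀ᶠ r in atTop, p.E r = r ^ 2 * e r⁻¹ := by
    filter_upwards [h, eventually_gt_atTop 0] with r hr hr0
    rw [E, p.D_eq_dPoly hr0.ne', hr]
    simp only [he]; field_simp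
  have hev1 : ∃ C, ∀ᶠ r in atTop, |p.E r / r| ≤ C := by
    refine ⟨C, ?_⟩
    filter_upwards [hev, eventually_ge_atTop 1] with r hr hr1
    have hr0 : 0 < r := by linarith
    rw [hr, show r ^ 2 * e r⁻¹ / r = r * e r⁻¹ by field_simp, abs_mul, abs_of_pos hr0]
    have := (hC r⁻¹ ⟨by positivity, inv_le_one_of_one_le₀ hr1⟩).1
    calc r * |e r⁻¹| ≤ r * (C * r⁻¹) := mul_le_mul_of_nonneg_left this hr0.le
      _ = C := by field_simp
  have hev2 : ∃ C, ∀ᶠ r in atTop, |deriv p.E r| ≤ C := by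
    refine ⟨3 * C, ?_⟩
    obtain ⟨R, hR⟩ := eventually_atTop.1 hev
    filter_upwards [eventually_gt_atTop R, eventually_ge_atTop 1] with r hr hr1
    have hr0 : 0 < r := by linarith
    have h1 : p.E =ᶠ[𝓝 r] fun r => r ^ 2 * e r⁻¹ := by
      filter_upwards [Ioi_mem_nhds hr] with x hx
      exact hR x (le_of_lt hx)
    have h2 : HasDerivAt (fun r : ℝ => r ^ 2 * e r⁻¹)
        (2 * r * e r⁻¹ + r ^ 2 * (deriv e r⁻¹ * -(r ^ 2)⁻¹)) r := by
      have d1 : HasDerivAt (fun r : ℝ => r ^ 2) (2 * r) r := by simpa using hasDerivAt_pow 2 r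
      exact d1.mul ((hes.differentiable (by simp) r⁻¹).hasDerivAt.comp r (hasDerivAt_inv hr0.ne'))
    rw [h1.deriv_eq, h2.deriv]
    have h3 := hC r⁻¹ ⟨by positivity, inv_le_one_of_one_le₀ hr1⟩
    have e1 : 2 * r * e r⁻¹ + r ^ 2 * (deriv e r⁻¹ * -(r ^ 2)⁻¹) =
        2 * (r * e r⁻¹) - deriv e r⁻¹ := by field_simp; ring
    rw [e1]
    have h4 : |r * e r⁻¹| ≤ C := by
      rw [abs_mul, abs_of_pos hr0]
      calc r * |e r⁻¹| ≤ r * (C * r⁻¹) := mul_le_mul_of_nonneg_left h3.1 hr0.le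
        _ = C := by field_simp
    calc |2 * (r * e r⁻¹) - deriv e r⁻¹| ≤ |2 * (r * e r⁻¹)| + |deriv e r⁻¹| := abs_sub _ _
      _ = 2 * |r * e r⁻¹| + |deriv e r⁻¹| := by rw [abs_mul, abs_two]
      _ ≤ 3 * C := by linarith [h3.2]
  obtain ⟨C₁, hC₁, h₁⟩ := exists_bound_of_eventually (c := p.rp) (g := fun r => p.E r / r)
    (p.continuousOn_E.div continuousOn_id fun r hr => (h0.trans_le hr).ne') hev1
  obtain ⟨C₂, hC₂, h₂⟩ := exists_bound_of_eventually (c := p.rp) p.continuousOn_deriv_E hev2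
  refine ⟨max C₁ C₂, lt_max_of_lt_left hC₁, fun r hr => ⟨?_, (h₂ r hr).trans (le_max_right _ _)⟩⟩
  have hr0 : 0 < r := h0.trans_le hr
  have := h₁ r hr
  rw [abs_div, abs_of_pos hr0, div_le_iff₀ hr0] at this
  exact this.trans (mul_le_mul_of_nonneg_right (le_max_left _ _) hr0.le)

/-- `ϱ² g⁻¹(dt⋆, dt⋆)` as a function of `r` and of `q = sin² θ / Δ_θ`. -/
def tauQ (r q : ℝ) : ℝ :=
  -(p.D r * p.f r ^ 2) - 2 * p.m * (r ^ 2 + p.a ^ 2) * p.f r - p.m ^ 2 * p.a ^ 2 * q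

lemma gInv_zero_zero (r θ : ℝ) :
    gInv p.a p.M p.f r θ 0 0 =
      (rhoSq p.a r θ)⁻¹ * p.tauQ r (Real.sin θ ^ 2 / deltaTheta p.a θ) := by
  simp only [gInv, Matrix.smul_apply, Matrix.sub_apply, Matrix.neg_apply,
    Matrix.add_apply, Matrix.vecMulVec_apply, smul_eq_mul, Matrix.cons_val_zero, tauQ, m, D]
  by_cases hΔ : deltaTheta p.a θ = 0
  · simp [hΔ]; left; ring
  · field_simp; ring

lemma exists_tau_bounds : ∃ c C, 0 < c ∧ 0 < C ∧ ∀ r, p.rp ≤ r → ∀ q, 0 ≤ q → q ≤ 1 →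
    c ≤ p.tauQ r q ∧ p.tauQ r q ≤ C := by
  obtain ⟨G, hG, hG0, h⟩ := p.f_conformal
  have hcont : ∀ q, ContinuousOn (fun r => p.tauQ r q) (Ici p.rp) := by
    intro q
    have := p.continuousOn_f
    have hD := p.continuous_D
    unfold tauQ
    fun_prop
  have hlim : ∀ q, Tendsto (fun r => p.tauQ r q) atTop (𝓝 (p.m ^ 2 * (1 - p.a ^ 2 * q))) := by
    intro q
    set τ : ℝ → ℝ := fun t => -(p.dPoly t * G t ^ 2) - 2 * p.m * (1 + p.a ^ 2 * t ^ 2) * G t -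
      p.m ^ 2 * p.a ^ 2 * q with hτ
    have hτc : Continuous τ := by
      have h1 := p.contDiff_dPoly.continuous
      have h2 := hG.continuous
      fun_prop
    have e0 : τ 0 = p.m ^ 2 * (1 - p.a ^ 2 * q) := by
      simp only [hτ, dPoly, hG0, m]; ring
    rw [← e0]
    refine ((hτc.tendsto 0).comp tendsto_inv_atTop_zero).congr' ?_
    filter_upwards [h, eventually_gt_atTop 0] with r hr hr0
    rw [tauQ, p.D_eq_dPoly hr0.ne', hr]
    simp only [hτ, Function.comp]; field_simp
  have hpos : ∀ r, p.rp ≤ r → 0 < p.tauQ r 1 := by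
    intro r hr
    have h1 := p.f_spacelike r hr (Real.pi / 2) ⟨by linarith [Real.pi_pos], by linarith [Real.pi_pos]⟩
    rw [p.gInv_zero_zero] at h1
    have h2 : Real.sin (Real.pi / 2) ^ 2 / deltaTheta p.a (Real.pi / 2) = 1 := by
      simp [deltaTheta]
    have h3 : 0 < (rhoSq p.a r (Real.pi / 2))⁻¹ := by
      have := p.rp_pos.trans_le hr
      simp only [rhoSq]; positivity
    rw [h2] at h1
    exact pos_of_mul_pos_right h1 h3.le
  have hinv : ∃ C, 0 < C ∧ ∀ r, p.rp ≤ r → |(p.tauQ r 1)⁻¹| ≤ C := by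
    refine exists_bound_of_eventually ((hcont 1).inv₀ fun r hr => (hpos r hr).ne') ?_
    have hm : p.m ^ 2 * (1 - p.a ^ 2 * 1) ≠ 0 := by
      have := p.m_pos
      rw [mul_one, show 1 - p.a ^ 2 = p.m from rfl]; positivity
    have h1 := ((hlim 1).inv₀ hm).abs
    exact ⟨_, h1.eventually (ge_mem_nhds (lt_add_one _))⟩
  obtain ⟨C, hC, hC'⟩ := hinv
  obtain ⟨C₂, hC₂, h₂⟩ := exists_bound_of_eventually (hcont 0)
    ⟨_, (hlim 0).abs.eventually (ge_mem_nhds (lt_add_one _))⟩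
  refine ⟨C⁻¹, C₂, by positivity, hC₂, fun r hr q hq hq1 => ⟨?_, ?_⟩⟩
  · have h1 := hC' r hr
    rw [abs_of_pos (inv_pos.2 (hpos r hr))] at h1
    have h2 : C⁻¹ ≤ p.tauQ r 1 := inv_le_of_inv_le₀ (hpos r hr) h1
    refine h2.trans ?_
    simp only [tauQ]
    nlinarith [mul_nonneg (mul_nonneg (sq_nonneg p.m) (sq_nonneg p.a)) (sub_nonneg.2 hq1)]
  · refine le_trans ?_ ((le_abs_self _).trans (h₂ r hr))
    simp only [tauQ]
    nlinarith [mul_nonneg (mul_nonneg (sq_nonneg p.m) (sq_nonneg p.a)) hq]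

end Params

/-! ### The metric at the points of the slice -/

lemma norm_sq_E3 (x : E3) : ‖x‖ ^ 2 = x 0 ^ 2 + x 1 ^ 2 + x 2 ^ 2 := by
  rw [EuclideanSpace.norm_sq_eq, Fin.sum_univ_three]
  simp only [Real.norm_eq_abs, sq_abs]

lemma cylRadius_sq (x : E3) : cylRadius x ^ 2 = x 0 ^ 2 + x 1 ^ 2 :=
  Real.sq_sqrt (by positivity)

lemma cylRadius_nonneg (x : E3) : 0 ≤ cylRadius x := Real.sqrt_nonneg _

lemma cos_polar {x : E3} (hx : x ≠ 0) : Real.cos (polar x) = x 2 / ‖x‖ := by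
  have h0 : 0 < ‖x‖ := norm_pos_iff.2 hx
  have h1 : |x 2| ≤ ‖x‖ := by
    refine abs_le_of_sq_le_sq ?_ h0.le
    rw [norm_sq_E3]; nlinarith [sq_nonneg (x 0), sq_nonneg (x 1)]
  rw [abs_le] at h1
  exact Real.cos_arccos ((le_div_iff₀ h0).2 (by linarith)) ((div_le_one h0).2 h1.2)

lemma sin_polar {x : E3} (hx : x ≠ 0) : Real.sin (polar x) = cylRadius x / ‖x‖ := by
  have h0 : 0 < ‖x‖ := norm_pos_iff.2 hx
  have h1 := norm_sq_E3 x
  have h2 := cylRadius_sq x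
  have h3 : 1 - (x 2 / ‖x‖) ^ 2 = (cylRadius x / ‖x‖) ^ 2 := by field_simp; linarith
  rw [polar, Real.sin_arccos, h3, Real.sqrt_sq (div_nonneg (cylRadius_nonneg x) h0.le)]

/-- A lower bound for a positive definite Hermitian form in two variables. -/
lemma two_form_lower {A B C d t : ℝ} (hA : 0 ≤ A) (hC : 0 ≤ C) (hd : 0 < d)
    (hdet : d ≤ A * C - B ^ 2) (ht : A + C ≤ t) (X Y : ℂ) :
    d / (2 * t) * (‖X‖ ^ 2 + ‖Y‖ ^ 2) ≤
      A * ‖X‖ ^ 2 + 2 * B * (X * conj Y).re + C * ‖Y‖ ^ 2 := by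
  set Q := A * ‖X‖ ^ 2 + 2 * B * (X * conj Y).re + C * ‖Y‖ ^ 2 with hQ
  have hAC : 0 < A * C := by nlinarith [sq_nonneg B]
  have hA' : 0 < A := lt_of_le_of_ne hA fun h => by rw [← h] at hAC; simp at hAC
  have hC' : 0 < C := lt_of_le_of_ne hC fun h => by rw [← h] at hAC; simp at hAC
  have nX : ‖X‖ ^ 2 = X.re ^ 2 + X.im ^ 2 := by
    rw [← normSq_eq_norm_sq, normSq_apply]; ring
  have nY : ‖Y‖ ^ 2 = Y.re ^ 2 + Y.im ^ 2 := by
    rw [← normSq_eq_norm_sq, normSq_apply]; ring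
  have hre : (X * conj Y).re = X.re * Y.re + X.im * Y.im := by
    simp [mul_re]
  have h1 : d * ‖Y‖ ^ 2 ≤ A * Q := by
    have : A * Q = (A * X.re + B * Y.re) ^ 2 + (A * X.im + B * Y.im) ^ 2 +
        (A * C - B ^ 2) * ‖Y‖ ^ 2 := by rw [hQ, nX, nY, hre]; ring
    have h2 := mul_le_mul_of_nonneg_right hdet (sq_nonneg ‖Y‖)
    nlinarith [sq_nonneg (A * X.re + B * Y.re), sq_nonneg (A * X.im + B * Y.im)]
  have h2 : d * ‖X‖ ^ 2 ≤ C * Q := by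
    have : C * Q = (C * Y.re + B * X.re) ^ 2 + (C * Y.im + B * X.im) ^ 2 +
        (A * C - B ^ 2) * ‖X‖ ^ 2 := by rw [hQ, nX, nY, hre]; ring
    have h2 := mul_le_mul_of_nonneg_right hdet (sq_nonneg ‖X‖)
    nlinarith [sq_nonneg (C * Y.re + B * X.re), sq_nonneg (C * Y.im + B * X.im)]
  have hQ0 : 0 ≤ Q := by
    have : 0 ≤ A * Q := le_trans (by positivity) h1
    exact nonneg_of_mul_nonneg_right this hA'
  have ht0 : 0 < t := by linarith
  rw [div_mul_eq_mul_div, div_le_iff₀ (by positivity)]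
  nlinarith [mul_le_mul_of_nonneg_right ht hQ0]

namespace Params

variable (p : Params)

/-- `sin² θ / Δ_θ`. -/
def qq (θ : ℝ) : ℝ := Real.sin θ ^ 2 / deltaTheta p.a θ

/-- `ϱ² g⁻¹(dt⋆, dt⋆)`. -/
def tau (r θ : ℝ) : ℝ := p.tauQ r (p.qq θ)

lemma m_le_deltaTheta (θ : ℝ) : p.m ≤ deltaTheta p.a θ := by
  rw [m, deltaTheta]
  nlinarith [Real.cos_sq_le_one θ, sq_nonneg p.a]

lemma deltaTheta_pos (θ : ℝ) : 0 < deltaTheta p.a θ := p.m_pos.trans_le (p.m_le_deltaTheta θ)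

lemma deltaTheta_le_one (θ : ℝ) : deltaTheta p.a θ ≤ 1 := by
  rw [deltaTheta]; nlinarith [mul_nonneg (sq_nonneg p.a) (sq_nonneg (Real.cos θ))]

lemma qq_mem (θ : ℝ) : 0 ≤ p.qq θ ∧ p.qq θ ≤ 1 := by
  refine ⟨div_nonneg (sq_nonneg _) (p.deltaTheta_pos θ).le, (div_le_one (p.deltaTheta_pos θ)).2 ?_⟩
  rw [deltaTheta]
  have := Real.sin_sq_add_cos_sq θ
  nlinarith [p.sq_a_lt_one, sq_nonneg (Real.cos θ), sq_nonneg p.a]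

lemma rhoSq_bounds (r θ : ℝ) : r ^ 2 ≤ rhoSq p.a r θ ∧ rhoSq p.a r θ ≤ r ^ 2 + p.a ^ 2 := by
  rw [rhoSq]
  constructor <;> nlinarith [Real.cos_sq_le_one θ, sq_nonneg p.a, mul_nonneg (sq_nonneg p.a)
    (sq_nonneg (Real.cos θ)), mul_nonneg (sq_nonneg p.a) (sub_nonneg.2 (Real.cos_sq_le_one θ))]

lemma tau_pos {r : ℝ} (hr : p.rp ≤ r) (θ : ℝ) : 0 < p.tau r θ := by
  obtain ⟨c, C, hc, _, h⟩ := p.exists_tau_bounds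
  exact hc.trans_le (h r hr _ (p.qq_mem θ).1 (p.qq_mem θ).2).1

lemma rhoSq_pos {r : ℝ} (hr : p.rp ≤ r) (θ : ℝ) : 0 < rhoSq p.a r θ :=
  lt_of_lt_of_le (by have := p.rp_pos.trans_le hr; positivity) (p.rhoSq_bounds r θ).1

lemma isUnit_det_gInv {r θ : ℝ} (hr : p.rp ≤ r) (hs : Real.sin θ ≠ 0) :
    IsUnit (gInv p.a p.M p.f r θ).det := by
  rw [isUnit_iff_ne_zero, det_gInv _ _ _ _ _ hs (p.deltaTheta_pos θ).ne' (p.rhoSq_pos hr θ).ne']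
  have h1 := p.rhoSq_pos hr θ
  have h2 : 0 < (1 - p.a ^ 2) := p.m_pos
  exact neg_ne_zero.2 (by positivity)

/-- The `φ`-component of the shift. -/
def shiftPhi (r θ : ℝ) : ℝ := p.m * p.f r * p.a + p.m ^ 2 * p.a / deltaTheta p.a θ

lemma hMat_inv_form {r θ : ℝ} (hr : p.rp ≤ r) (hs : Real.sin θ ≠ 0) (ξ : Fin 3 → ℂ) :
    (∑ i, ∑ j, (((hMat p.a p.M p.f r θ)⁻¹ i j : ℝ) : ℂ) * ξ i * conj (ξ j)).re =
      (rhoSq p.a r θ)⁻¹ * (p.D r * ‖ξ 0‖ ^ 2 + deltaTheta p.a θ * ‖ξ 1‖ ^ 2 +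
        2 * (p.m * p.a) * (ξ 0 * conj (ξ 2)).re +
        p.m ^ 2 / (deltaTheta p.a θ * Real.sin θ ^ 2) * ‖ξ 2‖ ^ 2 +
        ‖(p.E r : ℂ) * ξ 0 + (p.shiftPhi r θ : ℂ) * ξ 2‖ ^ 2 / p.tau r θ) := by
  have hrho := p.rhoSq_pos hr θ
  have hτ := p.tau_pos hr θ
  have hΔ := p.deltaTheta_pos θ
  have h00 : gInv p.a p.M p.f r θ 0 0 = (rhoSq p.a r θ)⁻¹ * p.tau r θ := p.gInv_zero_zero r θ
  rw [hMat, gMat, inv_spatial_block (p.isUnit_det_gInv hr hs) (by rw [h00]; positivity), h00]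
  have n2 : ∀ w : ℂ, ‖w‖ ^ 2 = w.re ^ 2 + w.im ^ 2 := fun w => by
    rw [← normSq_eq_norm_sq, normSq_apply]; ring
  have e : ∀ i j : Fin 3, (Matrix.of fun i j : Fin 3 => -gInv p.a p.M p.f r θ i.succ j.succ +
      gInv p.a p.M p.f r θ i.succ 0 * gInv p.a p.M p.f r θ 0 j.succ /
        ((rhoSq p.a r θ)⁻¹ * p.tau r θ)) i j = (rhoSq p.a r θ)⁻¹ *
      (!![p.D r, 0, p.m * p.a; 0, deltaTheta p.a θ, 0; p.m * p.a, 0,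
        p.m ^ 2 / (deltaTheta p.a θ * Real.sin θ ^ 2)] i j +
        ![p.E r, 0, p.shiftPhi r θ] i * ![p.E r, 0, p.shiftPhi r θ] j / p.tau r θ) := by
    have v : ∀ i : Fin 3, gInv p.a p.M p.f r θ i.succ 0 =
        (rhoSq p.a r θ)⁻¹ * -![p.E r, 0, p.shiftPhi r θ] i := by
      intro i
      fin_cases i <;> simp [gInv, E, D, m, shiftPhi, hrho.ne']
      all_goals field_simp; ring
    have w : ∀ i j : Fin 3, gInv p.a p.M p.f r θ i.succ j.succ = (rhoSq p.a r θ)⁻¹ *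
        -!![p.D r, 0, p.m * p.a; 0, deltaTheta p.a θ, 0; p.m * p.a, 0,
        p.m ^ 2 / (deltaTheta p.a θ * Real.sin θ ^ 2)] i j := by
      intro i j
      fin_cases i <;> fin_cases j <;> simp [gInv, D, m]
    intro i j
    rw [Matrix.of_apply, gInv_symm _ _ _ _ _ 0 j.succ, v i, v j, w i j]
    field_simp
  simp only [e]
  simp only [Fin.sum_univ_three, Matrix.of_apply, Matrix.cons_val_zero, Matrix.cons_val_one,
    Matrix.cons_val, Matrix.cons_val', n2, add_re, add_im, mul_re,
    mul_im, conj_re, conj_im, ofReal_re, ofReal_im]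
  ring

set_option maxHeartbeats 1000000 in
lemma exists_form_lower : ∃ c, 0 < c ∧ ∀ r, p.rp ≤ r → ∀ θ, Real.sin θ ≠ 0 → ∀ ξ : Fin 3 → ℂ,
    c * (‖((r ^ 2 : ℝ) : ℂ) * ξ 0‖ ^ 2 + ‖ξ 1‖ ^ 2 + ‖((Real.sin θ)⁻¹ : ℝ) * ξ 2‖ ^ 2) ≤
      r ^ 2 * (∑ i, ∑ j, (((hMat p.a p.M p.f r θ)⁻¹ i j : ℝ) : ℂ) * ξ i *
        conj (ξ j)).re := by
  obtain ⟨τ₀, τ₁, hτ₀, hτ₁, hτ⟩ := p.exists_tau_bounds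
  obtain ⟨CD, hCD, hD⟩ := p.exists_D_le_pow
  obtain ⟨CE, hCE, hE⟩ := p.exists_E_le
  obtain ⟨Cf, hCf, hf⟩ := p.exists_f_le
  have h0 := p.rp_pos
  have hm := p.m_pos
  set S := Cf / p.rp ^ 2 + 1 with hS
  have hS0 : 0 < S := by positivity
  set t := (CD + CE ^ 2 / p.rp ^ 2 / τ₀) + (p.m + S ^ 2 / τ₀) with ht
  have ht0 : 0 < t := by positivity
  set d := p.m ^ 4 / τ₁ with hd
  have hd0 : 0 < d := by positivity
  set c₁ := p.rp ^ 2 / (p.rp ^ 2 + p.a ^ 2) with hc₁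
  have hc₁0 : 0 < c₁ := by positivity
  refine ⟨c₁ * min (d / (2 * t)) p.m, by positivity, fun r hr θ hs ξ => ?_⟩
  have hr0 : 0 < r := h0.trans_le hr
  have hrr : p.rp ^ 2 ≤ r ^ 2 := pow_le_pow_left₀ h0.le hr 2
  have hrho := p.rhoSq_pos hr θ
  have hΔ := p.deltaTheta_pos θ
  have hT := hτ r hr _ (p.qq_mem θ).1 (p.qq_mem θ).2
  rw [p.hMat_inv_form hr hs]
  set s := Real.sin θ with hs'
  have hs1 : s ^ 2 ≤ 1 := Real.sin_sq_le_one θ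
  set T := p.tau r θ with hTdef
  have hT0 : 0 < T := p.tau_pos hr θ
  have hT1 : τ₀ ≤ T := hT.1
  have hT2 : T ≤ τ₁ := hT.2
  set X : ℂ := ((r ^ 2 : ℝ) : ℂ) * ξ 0 with hX
  set Y : ℂ := ((s⁻¹ : ℝ) : ℂ) * ξ 2 with hY
  set g := p.shiftPhi r θ with hg
  set Δ := deltaTheta p.a θ with hΔ'
  have hgS : g ^ 2 ≤ S ^ 2 := by
    refine sq_le_sq' ?_ ?_ <;> [refine (abs_le.1 ?_).1; refine (abs_le.1 ?_).2] <;>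
    · have ha := p.abs_a_lt_one.le
      have h1 : |p.f r| ≤ Cf / p.rp ^ 2 := by
        rw [le_div_iff₀ (by positivity)]
        exact (mul_le_mul_of_nonneg_left hrr (abs_nonneg _)).trans (hf r hr)
      rw [hg, shiftPhi]
      refine (abs_add_le _ _).trans (add_le_add ?_ ?_)
      · rw [abs_mul, abs_mul, abs_of_pos hm]
        have h2 : p.m * |p.f r| * |p.a| ≤ 1 * |p.f r| * 1 := by
          gcongr; exact p.m_le_one
        linarith
      · rw [abs_div, abs_mul, abs_of_pos hΔ, abs_of_pos (by positivity : 0 < p.m ^ 2),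
          div_le_one hΔ]
        have h2 : p.m ^ 2 * |p.a| ≤ p.m * 1 * 1 := by
          rw [sq]; gcongr; exact p.m_le_one
        linarith [p.m_le_deltaTheta θ]
  have hA1 : p.D r / r ^ 4 ≤ CD := by
    rw [div_le_iff₀ (by positivity)]; exact hD r hr
  have hD0 := p.D_nonneg hr
  have hA2 : p.E r ^ 2 / (T * r ^ 4) ≤ CE ^ 2 / p.rp ^ 2 / τ₀ := by
    have h1 : p.E r ^ 2 ≤ (CE * r) ^ 2 := sq_le_sq' (abs_le.1 (hE r hr).1).1 (abs_le.1 (hE r hr).1).2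
    calc p.E r ^ 2 / (T * r ^ 4) ≤ (CE * r) ^ 2 / (T * r ^ 4) := by gcongr
      _ = CE ^ 2 / r ^ 2 / T := by field_simp
      _ ≤ _ := by gcongr
  have hC1 : p.m ^ 2 / Δ ≤ p.m := by
    rw [div_le_iff₀ hΔ, sq]; exact mul_le_mul_of_nonneg_left (p.m_le_deltaTheta θ) hm.le
  have hC2 : g ^ 2 * s ^ 2 / T ≤ S ^ 2 / τ₀ := by
    calc g ^ 2 * s ^ 2 / T ≤ S ^ 2 * 1 / τ₀ := by gcongr
      _ = _ := by rw [mul_one]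
  have hdet : d ≤ (p.D r / r ^ 4 + p.E r ^ 2 / (T * r ^ 4)) * (p.m ^ 2 / Δ + g ^ 2 * s ^ 2 / T) -
      (p.m * p.a * s / r ^ 2 + p.E r * g * s / (T * r ^ 2)) ^ 2 := by
    have e : (p.D r / r ^ 4 + p.E r ^ 2 / (T * r ^ 4)) * (p.m ^ 2 / Δ + g ^ 2 * s ^ 2 / T) -
      (p.m * p.a * s / r ^ 2 + p.E r * g * s / (T * r ^ 2)) ^ 2 =
        p.m ^ 4 * rhoSq p.a r θ ^ 2 / (Δ * T * r ^ 4) := by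
      have hTe : T = -(p.D r * p.f r ^ 2) - 2 * p.m * (r ^ 2 + p.a ^ 2) * p.f r -
          p.m ^ 2 * p.a ^ 2 * (s ^ 2 / Δ) := rfl
      have hc : Real.cos θ ^ 2 = 1 - s ^ 2 := by
        rw [← Real.sin_sq_add_cos_sq θ]; ring
      have hrhoe : rhoSq p.a r θ = r ^ 2 + p.a ^ 2 - p.a ^ 2 * s ^ 2 := by
        rw [rhoSq, hc]; ring
      have hΔe : Δ = p.m + p.a ^ 2 * s ^ 2 := by
        rw [hΔ', deltaTheta, hc, m]; ring
      have e1 : T * ((p.D r + p.E r ^ 2 / T) * (p.m ^ 2 / Δ + g ^ 2 * s ^ 2 / T) -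
          (p.m * p.a * s + p.E r * g * s / T) ^ 2) = p.m ^ 4 * rhoSq p.a r θ ^ 2 / Δ := by
        have e2 : T * ((p.D r + p.E r ^ 2 / T) * (p.m ^ 2 / Δ + g ^ 2 * s ^ 2 / T) -
          (p.m * p.a * s + p.E r * g * s / T) ^ 2) =
          T * (p.D r * p.m ^ 2 / Δ - p.m ^ 2 * p.a ^ 2 * s ^ 2) + p.D r * g ^ 2 * s ^ 2 +
            p.E r ^ 2 * p.m ^ 2 / Δ - 2 * p.m * p.a * s ^ 2 * p.E r * g := by
          field_simp; ring
        rw [e2, hrhoe, hTe, hg, shiftPhi, E]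
        rw [← hΔ']
        field_simp
        ring
      have e3 : (p.D r / r ^ 4 + p.E r ^ 2 / (T * r ^ 4)) * (p.m ^ 2 / Δ + g ^ 2 * s ^ 2 / T) -
          (p.m * p.a * s / r ^ 2 + p.E r * g * s / (T * r ^ 2)) ^ 2 =
          (T * ((p.D r + p.E r ^ 2 / T) * (p.m ^ 2 / Δ + g ^ 2 * s ^ 2 / T) -
          (p.m * p.a * s + p.E r * g * s / T) ^ 2)) / (T * r ^ 4) := by field_simp
      rw [e3, e1]; field_simp
    rw [e, hd]
    have h1 : r ^ 4 ≤ rhoSq p.a r θ ^ 2 := by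
      calc r ^ 4 = (r ^ 2) ^ 2 := by ring
        _ ≤ _ := pow_le_pow_left₀ (by positivity) (p.rhoSq_bounds r θ).1 2
    rw [div_le_div_iff₀ hτ₁ (by positivity)]
    have h2 : Δ * T ≤ 1 * τ₁ := mul_le_mul (p.deltaTheta_le_one θ) hT2 hT0.le zero_le_one
    calc p.m ^ 4 * (Δ * T * r ^ 4) ≤ p.m ^ 4 * (1 * τ₁ * r ^ 4) := by gcongr
      _ ≤ p.m ^ 4 * (1 * τ₁ * rhoSq p.a r θ ^ 2) := by gcongr
      _ = _ := by ring
  have hform := two_form_lower (A := p.D r / r ^ 4 + p.E r ^ 2 / (T * r ^ 4))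
    (B := p.m * p.a * s / r ^ 2 + p.E r * g * s / (T * r ^ 2)) (C := p.m ^ 2 / Δ + g ^ 2 * s ^ 2 / T)
    (by positivity) (by positivity) hd0 hdet (t := t) (by rw [ht]; linarith) X Y
  have n2 : ∀ w : ℂ, ‖w‖ ^ 2 = w.re ^ 2 + w.im ^ 2 := fun w => by
    rw [← normSq_eq_norm_sq, normSq_apply]; ring
  have hξ0 : ξ 0 = (((r ^ 2)⁻¹ : ℝ) : ℂ) * X := by
    rw [hX, ← mul_assoc, ← ofReal_mul, inv_mul_cancel₀ (by positivity)]; simp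
  have hξ2 : ξ 2 = (s : ℂ) * Y := by
    rw [hY, ← mul_assoc, ← ofReal_mul, mul_inv_cancel₀ hs]; simp
  have heq : p.D r * ‖ξ 0‖ ^ 2 + Δ * ‖ξ 1‖ ^ 2 + 2 * (p.m * p.a) * (ξ 0 * conj (ξ 2)).re +
      p.m ^ 2 / (Δ * s ^ 2) * ‖ξ 2‖ ^ 2 + ‖(p.E r : ℂ) * ξ 0 + (g : ℂ) * ξ 2‖ ^ 2 / T =
      ((p.D r / r ^ 4 + p.E r ^ 2 / (T * r ^ 4)) * ‖X‖ ^ 2 +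
        2 * (p.m * p.a * s / r ^ 2 + p.E r * g * s / (T * r ^ 2)) * (X * conj Y).re +
        (p.m ^ 2 / Δ + g ^ 2 * s ^ 2 / T) * ‖Y‖ ^ 2) + Δ * ‖ξ 1‖ ^ 2 := by
    rw [hξ0, hξ2]
    simp only [n2, add_re, add_im, mul_re,
      mul_im, conj_re, conj_im, ofReal_re, ofReal_im]
    field_simp
    ring
  rw [heq, ← mul_assoc]
  have hcr : c₁ ≤ r ^ 2 * (rhoSq p.a r θ)⁻¹ := by
    rw [← div_eq_mul_inv]
    have h1 : c₁ ≤ r ^ 2 / (r ^ 2 + p.a ^ 2) := by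
      rw [hc₁, div_le_div_iff₀ (by positivity) (by positivity)]
      nlinarith only [mul_le_mul_of_nonneg_right hrr (sq_nonneg p.a)]
    refine h1.trans ?_
    gcongr
    exact (p.rhoSq_bounds r θ).2
  have hmin1 := min_le_left (d / (2 * t)) p.m
  have hmin2 := min_le_right (d / (2 * t)) p.m
  have hlow : min (d / (2 * t)) p.m * (‖X‖ ^ 2 + ‖ξ 1‖ ^ 2 + ‖Y‖ ^ 2) ≤
      ((p.D r / r ^ 4 + p.E r ^ 2 / (T * r ^ 4)) * ‖X‖ ^ 2 +
        2 * (p.m * p.a * s / r ^ 2 + p.E r * g * s / (T * r ^ 2)) * (X * conj Y).re +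
        (p.m ^ 2 / Δ + g ^ 2 * s ^ 2 / T) * ‖Y‖ ^ 2) + Δ * ‖ξ 1‖ ^ 2 := by
    have h1 := mul_le_mul_of_nonneg_right hmin1 (by positivity : 0 ≤ ‖X‖ ^ 2 + ‖Y‖ ^ 2)
    have h2 := mul_le_mul_of_nonneg_right (hmin2.trans (p.m_le_deltaTheta θ)) (sq_nonneg ‖ξ 1‖)
    linarith
  have hmin0 : 0 < min (d / (2 * t)) p.m := lt_min (by positivity) hm
  calc c₁ * min (d / (2 * t)) p.m * (‖X‖ ^ 2 + ‖ξ 1‖ ^ 2 + ‖Y‖ ^ 2)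
      = c₁ * (min (d / (2 * t)) p.m * (‖X‖ ^ 2 + ‖ξ 1‖ ^ 2 + ‖Y‖ ^ 2)) := by ring
    _ ≤ _ := mul_le_mul hcr hlow (by positivity) (by positivity)

end Params

/-! ### The measure of the slice in polar coordinates -/

lemma ae_cylRadius_ne_zero : ∀ᵐ x : E3, cylRadius x ≠ 0 := by
  have h1 : (volume : Measure E3) {x : E3 | x 0 = 0} = 0 := by
    have h2 := Measure.addHaar_submodule (volume : Measure E3)
      (LinearMap.ker (EuclideanSpace.proj (𝕜 := ℝ) (0 : Fin 3) : E3 →L[ℝ] ℝ).toLinearMap) (by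
        intro h
        have h3 : (EuclideanSpace.single (0 : Fin 3) (1 : ℝ) : E3) ∈
          LinearMap.ker (EuclideanSpace.proj (𝕜 := ℝ) (0 : Fin 3) : E3 →L[ℝ] ℝ).toLinearMap := by
          rw [h]; trivial
        simp at h3)
    convert h2 using 2
    ext x; simp
  refine (measure_eq_zero_iff_ae_notMem.1 h1).mono fun x hx h => hx ?_
  have h2 := cylRadius_sq x
  rw [h] at h2
  have : x 0 ^ 2 = 0 := by nlinarith [sq_nonneg (x 0), sq_nonneg (x 1)]
  exact pow_eq_zero_iff (two_ne_zero) |>.1 this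

lemma cylRadius_pos {x : E3} (h : cylRadius x ≠ 0) : 0 < cylRadius x :=
  lt_of_le_of_ne (cylRadius_nonneg x) h.symm

lemma ne_zero_of_cylRadius {x : E3} (h : cylRadius x ≠ 0) : x ≠ 0 := by
  rintro rfl; simp [cylRadius] at h

lemma sin_polar_pos {x : E3} (h : cylRadius x ≠ 0) : 0 < Real.sin (polar x) := by
  have hx := ne_zero_of_cylRadius h
  rw [sin_polar hx]
  exact div_pos (cylRadius_pos h) (norm_pos_iff.2 hx)

/-- Polar coordinates with the measure `r⁻² dx`. -/
lemma map_pol_eq {c : ℝ} (hc : 0 < c) :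
    (volume.restrict (ext c)).withDensity (fun x => ENNReal.ofReal ((‖x‖ ^ 2)⁻¹)) =
      Measure.map pol (polMeasure c) := by
  have hm : Measurable fun x : E3 => ENNReal.ofReal ((‖x‖ ^ 2)⁻¹) := by fun_prop
  refine Measure.ext fun s hs => ?_
  rw [← map_pol hc, withDensity_apply _ hs, Measure.map_apply continuous_pol.measurable hs,
    setLIntegral_map hs hm continuous_pol.measurable,
    setLIntegral_withDensity_eq_setLIntegral_mul _ (by fun_prop)
      (show Measurable fun z : ℝ × S2 => ENNReal.ofReal ((‖pol z‖ ^ 2)⁻¹) from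
        hm.comp continuous_pol.measurable) (continuous_pol.measurable hs)]
  have e : ∀ᵐ z ∂(polMeasure c).restrict (pol ⁻¹' s), ((fun z : ℝ × S2 => ENNReal.ofReal (z.1 ^ 2)) *
      fun z => ENNReal.ofReal ((‖pol z‖ ^ 2)⁻¹)) z = 1 := by
    filter_upwards [ae_restrict_of_ae (ae_fst_mem c)] with z hz
    have hz0 : 0 < z.1 := hc.trans hz
    rw [Pi.mul_apply, norm_pol hz0.le, ← ENNReal.ofReal_mul (by positivity),
      mul_inv_cancel₀ (by positivity), ENNReal.ofReal_one]
  rw [lintegral_congr_ae e]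
  simp

namespace Params

variable (p : Params)

lemma volDensity_eq {x : E3} (hx : x ∈ p.X) (h : cylRadius x ≠ 0) :
    p.volDensity x = p.rhoSqAt x / (p.m ^ 2 * ‖x‖ ^ 2) := by
  have hs := sin_polar_pos h
  have hr := p.rhoSq_pos (le_of_lt hx) (polar x)
  have hΔ := p.deltaTheta_pos (polar x)
  have hn : 0 < ‖x‖ := p.rp_pos.trans hx
  have hm := p.m_pos
  rw [volDensity, gAt, gMat, Matrix.det_nonsing_inv, Ring.inverse_eq_inv',
    det_gInv _ _ _ _ _ hs.ne' hΔ.ne' hr.ne', jac, rhoSqAt]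
  have e : |(-((1 - p.a ^ 2) ^ 4 / (Real.sin (polar x) ^ 2 * rhoSq p.a ‖x‖ (polar x) ^ 2)))⁻¹| =
      (Real.sin (polar x) * rhoSq p.a ‖x‖ (polar x) / p.m ^ 2) ^ 2 := by
    rw [inv_neg, abs_neg, abs_of_pos (by
      have : 0 < 1 - p.a ^ 2 := hm
      positivity)]
    rw [m] at hm ⊢
    field_simp
  rw [e, Real.sqrt_sq (by positivity)]
  field_simp

lemma sliceDensity_eq {x : E3} (hx : x ∈ p.X) (h : cylRadius x ≠ 0) :
    ‖x‖⁻¹ * (Real.sqrt (p.hAt x).det / jac x) =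
      Real.sqrt (p.tau ‖x‖ (polar x) * p.rhoSqAt x) / (p.m ^ 2 * ‖x‖) * (‖x‖ ^ 2)⁻¹ := by
  have hs := sin_polar_pos h
  have hr := p.rhoSq_pos (le_of_lt hx) (polar x)
  have hτ := p.tau_pos (le_of_lt hx) (polar x)
  have hΔ := p.deltaTheta_pos (polar x)
  have hn : 0 < ‖x‖ := p.rp_pos.trans hx
  have hm := p.m_pos
  have h00 : gInv p.a p.M p.f ‖x‖ (polar x) 0 0 =
    (rhoSq p.a ‖x‖ (polar x))⁻¹ * p.tau ‖x‖ (polar x) := p.gInv_zero_zero _ _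
  have e : (p.hAt x).det = (p.tau ‖x‖ (polar x) * p.rhoSqAt x) *
      (Real.sin (polar x) / p.m ^ 2) ^ 2 := by
    rw [hAt, hMat, gMat, det_spatial_block (p.isUnit_det_gInv (le_of_lt hx) hs.ne'), h00,
      det_gInv _ _ _ _ _ hs.ne' hΔ.ne' hr.ne', rhoSqAt]
    rw [m] at hm ⊢
    field_simp
  rw [e, Real.sqrt_mul (by rw [rhoSqAt]; positivity), Real.sqrt_sq (by positivity), jac]
  field_simp

lemma exists_sliceMeasure_le : ∃ c C : ENNReal, c ≠ ⊤ ∧ C ≠ ⊤ ∧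
    p.sliceMeasure ≤ C • Measure.map pol (polMeasure p.rp) ∧
    Measure.map pol (polMeasure p.rp) ≤ c • p.sliceMeasure := by
  obtain ⟨τ₀, τ₁, hτ₀, hτ₁, hτ⟩ := p.exists_tau_bounds
  have h0 := p.rp_pos
  have hm := p.m_pos
  set K := Real.sqrt (τ₁ * (1 + p.a ^ 2 / p.rp ^ 2)) / p.m ^ 2 with hK
  set k := Real.sqrt τ₀ / p.m ^ 2 with hk
  have hk0 : 0 < k := div_pos (Real.sqrt_pos.2 hτ₀) (by positivity)
  have hdens : ∀ᵐ x ∂volume.restrict p.X,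
      k * (‖x‖ ^ 2)⁻¹ ≤ ‖x‖⁻¹ * (Real.sqrt (p.hAt x).det / jac x) ∧
      ‖x‖⁻¹ * (Real.sqrt (p.hAt x).det / jac x) ≤ K * (‖x‖ ^ 2)⁻¹ := by
    filter_upwards [ae_restrict_of_ae ae_cylRadius_ne_zero,
      ae_restrict_mem (isOpen_ext p.rp).measurableSet] with x hx hxX
    have hr : p.rp ≤ ‖x‖ := le_of_lt hxX
    have hn : 0 < ‖x‖ := h0.trans_le hr
    have hτx := hτ ‖x‖ hr _ (p.qq_mem (polar x)).1 (p.qq_mem (polar x)).2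
    have hb := p.rhoSq_bounds ‖x‖ (polar x)
    rw [p.sliceDensity_eq hxX hx]
    constructor
    · refine mul_le_mul_of_nonneg_right ?_ (by positivity)
      rw [hk, div_le_div_iff₀ (by positivity) (by positivity)]
      have h1 : Real.sqrt τ₀ * ‖x‖ ≤ Real.sqrt (p.tau ‖x‖ (polar x) * p.rhoSqAt x) := by
        refine Real.le_sqrt_of_sq_le ?_
        rw [mul_pow, Real.sq_sqrt hτ₀.le]
        exact mul_le_mul hτx.1 hb.1 (by positivity) (p.tau_pos hr _).le
      calc Real.sqrt τ₀ * (p.m ^ 2 * ‖x‖) = Real.sqrt τ₀ * ‖x‖ * p.m ^ 2 := by ring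
        _ ≤ _ := mul_le_mul_of_nonneg_right h1 (by positivity)
    · refine mul_le_mul_of_nonneg_right ?_ (by positivity)
      rw [hK, div_le_div_iff₀ (by positivity) (by positivity)]
      have h1 : Real.sqrt (p.tau ‖x‖ (polar x) * p.rhoSqAt x) ≤
          Real.sqrt (τ₁ * (1 + p.a ^ 2 / p.rp ^ 2)) * ‖x‖ := by
        rw [← Real.sqrt_sq hn.le, ← Real.sqrt_mul (by positivity)]
        refine Real.sqrt_le_sqrt ?_
        rw [Real.sqrt_sq hn.le, mul_assoc]
        refine mul_le_mul hτx.2 (hb.2.trans ?_) (p.rhoSq_pos hr _).le hτ₁.le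
        have h2 : p.rp ^ 2 ≤ ‖x‖ ^ 2 := pow_le_pow_left₀ h0.le hr 2
        have h3 : p.a ^ 2 = p.a ^ 2 / p.rp ^ 2 * p.rp ^ 2 := by field_simp
        have h4 := mul_le_mul_of_nonneg_left h2 (by positivity : 0 ≤ p.a ^ 2 / p.rp ^ 2)
        nlinarith
      calc _ ≤ Real.sqrt (τ₁ * (1 + p.a ^ 2 / p.rp ^ 2)) * ‖x‖ * p.m ^ 2 :=
            mul_le_mul_of_nonneg_right h1 (by positivity)
        _ = _ := by ring
  have hmeas : Measurable fun x : E3 => ENNReal.ofReal ((‖x‖ ^ 2)⁻¹) := by fun_prop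
  refine ⟨ENNReal.ofReal k⁻¹, ENNReal.ofReal K, ENNReal.ofReal_ne_top, ENNReal.ofReal_ne_top, ?_, ?_⟩
  · rw [← map_pol_eq h0, ← withDensity_smul _ hmeas, sliceMeasure]
    refine withDensity_mono ?_
    filter_upwards [hdens] with x hx
    rw [Pi.smul_apply, smul_eq_mul, ← ENNReal.ofReal_mul (by positivity)]
    exact ENNReal.ofReal_le_ofReal hx.2
  · rw [← map_pol_eq h0, sliceMeasure, ← withDensity_smul' _ _ ENNReal.ofReal_ne_top]
    refine withDensity_mono ?_
    filter_upwards [hdens] with x hx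
    rw [Pi.smul_apply, smul_eq_mul, ← ENNReal.ofReal_mul (by positivity)]
    refine ENNReal.ofReal_le_ofReal ?_
    calc (‖x‖ ^ 2)⁻¹ = k⁻¹ * (k * (‖x‖ ^ 2)⁻¹) := by field_simp
      _ ≤ _ := mul_le_mul_of_nonneg_left hx.1 (by positivity)

variable {p}

lemma MemL2.pol {F : E3 → ℂ} (h : p.MemL2 F) : MemLp (fun z => F (pol z)) 2 (polMeasure p.rp) := by
  obtain ⟨c, _, hc, _, _, hle⟩ := p.exists_sliceMeasure_le
  have h1 : MemLp F 2 (Measure.map KerrAdS.pol (polMeasure p.rp)) :=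
    (MemLp.smul_measure h hc).mono_measure hle
  exact h1.comp_of_map continuous_pol.aemeasurable

lemma memL2_of_pol {F : E3 → ℂ} (hm : AEStronglyMeasurable F (volume.restrict p.X))
    (h : MemLp (fun z => F (KerrAdS.pol z)) 2 (polMeasure p.rp)) : p.MemL2 F := by
  obtain ⟨_, C, _, hC, hle, _⟩ := p.exists_sliceMeasure_le
  have hm' : AEStronglyMeasurable F (Measure.map KerrAdS.pol (polMeasure p.rp)) :=
    hm.mono_ac (quasiMeasurePreserving_pol p.rp_pos).absolutelyContinuous
  have h1 : MemLp F 2 (Measure.map KerrAdS.pol (polMeasure p.rp)) :=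
    (memLp_map_measure_iff hm' continuous_pol.aemeasurable).2 h
  exact (h1.smul_measure hC).mono_measure hle

variable (p)

lemma exists_norm_bounds : ∃ c C, 0 < c ∧ 0 < C ∧ ∀ F, p.MemL2 F →
    p.normL2 F ^ 2 ≤ C * ∫ z, ‖F (pol z)‖ ^ 2 ∂polMeasure p.rp ∧
    ∫ z, ‖F (pol z)‖ ^ 2 ∂polMeasure p.rp ≤ c * p.normL2 F ^ 2 := by
  obtain ⟨c, C, hc, hC, hle, hle'⟩ := p.exists_sliceMeasure_le
  refine ⟨c.toReal + 1, C.toReal + 1, by positivity, by positivity, fun F hF => ?_⟩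
  have hF2 : MemLp F 2 p.sliceMeasure := hF
  have hm : MemLp F 2 (Measure.map pol (polMeasure p.rp)) :=
    (MemLp.smul_measure hF hc).mono_measure hle'
  have e1 : p.normL2 F ^ 2 = ∫ x, ‖F x‖ ^ 2 ∂p.sliceMeasure := by
    rw [normL2, hF2.eLpNorm_eq_integral_rpow_norm (by norm_num) (by norm_num),
      ENNReal.toReal_ofReal (by positivity)]
    simp only [ENNReal.toReal_ofNat, Real.rpow_two]
    rw [← Real.rpow_natCast, ← Real.rpow_mul (integral_nonneg fun x => by positivity)]
    norm_num
  have e2 : ∫ z, ‖F (pol z)‖ ^ 2 ∂polMeasure p.rp =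
      ∫ x, ‖F x‖ ^ 2 ∂(Measure.map pol (polMeasure p.rp)) := by
    have hm2 : AEStronglyMeasurable (fun x => ‖F x‖ ^ 2) (Measure.map pol (polMeasure p.rp)) :=
      hm.1.norm.pow 2
    rw [integral_map continuous_pol.aemeasurable hm2]
  have i1 : Integrable (fun x => ‖F x‖ ^ 2) p.sliceMeasure := hF2.integrable_norm_pow (by norm_num)
  have i2 : Integrable (fun x => ‖F x‖ ^ 2) (Measure.map pol (polMeasure p.rp)) :=
    hm.integrable_norm_pow (by norm_num)
  have n1 : 0 ≤ ∫ x, ‖F x‖ ^ 2 ∂p.sliceMeasure := integral_nonneg fun x => by positivity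
  have n2 : 0 ≤ ∫ x, ‖F x‖ ^ 2 ∂(Measure.map pol (polMeasure p.rp)) :=
    integral_nonneg fun x => by positivity
  rw [e1, e2]
  constructor
  · have := integral_mono_measure hle (.of_forall fun x => by positivity)
      (i2.smul_measure hC)
    rw [integral_smul_measure, smul_eq_mul] at this
    linarith
  · have := integral_mono_measure hle' (.of_forall fun x => by positivity)
      (i1.smul_measure hc)
    rw [integral_smul_measure, smul_eq_mul] at this
    linarith

end Params

/-! ### The energy space -/

/-- The components of the rotation fields along `∂_θ`. -/
def thetaComp (i : Fin 3) (x : E3) : ℝ := ![-x 1, x 0, 0] i / cylRadius x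

/-- The components of the rotation fields along the unit vector field in the direction `φ`. -/
def phiComp (i : Fin 3) (x : E3) : ℝ :=
  ![-(x 0 * x 2), -(x 1 * x 2), cylRadius x ^ 2] i / (cylRadius x * ‖x‖)

lemma rot_eq {x : E3} (h : cylRadius x ≠ 0) (i : Fin 3) :
    rot i x = thetaComp i x • vecTheta x + (phiComp i x * (Real.sin (polar x))⁻¹) • vecPhi x := by
  have hx := ne_zero_of_cylRadius h
  have hn : ‖x‖ ≠ 0 := norm_ne_zero_iff.2 hx
  have h2 := cylRadius_sq x
  rw [sin_polar hx]
  ext k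
  fin_cases i <;> fin_cases k <;>
    simp [rot, thetaComp, phiComp, vecTheta, vecPhi] <;> field_simp <;> rw [h2] <;> ring

lemma abs_thetaComp_le (i : Fin 3) (x : E3) : |thetaComp i x| ≤ 1 := by
  have h2 := cylRadius_sq x
  rw [thetaComp, abs_div, abs_of_nonneg (cylRadius_nonneg x)]
  refine div_le_one_of_le₀ (abs_le_of_sq_le_sq ?_ (cylRadius_nonneg x)) (cylRadius_nonneg x)
  rw [h2]
  fin_cases i <;> simp <;> nlinarith [sq_nonneg (x 0), sq_nonneg (x 1)]

lemma abs_phiComp_le (i : Fin 3) (x : E3) : |phiComp i x| ≤ 1 := by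
  have h2 := cylRadius_sq x
  have h3 := norm_sq_E3 x
  have h0 : 0 ≤ cylRadius x * ‖x‖ := mul_nonneg (cylRadius_nonneg x) (norm_nonneg _)
  rw [phiComp, abs_div, abs_of_nonneg h0]
  refine div_le_one_of_le₀ (abs_le_of_sq_le_sq ?_ h0) h0
  rw [mul_pow, h2, h3]
  fin_cases i <;> simp <;> nlinarith [sq_nonneg (x 0), sq_nonneg (x 1), sq_nonneg (x 2),
    mul_nonneg (sq_nonneg (x 0)) (sq_nonneg (x 1)), mul_nonneg (sq_nonneg (x 0)) (sq_nonneg (x 2)),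
    mul_nonneg (sq_nonneg (x 1)) (sq_nonneg (x 2)), sq_nonneg (x 0 * x 0), sq_nonneg (x 1 * x 1)]

namespace Params

variable (p : Params)

lemma exists_energy_lower : ∃ c, 0 < c ∧ ∀ x ∈ p.X, cylRadius x ≠ 0 → ∀ (w : ℂ) (L : E3 →L[ℝ] ℂ),
    c * (‖((‖x‖ ^ 2 : ℝ) : ℂ) * p.twistedR w L x‖ ^ 2 + ∑ i, ‖L (rot i x)‖ ^ 2) ≤
      ‖x‖ ^ 2 * p.hInvForm x (p.twistedD w L x) := by
  obtain ⟨c, hc, h⟩ := p.exists_form_lower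
  refine ⟨c / 6, by positivity, fun x hx hcx w L => ?_⟩
  have h1 := h ‖x‖ (le_of_lt hx) (polar x) (sin_polar_pos hcx).ne' (p.twistedD w L x)
  refine le_trans ?_ h1
  rw [show p.twistedD w L x 0 = p.twistedR w L x from rfl,
    show p.twistedD w L x 1 = L (vecTheta x) from rfl,
    show p.twistedD w L x 2 = L (vecPhi x) from rfl]
  set T := L (vecTheta x)
  set S := (((Real.sin (polar x))⁻¹ : ℝ) : ℂ) * L (vecPhi x) with hS
  have hi : ∀ i, ‖L (rot i x)‖ ^ 2 ≤ 2 * (‖T‖ ^ 2 + ‖S‖ ^ 2) := by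
    intro i
    have e : L (rot i x) = (thetaComp i x : ℂ) * T + (phiComp i x : ℂ) * S := by
      rw [rot_eq hcx, map_add, map_smul, map_smul, real_smul, real_smul, hS]
      push_cast; ring
    have h3 : ‖L (rot i x)‖ ≤ ‖T‖ + ‖S‖ := by
      rw [e]
      refine (norm_add_le _ _).trans (add_le_add ?_ ?_)
      · rw [norm_mul, norm_real]
        exact mul_le_of_le_one_left (norm_nonneg _) (abs_thetaComp_le i x)
      · rw [norm_mul, norm_real]
        exact mul_le_of_le_one_left (norm_nonneg _) (abs_phiComp_le i x)
    have h4 := pow_le_pow_left₀ (norm_nonneg _) h3 2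
    nlinarith [sq_nonneg (‖T‖ - ‖S‖)]
  have hsum : ∑ i, ‖L (rot i x)‖ ^ 2 ≤ 6 * (‖T‖ ^ 2 + ‖S‖ ^ 2) := by
    rw [Fin.sum_univ_three]; linarith [hi 0, hi 1, hi 2]
  set Q := ‖((‖x‖ ^ 2 : ℝ) : ℂ) * p.twistedR w L x‖ ^ 2 with hQ
  have hQ0 : 0 ≤ Q := by positivity
  have h5 : Q + ∑ i, ‖L (rot i x)‖ ^ 2 ≤ 6 * (Q + ‖T‖ ^ 2 + ‖S‖ ^ 2) := by linarith
  calc c / 6 * (Q + ∑ i, ‖L (rot i x)‖ ^ 2) ≤ c / 6 * (6 * (Q + ‖T‖ ^ 2 + ‖S‖ ^ 2)) :=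
        mul_le_mul_of_nonneg_left h5 (by positivity)
    _ = _ := by ring

variable {p}

lemma twistRad_eq {u : E3 → ℂ} {du : E3 → E3 →L[ℝ] ℂ} {z : ℝ × S2} (hz : 0 < z.1) :
    twistRad (3 / 2 - p.ν) u du z =
      ((‖pol z‖ ^ 2 : ℝ) : ℂ) * p.twistedR (u (pol z)) (du (pol z)) (pol z) := by
  rw [twistRad, twistedR, norm_pol hz.le, vecR_pol hz, radD]

lemma MemH1.memLp {u : E3 → ℂ} {du : E3 → E3 →L[ℝ] ℂ} (h : p.MemH1 u du) :
    MemLp (twistRad (3 / 2 - p.ν) u du) 2 (polMeasure p.rp) ∧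
      ∀ i, MemLp (angD i du) 2 (polMeasure p.rp) := by
  obtain ⟨c, hc, hlow⟩ := p.exists_energy_lower
  obtain ⟨c', _, hc', _, _, hle⟩ := p.exists_sliceMeasure_le
  have h0 := p.rp_pos
  have hX : MeasurableSet p.X := (isOpen_ext p.rp).measurableSet
  have hac := (quasiMeasurePreserving_pol h0).absolutelyContinuous
  have hdu : AEStronglyMeasurable du (volume.restrict p.X) :=
    h.weakDeriv.locInt_deriv.aestronglyMeasurable
  have hu : AEStronglyMeasurable u (volume.restrict p.X) := h.weakDeriv.locInt.aestronglyMeasurable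
  have hvR : Measurable vecR := by unfold vecR; fun_prop
  have m0 : AEStronglyMeasurable (fun x => ((‖x‖ ^ 2 : ℝ) : ℂ) * p.twistedR (u x) (du x) x)
      (volume.restrict p.X) := by
    refine AEStronglyMeasurable.mul (by fun_prop) ?_
    refine (aesm_clm_apply hdu hvR.aestronglyMeasurable).add (AEStronglyMeasurable.mul ?_ hu)
    exact (measurable_ofReal.comp (by fun_prop)).aestronglyMeasurable
  have m1 : ∀ i, AEStronglyMeasurable (fun x => du x (rot i x)) (volume.restrict p.X) := fun i =>
    aesm_clm_apply hdu (continuous_rot i).aestronglyMeasurable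
  have hax : ∀ᵐ x ∂Measure.map pol (polMeasure p.rp), x ∈ p.X ∧ cylRadius x ≠ 0 := by
    refine hac.ae_le ?_
    filter_upwards [ae_restrict_of_ae ae_cylRadius_ne_zero, ae_restrict_mem hX] with x h1 h2
    exact ⟨h2, h1⟩
  have hfin : ∫⁻ x, ENNReal.ofReal (‖x‖ ^ 2 * p.hInvForm x (p.twistedD (u x) (du x) x))
      ∂Measure.map pol (polMeasure p.rp) < ⊤ := by
    refine (lintegral_mono' hle le_rfl).trans_lt ?_
    rw [lintegral_smul_measure]
    exact ENNReal.mul_lt_top hc'.lt_top h.energy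
  have key : ∀ H : E3 → ℂ, AEStronglyMeasurable H (volume.restrict p.X) →
      (∀ x ∈ p.X, cylRadius x ≠ 0 → c * ‖H x‖ ^ 2 ≤
        ‖x‖ ^ 2 * p.hInvForm x (p.twistedD (u x) (du x) x)) →
      MemLp (fun z => H (pol z)) 2 (polMeasure p.rp) := by
    intro H hH hle
    have hH' := hH.mono_ac hac
    refine MemLp.comp_of_map ?_ continuous_pol.aemeasurable
    refine (memLp_two_iff_integrable_sq_norm hH').2 ⟨hH'.norm.pow 2, ?_⟩
    rw [hasFiniteIntegral_iff_ofReal (.of_forall fun x => by positivity)]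
    have h1 : ∫⁻ x, ENNReal.ofReal (‖H x‖ ^ 2) ∂Measure.map pol (polMeasure p.rp) ≤
        ∫⁻ x, ENNReal.ofReal c⁻¹ * ENNReal.ofReal (‖x‖ ^ 2 *
          p.hInvForm x (p.twistedD (u x) (du x) x)) ∂Measure.map pol (polMeasure p.rp) := by
      refine lintegral_mono_ae ?_
      filter_upwards [hax] with x hx
      rw [← ENNReal.ofReal_mul (by positivity)]
      refine ENNReal.ofReal_le_ofReal ?_
      calc ‖H x‖ ^ 2 = c⁻¹ * (c * ‖H x‖ ^ 2) := by field_simp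
        _ ≤ _ := mul_le_mul_of_nonneg_left (hle x hx.1 hx.2) (by positivity)
    refine h1.trans_lt ?_
    rw [lintegral_const_mul' _ _ ENNReal.ofReal_ne_top]
    exact ENNReal.mul_lt_top ENNReal.ofReal_lt_top hfin
  constructor
  · refine (key _ m0 fun x hx hcx => ?_).ae_eq ?_
    · refine le_trans (mul_le_mul_of_nonneg_left ?_ hc.le) (hlow x hx hcx (u x) (du x))
      have : 0 ≤ ∑ i, ‖du x (rot i x)‖ ^ 2 := Finset.sum_nonneg fun i _ => by positivity
      linarith
    · filter_upwards [ae_fst_mem p.rp] with z hz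
      exact (twistRad_eq (h0.trans hz)).symm
  · intro i
    refine key _ (m1 i) fun x hx hcx => ?_
    refine le_trans (mul_le_mul_of_nonneg_left ?_ hc.le) (hlow x hx hcx (u x) (du x))
    have h1 := Finset.single_le_sum (f := fun i => ‖du x (rot i x)‖ ^ 2) (fun i _ => by positivity)
      (Finset.mem_univ i)
    have h2 : 0 ≤ ‖((‖x‖ ^ 2 : ℝ) : ℂ) * p.twistedR (u x) (du x) x‖ ^ 2 := by positivity
    linarith

end Params

lemma LocInt.integrable_mul_test {c : ℝ} (hc : 0 < c) {H : ℝ × S2 → ℂ} (hH : LocInt c H)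
    {ψ : E3 → ℂ} (hψ : Continuous ψ) (hψc : HasCompactSupport ψ) (hψs : tsupport ψ ⊆ ext c) :
    Integrable (fun z => H z * ψ (pol z)) (polMeasure c) := by
  obtain ⟨x, y, hx, hxy, hs⟩ : ∃ x y, c < x ∧ x < y ∧ ∀ v ∈ tsupport ψ, ‖v‖ ∈ Icc x y := by
    have hK : IsCompact (norm '' tsupport ψ) := hψc.isCompact.image continuous_norm
    by_cases hne : (norm '' tsupport ψ).Nonempty
    · obtain ⟨m, hm, hm'⟩ := hK.exists_isLeast hne
      obtain ⟨M, hM, hM'⟩ := hK.exists_isGreatest hne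
      obtain ⟨v, hv, rfl⟩ := hm
      exact ⟨‖v‖, M + 1, hψs hv, lt_of_le_of_lt (hM' ⟨v, hv, rfl⟩) (lt_add_one _),
        fun w hw => ⟨hm' ⟨w, hw, rfl⟩, (hM' ⟨w, hw, rfl⟩).trans (by linarith)⟩⟩
    · refine ⟨c + 1, c + 2, by linarith, by linarith, fun v hv => ?_⟩
      exact absurd ⟨_, ⟨v, hv, rfl⟩⟩ hne
  have h1 : LocInt c (fun z => ψ (pol z) * H z) :=
    hH.mul (hψ.comp continuous_pol).continuousOn
  have h2 : IntegrableOn (fun z => H z * ψ (pol z)) (Icc x y ×ˢ univ) (polMeasure c) := by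
    have := h1 x y hx hxy
    rw [shell_eq_restrict hx] at this
    simpa only [IntegrableOn, mul_comm] using this
  refine Integrable.congr (h2.integrable_indicator (measurableSet_Icc.prod MeasurableSet.univ)) ?_
  filter_upwards [ae_fst_mem c] with z hz
  by_cases hzs : z ∈ Icc x y ×ˢ (univ : Set S2)
  · rw [indicator_of_mem hzs]
  · have h3 : pol z ∉ tsupport ψ := fun h => by
      have := hs _ h
      rw [norm_pol (hc.trans hz).le] at this
      exact hzs ⟨this, trivial⟩
    rw [indicator_of_notMem hzs, image_eq_zero_of_notMem_tsupport h3, mul_zero]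

lemma sum_rot_mul {x : E3} (h : cylRadius x ≠ 0) (L M : E3 →L[ℝ] ℂ) :
    ∑ i, L (rot i x) * M (rot i x) = L (vecTheta x) * M (vecTheta x) +
      (((Real.sin (polar x) ^ 2)⁻¹ : ℝ) : ℂ) * (L (vecPhi x) * M (vecPhi x)) := by
  have hx := ne_zero_of_cylRadius h
  have hn : ‖x‖ ≠ 0 := norm_ne_zero_iff.2 hx
  have h2 := cylRadius_sq x
  have h3 := norm_sq_E3 x
  have e1 : ∑ i, thetaComp i x ^ 2 = 1 := by
    simp only [thetaComp, Fin.sum_univ_three, Matrix.cons_val_zero, Matrix.cons_val_one,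
      Matrix.cons_val]
    have h4 : cylRadius x ^ 2 ≠ 0 := pow_ne_zero _ h
    rw [div_pow, div_pow, div_pow, ← add_div, ← add_div, div_eq_one_iff_eq h4, h2]; ring
  have e2 : ∑ i, thetaComp i x * phiComp i x = 0 := by
    simp only [thetaComp, phiComp, Fin.sum_univ_three, Matrix.cons_val_zero, Matrix.cons_val_one,
      Matrix.cons_val]
    field_simp; ring
  have e3 : ∑ i, phiComp i x ^ 2 = 1 := by
    simp only [phiComp, Fin.sum_univ_three, Matrix.cons_val_zero, Matrix.cons_val_one,
      Matrix.cons_val]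
    field_simp
    rw [h3, show cylRadius x ^ 4 = (cylRadius x ^ 2) ^ 2 by ring, h2]; ring
  have e : ∀ i, ∀ L : E3 →L[ℝ] ℂ, L (rot i x) = (thetaComp i x : ℂ) * L (vecTheta x) +
      (phiComp i x : ℂ) * ((((Real.sin (polar x))⁻¹ : ℝ) : ℂ) * L (vecPhi x)) := by
    intro i L
    rw [rot_eq h, map_add, map_smul, map_smul, real_smul, real_smul]
    push_cast; ring
  simp only [e]
  rw [Fin.sum_univ_three] at e1 e2 e3 ⊢
  have e1' : (thetaComp 0 x : ℂ) ^ 2 + (thetaComp 1 x : ℂ) ^ 2 + (thetaComp 2 x : ℂ) ^ 2 = 1 := by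
    exact_mod_cast e1
  have e2' : (thetaComp 0 x : ℂ) * phiComp 0 x + (thetaComp 1 x : ℂ) * phiComp 1 x +
      (thetaComp 2 x : ℂ) * phiComp 2 x = 0 := by exact_mod_cast e2
  have e3' : (phiComp 0 x : ℂ) ^ 2 + (phiComp 1 x : ℂ) ^ 2 + (phiComp 2 x : ℂ) ^ 2 = 1 := by
    exact_mod_cast e3
  rw [show (((Real.sin (polar x) ^ 2)⁻¹ : ℝ) : ℂ) = (((Real.sin (polar x))⁻¹ : ℝ) : ℂ) ^ 2 by
    push_cast; ring]
  set S := (((Real.sin (polar x))⁻¹ : ℝ) : ℂ)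
  linear_combination L (vecTheta x) * M (vecTheta x) * e1' +
    (L (vecTheta x) * S * M (vecPhi x) + M (vecTheta x) * S * L (vecPhi x)) * e2' +
    S ^ 2 * L (vecPhi x) * M (vecPhi x) * e3'

namespace Params

variable (p : Params)

/-! ### The operator in polar coordinates -/

/-- `Δ_θ` as a function on the slice. -/
def dth (x : E3) : ℝ := 1 - p.a ^ 2 * (x 2 / ‖x‖) ^ 2

/-- `ϱ²` as a function on the slice. -/
def rho (x : E3) : ℝ := ‖x‖ ^ 2 + p.a ^ 2 * (x 2 / ‖x‖) ^ 2

/-- `ϱ² g⁻¹(dt⋆, dt⋆)` as a function on the slice. -/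
def tt (x : E3) : ℝ := p.tauQ ‖x‖ ((1 - (x 2 / ‖x‖) ^ 2) / p.dth x)

/-- The component of `-ϱ² g⁻¹` along `dt⋆ dφ⋆`. -/
def tphi (x : E3) : ℝ := p.a * (p.m * p.f ‖x‖ + p.m ^ 2 / p.dth x)

/-- The correction in the azimuthal direction to the angular Laplacian `∑ X_i Δ_θ X_i`. -/
def azi (x : E3) : ℝ := p.a ^ 2 * (p.m + p.dth x) / p.dth x

lemma dth_eq {x : E3} (hx : x ≠ 0) : p.dth x = deltaTheta p.a (polar x) := by
  rw [dth, deltaTheta, cos_polar hx]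

lemma rho_eq {x : E3} (hx : x ≠ 0) : p.rho x = p.rhoSqAt x := by
  rw [rho, rhoSqAt, rhoSq, cos_polar hx]

lemma sin_sq_polar {x : E3} (hx : x ≠ 0) : Real.sin (polar x) ^ 2 = 1 - (x 2 / ‖x‖) ^ 2 := by
  rw [Real.sin_sq, cos_polar hx]

lemma tt_eq {x : E3} (hx : x ≠ 0) : p.tt x = p.tau ‖x‖ (polar x) := by
  rw [tt, tau, qq, sin_sq_polar hx, p.dth_eq hx]

lemma dth_pos {x : E3} (hx : x ≠ 0) : 0 < p.dth x := by
  rw [p.dth_eq hx]; exact p.deltaTheta_pos _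

/-- The coefficient of `ψ_r` in the weak formulation of `P(λ) u`. -/
def jRad (l : ℂ) (x : E3) (c : ℂ) (L : E3 →L[ℝ] ℂ) : ℂ :=
  (p.D ‖x‖ : ℂ) * L (vecR x) - I * l * (p.E ‖x‖ : ℂ) * c +
    ((p.m * p.a : ℝ) : ℂ) * L (rot 2 x)

/-- The coefficient of `ψ` in the weak formulation of `P(λ) u`. -/
def jZero (l : ℂ) (x : E3) (c : ℂ) (L : E3 →L[ℝ] ℂ) : ℂ :=
  I * l * (p.E ‖x‖ : ℂ) * L (vecR x) - l ^ 2 * (p.tt x : ℂ) * c +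
    I * l * (p.tphi x : ℂ) * L (rot 2 x) +
    ((p.ν ^ 2 - 9 / 4 : ℝ) : ℂ) * (p.rho x : ℂ) * c

/-- The coefficient of `X_i ψ` in the weak formulation of `P(λ) u`. -/
def jAng (l : ℂ) (i : Fin 3) (x : E3) (c : ℂ) (L : E3 →L[ℝ] ℂ) : ℂ :=
  (p.dth x : ℂ) * L (rot i x) + if i = 2 then ((p.m * p.a : ℝ) : ℂ) * L (vecR x) -
    (p.azi x : ℂ) * L (rot 2 x) - I * l * (p.tphi x : ℂ) * c else 0

lemma form_eq (l : ℂ) {x : E3} (hx : x ∈ p.X) (h : cylRadius x ≠ 0) (v w : ℂ)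
    (L M : E3 →L[ℝ] ℂ) :
    (p.volDensity x : ℂ) * (-(∑ i, ∑ j, ((p.gInvAt x i j : ℝ) : ℂ) *
        stationaryD (-l) v L x i * stationaryD l w M x j) +
        ((p.ν ^ 2 - 9 / 4 : ℝ) : ℂ) * w * v) =
      (((p.m ^ 2 * ‖x‖ ^ 2)⁻¹ : ℝ) : ℂ) * (p.jRad l x w M * L (vecR x) + p.jZero l x w M * v +
        ∑ i, p.jAng l i x w M * L (rot i x)) := by
  have hx0 := ne_zero_of_cylRadius h
  have hn : (‖x‖ : ℂ) ≠ 0 := by exact_mod_cast norm_ne_zero_iff.2 hx0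
  have hm : (p.m : ℂ) ≠ 0 := by exact_mod_cast p.m_pos.ne'
  have hρ : (p.rhoSqAt x : ℂ) ≠ 0 := by exact_mod_cast (p.rhoSq_pos (le_of_lt hx) (polar x)).ne'
  have hs : (Real.sin (polar x) : ℂ) ≠ 0 := by exact_mod_cast (sin_polar_pos h).ne'
  have hd : (p.dth x : ℂ) ≠ 0 := by exact_mod_cast (p.dth_pos hx0).ne'
  have hd' : p.dth x = p.m + p.a ^ 2 * Real.sin (polar x) ^ 2 := by
    rw [p.dth_eq hx0, deltaTheta, m, Real.sin_sq]; ring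
  have hsum := sum_rot_mul h M L
  have e : ∑ i, p.jAng l i x w M * L (rot i x) = (p.dth x : ℂ) * (∑ i, M (rot i x) * L (rot i x)) +
      (((p.m * p.a : ℝ) : ℂ) * M (vecR x) -
    (p.azi x : ℂ) * M (rot 2 x) - I * l * (p.tphi x : ℂ) * w) * L (rot 2 x) := by
    simp only [jAng, Fin.sum_univ_three, Fin.isValue]
    simp
    ring
  rw [e, hsum, p.volDensity_eq hx h]
  unfold gInvAt
  rw [gInv_bilin]
  simp only [rot_two]
  rw [show rhoSq p.a ‖x‖ (polar x) = p.rhoSqAt x from rfl, ← p.dth_eq hx0,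
    show deltaR p.a p.M ‖x‖ = p.D ‖x‖ from rfl]
  simp only [stationaryD, jRad, jZero, rot_two, p.rho_eq hx0, E, tt, tauQ, tphi, azi, ← sin_sq_polar hx0,
    Matrix.cons_val_zero, Matrix.cons_val_one, Matrix.cons_val]
  rw [show (1 - p.a ^ 2) = p.m from rfl]
  have hd2 : (p.dth x : ℂ) = p.m + p.a ^ 2 * Real.sin (polar x) ^ 2 := by
    rw [hd']; push_cast; ring
  clear hd' e hsum
  generalize Real.sin (polar x) = s' at *
  push_cast
  generalize (p.dth x : ℂ) = d at *
  generalize (s' : ℂ) = s at *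
  generalize (p.rhoSqAt x : ℂ) = ρ at *
  generalize (p.D ‖x‖ : ℂ) = D at *
  generalize (p.f ‖x‖ : ℂ) = f at *
  generalize (p.m : ℂ) = m at *
  generalize (‖x‖ : ℂ) = r at *
  generalize (p.a : ℂ) = a at *
  generalize L (vecR x) = Lr
  generalize L (vecTheta x) = Lt
  generalize L (vecPhi x) = Lp
  generalize M (vecR x) = Mr
  generalize M (vecTheta x) = Mt
  generalize M (vecPhi x) = Mp
  have hI := I_sq
  field_simp
  subst hd2
  ring_nf
  simp only [hI]
  ring

end Params

lemma LocInt.sub {c : ℝ} {H K : ℝ × S2 → ℂ} (hH : LocInt c H) (hK : LocInt c K) :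
    LocInt c (fun z => H z - K z) := fun x y hx hy => (hH x y hx hy).sub (hK x y hx hy)

lemma LocInt.congr {c : ℝ} {H K : ℝ × S2 → ℂ} (hH : LocInt c H)
    (h : ∀ᵐ z ∂polMeasure c, H z = K z) : LocInt c K := fun x y hx hy => by
  refine (hH x y hx hy).congr ?_
  rw [shell_eq_restrict hx]
  exact ae_restrict_of_ae h

lemma LocInt.const_mul {c : ℝ} {H : ℝ × S2 → ℂ} (hH : LocInt c H) (k : ℂ) :
    LocInt c (fun z => k * H z) := fun x y hx hy => (hH x y hx hy).const_mul k

lemma LocInt.sum {c : ℝ} {ι : Type*} {s : Finset ι} {H : ι → ℝ × S2 → ℂ}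
    (hH : ∀ i ∈ s, LocInt c (H i)) : LocInt c (fun z => ∑ i ∈ s, H i z) := fun x y hx hy =>
  integrable_finsetSum _ fun i hi => hH i hi x y hx hy

/-- Functions of `|x|` and `x₂` are invariant under rotations about the axis. -/
lemma fderiv_axisymmetric {G : ℝ × ℝ → ℝ} {x : E3} (hx : x ≠ 0)
    (hG : DifferentiableAt ℝ G (‖x‖, x 2)) :
    fderiv ℝ (fun x : E3 => G (‖x‖, x 2)) x (rot 2 x) = 0 := by
  have h1 : DifferentiableAt ℝ (fun x : E3 => ‖x‖) x :=
    (contDiffAt_norm ℝ hx (n := 1)).differentiableAt (by simp)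
  have h2 : DifferentiableAt ℝ (fun x : E3 => x 2) x :=
    ((contDiff_coord 2).differentiable (by simp)).differentiableAt
  have h3 : fderiv ℝ (fun x : E3 => ‖x‖) x (rot 2 x) = 0 := by
    have := fderiv_norm_comp (g := fun r => r) (x := x) differentiableAt_id hx (rot 2 x)
    rw [this, inner_rot]; simp
  have h4 : fderiv ℝ (fun x : E3 => x 2) x (rot 2 x) = 0 := by
    rw [fderiv_coord]; simp [rot]
  have h5 := (hG.hasFDerivAt.comp x (h1.hasFDerivAt.prodMk h2.hasFDerivAt)).fderiv
  have h6 : (fun x : E3 => G (‖x‖, x 2)) = G ∘ fun x : E3 => (‖x‖, x 2) := rfl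
  rw [h6, h5]
  simp only [ContinuousLinearMap.comp_apply, ContinuousLinearMap.prod_apply, h3, h4]
  exact map_zero _

namespace Params

variable (p : Params)

/-! ### Coefficients -/

lemma m_le_dth {x : E3} (hx : x ≠ 0) : p.m ≤ p.dth x := by
  rw [p.dth_eq hx]; exact p.m_le_deltaTheta _

lemma dth_le_one {x : E3} (hx : x ≠ 0) : p.dth x ≤ 1 := by
  rw [p.dth_eq hx]; exact p.deltaTheta_le_one _

lemma exists_tt_bounds : ∃ c C, 0 < c ∧ 0 < C ∧ ∀ x ∈ ext p.rp, c ≤ p.tt x ∧ p.tt x ≤ C := by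
  obtain ⟨c, C, hc, hC, h⟩ := p.exists_tau_bounds
  refine ⟨c, C, hc, hC, fun x hx => ?_⟩
  rw [p.tt_eq (ne_zero_of_mem_ext p.rp_pos hx)]
  exact h _ (le_of_lt hx) _ (p.qq_mem _).1 (p.qq_mem _).2

lemma exists_abs_f_le : ∃ C, 0 < C ∧ ∀ r, p.rp ≤ r → |p.f r| ≤ C := by
  obtain ⟨C, hC, h⟩ := p.exists_f_le
  have h0 := p.rp_pos
  refine ⟨C / p.rp ^ 2, by positivity, fun r hr => ?_⟩
  rw [le_div_iff₀ (by positivity)]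
  exact (mul_le_mul_of_nonneg_left (pow_le_pow_left₀ h0.le hr 2) (abs_nonneg _)).trans (h r hr)

lemma exists_tphi_le : ∃ C, 0 < C ∧ ∀ x ∈ ext p.rp, |p.tphi x| ≤ C := by
  obtain ⟨C, hC, h⟩ := p.exists_abs_f_le
  refine ⟨C + 1, by positivity, fun x hx => ?_⟩
  have hx0 := ne_zero_of_mem_ext p.rp_pos hx
  have hm := p.m_pos
  have hd := p.dth_pos hx0
  have h1 : p.m ^ 2 / p.dth x ≤ 1 := by
    rw [div_le_one hd]
    nlinarith [p.m_le_dth hx0, p.m_le_one]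
  have h2 : |p.m * p.f ‖x‖ + p.m ^ 2 / p.dth x| ≤ C + 1 := by
    refine (abs_add_le _ _).trans (add_le_add ?_ ?_)
    · rw [abs_mul, abs_of_pos hm]
      exact (mul_le_of_le_one_left (abs_nonneg _) p.m_le_one).trans (h _ (le_of_lt hx))
    · rwa [abs_of_nonneg (by positivity)]
  rw [tphi, abs_mul]
  exact (mul_le_of_le_one_left (abs_nonneg _) p.abs_a_lt_one.le).trans h2

lemma azi_nonneg_le {x : E3} (hx : x ≠ 0) : 0 ≤ p.azi x ∧ p.azi x ≤ 2 := by
  have hm := p.m_pos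
  have hd := p.dth_pos hx
  refine ⟨by rw [azi]; positivity, ?_⟩
  rw [azi, div_le_iff₀ hd]
  nlinarith [p.m_le_dth hx, p.sq_a_lt_one, sq_nonneg p.a]

/-- The cosine of the polar angle is smooth away from the origin. -/
lemma contDiffOn_cosine {c : ℝ} (hc : 0 < c) : ContDiffOn ℝ ∞ (fun x : E3 => x 2 / ‖x‖) (ext c) :=
  fun x hx => by
    have hx0 := ne_zero_of_mem_ext hc hx
    exact ((contDiff_coord 2).contDiffAt.div (contDiffAt_norm ℝ hx0)
      (norm_ne_zero_iff.2 hx0)).contDiffWithinAt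

lemma contDiffOn_dth : ContDiffOn ℝ ∞ p.dth (ext p.rp) :=
  contDiffOn_const.sub (contDiffOn_const.mul ((contDiffOn_cosine p.rp_pos).pow 2))

lemma contDiffOn_norm {c : ℝ} (hc : 0 < c) : ContDiffOn ℝ ∞ (fun x : E3 => ‖x‖) (ext c) :=
  fun _ hx => (contDiffAt_norm ℝ (ne_zero_of_mem_ext hc hx)).contDiffWithinAt

lemma contDiffOn_rho : ContDiffOn ℝ ∞ p.rho (ext p.rp) :=
  ((contDiffOn_norm p.rp_pos).pow 2).add
    (contDiffOn_const.mul ((contDiffOn_cosine p.rp_pos).pow 2))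

lemma contDiffOn_radial_comp {g : ℝ → ℝ} (hg : ∀ r, p.rp ≤ r → ContDiffAt ℝ ∞ g r) :
    ContDiffOn ℝ ∞ (fun x : E3 => g ‖x‖) (ext p.rp) := fun x hx =>
  ((hg ‖x‖ (le_of_lt hx)).comp x
    (contDiffAt_norm ℝ (ne_zero_of_mem_ext p.rp_pos hx))).contDiffWithinAt

lemma contDiffOn_tphi : ContDiffOn ℝ ∞ p.tphi (ext p.rp) :=
  contDiffOn_const.mul ((contDiffOn_const.mul
    (p.contDiffOn_radial_comp fun _ hr => p.contDiffAt_f hr)).add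
    (contDiffOn_const.div p.contDiffOn_dth fun _ hx =>
      (p.dth_pos (ne_zero_of_mem_ext p.rp_pos hx)).ne'))

lemma contDiffOn_azi : ContDiffOn ℝ ∞ p.azi (ext p.rp) :=
  (contDiffOn_const.mul (contDiffOn_const.add p.contDiffOn_dth)).div p.contDiffOn_dth fun _ hx =>
      (p.dth_pos (ne_zero_of_mem_ext p.rp_pos hx)).ne'

lemma contDiffOn_tt : ContDiffOn ℝ ∞ p.tt (ext p.rp) := by
  have hf := p.contDiffOn_radial_comp fun _ hr => p.contDiffAt_f hr
  have hD := p.contDiffOn_radial_comp fun _ _ => p.contDiff_D.contDiffAt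
  have hn := contDiffOn_norm p.rp_pos
  exact (((hD.mul (hf.pow 2)).neg.sub ((contDiffOn_const.mul ((hn.pow 2).add
    contDiffOn_const)).mul hf)).sub (contDiffOn_const.mul ((contDiffOn_const.sub
    ((contDiffOn_cosine p.rp_pos).pow 2)).div p.contDiffOn_dth fun _ hx =>
      (p.dth_pos (ne_zero_of_mem_ext p.rp_pos hx)).ne')))

lemma contDiffOn_D : ContDiffOn ℝ ∞ (fun x : E3 => p.D ‖x‖) (ext p.rp) :=
  p.contDiffOn_radial_comp fun _ _ => p.contDiff_D.contDiffAt

lemma contDiffOn_E : ContDiffOn ℝ ∞ (fun x : E3 => p.E ‖x‖) (ext p.rp) :=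
  p.contDiffOn_radial_comp fun _ hr => p.contDiffAt_E hr

lemma _root_.ContinuousOn.ofReal_comp {X : Type*} [TopologicalSpace X] {s : Set X} {g : X → ℝ}
    (hg : ContinuousOn g s) : ContinuousOn (fun x => (g x : ℂ)) s :=
  continuous_ofReal.comp_continuousOn hg

lemma aesm_coeff {g : E3 → ℝ} (hg : ContDiffOn ℝ ∞ g (ext p.rp)) :
    AEStronglyMeasurable (fun x => (g x : ℂ)) (volume.restrict p.X) :=
  hg.continuousOn.ofReal_comp.aestronglyMeasurable (isOpen_ext p.rp).measurableSet

lemma measurable_vecR : Measurable vecR := by unfold vecR; fun_prop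

lemma aesm_jRad {u : E3 → ℂ} {du : E3 → E3 →L[ℝ] ℂ} (l : ℂ)
    (hu : AEStronglyMeasurable u (volume.restrict p.X))
    (hdu : AEStronglyMeasurable du (volume.restrict p.X)) :
    AEStronglyMeasurable (fun x => p.jRad l x (u x) (du x)) (volume.restrict p.X) := by
  have hr := aesm_clm_apply hdu measurable_vecR.aestronglyMeasurable
  have h2 := aesm_clm_apply hdu (continuous_rot 2).aestronglyMeasurable
  exact (((p.aesm_coeff p.contDiffOn_D).mul hr).sub
    (((p.aesm_coeff p.contDiffOn_E).const_mul _).mul hu)).add (h2.const_mul _)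

lemma aesm_jZero {u : E3 → ℂ} {du : E3 → E3 →L[ℝ] ℂ} (l : ℂ)
    (hu : AEStronglyMeasurable u (volume.restrict p.X))
    (hdu : AEStronglyMeasurable du (volume.restrict p.X)) :
    AEStronglyMeasurable (fun x => p.jZero l x (u x) (du x))
    (volume.restrict p.X) := by
  have hr := aesm_clm_apply hdu measurable_vecR.aestronglyMeasurable
  have h2 := aesm_clm_apply hdu (continuous_rot 2).aestronglyMeasurable
  exact (((((p.aesm_coeff p.contDiffOn_E).const_mul _).mul hr).sub
    (((p.aesm_coeff p.contDiffOn_tt).const_mul _).mul hu)).add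
    (((p.aesm_coeff p.contDiffOn_tphi).const_mul _).mul h2)).add
    (((p.aesm_coeff p.contDiffOn_rho).const_mul _).mul hu)

lemma aesm_jAng {u : E3 → ℂ} {du : E3 → E3 →L[ℝ] ℂ} (l : ℂ)
    (hu : AEStronglyMeasurable u (volume.restrict p.X))
    (hdu : AEStronglyMeasurable du (volume.restrict p.X)) (i : Fin 3) :
    AEStronglyMeasurable (fun x => p.jAng l i x (u x) (du x))
    (volume.restrict p.X) := by
  have hr := aesm_clm_apply hdu measurable_vecR.aestronglyMeasurable
  have h2 := fun i => aesm_clm_apply hdu (continuous_rot i).aestronglyMeasurable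
  refine ((p.aesm_coeff p.contDiffOn_dth).mul (h2 i)).add ?_
  by_cases hi : i = 2
  · simp only [hi, if_true]
    exact ((hr.const_mul _).sub ((p.aesm_coeff p.contDiffOn_azi).mul (h2 2))).sub
      (((p.aesm_coeff p.contDiffOn_tphi).const_mul _).mul hu)
  · simp only [hi, if_false]
    exact aestronglyMeasurable_const

variable {p}

lemma isP_iff {u F : E3 → ℂ} {du : E3 → E3 →L[ℝ] ℂ} (h : IsWeakDeriv p.X u du)
    (hF : AEStronglyMeasurable F (volume.restrict p.X)) (l : ℂ) :
    p.IsP l u F ↔ ∀ ψ, IsTest p.X ψ → ∫ z,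
      (p.jRad l (pol z) (u (pol z)) (du (pol z)) * fderiv ℝ ψ (pol z) (vecR (pol z)) +
        p.jZero l (pol z) (u (pol z)) (du (pol z)) * ψ (pol z) +
        ∑ i, p.jAng l i (pol z) (u (pol z)) (du (pol z)) * fderiv ℝ ψ (pol z) (rot i (pol z)))
        ∂polMeasure p.rp = ∫ z, F (pol z) * ψ (pol z) ∂polMeasure p.rp := by
  have hX : MeasurableSet p.X := (isOpen_ext p.rp).measurableSet
  have hu : AEStronglyMeasurable u (volume.restrict p.X) := h.locInt.aestronglyMeasurable
  have hdu : AEStronglyMeasurable du (volume.restrict p.X) := h.locInt_deriv.aestronglyMeasurable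
  have hm := p.m_pos
  have hm0 : (p.m : ℂ) ≠ 0 := by exact_mod_cast hm.ne'
  have key : ∀ ψ, IsTest p.X ψ → ((∫ x in p.X, (p.volDensity x : ℂ) *
        (-(∑ i, ∑ j, ((p.gInvAt x i j : ℝ) : ℂ) *
            stationaryD (-l) (ψ x) (fderiv ℝ ψ x) x i * stationaryD l (u x) (du x) x j)
          + ((p.ν ^ 2 - 9 / 4 : ℝ) : ℂ) * u x * ψ x)
      = ∫ x in p.X, ((p.volDensity x / p.rhoSqAt x : ℝ) : ℂ) * F x * ψ x) ↔ ∫ z,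
      (p.jRad l (pol z) (u (pol z)) (du (pol z)) * fderiv ℝ ψ (pol z) (vecR (pol z)) +
        p.jZero l (pol z) (u (pol z)) (du (pol z)) * ψ (pol z) +
        ∑ i, p.jAng l i (pol z) (u (pol z)) (du (pol z)) * fderiv ℝ ψ (pol z) (rot i (pol z)))
        ∂polMeasure p.rp = ∫ z, F (pol z) * ψ (pol z) ∂polMeasure p.rp) := by
    intro ψ hψ
    have hψm := hψ.smooth.continuous.aestronglyMeasurable (μ := volume.restrict p.X)
    have hdψ := (hψ.smooth.continuous_fderiv (by simp)).aestronglyMeasurable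
      (μ := volume.restrict p.X)
    have hw : AEStronglyMeasurable (fun x : E3 => (((p.m ^ 2 * ‖x‖ ^ 2)⁻¹ : ℝ) : ℂ))
        (volume.restrict p.X) :=
      (measurable_ofReal.comp (by fun_prop)).aestronglyMeasurable
    have e1 : ∫ x in p.X, (p.volDensity x : ℂ) *
        (-(∑ i, ∑ j, ((p.gInvAt x i j : ℝ) : ℂ) *
            stationaryD (-l) (ψ x) (fderiv ℝ ψ x) x i * stationaryD l (u x) (du x) x j)
          + ((p.ν ^ 2 - 9 / 4 : ℝ) : ℂ) * u x * ψ x) =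
        ((p.m : ℂ) ^ 2)⁻¹ * ∫ z,
      (p.jRad l (pol z) (u (pol z)) (du (pol z)) * fderiv ℝ ψ (pol z) (vecR (pol z)) +
        p.jZero l (pol z) (u (pol z)) (du (pol z)) * ψ (pol z) +
        ∑ i, p.jAng l i (pol z) (u (pol z)) (du (pol z)) * fderiv ℝ ψ (pol z) (rot i (pol z)))
        ∂polMeasure p.rp := by
      rw [← integral_const_mul]
      have e : ∀ᵐ x ∂volume.restrict p.X, (p.volDensity x : ℂ) *
        (-(∑ i, ∑ j, ((p.gInvAt x i j : ℝ) : ℂ) *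
            stationaryD (-l) (ψ x) (fderiv ℝ ψ x) x i * stationaryD l (u x) (du x) x j)
          + ((p.ν ^ 2 - 9 / 4 : ℝ) : ℂ) * u x * ψ x) = (((p.m ^ 2 * ‖x‖ ^ 2)⁻¹ : ℝ) : ℂ) *
          (p.jRad l x (u x) (du x) * fderiv ℝ ψ x (vecR x) + p.jZero l x (u x) (du x) * ψ x +
        ∑ i, p.jAng l i x (u x) (du x) * fderiv ℝ ψ x (rot i x)) := by
        filter_upwards [ae_restrict_of_ae ae_cylRadius_ne_zero, ae_restrict_mem hX] with x h1 h2
        exact p.form_eq l h2 h1 _ _ _ _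
      rw [integral_congr_ae e]
      refine (integral_pol p.rp_pos (hw.mul (((((p.aesm_jRad l hu hdu).mul (aesm_clm_apply hdψ
        measurable_vecR.aestronglyMeasurable))).add ((p.aesm_jZero l hu hdu).mul hψm)).add ?_))).trans ?_
      · exact Finset.aestronglyMeasurable_fun_sum _ fun i _ => (p.aesm_jAng l hu hdu i).mul
          (aesm_clm_apply hdψ (continuous_rot i).aestronglyMeasurable)
      · refine integral_congr_ae ?_
        filter_upwards [ae_fst_mem p.rp] with z hz
        have hz0 : 0 < z.1 := p.rp_pos.trans hz
        have hz0' : (z.1 : ℂ) ≠ 0 := by exact_mod_cast hz0.ne'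
        simp only [Pi.mul_apply, Pi.add_apply, norm_pol hz0.le]
        push_cast
        field_simp
    have e2 : ∫ x in p.X, ((p.volDensity x / p.rhoSqAt x : ℝ) : ℂ) * F x * ψ x =
        ((p.m : ℂ) ^ 2)⁻¹ * ∫ z, F (pol z) * ψ (pol z) ∂polMeasure p.rp := by
      rw [← integral_const_mul]
      have e : ∀ᵐ x ∂volume.restrict p.X, ((p.volDensity x / p.rhoSqAt x : ℝ) : ℂ) * F x * ψ x =
          (((p.m ^ 2 * ‖x‖ ^ 2)⁻¹ : ℝ) : ℂ) * (F x * ψ x) := by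
        filter_upwards [ae_restrict_of_ae ae_cylRadius_ne_zero, ae_restrict_mem hX] with x h1 h2
        have hρ : p.rhoSqAt x ≠ 0 := (p.rhoSq_pos (le_of_lt h2) (polar x)).ne'
        have hn : ‖x‖ ≠ 0 := norm_ne_zero_iff.2 (ne_zero_of_cylRadius h1)
        rw [p.volDensity_eq h2 h1, mul_assoc]
        congr 2
        field_simp
      rw [integral_congr_ae e]
      refine (integral_pol p.rp_pos (hw.mul (hF.mul hψm))).trans ?_
      refine integral_congr_ae ?_
      filter_upwards [ae_fst_mem p.rp] with z hz
      have hz0 : 0 < z.1 := p.rp_pos.trans hz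
      have hz0' : (z.1 : ℂ) ≠ 0 := by exact_mod_cast hz0.ne'
      simp only [Pi.mul_apply, norm_pol hz0.le]
      push_cast
      field_simp
    rw [e1, e2]
    exact mul_right_inj' (by simpa using hm0)
  constructor
  · rintro ⟨dv, hdv, hP⟩ ψ hψ
    refine (key ψ hψ).1 ?_
    rw [← hP ψ hψ]
    refine integral_congr_ae ?_
    filter_upwards [ae_restrict_of_ae (h.ae_eq (isOpen_ext p.rp) hdv), ae_restrict_mem hX]
      with x h1 h2
    rw [h1 h2]
  · exact fun hP => ⟨du, h, fun ψ hψ => (key ψ hψ).2 (hP ψ hψ)⟩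

end Params

lemma LocInt.integrable_mul_fderiv {c : ℝ} (hc : 0 < c) {H : ℝ × S2 → ℂ} (hH : LocInt c H)
    {ψ : E3 → ℂ} (hψ : IsTest (ext c) ψ) {V : E3 → E3} (hV : ContinuousOn V (ext c)) :
    Integrable (fun z => H z * fderiv ℝ ψ (pol z) (V (pol z))) (polMeasure c) := by
  have h1 : ∀ a : Fin 3, Integrable (fun z => (V (pol z) a : ℂ) * H z *
      fderiv ℝ ψ (pol z) (basisVec a)) (polMeasure c) := fun a => by
    obtain ⟨c1, c2, c3⟩ := hψ.fderiv_apply (basisVec a)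
    refine LocInt.integrable_mul_test hc (hH.mul ?_) c1 c2 c3
    exact continuous_ofReal.comp_continuousOn (continuousOn_comp_pol hc
      ((contDiff_coord a).continuous.comp_continuousOn hV))
  refine (integrable_finsetSum Finset.univ fun a _ => h1 a).congr (.of_forall fun z => ?_)
  simp only
  rw [clm_apply_eq_sum (fderiv ℝ ψ (pol z)), Finset.mul_sum]
  refine Finset.sum_congr rfl fun a _ => ?_
  rw [real_smul]; ring

lemma integral_lin_five {α : Type*} [MeasurableSpace α] {μ : Measure α}
    {f₀ f₁ f₂ f₃ f₄ f₅ : α → ℂ} (h₀ : Integrable f₀ μ) (h₁ : Integrable f₁ μ)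
    (h₂ : Integrable f₂ μ) (h₃ : Integrable f₃ μ) (h₄ : Integrable f₄ μ) (h₅ : Integrable f₅ μ)
    (c₁ c₂ c₃ c₄ c₅ : ℂ) :
    ∫ z, (f₀ z + c₁ * f₁ z + c₂ * f₂ z + c₃ * f₃ z + c₄ * f₄ z + c₅ * f₅ z) ∂μ =
      ∫ z, f₀ z ∂μ + c₁ * ∫ z, f₁ z ∂μ + c₂ * ∫ z, f₂ z ∂μ + c₃ * ∫ z, f₃ z ∂μ +
        c₄ * ∫ z, f₄ z ∂μ + c₅ * ∫ z, f₅ z ∂μ := by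
  have j₁ : Integrable (fun z => f₀ z + c₁ * f₁ z) μ := h₀.add (h₁.const_mul c₁)
  have j₂ : Integrable (fun z => f₀ z + c₁ * f₁ z + c₂ * f₂ z) μ := j₁.add (h₂.const_mul c₂)
  have j₃ : Integrable (fun z => f₀ z + c₁ * f₁ z + c₂ * f₂ z + c₃ * f₃ z) μ :=
    j₂.add (h₃.const_mul c₃)
  have j₄ : Integrable (fun z => f₀ z + c₁ * f₁ z + c₂ * f₂ z + c₃ * f₃ z + c₄ * f₄ z) μ :=
    j₃.add (h₄.const_mul c₄)
  rw [integral_add j₄ (h₅.const_mul _), integral_add j₃ (h₄.const_mul _),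
    integral_add j₂ (h₃.const_mul _), integral_add j₁ (h₂.const_mul _),
    integral_add h₀ (h₁.const_mul _)]
  simp only [integral_const_mul]

lemma continuousOn_vecR {c : ℝ} (hc : 0 < c) : ContinuousOn vecR (ext c) := fun _ hx =>
  ((continuous_norm.continuousAt.inv₀ (norm_ne_zero_iff.2 (ne_zero_of_mem_ext hc hx))).smul
    continuousAt_id).continuousWithinAt

lemma IsTest.integrable_mul {c : ℝ} (hc : 0 < c) {H : ℝ × S2 → ℂ} (hH : LocInt c H)
    {ψ : E3 → ℂ} (hψ : IsTest (ext c) ψ) :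
    Integrable (fun z => H z * ψ (pol z)) (polMeasure c) :=
  hH.integrable_mul_test hc hψ.smooth.continuous hψ.compact hψ.supp

namespace Params

variable {p : Params}

/-! ### Dependence on the spectral parameter -/

lemma InMode.angD_eq {k : ℤ} {u : E3 → ℂ} {du : E3 → E3 →L[ℝ] ℂ} (hk : p.InMode k u)
    (h : IsWeakDeriv p.X u du) :
    ∀ᵐ z ∂polMeasure p.rp, angD 2 du z = I * (k : ℂ) * u (pol z) := by
  have hX : IsOpen p.X := isOpen_ext p.rp
  have hd2 : LocallyIntegrableOn (fun x => du x (rot 2 x)) p.X := by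
    have h1 : ∀ a, LocallyIntegrableOn (fun x => rot 2 x a • du x (basisVec a)) p.X := fun a =>
      (h.locInt_apply _).continuousOn_smul hX.isLocallyClosed
        (contDiff_rot 2 a).continuous.continuousOn
    have h2 := (h1 0).add ((h1 1).add (h1 2))
    have e : (fun x => du x (rot 2 x)) = (fun x => rot 2 x 0 • du x (basisVec 0)) +
        ((fun x => rot 2 x 1 • du x (basisVec 1)) + fun x => rot 2 x 2 • du x (basisVec 2)) := by
      ext x
      rw [clm_apply_eq_sum, Fin.sum_univ_three]
      simp [add_assoc]
    rw [e]; exact h2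
  have key : ∀ᵐ x, x ∈ p.X → du x (rot 2 x) - I * (k : ℂ) * u x = 0 := by
    refine hX.ae_eq_zero_of_integral_contDiff_smul_eq_zero
      (hd2.sub (h.locInt.smul (I * (k : ℂ)))) fun g hg hgc hgs => ?_
    have hs : tsupport (fun x => (g x : ℂ)) ⊆ tsupport g :=
      closure_mono fun _ hx => by
        intro h0
        exact hx (by simp [h0])
    have ht : IsTest p.X (fun x => (g x : ℂ)) :=
      ⟨ofRealCLM.contDiff.comp hg, hgc.isCompact.of_isClosed_subset (isClosed_tsupport _) hs,
        hs.trans hgs⟩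
    have e1 := h.byParts_field hX (fun a => (contDiff_rot 2 a).contDiffOn)
      (fun x _ => div_rot 2 x) ht
    have e2 := hk _ ht
    have i1 := integrableOn_mul_test hd2 ht.smooth.continuous ht.compact ht.supp
    have i2 := integrableOn_mul_test h.locInt ht.smooth.continuous ht.compact ht.supp
    have e3 : ∫ x, g x • (du x (rot 2 x) - I * (k : ℂ) * u x) =
        ∫ x in p.X, (du x (rot 2 x) * (g x : ℂ) - I * (k : ℂ) * (u x * (g x : ℂ))) := by
      rw [← setIntegral_eq_integral_of_forall_compl_eq_zero (s := p.X)]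
      · refine integral_congr_ae (.of_forall fun x => ?_)
        simp only [real_smul]; ring
      · intro x hx
        rw [image_eq_zero_of_notMem_tsupport fun h => hx (hgs h), zero_smul]
    rw [e3, integral_sub i1 (i2.const_mul _), integral_const_mul, ← e2]
    simp only [rot_two] at e1 ⊢
    rw [e1]; ring
  have h3 := (quasiMeasurePreserving_pol p.rp_pos).ae
    ((ae_restrict_iff' (isOpen_ext p.rp).measurableSet).2 key)
  filter_upwards [h3] with z hz
  exact sub_eq_zero.1 hz

lemma _root_.KerrAdS.du_vecR {du : E3 → E3 →L[ℝ] ℂ} {z : ℝ × S2} (hz : 0 < z.1) :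
    du (pol z) (vecR (pol z)) = radD du z := by
  rw [vecR_pol hz, radD]

lemma _root_.KerrAdS.locInt_radD' {κ c : ℝ} (hc : 0 < c) {u : E3 → ℂ} {du : E3 → E3 →L[ℝ] ℂ}
    (hu : MemLp (fun z => u (pol z)) 2 (polMeasure c))
    (hr : MemLp (twistRad κ u du) 2 (polMeasure c)) : LocInt c (fun z => du (pol z) (vecR (pol z))) :=
  (locInt_radD hc hu hr).congr <| by
    filter_upwards [ae_fst_mem c] with z hz
    rw [du_vecR (hc.trans hz)]

lemma continuousOn_coeff {g : E3 → ℝ} (hg : ContDiffOn ℝ ∞ g (ext p.rp)) :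
    ContinuousOn (fun z => (g (pol z) : ℂ)) (Ioi p.rp ×ˢ univ) :=
  (continuousOn_comp_pol p.rp_pos hg.continuousOn).ofReal_comp

lemma memLp_coeff_mul {g : E3 → ℝ} (hg : ContDiffOn ℝ ∞ g (ext p.rp)) {C : ℝ}
    (hC : ∀ x ∈ ext p.rp, |g x| ≤ C) {H : ℝ × S2 → ℂ} (hH : MemLp H 2 (polMeasure p.rp)) :
    MemLp (fun z => (g (pol z) : ℂ) * H z) 2 (polMeasure p.rp) := by
  have hm : AEStronglyMeasurable (fun z => (g (pol z) : ℂ)) (polMeasure p.rp) :=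
    (p.aesm_coeff hg).comp_quasiMeasurePreserving (quasiMeasurePreserving_pol p.rp_pos)
  refine MemLp.of_le_mul (c := C) hH (hm.mul hH.1) ?_
  filter_upwards [ae_fst_mem p.rp] with z hz
  rw [norm_mul, norm_real, Real.norm_eq_abs]
  exact mul_le_mul_of_nonneg_right (hC _ (pol_mem_ext p.rp_pos hz)) (norm_nonneg _)

/-- A square integrable function is measurable for Lebesgue measure. -/
lemma MemL2.aesm {F : E3 → ℂ} (h : p.MemL2 F) : AEStronglyMeasurable F (volume.restrict p.X) := by
  obtain ⟨c, _, _, _, _, hle⟩ := p.exists_sliceMeasure_le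
  refine h.1.mono_ac ?_
  refine Measure.AbsolutelyContinuous.trans ?_
    ((Measure.absolutelyContinuous_of_le hle).trans Measure.smul_absolutelyContinuous)
  rw [← map_pol_eq p.rp_pos]
  refine withDensity_absolutelyContinuous' (by fun_prop) ?_
  filter_upwards [ae_restrict_mem (isOpen_ext p.rp).measurableSet] with x hx
  have : 0 < ‖x‖ := p.rp_pos.trans hx
  simp [this.ne']

/-- The operator `P(λ) - P(0)` in terms of the differential. -/
def spectralShift (p : Params) (l : ℂ) (u : E3 → ℂ) (du : E3 → E3 →L[ℝ] ℂ) (x : E3) : ℂ :=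
  2 * (I * l) * ((p.E ‖x‖ : ℂ) * du x (vecR x)) +
    I * l * ((deriv p.E ‖x‖ : ℝ) : ℂ) * u x +
    2 * (I * l) * ((p.tphi x : ℂ) * du x (rot 2 x)) - l ^ 2 * ((p.tt x : ℂ) * u x)

lemma contDiffOn_deriv_E (p : Params) :
    ContDiffOn ℝ ∞ (fun x : E3 => deriv p.E ‖x‖) (ext p.rp) := by
  refine p.contDiffOn_radial_comp fun r hr => ?_
  have h2 : deriv p.E = fun x => fderiv ℝ p.E x 1 := by ext x; rw [fderiv_apply_one_eq_deriv]
  rw [h2]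
  exact ((p.contDiffAt_E hr).fderiv_right (m := ∞) (by simp)).clm_apply contDiffAt_const

lemma fderiv_tphi {x : E3} (hx : x ∈ ext p.rp) :
    fderiv ℝ (fun x : E3 => p.tphi x / ‖x‖ ^ 2) x (rot 2 x) = 0 := by
  have hx0 := ne_zero_of_mem_ext p.rp_pos hx
  have hn : ‖x‖ ≠ 0 := norm_ne_zero_iff.2 hx0
  refine fderiv_axisymmetric (G := fun y : ℝ × ℝ => p.a * (p.m * p.f y.1 + p.m ^ 2 /
    (1 - p.a ^ 2 * (y.2 / y.1) ^ 2)) / y.1 ^ 2) hx0 ?_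
  have h1 : DifferentiableAt ℝ (fun y : ℝ × ℝ => p.f y.1) (‖x‖, x 2) :=
    ((p.contDiffAt_f (le_of_lt hx)).differentiableAt (by simp)).comp (‖x‖, x 2) differentiableAt_fst
  have h2 : DifferentiableAt ℝ (fun y : ℝ × ℝ => y.2 / y.1) (‖x‖, x 2) := by
    simp only [div_eq_mul_inv]
    exact differentiableAt_snd.mul (differentiableAt_fst.inv (by exact hn))
  have h3 : 1 - p.a ^ 2 * (x 2 / ‖x‖) ^ 2 ≠ 0 := (p.dth_pos hx0).ne'
  have h4 : DifferentiableAt ℝ (fun y : ℝ × ℝ => p.a * (p.m * p.f y.1 + p.m ^ 2 *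
      (1 - p.a ^ 2 * (y.2 / y.1) ^ 2)⁻¹)) (‖x‖, x 2) :=
    ((h1.const_mul _).add ((((differentiableAt_const _).sub ((h2.pow 2).const_mul _)).inv
      h3).const_mul _)).const_mul _
  have h5 : DifferentiableAt ℝ (fun y : ℝ × ℝ => (y.1 ^ 2)⁻¹) (‖x‖, x 2) :=
    (differentiableAt_fst.pow 2).inv (by simpa using hn)
  refine (h4.mul h5).congr_of_eventuallyEq (.of_forall fun y => ?_)
  simp only [div_eq_mul_inv, Pi.mul_apply]

lemma byParts_E {u : E3 → ℂ} {du : E3 → E3 →L[ℝ] ℂ} (h : IsWeakDeriv p.X u du)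
    (hu : LocInt p.rp fun z => u (pol z)) {ψ : E3 → ℂ} (hψ : IsTest p.X ψ) :
    ∫ z, (p.E ‖pol z‖ : ℂ) * u (pol z) * fderiv ℝ ψ (pol z) (vecR (pol z)) ∂polMeasure p.rp =
      -∫ z, (p.E ‖pol z‖ : ℂ) * du (pol z) (vecR (pol z)) * ψ (pol z) ∂polMeasure p.rp -
      ∫ z, ((deriv p.E ‖pol z‖ : ℝ) : ℂ) * u (pol z) * ψ (pol z) ∂polMeasure p.rp := by
  have ht : IsTest (ext p.rp) (fun x => (p.E ‖x‖ : ℂ) * ψ x) :=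
    contDiff_mul_of_tsupport (isOpen_ext p.rp) hψ
      (ofRealCLM.contDiff.comp_contDiffOn p.contDiffOn_E)
  have e := IsWeakDeriv.byParts_radial p.rp_pos h ht
  have hd : ∀ z : ℝ × S2, p.rp < z.1 → fderiv ℝ (fun x => (p.E ‖x‖ : ℂ) * ψ x) (pol z) z.2 =
      (p.E ‖pol z‖ : ℂ) * fderiv ℝ ψ (pol z) (vecR (pol z)) +
        ((deriv p.E ‖pol z‖ : ℝ) : ℂ) * ψ (pol z) := by
    intro z hz
    have hz0 : 0 < z.1 := p.rp_pos.trans hz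
    have hx := pol_mem_ext p.rp_pos hz
    have hx0 := ne_zero_of_mem_ext p.rp_pos hx
    have d0 : DifferentiableAt ℝ (fun x : E3 => p.E ‖x‖) (pol z) :=
      (p.contDiffOn_E.contDiffAt ((isOpen_ext p.rp).mem_nhds hx)).differentiableAt (by simp)
    have d1 := ofRealCLM.hasFDerivAt.comp (pol z) d0.hasFDerivAt
    have d3 : HasFDerivAt (fun x : E3 => (p.E ‖x‖ : ℂ)) _ (pol z) := d1
    rw [fderiv_fun_mul d3.differentiableAt (hψ.smooth.differentiable (by simp)).differentiableAt,
      d3.fderiv, vecR_pol hz0]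
    have e4 := fderiv_norm_comp (g := p.E) ((p.contDiffAt_E (le_of_lt hx)).differentiableAt
      (by simp)) hx0 (z.2 : E3)
    rw [inner_pol_snd, norm_pol hz0.le, div_self hz0.ne', mul_one] at e4
    simp only [add_apply, smul_apply, ContinuousLinearMap.comp_apply, smul_eq_mul, e4,
      ofRealCLM_apply, norm_pol hz0.le]
    ring
  have i1 := (hu.mul (continuousOn_coeff p.contDiffOn_E)).integrable_mul_fderiv p.rp_pos hψ
    (continuousOn_vecR p.rp_pos)
  have i2 := hψ.integrable_mul p.rp_pos (hu.mul (continuousOn_coeff p.contDiffOn_deriv_E))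
  have e1 : ∫ z, u (pol z) * fderiv ℝ (fun x => (p.E ‖x‖ : ℂ) * ψ x) (pol z) z.2
      ∂polMeasure p.rp =
      ∫ z, (p.E ‖pol z‖ : ℂ) * u (pol z) * fderiv ℝ ψ (pol z) (vecR (pol z)) ∂polMeasure p.rp +
      ∫ z, ((deriv p.E ‖pol z‖ : ℝ) : ℂ) * u (pol z) * ψ (pol z) ∂polMeasure p.rp := by
    rw [← integral_add i1 i2]
    refine integral_congr_ae ?_
    filter_upwards [ae_fst_mem p.rp] with z hz
    rw [hd z hz]; ring
  have e2 : ∫ z, radD du z * ((p.E ‖pol z‖ : ℂ) * ψ (pol z)) ∂polMeasure p.rp =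
      ∫ z, (p.E ‖pol z‖ : ℂ) * du (pol z) (vecR (pol z)) * ψ (pol z) ∂polMeasure p.rp := by
    refine integral_congr_ae ?_
    filter_upwards [ae_fst_mem p.rp] with z hz
    rw [du_vecR (p.rp_pos.trans hz)]; ring
  rw [e1, e2] at e
  linear_combination e

lemma byParts_tphi {u : E3 → ℂ} {du : E3 → E3 →L[ℝ] ℂ} (h : IsWeakDeriv p.X u du)
    {ψ : E3 → ℂ} (hψ : IsTest p.X ψ) :
    ∫ z, (p.tphi (pol z) : ℂ) * u (pol z) * fderiv ℝ ψ (pol z) (rot 2 (pol z)) ∂polMeasure p.rp =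
      -∫ z, (p.tphi (pol z) : ℂ) * du (pol z) (rot 2 (pol z)) * ψ (pol z) ∂polMeasure p.rp := by
  have hsm : ContDiffOn ℝ ∞ (fun x : E3 => p.tphi x / ‖x‖ ^ 2) (ext p.rp) :=
    p.contDiffOn_tphi.div ((contDiffOn_norm p.rp_pos).pow 2) fun x hx =>
      pow_ne_zero _ (norm_ne_zero_iff.2 (ne_zero_of_mem_ext p.rp_pos hx))
  have ht : IsTest (ext p.rp) (fun x => ((p.tphi x / ‖x‖ ^ 2 : ℝ) : ℂ) * ψ x) :=
    contDiff_mul_of_tsupport (isOpen_ext p.rp) hψ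
      (ofRealCLM.contDiff.comp_contDiffOn hsm)
  have e := IsWeakDeriv.byParts_rot p.rp_pos h 2 ht
  refine Eq.trans (integral_congr_ae ?_) (e.trans (congrArg Neg.neg (integral_congr_ae ?_)))
  · filter_upwards [ae_fst_mem p.rp] with z hz
    have hz0 : 0 < z.1 := p.rp_pos.trans hz
    have hz0' : (z.1 : ℂ) ≠ 0 := by exact_mod_cast hz0.ne'
    have hx := pol_mem_ext p.rp_pos hz
    have d0 : DifferentiableAt ℝ (fun x : E3 => p.tphi x / ‖x‖ ^ 2) (pol z) :=
      (hsm.contDiffAt ((isOpen_ext p.rp).mem_nhds hx)).differentiableAt (by simp)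
    have d1 := ofRealCLM.hasFDerivAt.comp (pol z) d0.hasFDerivAt
    have d3 : HasFDerivAt (fun x : E3 => ((p.tphi x / ‖x‖ ^ 2 : ℝ) : ℂ)) _ (pol z) := d1
    rw [fderiv_fun_mul d3.differentiableAt (hψ.smooth.differentiable (by simp)).differentiableAt,
      d3.fderiv]
    simp only [add_apply, smul_apply, ContinuousLinearMap.comp_apply, smul_eq_mul, fderiv_tphi hx,
      map_zero, norm_pol hz0.le]
    push_cast
    field_simp
    ring
  · filter_upwards [ae_fst_mem p.rp] with z hz
    have hz0 : 0 < z.1 := p.rp_pos.trans hz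
    have hz0' : (z.1 : ℂ) ≠ 0 := by exact_mod_cast hz0.ne'
    rw [angD, norm_pol hz0.le]
    push_cast
    field_simp

lemma jRad_sub (p : Params) (l : ℂ) (x : E3) (c : ℂ) (L : E3 →L[ℝ] ℂ) :
    p.jRad l x c L = p.jRad 0 x c L - I * l * ((p.E ‖x‖ : ℂ) * c) := by
  simp only [jRad]; ring

lemma jZero_sub (p : Params) (l : ℂ) (x : E3) (c : ℂ) (L : E3 →L[ℝ] ℂ) :
    p.jZero l x c L = p.jZero 0 x c L + I * l * ((p.E ‖x‖ : ℂ) * L (vecR x)) -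
      l ^ 2 * ((p.tt x : ℂ) * c) + I * l * ((p.tphi x : ℂ) * L (rot 2 x)) := by
  simp only [jZero]; ring

lemma sum_jAng_sub (p : Params) (l : ℂ) (x : E3) (c : ℂ) (L M : E3 →L[ℝ] ℂ) :
    ∑ i, p.jAng l i x c L * M (rot i x) = ∑ i, p.jAng 0 i x c L * M (rot i x) -
      I * l * ((p.tphi x : ℂ) * c * M (rot 2 x)) := by
  simp [jAng, Fin.sum_univ_three]; ring

lemma locInt_jRad (l : ℂ) {u : E3 → ℂ} {du : E3 → E3 →L[ℝ] ℂ}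
    (hu : LocInt p.rp fun z => u (pol z)) (hr : LocInt p.rp fun z => du (pol z) (vecR (pol z)))
    (ha : ∀ i, LocInt p.rp fun z => du (pol z) (rot i (pol z))) :
    LocInt p.rp fun z => p.jRad l (pol z) (u (pol z)) (du (pol z)) := by
  have h1 := ((hr.mul (continuousOn_coeff p.contDiffOn_D)).sub
    ((hu.mul (continuousOn_coeff p.contDiffOn_E)).const_mul (I * l))).add
    ((ha 2).const_mul ((p.m * p.a : ℝ) : ℂ))
  exact h1.congr (.of_forall fun z => by simp only [jRad]; ring)

lemma locInt_jZero (l : ℂ) {u : E3 → ℂ} {du : E3 → E3 →L[ℝ] ℂ}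
    (hu : LocInt p.rp fun z => u (pol z)) (hr : LocInt p.rp fun z => du (pol z) (vecR (pol z)))
    (ha : ∀ i, LocInt p.rp fun z => du (pol z) (rot i (pol z))) :
    LocInt p.rp fun z => p.jZero l (pol z) (u (pol z)) (du (pol z)) := by
  have h1 := ((((hr.mul (continuousOn_coeff p.contDiffOn_E)).const_mul (I * l)).sub
    ((hu.mul (continuousOn_coeff p.contDiffOn_tt)).const_mul (l ^ 2))).add
    (((ha 2).mul (continuousOn_coeff p.contDiffOn_tphi)).const_mul (I * l))).add
    ((hu.mul (continuousOn_coeff p.contDiffOn_rho)).const_mul ((p.ν ^ 2 - 9 / 4 : ℝ) : ℂ))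
  exact h1.congr (.of_forall fun z => by simp only [jZero]; ring)

lemma locInt_jAng (l : ℂ) {u : E3 → ℂ} {du : E3 → E3 →L[ℝ] ℂ}
    (hu : LocInt p.rp fun z => u (pol z)) (hr : LocInt p.rp fun z => du (pol z) (vecR (pol z)))
    (ha : ∀ i, LocInt p.rp fun z => du (pol z) (rot i (pol z))) (i : Fin 3) :
    LocInt p.rp fun z => p.jAng l i (pol z) (u (pol z)) (du (pol z)) := by
  refine ((ha i).mul (continuousOn_coeff p.contDiffOn_dth)).add ?_
  by_cases hi : i = 2
  · have h1 := ((hr.const_mul ((p.m * p.a : ℝ) : ℂ)).sub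
      ((ha 2).mul (continuousOn_coeff p.contDiffOn_azi))).sub
      ((hu.mul (continuousOn_coeff p.contDiffOn_tphi)).const_mul (I * l))
    exact h1.congr (.of_forall fun z => by simp only [hi, if_true]; ring)
  · exact (LocInt.const 0).congr (.of_forall fun z => by simp [hi])

lemma integrable_form (l : ℂ) {u : E3 → ℂ} {du : E3 → E3 →L[ℝ] ℂ}
    (hu : LocInt p.rp fun z => u (pol z)) (hr : LocInt p.rp fun z => du (pol z) (vecR (pol z)))
    (ha : ∀ i, LocInt p.rp fun z => du (pol z) (rot i (pol z))) {ψ : E3 → ℂ} (hψ : IsTest p.X ψ) :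
    Integrable (fun z =>
      p.jRad l (pol z) (u (pol z)) (du (pol z)) * fderiv ℝ ψ (pol z) (vecR (pol z)) +
        p.jZero l (pol z) (u (pol z)) (du (pol z)) * ψ (pol z) +
        ∑ i, p.jAng l i (pol z) (u (pol z)) (du (pol z)) * fderiv ℝ ψ (pol z) (rot i (pol z)))
      (polMeasure p.rp) :=
  (((locInt_jRad l hu hr ha).integrable_mul_fderiv p.rp_pos hψ (continuousOn_vecR p.rp_pos)).add
    (hψ.integrable_mul p.rp_pos (locInt_jZero l hu hr ha))).add
    (integrable_finsetSum _ fun i _ => (locInt_jAng l hu hr ha i).integrable_mul_fderiv p.rp_pos hψ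
      (continuous_rot i).continuousOn)

lemma isP_of_isP_zero {u F : E3 → ℂ} {du : E3 → E3 →L[ℝ] ℂ} (h : IsWeakDeriv p.X u du)
    (hu : LocInt p.rp fun z => u (pol z)) (hr : LocInt p.rp fun z => du (pol z) (vecR (pol z)))
    (ha : ∀ i, LocInt p.rp fun z => du (pol z) (rot i (pol z)))
    (hF : AEStronglyMeasurable F (volume.restrict p.X))
    (hF' : LocInt p.rp fun z => F (pol z)) (l : ℂ) (hP : p.IsP 0 u F)
    (hFl : AEStronglyMeasurable (fun x => F x + p.spectralShift l u du x)
      (volume.restrict p.X)) :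
    p.IsP l u fun x => F x + p.spectralShift l u du x := by
  rw [isP_iff h hF] at hP
  rw [isP_iff h hFl]
  intro ψ hψ
  have cE := continuousOn_coeff p.contDiffOn_E
  have cE' := continuousOn_coeff p.contDiffOn_deriv_E
  have ctp := continuousOn_coeff p.contDiffOn_tphi
  have ctt := continuousOn_coeff p.contDiffOn_tt
  have i1 := (hu.mul cE).integrable_mul_fderiv p.rp_pos hψ (continuousOn_vecR p.rp_pos)
  have i2 := (hu.mul ctp).integrable_mul_fderiv p.rp_pos hψ (continuous_rot 2).continuousOn
  have i3 := hψ.integrable_mul p.rp_pos (hr.mul cE)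
  have i4 := hψ.integrable_mul p.rp_pos (hu.mul cE')
  have i5 := hψ.integrable_mul p.rp_pos ((ha 2).mul ctp)
  have i6 := hψ.integrable_mul p.rp_pos (hu.mul ctt)
  have i7 := hψ.integrable_mul p.rp_pos hF'
  have b1 := byParts_E h hu hψ
  have b2 := byParts_tphi h hψ
  have i0 := integrable_form 0 hu hr ha hψ
  have e1 : ∫ z,
      (p.jRad l (pol z) (u (pol z)) (du (pol z)) * fderiv ℝ ψ (pol z) (vecR (pol z)) +
        p.jZero l (pol z) (u (pol z)) (du (pol z)) * ψ (pol z) +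
        ∑ i, p.jAng l i (pol z) (u (pol z)) (du (pol z)) * fderiv ℝ ψ (pol z) (rot i (pol z)))
        ∂polMeasure p.rp = ∫ z,
      (p.jRad 0 (pol z) (u (pol z)) (du (pol z)) * fderiv ℝ ψ (pol z) (vecR (pol z)) +
        p.jZero 0 (pol z) (u (pol z)) (du (pol z)) * ψ (pol z) +
        ∑ i, p.jAng 0 i (pol z) (u (pol z)) (du (pol z)) * fderiv ℝ ψ (pol z) (rot i (pol z)))
        ∂polMeasure p.rp -
      I * l * (∫ z, (p.E ‖pol z‖ : ℂ) * u (pol z) * fderiv ℝ ψ (pol z) (vecR (pol z))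
        ∂polMeasure p.rp) +
      I * l * (∫ z, (p.E ‖pol z‖ : ℂ) * du (pol z) (vecR (pol z)) * ψ (pol z)
        ∂polMeasure p.rp) -
      l ^ 2 * (∫ z, (p.tt (pol z) : ℂ) * u (pol z) * ψ (pol z) ∂polMeasure p.rp) +
      I * l * (∫ z, (p.tphi (pol z) : ℂ) * du (pol z) (rot 2 (pol z)) * ψ (pol z)
        ∂polMeasure p.rp) -
      I * l * (∫ z, (p.tphi (pol z) : ℂ) * u (pol z) * fderiv ℝ ψ (pol z) (rot 2 (pol z))
        ∂polMeasure p.rp) := by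
    have e := integral_lin_five i0 i1 i3 i6 i5 i2 (-(I * l)) (I * l) (-l ^ 2)
      (I * l) (-(I * l))
    refine (Eq.trans ?_ e).trans (by ring)
    refine integral_congr_ae (.of_forall fun z => ?_)
    simp only
    rw [sum_jAng_sub, jRad_sub, jZero_sub]
    ring
  have e2 : ∫ z, (F (pol z) + p.spectralShift l u du (pol z)) * ψ (pol z) ∂polMeasure p.rp =
      ∫ z, F (pol z) * ψ (pol z) ∂polMeasure p.rp +
      2 * (I * l) * (∫ z, (p.E ‖pol z‖ : ℂ) * du (pol z) (vecR (pol z)) * ψ (pol z)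
        ∂polMeasure p.rp) +
      I * l * (∫ z, ((deriv p.E ‖pol z‖ : ℝ) : ℂ) * u (pol z) * ψ (pol z)
        ∂polMeasure p.rp) +
      2 * (I * l) * (∫ z, (p.tphi (pol z) : ℂ) * du (pol z) (rot 2 (pol z)) * ψ (pol z)
        ∂polMeasure p.rp) -
      l ^ 2 * (∫ z, (p.tt (pol z) : ℂ) * u (pol z) * ψ (pol z) ∂polMeasure p.rp) := by
    have e := integral_lin_five i7 i3 i4 i5 i6 i6 (2 * (I * l)) (I * l)
      (2 * (I * l)) (-l ^ 2) 0
    refine (Eq.trans ?_ e).trans (by ring)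
    refine integral_congr_ae (.of_forall fun z => ?_)
    simp only [spectralShift]
    ring
  rw [e1, e2, hP ψ hψ, b1, b2]
  ring

/-- `P(λ) u` is square integrable for all `λ` if `P(0) u` is. -/
lemma exists_isP {κ : ℝ} {u F : E3 → ℂ} {du : E3 → E3 →L[ℝ] ℂ} (h : IsWeakDeriv p.X u du)
    (hu : p.MemL2 u) (hr : MemLp (twistRad κ u du) 2 (polMeasure p.rp))
    (ha : ∀ i, MemLp (angD i du) 2 (polMeasure p.rp)) (hF : p.MemL2 F) (hP : p.IsP 0 u F) (l : ℂ) :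
    ∃ F, p.MemL2 F ∧ p.IsP l u F := by
  have h0 := p.rp_pos
  have hu' := hu.pol
  have hrad := locInt_radD' h0 hu' hr
  have haL : ∀ i, LocInt p.rp fun z => du (pol z) (rot i (pol z)) := fun i => .of_memLp (ha i)
  have hX : MeasurableSet p.X := (isOpen_ext p.rp).measurableSet
  have hum : AEStronglyMeasurable u (volume.restrict p.X) := h.locInt.aestronglyMeasurable
  have hdu : AEStronglyMeasurable du (volume.restrict p.X) := h.locInt_deriv.aestronglyMeasurable
  have hFm : AEStronglyMeasurable F (volume.restrict p.X) := hF.aesm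
  have hS : AEStronglyMeasurable (p.spectralShift l u du) (volume.restrict p.X) := by
    have hr := aesm_clm_apply hdu measurable_vecR.aestronglyMeasurable
    have h2 := aesm_clm_apply hdu (continuous_rot 2).aestronglyMeasurable
    exact (((((p.aesm_coeff p.contDiffOn_E).mul hr).const_mul _).add
      (((p.aesm_coeff p.contDiffOn_deriv_E).const_mul _).mul hum)).add
      (((p.aesm_coeff p.contDiffOn_tphi).mul h2).const_mul _)).sub
      (((p.aesm_coeff p.contDiffOn_tt).mul hum).const_mul _)
  refine ⟨_, memL2_of_pol (hFm.add hS) ?_, isP_of_isP_zero h (.of_memLp hu') hrad haL hFm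
    (.of_memLp hF.pol) l hP (hFm.add hS)⟩
  obtain ⟨CE, hCE, hE⟩ := p.exists_E_le
  obtain ⟨_, CT, _, hCT, hT⟩ := p.exists_tt_bounds
  obtain ⟨Cp, hCp, hp⟩ := p.exists_tphi_le
  have m1 : MemLp (fun z : ℝ × S2 => ((p.E z.1 / z.1 ^ 2 : ℝ) : ℂ) * twistRad κ u du z) 2
      (polMeasure p.rp) := by
    refine memLp_radial_mul (k := fun r => p.E r / r ^ 2) (C := CE / p.rp) ?_ (fun r hr => ?_) hr
    · exact (p.continuousOn_E.mono Ioi_subset_Ici_self).div (by fun_prop) fun r hr =>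
        pow_ne_zero _ (h0.trans hr).ne'
    · have hr0 : 0 < r := h0.trans hr
      rw [abs_div, abs_of_nonneg (sq_nonneg r), div_le_div_iff₀ (by positivity) h0]
      calc |p.E r| * p.rp ≤ CE * r * r := mul_le_mul (hE r hr.le).1 hr.le h0.le (by positivity)
        _ = _ := by ring
  have m2 : MemLp (fun z : ℝ × S2 => ((p.E z.1 * (κ / z.1) : ℝ) : ℂ) * u (pol z)) 2
      (polMeasure p.rp) := by
    refine memLp_radial_mul (k := fun r => p.E r * (κ / r)) (C := CE * |κ|) ?_ (fun r hr => ?_) hu'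
    · exact (p.continuousOn_E.mono Ioi_subset_Ici_self).mul (continuousOn_const.div continuousOn_id
        fun r hr => (h0.trans hr).ne')
    · have hr0 : 0 < r := h0.trans hr
      rw [abs_mul, abs_div, abs_of_pos hr0, mul_div_assoc', div_le_iff₀ hr0]
      calc |p.E r| * |κ| ≤ CE * r * |κ| :=
            mul_le_mul_of_nonneg_right (hE r hr.le).1 (abs_nonneg _)
        _ = _ := by ring
  have m3 : MemLp (fun z : ℝ × S2 => ((deriv p.E z.1 : ℝ) : ℂ) * u (pol z)) 2
      (polMeasure p.rp) :=
    memLp_radial_mul (k := deriv p.E) (p.continuousOn_deriv_E.mono Ioi_subset_Ici_self)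
      (fun r hr => (hE r hr.le).2) hu'
  have m4 : MemLp (fun z : ℝ × S2 => (p.tphi (pol z) : ℂ) * angD 2 du z) 2 (polMeasure p.rp) :=
    memLp_coeff_mul p.contDiffOn_tphi hp (ha 2)
  have m5 : MemLp (fun z : ℝ × S2 => (p.tt (pol z) : ℂ) * u (pol z)) 2 (polMeasure p.rp) :=
    memLp_coeff_mul (C := CT) p.contDiffOn_tt (fun x hx => by
      obtain ⟨c, _, hc, _, hc'⟩ := p.exists_tt_bounds
      rw [abs_of_nonneg (hc.le.trans (hc' x hx).1)]; exact (hT x hx).2) hu'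
  have m6 := hF.pol.add (((((m1.sub m2).const_mul (2 * (I * l))).add
    (m3.const_mul (I * l))).add (m4.const_mul (2 * (I * l)))).sub
    (m5.const_mul (l ^ 2)))
  refine m6.ae_eq ?_
  filter_upwards [ae_fst_mem p.rp] with z hz
  have hz0 : 0 < z.1 := h0.trans hz
  have hz0' : (z.1 : ℂ) ≠ 0 := by exact_mod_cast hz0.ne'
  simp only [Pi.add_apply, Pi.sub_apply, spectralShift, du_vecR hz0, norm_pol hz0.le,
    radD_eq_twistRad (κ := κ) (u := u) hz0, angD]
  push_cast
  field_simp

end Params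

lemma LocInt.ae_integrable {c : ℝ} {H : ℝ × S2 → ℂ} (hH : LocInt c H) :
    ∀ᵐ r ∂radMeasure c, Integrable (fun y => H (r, y)) sphereMeasure := by
  have h1 : ∀ n : ℕ, ∀ᵐ r, r ∈ Icc (c + (n + 1 : ℝ)⁻¹) (c + n + 2) →
      Integrable (fun y => H (r, y)) sphereMeasure := by
    intro n
    have hn : (0 : ℝ) < (n + 1 : ℝ)⁻¹ := by positivity
    have hn1 : (n + 1 : ℝ)⁻¹ ≤ 1 := inv_le_one_of_one_le₀ (by linarith [n.cast_nonneg (α := ℝ)])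
    have h2 := hH (c + (n + 1 : ℝ)⁻¹) (c + n + 2) (by linarith)
      (by linarith [n.cast_nonneg (α := ℝ)])
    exact (ae_restrict_iff' measurableSet_Icc).1 h2.prod_right_ae
  refine (ae_restrict_iff' measurableSet_Ioi).2 ?_
  filter_upwards [ae_all_iff.2 h1] with r hr hrc
  obtain ⟨n, hn⟩ := exists_nat_gt (max (r - c) (r - c)⁻¹)
  have h3 : 0 < r - c := sub_pos.2 hrc
  refine hr n ⟨?_, by linarith [(le_max_left (r - c) (r - c)⁻¹).trans hn.le]⟩
  have h4 : (n + 1 : ℝ)⁻¹ ≤ r - c := by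
    rw [inv_le_comm₀ (by positivity) h3]
    linarith [(le_max_right (r - c) (r - c)⁻¹).trans hn.le]
  linarith

lemma fib_add_ae {c : ℝ} {H K : ℝ × S2 → ℂ} (hH : LocInt c H) (hK : LocInt c K) :
    ∀ᵐ r ∂radMeasure c, fib (fun z => H z + K z) r = fib H r + fib K r := by
  filter_upwards [hH.ae_integrable, hK.ae_integrable] with r h1 h2
  exact integral_add h1 h2

lemma fib_sum_ae {c : ℝ} {ι : Type*} {s : Finset ι} {H : ι → ℝ × S2 → ℂ}
    (hH : ∀ i ∈ s, LocInt c (H i)) :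
    ∀ᵐ r ∂radMeasure c, fib (fun z => ∑ i ∈ s, H i z) r = ∑ i ∈ s, fib (H i) r := by
  have h : ∀ᵐ r ∂radMeasure c, ∀ i ∈ s, Integrable (fun y => H i (r, y)) sphereMeasure :=
    (s.eventually_all).2 fun i hi => (hH i hi).ae_integrable
  filter_upwards [h] with r hr
  exact integral_finsetSum _ hr

lemma fib_congr {c : ℝ} {H K : ℝ × S2 → ℂ} (h : ∀ᵐ z ∂polMeasure c, H z = K z) :
    ∀ᵐ r ∂radMeasure c, fib H r = fib K r := by
  filter_upwards [Measure.ae_ae_of_ae_prod h] with r hr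
  exact integral_congr_ae hr

/-- The twisted radial derivative `r² (∂_r u + s u)` with `s = κ / r + q`. -/
def twistFull (κ : ℝ) (q : E3 → ℝ) (u : E3 → ℂ) (du : E3 → E3 →L[ℝ] ℂ) (z : ℝ × S2) : ℂ :=
  twistRad κ u du z + ((z.1 ^ 2 * q (pol z) : ℝ) : ℂ) * u (pol z)

namespace Params

variable {p : Params}

/-- The equation `P(λ) u = F` in weak form, tested with a spherical polynomial. -/
lemma IsP.weakDeriv1 {l : ℂ} {u F : E3 → ℂ} {du : E3 → E3 →L[ℝ] ℂ} (h : IsWeakDeriv p.X u du)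
    (hu : LocInt p.rp fun z => u (pol z)) (hr : LocInt p.rp fun z => du (pol z) (vecR (pol z)))
    (ha : ∀ i, LocInt p.rp fun z => du (pol z) (rot i (pol z)))
    (hF : AEStronglyMeasurable F (volume.restrict p.X)) (hF' : LocInt p.rp fun z => F (pol z))
    (hP : p.IsP l u F) {φ : E3 → ℝ} (hφ : ContDiff ℝ ∞ φ) :
    WeakDeriv1 p.rp (fib fun z => (φ z.2 : ℂ) * p.jRad l (pol z) (u (pol z)) (du (pol z)))
      (fib fun z => (φ z.2 : ℂ) * (p.jZero l (pol z) (u (pol z)) (du (pol z)) - F (pol z)) +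
        ∑ i, (rotD i φ z.2 : ℂ) * p.jAng l i (pol z) (u (pol z)) (du (pol z))) := by
  have h0 := p.rp_pos
  rw [isP_iff h hF] at hP
  have k1 := continuousOn_comp_snd (c := p.rp) hφ.continuous
  have k2 := fun i => continuousOn_comp_snd (c := p.rp) (continuous_rotD i hφ)
  have jR := (locInt_jRad l hu hr ha).mul k1
  have jZ := ((locInt_jZero l hu hr ha).sub hF').mul k1
  have jA : LocInt p.rp fun z => ∑ i, (rotD i φ z.2 : ℂ) *
      p.jAng l i (pol z) (u (pol z)) (du (pol z)) :=
    LocInt.sum fun i _ => (locInt_jAng l hu hr ha i).mul (k2 i)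
  refine weakDeriv1_fib jR (jZ.add jA) fun g h1 h2 h3 => ?_
  have hΦ := contDiffOn_rayExt h0 hφ
  have ht : IsTest p.X (radialTest g (rayExt φ)) := isTest_radialTest h0 h1 h2 h3 hΦ
  have e := hP _ ht
  have hd := h1.continuous_deriv (by simp)
  have hdt : tsupport (deriv g) ⊆ Ioi p.rp := (closure_minimal support_deriv_subset
    (isClosed_tsupport _)).trans h3
  have i1 := jR.integrable_mul hd h2.deriv hdt
  have i2 := (jZ.add jA).integrable_mul h1.continuous h2 h3
  have iF : Integrable (fun z => F (pol z) * radialTest g (rayExt φ) (pol z)) (polMeasure p.rp) :=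
    ht.integrable_mul h0 hF'
  have iform := integrable_form l hu hr ha ht
  rw [eq_neg_iff_add_eq_zero, ← integral_add i1 i2, ← sub_eq_zero.2 e, ← integral_sub iform iF]
  refine integral_congr_ae ?_
  filter_upwards [ae_fst_mem p.rp] with z hz
  have hz0 := h0.trans hz
  have e1 := fderiv_radialTest_snd h0 h1 hΦ hz
  have e2 := fun i => fderiv_radialTest_rot h0 h1 hΦ hz i
  have e3 := radialTest_pol h0 g (rayExt φ) hz
  have e4 := fderiv_rayExt_vecR hφ (ne_zero_of_mem_ext h0 (pol_mem_ext h0 hz))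
  rw [vecR_pol hz0] at e4
  rw [rayExt_pol φ hz0] at e1 e3
  simp only [fderiv_rayExt_rot hφ hz0] at e2
  rw [e4] at e1
  simp only [vecR_pol hz0, e1, e2, e3]
  rw [mul_add, Finset.mul_sum]
  have e5 : ∀ i, (g z.1 : ℂ) * ((rotD i φ z.2 : ℂ) *
      p.jAng l i (pol z) (u (pol z)) (du (pol z))) = p.jAng l i (pol z) (u (pol z)) (du (pol z)) *
      ((g z.1 : ℂ) * (rotD i φ z.2 : ℂ)) := fun i => by ring
  simp only [e5, ofReal_zero]
  ring

/-- The potential created by the twist `s = κ / r + q`. -/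
def pot (p : Params) (q : E3 → ℝ) (x : E3) : ℝ :=
  fderiv ℝ (fun x => p.D ‖x‖ * ((3 / 2 - p.ν) / ‖x‖ + q x)) x (vecR x) -
    p.D ‖x‖ * ((3 / 2 - p.ν) / ‖x‖ + q x) ^ 2 + (p.ν ^ 2 - 9 / 4) * p.rho x

/-- Admissible corrections of the twist. -/
structure IsTwist (p : Params) (q : E3 → ℝ) : Prop where
  smooth : ContDiffOn ℝ ∞ q (ext p.rp)
  bound : ∃ C, 0 ≤ C ∧ ∀ x ∈ ext p.rp, |q x| ≤ C * ‖x‖ ^ (-1 - 2 * p.ν)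
  pot_bound : ∃ C, ∀ x ∈ ext p.rp, |p.pot q x| ≤ C

section

variable (l : ℂ) (q : E3 → ℝ) (u F : E3 → ℂ) (du : E3 → E3 →L[ℝ] ℂ)

/-- The radial flux. -/
def fluxRad (p : Params) (z : ℝ × S2) : ℂ :=
  ((p.D z.1 / z.1 ^ 2 : ℝ) : ℂ) * twistFull (3 / 2 - p.ν) q u du z -
    I * l * ((p.E z.1 : ℂ) * u (pol z)) + ((p.m * p.a : ℝ) : ℂ) * angD 2 du z

/-- The part of the equation without radial derivatives of the flux. -/
def bulkZero (p : Params) (z : ℝ × S2) : ℂ :=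
  I * l * (((p.E z.1 / z.1 ^ 2 : ℝ) : ℂ) * twistRad (3 / 2 - p.ν) u du z) +
    (p.pot q (pol z) : ℂ) * u (pol z) - l ^ 2 * ((p.tt (pol z) : ℂ) * u (pol z)) +
    I * l * ((p.tphi (pol z) : ℂ) * angD 2 du z) -
    ((p.m * p.a : ℝ) : ℂ) * ((((3 / 2 - p.ν) / z.1 : ℝ) : ℂ) * angD 2 du z) - F (pol z)

/-- The coupling between the twist and the radial derivative. -/
def bulkTwist (p : Params) (z : ℝ × S2) : ℂ :=
  ((p.D z.1 * q (pol z) / (z.1 ^ 2 * z.1 ^ (1 - 2 * p.ν)) : ℝ) : ℂ) *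
    twistFull (3 / 2 - p.ν) q u du z

/-- The angular fluxes. -/
def fluxAng (p : Params) (i : Fin 3) (z : ℝ × S2) : ℂ := p.jAng l i (pol z) (u (pol z)) (du (pol z))

end

section

variable {l : ℂ} {q : E3 → ℝ} {u F : E3 → ℂ} {du : E3 → E3 →L[ℝ] ℂ}

lemma memLp_twistFull (hq : p.IsTwist q) (h : IsWeakDeriv p.X u du)
    (hu : MemLp (fun z => u (pol z)) 2 (polMeasure p.rp))
    (hr : MemLp (twistRad (3 / 2 - p.ν) u du) 2 (polMeasure p.rp)) :
    MemLp (twistFull (3 / 2 - p.ν) q u du) 2 (polMeasure p.rp) := by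
  have h0 := p.rp_pos
  obtain ⟨C, hC, hb⟩ := hq.bound
  have hw := memLp_weight p.ν_pos rfl h0 h hu hr
  have hsm : ContDiffOn ℝ ∞ (fun x : E3 => ‖x‖ ^ (1 + 2 * p.ν) * q x) (ext p.rp) :=
    (contDiffOn_norm_rpow h0 _).mul hq.smooth
  have h1 := memLp_coeff_mul (C := C) hsm (fun x hx => by
    have hx0 : 0 < ‖x‖ := h0.trans hx
    rw [abs_mul, abs_of_pos (by positivity)]
    calc ‖x‖ ^ (1 + 2 * p.ν) * |q x| ≤ ‖x‖ ^ (1 + 2 * p.ν) * (C * ‖x‖ ^ (-1 - 2 * p.ν)) :=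
          mul_le_mul_of_nonneg_left (hb x hx) (by positivity)
      _ = C * (‖x‖ ^ (1 + 2 * p.ν) * ‖x‖ ^ (-1 - 2 * p.ν)) := by ring
      _ ≤ C := by
        rw [← Real.rpow_add hx0]
        ring_nf; simp) hw
  refine hr.add (h1.ae_eq ?_)
  filter_upwards [ae_fst_mem p.rp] with z hz
  have hz0 : 0 < z.1 := h0.trans hz
  rw [norm_pol hz0.le, ← mul_assoc, ← ofReal_mul]
  congr 2
  rw [mul_right_comm, ← Real.rpow_add hz0]
  ring_nf
  rw [Real.rpow_two]; ring

end

lemma continuousOn_div_pow {g : ℝ → ℝ} (hg : ContinuousOn g (Ici p.rp)) (n : ℕ) :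
    ContinuousOn (fun r => g r / r ^ n) (Ioi p.rp) :=
  (hg.mono Ioi_subset_Ici_self).div (by fun_prop) fun _ hr => pow_ne_zero _ (p.rp_pos.trans hr).ne'

lemma memLp_E (hr : MemLp (twistRad (3 / 2 - p.ν) u du) 2 (polMeasure p.rp)) :
    MemLp (fun z : ℝ × S2 => ((p.E z.1 / z.1 ^ 2 : ℝ) : ℂ) * twistRad (3 / 2 - p.ν) u du z) 2
      (polMeasure p.rp) := by
  have h0 := p.rp_pos
  obtain ⟨CE, hCE, hE⟩ := p.exists_E_le
  refine memLp_radial_mul (k := fun r => p.E r / r ^ 2) (C := CE / p.rp)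
    (continuousOn_div_pow p.continuousOn_E 2) (fun r hr => ?_) hr
  have hr0 : 0 < r := h0.trans hr
  rw [abs_div, abs_of_nonneg (sq_nonneg r), div_le_div_iff₀ (by positivity) h0]
  calc |p.E r| * p.rp ≤ CE * r * r := mul_le_mul (hE r hr.le).1 hr.le h0.le (by positivity)
    _ = _ := by ring

lemma memLp_tt {H : ℝ × S2 → ℂ} (hu : MemLp H 2 (polMeasure p.rp)) :
    MemLp (fun z : ℝ × S2 => (p.tt (pol z) : ℂ) * H z) 2 (polMeasure p.rp) := by
  obtain ⟨c, CT, hc, hCT, hT⟩ := p.exists_tt_bounds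
  exact memLp_coeff_mul (C := CT) p.contDiffOn_tt (fun x hx => by
    rw [abs_of_nonneg (hc.le.trans (hT x hx).1)]; exact (hT x hx).2) hu

lemma memLp_tphi {H : ℝ × S2 → ℂ} (hu : MemLp H 2 (polMeasure p.rp)) :
    MemLp (fun z : ℝ × S2 => (p.tphi (pol z) : ℂ) * H z) 2 (polMeasure p.rp) := by
  obtain ⟨Cp, hCp, hp⟩ := p.exists_tphi_le
  exact memLp_coeff_mul p.contDiffOn_tphi hp hu

lemma memLp_azi {H : ℝ × S2 → ℂ} (hu : MemLp H 2 (polMeasure p.rp)) :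
    MemLp (fun z : ℝ × S2 => (p.azi (pol z) : ℂ) * H z) 2 (polMeasure p.rp) :=
  memLp_coeff_mul (C := 2) p.contDiffOn_azi (fun x hx => by
    have := p.azi_nonneg_le (ne_zero_of_mem_ext p.rp_pos hx)
    rw [abs_of_nonneg this.1]; exact this.2) hu

lemma memLp_dth {H : ℝ × S2 → ℂ} (hu : MemLp H 2 (polMeasure p.rp)) :
    MemLp (fun z : ℝ × S2 => (p.dth (pol z) : ℂ) * H z) 2 (polMeasure p.rp) :=
  memLp_coeff_mul (C := 1) p.contDiffOn_dth (fun x hx => by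
    have hx0 := ne_zero_of_mem_ext p.rp_pos hx
    rw [abs_of_pos (p.dth_pos hx0)]; exact p.dth_le_one hx0) hu

lemma memLp_div (κ : ℝ) {H : ℝ × S2 → ℂ} (hu : MemLp H 2 (polMeasure p.rp)) :
    MemLp (fun z : ℝ × S2 => ((κ / z.1 : ℝ) : ℂ) * H z) 2 (polMeasure p.rp) := by
  have h0 := p.rp_pos
  refine memLp_radial_mul (k := fun r => κ / r) (C := |κ| / p.rp)
    (continuousOn_const.div continuousOn_id fun r hr => (h0.trans hr).ne') (fun r hr => ?_) hu
  rw [abs_div, abs_of_pos (h0.trans hr)]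
  exact div_le_div_of_nonneg_left (abs_nonneg _) h0 hr.le

lemma memLp_radD {κ : ℝ} (hu : MemLp (fun z => u (pol z)) 2 (polMeasure p.rp))
    (hr : MemLp (twistRad κ u du) 2 (polMeasure p.rp)) :
    MemLp (fun z => du (pol z) (vecR (pol z))) 2 (polMeasure p.rp) := by
  have h0 := p.rp_pos
  have h1 : MemLp (fun z : ℝ × S2 => (((z.1 ^ 2)⁻¹ : ℝ) : ℂ) * twistRad κ u du z) 2
      (polMeasure p.rp) :=
    memLp_radial_mul (k := fun r => (r ^ 2)⁻¹) (C := (p.rp ^ 2)⁻¹)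
      (ContinuousOn.inv₀ (by fun_prop) fun r hr => pow_ne_zero _ (h0.trans hr).ne') (fun r hr => by
        rw [abs_of_nonneg (by positivity)]
        exact inv_anti₀ (by positivity) (pow_le_pow_left₀ h0.le hr.le 2)) hr
  refine (h1.sub (memLp_div κ hu)).ae_eq ?_
  filter_upwards [ae_fst_mem p.rp] with z hz
  have hz0 : 0 < z.1 := h0.trans hz
  rw [du_vecR hz0, radD_eq_twistRad (κ := κ) (u := u) hz0, Pi.sub_apply]

lemma memLp_fluxRad (hq : p.IsTwist q) (h : IsWeakDeriv p.X u du)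
    (hu : MemLp (fun z => u (pol z)) 2 (polMeasure p.rp))
    (hr : MemLp (twistRad (3 / 2 - p.ν) u du) 2 (polMeasure p.rp))
    (ha : ∀ i, MemLp (angD i du) 2 (polMeasure p.rp)) :
    MemLp (fun z : ℝ × S2 => (((z.1 ^ 2)⁻¹ : ℝ) : ℂ) * p.fluxRad l q u du z) 2
      (polMeasure p.rp) := by
  have h0 := p.rp_pos
  obtain ⟨CD, hCD, hD⟩ := p.exists_D_le_pow
  obtain ⟨CE, hCE, hE⟩ := p.exists_E_le
  have m1 : MemLp (fun z : ℝ × S2 => ((p.D z.1 / z.1 ^ 4 : ℝ) : ℂ) *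
      twistFull (3 / 2 - p.ν) q u du z) 2 (polMeasure p.rp) :=
    memLp_radial_mul (k := fun r => p.D r / r ^ 4) (C := CD)
      (continuousOn_div_pow p.continuous_D.continuousOn 4) (fun r hr => by
        have hr0 : 0 < r := h0.trans hr
        rw [abs_of_nonneg (div_nonneg (p.D_nonneg hr.le) (by positivity)),
          div_le_iff₀ (by positivity)]
        exact hD r hr.le) (memLp_twistFull hq h hu hr)
  have m2 : MemLp (fun z : ℝ × S2 => ((p.E z.1 / z.1 ^ 2 : ℝ) : ℂ) * u (pol z)) 2
      (polMeasure p.rp) := by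
    refine memLp_radial_mul (k := fun r => p.E r / r ^ 2) (C := CE / p.rp)
      (continuousOn_div_pow p.continuousOn_E 2) (fun r hr => ?_) hu
    have hr0 : 0 < r := h0.trans hr
    rw [abs_div, abs_of_nonneg (sq_nonneg r), div_le_div_iff₀ (by positivity) h0]
    calc |p.E r| * p.rp ≤ CE * r * r := mul_le_mul (hE r hr.le).1 hr.le h0.le (by positivity)
      _ = _ := by ring
  have m3 := memLp_div 1 (memLp_div 1 (ha 2))
  refine ((m1.sub (m2.const_mul (I * l))).add (m3.const_mul ((p.m * p.a : ℝ) : ℂ))).ae_eq ?_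
  filter_upwards [ae_fst_mem p.rp] with z hz
  have hz0 : (z.1 : ℂ) ≠ 0 := by exact_mod_cast (h0.trans hz).ne'
  simp only [Pi.sub_apply, Pi.add_apply, fluxRad]
  push_cast
  field_simp

lemma IsTwist.memLp_pot (hq : p.IsTwist q) {H : ℝ × S2 → ℂ} (hu : MemLp H 2 (polMeasure p.rp)) :
    MemLp (fun z : ℝ × S2 => (p.pot q (pol z) : ℂ) * H z) 2 (polMeasure p.rp) := by
  have h0 := p.rp_pos
  obtain ⟨C, hC⟩ := hq.pot_bound
  have hs : ContDiffOn ℝ ∞ (fun x : E3 => p.D ‖x‖ * ((3 / 2 - p.ν) / ‖x‖ + q x)) (ext p.rp) :=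
    p.contDiffOn_D.mul ((contDiffOn_const.div (contDiffOn_norm h0) fun x hx =>
      norm_ne_zero_iff.2 (ne_zero_of_mem_ext h0 hx)).add hq.smooth)
  have hc : ContinuousOn (p.pot q) (ext p.rp) := by
    refine (ContinuousOn.sub ?_ ?_).add (continuousOn_const.mul p.contDiffOn_rho.continuousOn)
    · exact (hs.continuousOn_fderiv_of_isOpen (isOpen_ext _) (by simp)).clm_apply
        (continuousOn_vecR h0)
    · exact p.contDiffOn_D.continuousOn.mul (((contDiffOn_const.div (contDiffOn_norm h0) fun x hx =>
      norm_ne_zero_iff.2 (ne_zero_of_mem_ext h0 hx)).add hq.smooth).continuousOn.pow 2)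
  have hm : AEStronglyMeasurable (fun z => (p.pot q (pol z) : ℂ)) (polMeasure p.rp) :=
    (hc.ofReal_comp.aestronglyMeasurable (μ := (volume : Measure E3))
      (isOpen_ext p.rp).measurableSet).comp_quasiMeasurePreserving (quasiMeasurePreserving_pol h0)
  refine MemLp.of_le_mul (c := C) hu (hm.mul hu.1) ?_
  filter_upwards [ae_fst_mem p.rp] with z hz
  rw [norm_mul, norm_real, Real.norm_eq_abs]
  exact mul_le_mul_of_nonneg_right (hC _ (pol_mem_ext h0 hz)) (norm_nonneg _)

lemma memLp_bulkZero (hq : p.IsTwist q)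
    (hu : MemLp (fun z => u (pol z)) 2 (polMeasure p.rp))
    (hr : MemLp (twistRad (3 / 2 - p.ν) u du) 2 (polMeasure p.rp))
    (ha : ∀ i, MemLp (angD i du) 2 (polMeasure p.rp))
    (hF : MemLp (fun z => F (pol z)) 2 (polMeasure p.rp)) :
    MemLp (p.bulkZero l q u F du) 2 (polMeasure p.rp) :=
  ((((((memLp_E hr).const_mul (I * l)).add (hq.memLp_pot hu)).sub
    ((memLp_tt hu).const_mul (l ^ 2))).add ((memLp_tphi (ha 2)).const_mul (I * l))).sub
    ((memLp_div (3 / 2 - p.ν) (ha 2)).const_mul ((p.m * p.a : ℝ) : ℂ))).sub hF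

lemma memLp_bulkTwist (hq : p.IsTwist q) (h : IsWeakDeriv p.X u du)
    (hu : MemLp (fun z => u (pol z)) 2 (polMeasure p.rp))
    (hr : MemLp (twistRad (3 / 2 - p.ν) u du) 2 (polMeasure p.rp)) :
    MemLp (p.bulkTwist q u du) 2 (polMeasure p.rp) := by
  have h0 := p.rp_pos
  obtain ⟨C, hC, hb⟩ := hq.bound
  obtain ⟨CD, hCD, hD⟩ := p.exists_D_le_pow
  have hs : ContDiffOn ℝ ∞ (fun x : E3 => p.D ‖x‖ * q x / (‖x‖ ^ 2 * ‖x‖ ^ (1 - 2 * p.ν)))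
      (ext p.rp) :=
    (p.contDiffOn_D.mul hq.smooth).div (((contDiffOn_norm h0).pow 2).mul
      (contDiffOn_norm_rpow h0 _)) fun x hx => by
        have hx0 : 0 < ‖x‖ := h0.trans hx
        positivity
  have m := memLp_coeff_mul (C := CD * C) hs (fun x hx => by
    have hx0 : 0 < ‖x‖ := h0.trans hx
    have hw : 0 < ‖x‖ ^ 2 * ‖x‖ ^ (1 - 2 * p.ν) := by positivity
    rw [abs_div, abs_of_pos hw, abs_mul, abs_of_nonneg (p.D_nonneg (le_of_lt hx)),
      div_le_iff₀ hw]
    calc p.D ‖x‖ * |q x| ≤ CD * ‖x‖ ^ 4 * (C * ‖x‖ ^ (-1 - 2 * p.ν)) :=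
          mul_le_mul (hD _ (le_of_lt hx)) (hb x hx) (abs_nonneg _) (by positivity)
      _ = CD * C * (‖x‖ ^ 4 * ‖x‖ ^ (-1 - 2 * p.ν)) := by ring
      _ = CD * C * (‖x‖ ^ 2 * ‖x‖ ^ (1 - 2 * p.ν)) := by
        congr 1
        rw [← Real.rpow_natCast, ← Real.rpow_natCast, ← Real.rpow_add hx0, ← Real.rpow_add hx0]
        congr 1; push_cast; ring) (memLp_twistFull hq h hu hr)
  refine m.ae_eq ?_
  filter_upwards [ae_fst_mem p.rp] with z hz
  rw [bulkTwist, norm_pol (h0.trans hz).le]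

lemma memLp_fluxAng (hu : MemLp (fun z => u (pol z)) 2 (polMeasure p.rp))
    (hr : MemLp (twistRad (3 / 2 - p.ν) u du) 2 (polMeasure p.rp))
    (ha : ∀ i, MemLp (angD i du) 2 (polMeasure p.rp)) (i : Fin 3) :
    MemLp (p.fluxAng l u du i) 2 (polMeasure p.rp) := by
  refine (memLp_dth (ha i)).add ?_
  by_cases hi : i = 2
  · simp only [hi, if_true]
    refine MemLp.ae_eq ?_ ((((memLp_radD hu hr).const_mul ((p.m * p.a : ℝ) : ℂ)).sub
      (memLp_azi (ha 2))).sub ((memLp_tphi hu).const_mul (I * l)))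
    refine Eventually.of_forall fun z => ?_
    simp only [Pi.sub_apply, angD, mul_assoc]
  · simp only [hi, if_false]
    exact MemLp.zero

lemma fluxRad_eq {z : ℝ × S2} (hz : p.rp < z.1) :
    p.fluxRad l q u du z = p.jRad l (pol z) (u (pol z)) (du (pol z)) +
      ((p.D ‖pol z‖ * ((3 / 2 - p.ν) / ‖pol z‖ + q (pol z)) : ℝ) : ℂ) * u (pol z) := by
  have hz0 : 0 < z.1 := p.rp_pos.trans hz
  have hz1 : (z.1 : ℂ) ≠ 0 := by exact_mod_cast hz0.ne'
  rw [fluxRad, jRad, twistFull, twistRad, du_vecR hz0, norm_pol hz0.le, angD]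
  push_cast
  field_simp
  ring

lemma weak_fluxRad (hq : p.IsTwist q) (h : IsWeakDeriv p.X u du)
    (hu : MemLp (fun z => u (pol z)) 2 (polMeasure p.rp))
    (hr : MemLp (twistRad (3 / 2 - p.ν) u du) 2 (polMeasure p.rp))
    (ha : ∀ i, MemLp (angD i du) 2 (polMeasure p.rp)) (hF : p.MemL2 F) (hP : p.IsP l u F)
    (n : ℕ) (j : Fin (angDim n)) :
    WeakDeriv1 p.rp (coef n j (p.fluxRad l q u du)) fun r => coef n j (p.bulkZero l q u F du) r +
      ((r ^ (1 - 2 * p.ν) : ℝ) : ℂ) * coef n j (p.bulkTwist q u du) r +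
      (((3 / 2 - p.ν) / r : ℝ) : ℂ) * coef n j (p.fluxRad l q u du) r +
      ∑ i, fib (fun z => (rotD i (angFun n j) z.2 : ℂ) * p.fluxAng l u du i z) r := by
  have h0 := p.rp_pos
  have huL : LocInt p.rp fun z => u (pol z) := .of_memLp hu
  have hrL := locInt_radD' h0 hu hr
  have hrL' := locInt_radD h0 hu hr
  have haL : ∀ i, LocInt p.rp fun z => du (pol z) (rot i (pol z)) := fun i => .of_memLp (ha i)
  set φ := angFun n j with hφd
  have hφ : ContDiff ℝ ∞ φ := angFun_contDiff n j
  set Ds : E3 → ℝ := fun x => p.D ‖x‖ * ((3 / 2 - p.ν) / ‖x‖ + q x) with hDs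
  have hDs' : ContDiffOn ℝ ∞ Ds (ext p.rp) :=
    p.contDiffOn_D.mul ((contDiffOn_const.div (contDiffOn_norm h0) fun x hx =>
      norm_ne_zero_iff.2 (ne_zero_of_mem_ext h0 hx)).add hq.smooth)
  have hΦ : ContDiffOn ℝ ∞ (fun x => Ds x * rayExt φ x) (ext p.rp) :=
    hDs'.mul (contDiffOn_rayExt h0 hφ)
  have W1 := hP.weakDeriv1 h huL hrL haL hF.aesm (.of_memLp hF.pol) hφ
  have W2 := IsWeakDeriv.weakDeriv1 h0 h huL hrL' hΦ
  have k1 := continuousOn_comp_snd (c := p.rp) hφ.continuous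
  have k2 := fun i => continuousOn_comp_snd (c := p.rp) (continuous_rotD i hφ)
  have jR := (locInt_jRad l huL hrL haL).mul k1
  have jZ := ((locInt_jZero l huL hrL haL).sub (.of_memLp hF.pol)).mul k1
  have jA := fun i => (locInt_jAng l huL hrL haL i).mul (k2 i)
  have jAs : LocInt p.rp fun z => ∑ i, (rotD i φ z.2 : ℂ) *
      p.jAng l i (pol z) (u (pol z)) (du (pol z)) := LocInt.sum fun i _ => jA i
  have c1 := continuousOn_coeff hΦ
  have c2 : ContinuousOn (fun z : ℝ × S2 => ((fderiv ℝ (fun x => Ds x * rayExt φ x) (pol z) z.2 : ℝ)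
      : ℂ)) (Ioi p.rp ×ˢ univ) := (continuousOn_radial_deriv h0 hΦ).ofReal_comp
  have jT := huL.mul c1
  have jT' := (hrL'.mul c1).add (huL.mul c2)
  have hflux : LocInt p.rp (p.fluxRad l q u du) := by
    refine ((locInt_jRad l huL hrL haL).add (huL.mul (continuousOn_coeff hDs'))).congr ?_
    filter_upwards [ae_fst_mem p.rp] with z hz
    rw [fluxRad_eq hz]
  have jF := hflux.mul k1
  have kr : ∀ g : ℝ → ℝ, ContinuousOn g (Ioi p.rp) →
      ContinuousOn (fun z : ℝ × S2 => (g z.1 : ℂ)) (Ioi p.rp ×ˢ univ) := fun g hg =>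
    (hg.comp continuousOn_fst fun _ hz => hz.1).ofReal_comp
  have jF' := jF.mul (kr (fun r => (3 / 2 - p.ν) / r)
    (continuousOn_const.div continuousOn_id fun r hr => (h0.trans hr).ne'))
  have jB := (LocInt.of_memLp (memLp_bulkZero (l := l) hq hu hr ha hF.pol)).mul k1
  have jY := ((LocInt.of_memLp (memLp_bulkTwist hq h hu hr)).mul k1).mul
    (kr (fun r => r ^ (1 - 2 * p.ν)) fun r hr =>
      (Real.continuousAt_rpow_const _ _ (Or.inl (h0.trans hr).ne')).continuousWithinAt)
  refine (W1.add W2).congr ?_ ?_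
  · have e : ∀ᵐ z ∂polMeasure p.rp, (φ z.2 : ℂ) * p.jRad l (pol z) (u (pol z)) (du (pol z)) +
        ((Ds (pol z) * rayExt φ (pol z) : ℝ) : ℂ) * u (pol z) =
        (φ z.2 : ℂ) * p.fluxRad l q u du z := by
      filter_upwards [ae_fst_mem p.rp] with z hz
      rw [fluxRad_eq hz, rayExt_pol φ (h0.trans hz), hDs]
      push_cast; ring
    filter_upwards [fib_add_ae jR jT, fib_congr e] with r h1 h2
    rw [← h1, h2]; rfl
  · have e : ∀ᵐ z ∂polMeasure p.rp, ((φ z.2 : ℂ) * (p.jZero l (pol z) (u (pol z)) (du (pol z)) -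
        F (pol z)) + ∑ i, (rotD i φ z.2 : ℂ) * p.jAng l i (pol z) (u (pol z)) (du (pol z))) +
        (((Ds (pol z) * rayExt φ (pol z) : ℝ) : ℂ) * radD du z +
          ((fderiv ℝ (fun x => Ds x * rayExt φ x) (pol z) z.2 : ℝ) : ℂ) * u (pol z)) =
        (φ z.2 : ℂ) * p.bulkZero l q u F du z +
        ((z.1 ^ (1 - 2 * p.ν) : ℝ) : ℂ) * ((φ z.2 : ℂ) * p.bulkTwist q u du z) +
        (((3 / 2 - p.ν) / z.1 : ℝ) : ℂ) * ((φ z.2 : ℂ) * p.fluxRad l q u du z) +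
        ∑ i, (rotD i φ z.2 : ℂ) * p.jAng l i (pol z) (u (pol z)) (du (pol z)) := by
      filter_upwards [ae_fst_mem p.rp] with z hz
      have hz0 : 0 < z.1 := h0.trans hz
      have hx := pol_mem_ext h0 hz
      have hx0 := ne_zero_of_mem_ext h0 hx
      have d1 : DifferentiableAt ℝ Ds (pol z) :=
        (hDs'.contDiffAt ((isOpen_ext _).mem_nhds hx)).differentiableAt (by simp)
      have d2 : DifferentiableAt ℝ (rayExt φ) (pol z) :=
        (contDiffAt_rayExt hφ hx0).differentiableAt (by simp)
      have e4 := fderiv_rayExt_vecR hφ hx0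
      rw [vecR_pol hz0] at e4
      have e5 : fderiv ℝ (fun x => Ds x * rayExt φ x) (pol z) z.2 =
          φ z.2 * fderiv ℝ Ds (pol z) z.2 := by
        rw [fderiv_fun_mul d1 d2]
        simp only [add_apply, smul_apply, smul_eq_mul, e4, rayExt_pol φ hz0]
        ring
      have e6 : p.pot q (pol z) = fderiv ℝ Ds (pol z) z.2 -
          p.D z.1 * ((3 / 2 - p.ν) / z.1 + q (pol z)) ^ 2 + (p.ν ^ 2 - 9 / 4) * p.rho (pol z) := by
        rw [pot, vecR_pol hz0, norm_pol hz0.le]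
      have e7 : fderiv ℝ Ds (pol z) z.2 = p.pot q (pol z) +
          p.D z.1 * ((3 / 2 - p.ν) / z.1 + q (pol z)) ^ 2 - (p.ν ^ 2 - 9 / 4) * p.rho (pol z) := by
        rw [e6]; ring
      rw [e5, e7, rayExt_pol φ hz0, fluxRad_eq hz, jZero, jRad, bulkZero, bulkTwist, twistFull,
        twistRad, du_vecR hz0, hDs, angD]
      simp only [norm_pol hz0.le]
      have hw : (z.1 ^ (1 - 2 * p.ν) : ℝ) ≠ 0 := (Real.rpow_pos_of_pos hz0 _).ne'
      generalize z.1 ^ (1 - 2 * p.ν) = w at *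
      have hw' : (w : ℂ) ≠ 0 := by exact_mod_cast hw
      have hz1 : (z.1 : ℂ) ≠ 0 := by exact_mod_cast hz0.ne'
      push_cast
      field_simp
      ring
    have e3 : ∀ r, ((r ^ (1 - 2 * p.ν) : ℝ) : ℂ) * coef n j (p.bulkTwist q u du) r =
        fib (fun z => ((z.1 ^ (1 - 2 * p.ν) : ℝ) : ℂ) * ((φ z.2 : ℂ) * p.bulkTwist q u du z)) r := by
      intro r; rw [coef, fib, fib, ← integral_const_mul]
    have e4 : ∀ r, (((3 / 2 - p.ν) / r : ℝ) : ℂ) * coef n j (p.fluxRad l q u du) r =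
        fib (fun z => (((3 / 2 - p.ν) / z.1 : ℝ) : ℂ) * ((φ z.2 : ℂ) * p.fluxRad l q u du z)) r := by
      intro r; rw [coef, fib, fib, ← integral_const_mul]
    filter_upwards [fib_add_ae (jZ.add jAs) jT', fib_congr e,
      fib_add_ae ((jB.add jY).add jF') jAs, fib_add_ae (jB.add jY) jF', fib_add_ae jB jY,
      fib_sum_ae (s := Finset.univ) fun i _ => jA i] with r h1 h2 h3 h4 h5 h6
    rw [← h1, h2, h3, h4, h5, h6, e3, e4]
    rfl

lemma weakSystem (hq : p.IsTwist q) (h : IsWeakDeriv p.X u du)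
    (hu : MemLp (fun z => u (pol z)) 2 (polMeasure p.rp))
    (hr : MemLp (twistRad (3 / 2 - p.ν) u du) 2 (polMeasure p.rp))
    (ha : ∀ i, MemLp (angD i du) 2 (polMeasure p.rp)) (hF : p.MemL2 F) (hP : p.IsP l u F)
    (hflux : ∀ n j, Tendsto (fun N : ℕ => (N : ℝ)⁻¹ * ∫ r in Icc (N : ℝ) (2 * N),
      ‖coef n j (p.fluxRad l q u du) r‖ * ‖coef n j (fun z => u (pol z)) r‖) atTop (𝓝 0)) :
    WeakSystem p.rp (3 / 2 - p.ν) u du (fun r => r ^ (1 - 2 * p.ν)) (p.fluxRad l q u du)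
      (p.bulkZero l q u F du) (p.bulkTwist q u du) (p.fluxAng l u du) where
  pos := p.rp_pos
  weakDeriv := h
  memLp_u := hu
  memLp_rad := hr
  memLp_ang := ha
  memLp_wu := memLp_weight p.ν_pos rfl p.rp_pos h hu hr
  memLp_flux := memLp_fluxRad hq h hu hr ha
  memLp_zero := memLp_bulkZero hq hu hr ha hF.pol
  memLp_Y := memLp_bulkTwist hq h hu hr
  memLp_Ha := memLp_fluxAng hu hr ha
  weak := weak_fluxRad hq h hu hr ha hF hP
  flux := hflux

/-- The size of the radial flux in a mode. -/
lemma exists_coef_fluxRad_le (hq : p.IsTwist q) (h : IsWeakDeriv p.X u du)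
    (hu : MemLp (fun z => u (pol z)) 2 (polMeasure p.rp))
    (hr : MemLp (twistRad (3 / 2 - p.ν) u du) 2 (polMeasure p.rp)) {k : ℤ}
    (hk : ∀ᵐ z ∂polMeasure p.rp, angD 2 du z = I * (k : ℂ) * u (pol z)) (l : ℂ) :
    ∃ C, 0 ≤ C ∧ ∀ n j, ∀ᵐ r ∂radMeasure p.rp, ‖coef n j (p.fluxRad l q u du) r‖ ≤
      C * (r ^ 2 * ‖coef n j (twistFull (3 / 2 - p.ν) q u du) r‖ +
        r * ‖coef n j (fun z => u (pol z)) r‖) := by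
  have h0 := p.rp_pos
  obtain ⟨CD, hCD, hD⟩ := p.exists_D_le_pow
  obtain ⟨CE, hCE, hE⟩ := p.exists_E_le
  set K := ‖l‖ * CE + |(k : ℝ)| / p.rp with hK
  have hK0 : 0 ≤ K := by positivity
  refine ⟨CD + K, by positivity, fun n j => ?_⟩
  have e : ∀ᵐ z ∂polMeasure p.rp, p.fluxRad l q u du z =
      ((p.D z.1 / z.1 ^ 2 : ℝ) : ℂ) * twistFull (3 / 2 - p.ν) q u du z +
        (-(I * l * (p.E z.1 : ℂ)) + ((p.m * p.a : ℝ) : ℂ) * (I * (k : ℂ))) *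
          u (pol z) := by
    filter_upwards [hk] with z hz
    rw [fluxRad, hz]; ring
  have hT := memLp_twistFull hq h hu hr
  filter_upwards [coef_congr (n := n) (j := j) e, ae_restrict_mem measurableSet_Ioi,
    ae_memLp_slice hT, ae_memLp_slice hu] with r h1 hrm h2 h3
  have hr0 : 0 < r := h0.trans hrm
  have e1 : coef n j (fun z => ((p.D z.1 / z.1 ^ 2 : ℝ) : ℂ) * twistFull (3 / 2 - p.ν) q u du z +
        (-(I * l * (p.E z.1 : ℂ)) + ((p.m * p.a : ℝ) : ℂ) * (I * (k : ℂ))) *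
          u (pol z)) r = ((p.D r / r ^ 2 : ℝ) : ℂ) * coef n j (twistFull (3 / 2 - p.ν) q u du) r +
        (-(I * l * (p.E r : ℂ)) + ((p.m * p.a : ℝ) : ℂ) * (I * (k : ℂ))) *
          coef n j (fun z => u (pol z)) r := by
    have m1 : MemLp (fun y => ((p.D r / r ^ 2 : ℝ) : ℂ) *
        twistFull (3 / 2 - p.ν) q u du (r, y)) 2 sphereMeasure := h2.const_mul _
    have m2 : MemLp (fun y => (-(I * l * (p.E r : ℂ)) +
        ((p.m * p.a : ℝ) : ℂ) * (I * (k : ℂ))) * u (pol (r, y))) 2 sphereMeasure :=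
      h3.const_mul _
    rw [← coef_radial_mul n j (fun r => ((p.D r / r ^ 2 : ℝ) : ℂ)),
      ← coef_radial_mul n j (fun r => -(I * l * (p.E r : ℂ)) +
        ((p.m * p.a : ℝ) : ℂ) * (I * (k : ℂ)))]
    exact coef_add (H := fun z => ((p.D z.1 / z.1 ^ 2 : ℝ) : ℂ) *
      twistFull (3 / 2 - p.ν) q u du z) (K := fun z => (-(I * l * (p.E z.1 : ℂ)) +
      ((p.m * p.a : ℝ) : ℂ) * (I * (k : ℂ))) * u (pol z)) m1 m2
  rw [h1, e1]
  set A := ‖coef n j (twistFull (3 / 2 - p.ν) q u du) r‖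
  set U := ‖coef n j (fun z => u (pol z)) r‖
  have b1 : ‖((p.D r / r ^ 2 : ℝ) : ℂ)‖ ≤ CD * r ^ 2 := by
    rw [norm_real, Real.norm_of_nonneg (div_nonneg (p.D_nonneg (le_of_lt hrm))
      (by positivity)), div_le_iff₀ (by positivity)]
    calc p.D r ≤ CD * r ^ 4 := hD r (le_of_lt hrm)
      _ = _ := by ring
  have b2 : ‖-(I * l * (p.E r : ℂ)) + ((p.m * p.a : ℝ) : ℂ) * (I * (k : ℂ))‖ ≤
      K * r := by
    refine (norm_add_le _ _).trans ?_
    rw [norm_neg, norm_mul, norm_mul, norm_mul, norm_mul, norm_I, norm_real,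
      norm_real, norm_intCast, one_mul, one_mul, Real.norm_eq_abs,
      Real.norm_eq_abs, hK, add_mul]
    refine add_le_add ?_ ?_
    · calc ‖l‖ * |p.E r| ≤ ‖l‖ * (CE * r) :=
            mul_le_mul_of_nonneg_left (hE r (le_of_lt hrm)).1 (norm_nonneg _)
        _ = _ := by ring
    · have h4 : |p.m * p.a| ≤ 1 := by
        rw [abs_mul, abs_of_pos p.m_pos]
        exact mul_le_one₀ p.m_le_one (abs_nonneg _) p.abs_a_lt_one.le
      calc |p.m * p.a| * |(k : ℝ)| ≤ 1 * |(k : ℝ)| := mul_le_mul_of_nonneg_right h4 (abs_nonneg _)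
        _ = |(k : ℝ)| / p.rp * p.rp := by field_simp
        _ ≤ |(k : ℝ)| / p.rp * r := mul_le_mul_of_nonneg_left (le_of_lt hrm) (by positivity)
  have hA : 0 ≤ A := norm_nonneg _
  have hU : 0 ≤ U := norm_nonneg _
  refine (norm_add_le _ _).trans ?_
  rw [norm_mul, norm_mul]
  calc _ ≤ CD * r ^ 2 * A + K * r * U :=
        add_le_add (mul_le_mul_of_nonneg_right b1 hA) (mul_le_mul_of_nonneg_right b2 hU)
    _ ≤ _ := by
      have := mul_nonneg hK0 (mul_nonneg (sq_nonneg r) hA)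
      have := mul_nonneg hCD.le (mul_nonneg hr0.le hU)
      nlinarith

/-! ### The energy identity -/

/-- The angular velocity of the horizon. -/
def Ω (p : Params) : ℝ := p.a / (p.rp ^ 2 + p.a ^ 2)

/-- The frequency dependent part of the flux that remains in the frame corotating with the
horizon. -/
def drag (p : Params) (k : ℤ) (r : ℝ) : ℝ := k * (p.Ω * p.E r - p.m * p.a)

lemma drag_eq (k : ℤ) (r : ℝ) :
    p.drag k r = k * (p.Ω * (p.D r * p.f r + p.m * (r ^ 2 - p.rp ^ 2))) := by
  have : p.rp ^ 2 + p.a ^ 2 ≠ 0 := by have := p.rp_pos; positivity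
  rw [drag, Ω, E]
  field_simp
  ring

lemma exists_drag_sq_le (p : Params) (k : ℤ) : ∃ C, 0 ≤ C ∧ ∀ r, p.rp ≤ r →
    p.drag k r ^ 2 ≤ C * p.D r := by
  obtain ⟨CD, hCD, hD⟩ := p.exists_D_le_pow
  obtain ⟨Cf, hCf, hf⟩ := p.exists_f_le
  refine ⟨2 * (k * p.Ω) ^ 2 * (CD * Cf ^ 2 + 1), by positivity, fun r hr => ?_⟩
  have hDn := p.D_nonneg hr
  have h1 : p.D r * p.f r ^ 2 ≤ CD * Cf ^ 2 := by
    have h2 : (|p.f r| * r ^ 2) ^ 2 ≤ Cf ^ 2 := pow_le_pow_left₀ (by positivity) (hf r hr) 2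
    calc p.D r * p.f r ^ 2 ≤ CD * r ^ 4 * p.f r ^ 2 :=
          mul_le_mul_of_nonneg_right (hD r hr) (sq_nonneg _)
      _ = CD * (|p.f r| * r ^ 2) ^ 2 := by rw [mul_pow, sq_abs]; ring
      _ ≤ _ := mul_le_mul_of_nonneg_left h2 hCD.le
  have h3 := p.sq_le_D hr
  have h4 : (p.D r * p.f r + p.m * (r ^ 2 - p.rp ^ 2)) ^ 2 ≤ 2 * ((CD * Cf ^ 2 + 1) * p.D r) := by
    have h5 : p.m ^ 2 ≤ 1 := pow_le_one₀ p.m_pos.le p.m_le_one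
    have h6 : p.m ^ 2 * (r ^ 2 - p.rp ^ 2) ^ 2 ≤ p.D r := by
      calc _ ≤ 1 * (r ^ 2 - p.rp ^ 2) ^ 2 := mul_le_mul_of_nonneg_right h5 (sq_nonneg _)
        _ ≤ _ := by rw [one_mul]; exact h3
    have h7 : (p.D r * p.f r) ^ 2 ≤ CD * Cf ^ 2 * p.D r := by
      calc (p.D r * p.f r) ^ 2 = p.D r * p.f r ^ 2 * p.D r := by ring
        _ ≤ _ := mul_le_mul_of_nonneg_right h1 hDn
    nlinarith [sq_nonneg (p.D r * p.f r - p.m * (r ^ 2 - p.rp ^ 2))]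
  rw [drag_eq, ← mul_assoc, mul_pow]
  calc _ ≤ (k * p.Ω) ^ 2 * (2 * ((CD * Cf ^ 2 + 1) * p.D r)) :=
        mul_le_mul_of_nonneg_left h4 (sq_nonneg _)
    _ = _ := by ring

lemma exists_horizon_le (p : Params) (k : ℤ) : ∃ C, 0 ≤ C ∧ ∀ r, p.rp ≤ r → r ≤ p.rp + 2 →
    p.D r / r ^ 2 ≤ C * (r - p.rp) ∧ |p.drag k r| ≤ C * (r - p.rp) := by
  have h0 := p.rp_pos
  obtain ⟨CD, hCD, hD⟩ := p.exists_D_le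
  obtain ⟨Cf, hCf, hf⟩ := p.exists_abs_f_le
  set R := p.rp + 2
  have hR : 0 < R := by positivity
  set C₁ := CD * R ^ 3
  have h1 : ∀ r, p.rp ≤ r → r ≤ R → p.D r ≤ C₁ * (r - p.rp) := fun r hr hrR => by
    refine (hD r hr).trans ?_
    rw [← mul_assoc]
    refine mul_le_mul_of_nonneg_right ?_ (sub_nonneg.2 hr)
    exact mul_le_mul_of_nonneg_left (pow_le_pow_left₀ (h0.le.trans hr) hrR 3) hCD.le
  set C₂ := |(k : ℝ)| * (|p.Ω| * (C₁ * Cf + 2 * R)) with hC₂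
  have hC₁ : 0 ≤ C₁ := by positivity
  have hC₂0 : 0 ≤ C₂ :=
    mul_nonneg (abs_nonneg _) (mul_nonneg (abs_nonneg _) (by positivity))
  refine ⟨C₁ / p.rp ^ 2 + C₂, by positivity, fun r hr hrR => ⟨?_, ?_⟩⟩
  · have hs : 0 ≤ r - p.rp := sub_nonneg.2 hr
    have h2 : p.D r / r ^ 2 ≤ C₁ / p.rp ^ 2 * (r - p.rp) := by
      rw [div_mul_eq_mul_div]
      exact div_le_div₀ (by positivity) (h1 r hr hrR) (by positivity) (pow_le_pow_left₀ h0.le hr 2)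
    have : 0 ≤ C₂ * (r - p.rp) := by positivity
    linarith
  · have hs : 0 ≤ r - p.rp := sub_nonneg.2 hr
    rw [drag_eq, abs_mul, abs_mul]
    have h3 : |p.D r * p.f r + p.m * (r ^ 2 - p.rp ^ 2)| ≤ (C₁ * Cf + 2 * R) * (r - p.rp) := by
      refine (abs_add_le _ _).trans ?_
      rw [abs_mul, abs_mul, abs_of_nonneg (p.D_nonneg hr), abs_of_pos p.m_pos, add_mul]
      refine add_le_add ?_ ?_
      · calc p.D r * |p.f r| ≤ C₁ * (r - p.rp) * Cf :=
              mul_le_mul (h1 r hr hrR) (hf r hr) (abs_nonneg _) (by positivity)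
          _ = _ := by ring
      · have e : r ^ 2 - p.rp ^ 2 = (r + p.rp) * (r - p.rp) := by ring
        rw [e, abs_mul, abs_of_nonneg hs, abs_of_nonneg (by linarith : 0 ≤ r + p.rp)]
        calc p.m * ((r + p.rp) * (r - p.rp)) ≤ 1 * ((r + p.rp) * (r - p.rp)) :=
              mul_le_mul_of_nonneg_right p.m_le_one (mul_nonneg (by linarith) hs)
          _ ≤ _ := by
            rw [one_mul]
            exact mul_le_mul_of_nonneg_right (by linarith) hs
    calc _ ≤ |(k : ℝ)| * (|p.Ω| * ((C₁ * Cf + 2 * R) * (r - p.rp))) :=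
          mul_le_mul_of_nonneg_left (mul_le_mul_of_nonneg_left h3 (abs_nonneg _)) (abs_nonneg _)
      _ = C₂ * (r - p.rp) := by rw [hC₂]; ring
      _ ≤ _ := mul_le_mul_of_nonneg_right (le_add_of_nonneg_left (by positivity)) hs

lemma E_horizon (p : Params) : 0 < p.E p.rp := by
  have h : p.D p.rp = 0 := p.rp_root
  have := p.m_pos
  have := p.rp_pos
  rw [E, h, zero_mul, zero_add]
  positivity

lemma exists_E_pos (p : Params) : ∃ δ, 0 < δ ∧ ∀ r, p.rp ≤ r → r ≤ p.rp + δ → 0 ≤ p.E r := by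
  have h := (p.contDiffAt_E le_rfl).continuousAt.eventually (lt_mem_nhds p.E_horizon)
  obtain ⟨δ, hδ, h⟩ := Metric.eventually_nhds_iff.1 h
  refine ⟨δ / 2, by positivity, fun r hr hrδ => (h ?_).le⟩
  rw [Real.dist_eq, abs_of_nonneg (by linarith)]
  linarith

end Params

lemma re_energy (σ : ℂ) (a x n E B T W V b k : ℝ) :
    (I * conj σ * ((a : ℂ) - 2 * (σ * E + B) * x +
      (-(σ + b) ^ 2 * T - 2 * (σ + b) * k * W + V) * n)).re =
      σ.im * (a - 2 * B * x + (‖σ‖ ^ 2 * T - b ^ 2 * T - 2 * b * k * W + V) * n) := by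
  rw [← normSq_eq_norm_sq, normSq_apply]
  simp only [mul_re, mul_im, add_re, add_im, sub_re,
    sub_im, neg_re, neg_im, I_re, I_im, conj_re,
    conj_im, ofReal_re, ofReal_im, pow_two, re_ofNat,
    im_ofNat]
  ring

lemma re_flux (σ X : ℂ) (D n E B : ℝ) :
    (I * conj σ * ((D : ℂ) * X - I * (σ * E + B) * n)).re =
      D * (I * conj σ * X).re + (‖σ‖ ^ 2 * E + B * σ.re) * n := by
  rw [← normSq_eq_norm_sq, normSq_apply]
  simp only [mul_re, mul_im, add_re, add_im, sub_re,
    sub_im, I_re, I_im, conj_re,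
    conj_im, ofReal_re, ofReal_im]
  ring

namespace Params

variable {p : Params} {l : ℂ} {q : E3 → ℝ} {u F : E3 → ℂ} {du : E3 → E3 →L[ℝ] ℂ}

/-- The integrand of the energy identity. -/
def energyBulk (p : Params) (l : ℂ) (q : E3 → ℝ) (u F : E3 → ℂ) (du : E3 → E3 →L[ℝ] ℂ) :
    ℝ × S2 → ℂ :=
  quadBulk (3 / 2 - p.ν) u du (fun r => r ^ (1 - 2 * p.ν)) (p.fluxRad l q u du)
    (p.bulkZero l q u F du) (p.bulkTwist q u du) (p.fluxAng l u du)

lemma energyBulk_eq {k : ℤ} {z : ℝ × S2} (hz : p.rp < z.1)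
    (hk : angD 2 du z = I * (k : ℂ) * u (pol z)) :
    p.energyBulk l q u F du z =
      ((p.D z.1 / z.1 ^ 4 * ‖twistFull (3 / 2 - p.ν) q u du z‖ ^ 2 +
        p.dth (pol z) * ∑ i, ‖angD i du z‖ ^ 2 : ℝ) : ℂ) -
      2 * (l * p.E z.1 - ((p.m * p.a * k : ℝ) : ℂ)) *
        (((z.1 ^ 2)⁻¹ * (twistFull (3 / 2 - p.ν) q u du z * conj (u (pol z))).im : ℝ) : ℂ) +
      (-l ^ 2 * p.tt (pol z) - 2 * l * (k : ℝ) * p.tphi (pol z) +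
        ((p.pot q (pol z) - p.azi (pol z) * k ^ 2 : ℝ) : ℂ)) * ((‖u (pol z)‖ ^ 2 : ℝ) : ℂ) -
      F (pol z) * conj (u (pol z)) := by
  have hz0 : 0 < z.1 := p.rp_pos.trans hz
  have hz1 : (z.1 : ℂ) ≠ 0 := by exact_mod_cast hz0.ne'
  set V := twistFull (3 / 2 - p.ν) q u du z with hV
  set U := u (pol z) with hU
  have e0 : twistRad (3 / 2 - p.ν) u du z = V - ((z.1 ^ 2 * q (pol z) : ℝ) : ℂ) * U := by
    rw [hV, twistFull]; ring
  have e1 : du (pol z) (vecR (pol z)) = (((z.1 ^ 2)⁻¹ : ℝ) : ℂ) *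
      (V - ((z.1 ^ 2 * q (pol z) : ℝ) : ℂ) * U) - (((3 / 2 - p.ν) / z.1 : ℝ) : ℂ) * U := by
    rw [du_vecR hz0, radD_eq_twistRad (κ := 3 / 2 - p.ν) (u := u) hz0, e0]
  have e2 : du (pol z) (rot 2 (pol z)) = I * (k : ℂ) * U := hk
  have n1 : ((‖V‖ ^ 2 : ℝ) : ℂ) = V * conj V := by
    rw [mul_conj, normSq_eq_norm_sq]
  have n2 : ((‖U‖ ^ 2 : ℝ) : ℂ) = U * conj U := by
    rw [mul_conj, normSq_eq_norm_sq]
  have n3 : ∀ i, ((‖angD i du z‖ ^ 2 : ℝ) : ℂ) = angD i du z * conj (angD i du z) :=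
    fun i => by rw [mul_conj, normSq_eq_norm_sq]
  have n4 : ((V * conj U).im : ℂ) =
      -(I / 2) * (V * conj U - U * conj V) := by
    have h := sub_conj (V * conj U)
    rw [map_mul, conj_conj, mul_comm (conj V)] at h
    rw [h]
    push_cast
    linear_combination ((V * conj U).im : ℂ) * I_sq
  have hsum : ∑ i, p.fluxAng l u du i z * conj (angD i du z) =
      (p.dth (pol z) : ℂ) * ∑ i, angD i du z * conj (angD i du z) +
      (((p.m * p.a : ℝ) : ℂ) * du (pol z) (vecR (pol z)) -
        (p.azi (pol z) : ℂ) * du (pol z) (rot 2 (pol z)) -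
        I * l * (p.tphi (pol z) : ℂ) * U) * conj (angD 2 du z) := by
    simp [fluxAng, jAng, Fin.sum_univ_three, angD]
    ring
  rw [energyBulk, quadBulk, hsum, fluxRad, bulkZero, bulkTwist, ← hV, e0, e1, e2, hk]
  have hw : (z.1 ^ (1 - 2 * p.ν) : ℝ) ≠ 0 := (Real.rpow_pos_of_pos hz0 _).ne'
  generalize z.1 ^ (1 - 2 * p.ν) = w at *
  have hw' : (w : ℂ) ≠ 0 := by exact_mod_cast hw
  push_cast at n1 n2 n3 ⊢
  simp only [n1, n2, n3, n4, map_mul, map_sub, conj_ofReal, conj_I, map_intCast,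
    map_pow]
  have hI := I_sq
  generalize ∑ i, angD i du z * conj (angD i du z) = S
  generalize conj V = Vc
  generalize conj U = Uc
  field_simp
  ring_nf
  simp only [hI]
  ring

/-- The energy in the frame corotating with the horizon is coercive. -/
lemma exists_energyBulk_le (hq : p.IsTwist q) (k : ℤ) : ∃ c C, 0 < c ∧ 0 ≤ C ∧
    ∀ (l : ℂ), 0 < l.im → ∀ (u F : E3 → ℂ) (du : E3 → E3 →L[ℝ] ℂ) (z : ℝ × S2), p.rp < z.1 →
      angD 2 du z = I * (k : ℂ) * u (pol z) →
      l.im * (c * ‖l - ((k * p.Ω : ℝ) : ℂ)‖ ^ 2 - C) * ‖u (pol z)‖ ^ 2 -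
        ‖l - ((k * p.Ω : ℝ) : ℂ)‖ * (‖F (pol z)‖ * ‖u (pol z)‖) ≤
      (I * conj (l - ((k * p.Ω : ℝ) : ℂ)) * p.energyBulk l q u F du z).re := by
  obtain ⟨c, CT, hc, hCT, hT⟩ := p.exists_tt_bounds
  obtain ⟨CW, hCW, hW⟩ := p.exists_tphi_le
  obtain ⟨CB, hCB, hB⟩ := p.exists_drag_sq_le k
  obtain ⟨CV, hV⟩ := hq.pot_bound
  set b : ℝ := k * p.Ω with hb
  refine ⟨c, CB + |CV| + 2 * (k : ℝ) ^ 2 + b ^ 2 * CT + 2 * |b * k| * CW, hc, by positivity, ?_⟩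
  intro l hl u F du z hz hk
  have hz0 : 0 < z.1 := p.rp_pos.trans hz
  have hx := pol_mem_ext p.rp_pos hz
  have hx0 := ne_zero_of_mem_ext p.rp_pos hx
  set σ : ℂ := l - (b : ℂ) with hσ
  have hσi : σ.im = l.im := by simp [hσ]
  set V := twistFull (3 / 2 - p.ν) q u du z with hVd
  set U := u (pol z) with hUd
  set x := (z.1 ^ 2)⁻¹ * (V * conj U).im with hxd
  have e : p.energyBulk l q u F du z = (((p.D z.1 / z.1 ^ 4 * ‖V‖ ^ 2 +
        p.dth (pol z) * ∑ i, ‖angD i du z‖ ^ 2 : ℝ) : ℂ) -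
      2 * (σ * p.E z.1 + p.drag k z.1) * x +
      (-(σ + b) ^ 2 * p.tt (pol z) - 2 * (σ + b) * (k : ℝ) * p.tphi (pol z) +
        ((p.pot q (pol z) - p.azi (pol z) * k ^ 2 : ℝ) : ℂ)) * ((‖U‖ ^ 2 : ℝ) : ℂ)) -
      F (pol z) * conj U := by
    rw [energyBulk_eq hz hk, ← hVd, ← hUd, ← hxd, drag, hσ, hb]
    push_cast
    ring
  have hF : (I * conj σ * (F (pol z) * conj U)).re ≤
      ‖σ‖ * (‖F (pol z)‖ * ‖U‖) := by
    refine (re_le_norm _).trans ?_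
    simp
  rw [e, mul_sub (I * conj σ), sub_re, re_energy, hσi]
  have hD := p.D_pos hz
  have h1 : 2 * p.drag k z.1 * x ≤ p.D z.1 / z.1 ^ 4 * ‖V‖ ^ 2 + CB * ‖U‖ ^ 2 := by
    have h2 : |x| ≤ (z.1 ^ 2)⁻¹ * (‖V‖ * ‖U‖) := by
      rw [hxd, abs_mul, abs_of_nonneg (by positivity)]
      refine mul_le_mul_of_nonneg_left ?_ (by positivity)
      refine (abs_im_le_norm _).trans ?_
      simp
    have h3 : |p.drag k z.1| ≤ Real.sqrt CB * Real.sqrt (p.D z.1) := by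
      rw [← Real.sqrt_mul hCB]
      exact Real.abs_le_sqrt (hB _ hz.le)
    have h4 : |p.drag k z.1| * |x| ≤ Real.sqrt CB * Real.sqrt (p.D z.1) *
        ((z.1 ^ 2)⁻¹ * (‖V‖ * ‖U‖)) := mul_le_mul h3 h2 (abs_nonneg _) (by positivity)
    have h5 : p.drag k z.1 * x ≤ |p.drag k z.1| * |x| := by
      rw [← abs_mul]; exact le_abs_self _
    set A := Real.sqrt (p.D z.1) * (z.1 ^ 2)⁻¹ * ‖V‖ with hA
    set G := Real.sqrt CB * ‖U‖ with hG
    have hA2 : A ^ 2 = p.D z.1 / z.1 ^ 4 * ‖V‖ ^ 2 := by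
      rw [hA, mul_pow, mul_pow, Real.sq_sqrt hD.le]; field_simp
    have hG2 : G ^ 2 = CB * ‖U‖ ^ 2 := by rw [hG, mul_pow, Real.sq_sqrt hCB]
    have h6 : Real.sqrt CB * Real.sqrt (p.D z.1) * ((z.1 ^ 2)⁻¹ * (‖V‖ * ‖U‖)) = A * G := by
      rw [hA, hG]; ring
    rw [← hA2, ← hG2]
    nlinarith [sq_nonneg (A - G)]
  have h2 : 0 ≤ p.dth (pol z) * ∑ i, ‖angD i du z‖ ^ 2 :=
    mul_nonneg (p.dth_pos hx0).le (Finset.sum_nonneg fun i _ => by positivity)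
  have h3 : c * ‖σ‖ ^ 2 ≤ ‖σ‖ ^ 2 * p.tt (pol z) := by
    rw [mul_comm]; exact mul_le_mul_of_nonneg_left (hT _ hx).1 (by positivity)
  have h4 : b ^ 2 * p.tt (pol z) ≤ b ^ 2 * CT :=
    mul_le_mul_of_nonneg_left (hT _ hx).2 (by positivity)
  have h5 : 2 * b * k * p.tphi (pol z) ≤ 2 * |b * k| * CW := by
    have h6 : b * k * p.tphi (pol z) ≤ |b * k| * |p.tphi (pol z)| := by
      rw [← abs_mul]; exact le_abs_self _
    have h7 := mul_le_mul_of_nonneg_left (hW _ hx) (abs_nonneg (b * k))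
    nlinarith
  have h6 : -|CV| ≤ p.pot q (pol z) := by
    have := (hV _ hx).trans (le_abs_self CV)
    exact (abs_le.1 this).1
  have h7 : p.azi (pol z) * (k : ℝ) ^ 2 ≤ 2 * (k : ℝ) ^ 2 :=
    mul_le_mul_of_nonneg_right (p.azi_nonneg_le hx0).2 (by positivity)
  have h8 : c * ‖σ‖ ^ 2 - (CB + |CV| + 2 * (k : ℝ) ^ 2 + b ^ 2 * CT + 2 * |b * k| * CW) + CB ≤
      ‖σ‖ ^ 2 * p.tt (pol z) - b ^ 2 * p.tt (pol z) - 2 * b * k * p.tphi (pol z) +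
        (p.pot q (pol z) - p.azi (pol z) * k ^ 2) := by linarith
  have h9 := mul_le_mul_of_nonneg_right h8 (sq_nonneg ‖U‖)
  have h10 : (c * ‖σ‖ ^ 2 - (CB + |CV| + 2 * (k : ℝ) ^ 2 + b ^ 2 * CT + 2 * |b * k| * CW)) *
      ‖U‖ ^ 2 ≤ p.D z.1 / z.1 ^ 4 * ‖V‖ ^ 2 + p.dth (pol z) * ∑ i, ‖angD i du z‖ ^ 2 -
      2 * p.drag k z.1 * x + (‖σ‖ ^ 2 * p.tt (pol z) - b ^ 2 * p.tt (pol z) -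
        2 * b * k * p.tphi (pol z) + (p.pot q (pol z) - p.azi (pol z) * k ^ 2)) * ‖U‖ ^ 2 := by
    linarith
  have h11 := mul_le_mul_of_nonneg_left h10 hl.le
  linarith

/-- Near the horizon the boundary flux of the energy is nonnegative up to small terms. -/
lemma exists_fluxRad_le (k : ℤ) : ∃ δ C, 0 < δ ∧ 0 ≤ C ∧
    ∀ (l : ℂ) (q : E3 → ℝ) (u : E3 → ℂ) (du : E3 → E3 →L[ℝ] ℂ) (z : ℝ × S2), p.rp < z.1 →
      z.1 ≤ p.rp + δ → angD 2 du z = I * (k : ℂ) * u (pol z) →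
      -(C * ‖l - ((k * p.Ω : ℝ) : ℂ)‖ * (z.1 - p.rp) *
        (‖twistFull (3 / 2 - p.ν) q u du z‖ * ‖u (pol z)‖ + ‖u (pol z)‖ ^ 2)) ≤
      (I * conj (l - ((k * p.Ω : ℝ) : ℂ)) *
        (p.fluxRad l q u du z * conj (u (pol z)))).re := by
  obtain ⟨C, hC, h⟩ := p.exists_horizon_le k
  obtain ⟨δ, hδ, hE⟩ := p.exists_E_pos
  refine ⟨min δ 2, C, lt_min hδ two_pos, hC, fun l q u du z hz hzδ hk => ?_⟩
  have hs : 0 ≤ z.1 - p.rp := by linarith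
  obtain ⟨h1, h2⟩ := h z.1 hz.le (hzδ.trans (add_le_add le_rfl (min_le_right _ _)))
  have h3 := hE z.1 hz.le (hzδ.trans (add_le_add le_rfl (min_le_left _ _)))
  set σ : ℂ := l - ((k * p.Ω : ℝ) : ℂ) with hσ
  set V := twistFull (3 / 2 - p.ν) q u du z with hV
  set U := u (pol z) with hU
  have n2 : ((‖U‖ ^ 2 : ℝ) : ℂ) = U * conj U := by
    rw [mul_conj, normSq_eq_norm_sq]
  have e : p.fluxRad l q u du z * conj U = ((p.D z.1 / z.1 ^ 2 : ℝ) : ℂ) *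
      (V * conj U) - I * (σ * p.E z.1 + p.drag k z.1) * ((‖U‖ ^ 2 : ℝ) : ℂ) := by
    rw [n2, fluxRad, hk, drag, hσ]
    push_cast
    ring
  rw [e, re_flux]
  have b1 : -(‖σ‖ * (‖V‖ * ‖U‖)) ≤ (I * conj σ * (V * conj U)).re := by
    have := (abs_le.1 (abs_re_le_norm
      (I * conj σ * (V * conj U)))).1
    simpa [norm_mul] using this
  have b2 : -(‖σ‖ * (C * (z.1 - p.rp))) ≤ p.drag k z.1 * σ.re := by
    have h4 : |p.drag k z.1 * σ.re| ≤ C * (z.1 - p.rp) * ‖σ‖ := by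
      rw [abs_mul]
      exact mul_le_mul h2 (abs_re_le_norm σ) (abs_nonneg _) (by positivity)
    linarith [(abs_le.1 h4).1]
  have b3 : 0 ≤ p.D z.1 / z.1 ^ 2 := div_nonneg (p.D_nonneg hz.le) (by positivity)
  have b4 := mul_le_mul_of_nonneg_left b1 b3
  have b5 := mul_le_mul_of_nonneg_right h1 (by positivity : 0 ≤ ‖σ‖ * (‖V‖ * ‖U‖))
  have b6 := mul_le_mul_of_nonneg_right b2 (sq_nonneg ‖U‖)
  have b7 : 0 ≤ ‖σ‖ ^ 2 * p.E z.1 * ‖U‖ ^ 2 := by positivity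
  nlinarith

end Params

/-- Cutoffs that increase from `0` to `1` in a shrinking neighbourhood of `c`. -/
def cutNear (c : ℝ) (n : ℕ) (r : ℝ) : ℝ := Real.smoothTransition ((n + 1) * (r - c) - 1)

lemma hasDerivAt_cutNear (c : ℝ) (n : ℕ) (r : ℝ) : HasDerivAt (cutNear c n)
    (deriv Real.smoothTransition ((n + 1) * (r - c) - 1) * (n + 1)) r := by
  have h1 : HasDerivAt Real.smoothTransition
      (deriv Real.smoothTransition ((n + 1) * (r - c) - 1)) ((n + 1) * (r - c) - 1) :=
    ((Real.smoothTransition.contDiff (n := 1)).differentiable one_ne_zero _).hasDerivAt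
  have h2 : HasDerivAt (fun r : ℝ => (n + 1) * (r - c) - 1) ((n : ℝ) + 1) r := by
    simpa using (((hasDerivAt_id r).sub_const c).const_mul ((n : ℝ) + 1)).sub_const 1
  exact h1.comp r h2

lemma cutNear_eq_one {c : ℝ} {n : ℕ} {r : ℝ} (h : c + 2 / (n + 1) ≤ r) : cutNear c n r = 1 := by
  refine Real.smoothTransition.one_of_one_le ?_
  have h1 : 2 / ((n : ℝ) + 1) ≤ r - c := by linarith
  rw [div_le_iff₀ (by positivity)] at h1
  linarith

lemma isCutoff_cutNear (c : ℝ) (n : ℕ) : IsCutoff c (cutNear c n) where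
  smooth := Real.smoothTransition.contDiff.comp
    ((contDiff_const.mul (contDiff_id.sub contDiff_const)).sub contDiff_const)
  nonneg r := Real.smoothTransition.nonneg _
  le_one r := Real.smoothTransition.le_one _
  eq_one := ⟨c + 2 / (n + 1), fun r hr => cutNear_eq_one hr⟩
  eq_zero := ⟨c + 1 / (n + 1), by
      have : 0 < 1 / ((n : ℝ) + 1) := by positivity
      linarith, fun r hr => by
    refine Real.smoothTransition.zero_of_nonpos ?_
    have h1 : r - c ≤ 1 / ((n : ℝ) + 1) := by linarith
    rw [le_div_iff₀ (by positivity)] at h1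
    linarith⟩

lemma deriv_cutNear_nonneg (c : ℝ) (n : ℕ) (r : ℝ) : 0 ≤ deriv (cutNear c n) r := by
  rw [(hasDerivAt_cutNear c n r).deriv]
  exact mul_nonneg Real.smoothTransition.monotone.deriv_nonneg (by positivity)

lemma deriv_cutNear_eq_zero {c : ℝ} {n : ℕ} {r : ℝ} (h : c + 2 / (n + 1) < r) :
    deriv (cutNear c n) r = 0 := by
  have : cutNear c n =ᶠ[𝓝 r] fun _ => 1 := by
    filter_upwards [Ioi_mem_nhds h] with y hy using cutNear_eq_one (le_of_lt hy)
  rw [this.deriv_eq]; simp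

lemma exists_deriv_cutNear_le (c : ℝ) :
    ∃ K, 0 ≤ K ∧ ∀ n r, c < r → deriv (cutNear c n) r * (r - c) ≤ K := by
  obtain ⟨C, hC, h⟩ := exists_bound_deriv_smoothTransition
  refine ⟨2 * C, by positivity, fun n r hr => ?_⟩
  rcases le_or_gt r (c + 2 / (n + 1)) with h1 | h1
  · have h2 : r - c ≤ 2 / ((n : ℝ) + 1) := by linarith
    rw [le_div_iff₀ (by positivity)] at h2
    rw [(hasDerivAt_cutNear c n r).deriv]
    calc _ = deriv Real.smoothTransition ((n + 1) * (r - c) - 1) * ((r - c) * (n + 1)) := by ring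
      _ ≤ C * 2 := mul_le_mul ((le_abs_self _).trans (h _)) h2
        (mul_nonneg (by linarith) (by positivity)) hC
      _ = _ := by ring
  · rw [deriv_cutNear_eq_zero h1, zero_mul]; positivity

lemma tendsto_cutNear {c r : ℝ} (h : c < r) : ∀ᶠ n : ℕ in atTop, c + 2 / (n + 1) < r := by
  have h1 : Tendsto (fun n : ℕ => c + 2 / ((n : ℝ) + 1)) atTop (𝓝 (c + 0)) :=
    tendsto_const_nhds.add (tendsto_const_nhds.div_atTop
      (tendsto_atTop_add_const_right _ _ tendsto_natCast_atTop_atTop))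
  rw [add_zero] at h1
  exact h1.eventually_lt_const h

/-- An integral inequality with cutoffs, in the limit of the cutoffs exhausting the domain. -/
lemma integral_nonpos_of_cutNear {c : ℝ} {G M : ℝ × S2 → ℝ} (hG : Integrable G (polMeasure c))
    (hM : Integrable M (polMeasure c))
    (h : ∀ᶠ n : ℕ in atTop, ∫ z, (cutNear c n z.1 * G z -
      (Iio (c + 3 / ((n : ℝ) + 1))).indicator (fun _ => (1 : ℝ)) z.1 * M z) ∂polMeasure c ≤ 0) :
    ∫ z, G z ∂polMeasure c ≤ 0 := by
  have hlim : Tendsto (fun n : ℕ => ∫ z, (cutNear c n z.1 * G z -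
      (Iio (c + 3 / ((n : ℝ) + 1))).indicator (fun _ => (1 : ℝ)) z.1 * M z) ∂polMeasure c) atTop
      (𝓝 (∫ z, G z ∂polMeasure c)) := by
    refine tendsto_integral_of_dominated_convergence (fun z => |G z| + |M z|) (fun n => ?_)
      (hG.abs.add hM.abs) (fun n => Eventually.of_forall fun z => ?_) ?_
    · refine ((((isCutoff_cutNear c n).smooth.continuous.comp
        continuous_fst).aestronglyMeasurable).mul hG.aestronglyMeasurable).sub (AEStronglyMeasurable.mul ?_ hM.aestronglyMeasurable)
      exact ((measurable_const.indicator measurableSet_Iio).comp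
        measurable_fst).aestronglyMeasurable
    · refine (norm_sub_le _ _).trans (add_le_add ?_ ?_)
      · rw [Real.norm_eq_abs, abs_mul, abs_of_nonneg ((isCutoff_cutNear c n).nonneg _)]
        exact mul_le_of_le_one_left (abs_nonneg _) ((isCutoff_cutNear c n).le_one _)
      · rw [Real.norm_eq_abs, abs_mul]
        refine mul_le_of_le_one_left (abs_nonneg _) ?_
        by_cases hz : z.1 ∈ Iio (c + 3 / ((n : ℝ) + 1)) <;> simp [hz]
    · filter_upwards [ae_fst_mem c] with z hz
      refine tendsto_const_nhds.congr' ?_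
      have h1 : Tendsto (fun n : ℕ => c + 3 / ((n : ℝ) + 1)) atTop (𝓝 (c + 0)) :=
        tendsto_const_nhds.add (tendsto_const_nhds.div_atTop
          (tendsto_atTop_add_const_right _ _ tendsto_natCast_atTop_atTop))
      rw [add_zero] at h1
      filter_upwards [tendsto_cutNear hz, h1.eventually_lt_const hz] with n h2 h3
      rw [cutNear_eq_one h2.le, indicator_of_notMem (by simpa using h3.le)]
      ring
  exact le_of_tendsto hlim h

namespace Params

variable {p : Params} {l : ℂ} {q : E3 → ℝ} {u F : E3 → ℂ} {du : E3 → E3 →L[ℝ] ℂ}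

/-- The energy estimate in a mode. -/
lemma exists_energy_le (hq : p.IsTwist q) (k : ℤ) : ∃ c C, 0 < c ∧ 0 ≤ C ∧
    ∀ (l : ℂ), 0 < l.im → ∀ (u F : E3 → ℂ) (du : E3 → E3 →L[ℝ] ℂ),
      WeakSystem p.rp (3 / 2 - p.ν) u du (fun r => r ^ (1 - 2 * p.ν)) (p.fluxRad l q u du)
        (p.bulkZero l q u F du) (p.bulkTwist q u du) (p.fluxAng l u du) →
      MemLp (fun z => F (pol z)) 2 (polMeasure p.rp) →
      (∀ᵐ z ∂polMeasure p.rp, angD 2 du z = I * (k : ℂ) * u (pol z)) →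
      l.im * (c * ‖l - ((k * p.Ω : ℝ) : ℂ)‖ ^ 2 - C) * ∫ z, ‖u (pol z)‖ ^ 2 ∂polMeasure p.rp ≤
        ‖l - ((k * p.Ω : ℝ) : ℂ)‖ * ∫ z, ‖F (pol z)‖ * ‖u (pol z)‖ ∂polMeasure p.rp := by
  obtain ⟨c, C, hc, hC, hbulk⟩ := exists_energyBulk_le hq k
  obtain ⟨δ, C', hδ, hC', hflux⟩ := p.exists_fluxRad_le k
  obtain ⟨K, hK, hcut⟩ := exists_deriv_cutNear_le p.rp
  refine ⟨c, C, hc, hC, fun l hl u F du hW hF hk => ?_⟩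
  have hb := hbulk l hl u F du
  have hf := hflux l q u du
  set σ : ℂ := l - ((k * p.Ω : ℝ) : ℂ)
  set V := twistFull (3 / 2 - p.ν) q u du
  have hV : MemLp V 2 (polMeasure p.rp) :=
    memLp_twistFull hq hW.weakDeriv hW.memLp_u hW.memLp_rad
  have iu : Integrable (fun z => ‖u (pol z)‖ ^ 2) (polMeasure p.rp) :=
    hW.memLp_u.norm.integrable_sq
  have iF : Integrable (fun z => ‖F (pol z)‖ * ‖u (pol z)‖) (polMeasure p.rp) :=
    hF.norm.integrable_mul hW.memLp_u.norm
  have iV : Integrable (fun z => ‖V z‖ * ‖u (pol z)‖) (polMeasure p.rp) :=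
    hV.norm.integrable_mul hW.memLp_u.norm
  set A := l.im * (c * ‖σ‖ ^ 2 - C)
  have main := integral_nonpos_of_cutNear
    (G := fun z => A * ‖u (pol z)‖ ^ 2 - ‖σ‖ * (‖F (pol z)‖ * ‖u (pol z)‖))
    (M := fun z => K * (C' * ‖σ‖) * (‖V z‖ * ‖u (pol z)‖ + ‖u (pol z)‖ ^ 2))
    ((iu.const_mul A).sub (iF.const_mul ‖σ‖)) ((iV.add iu).const_mul _) ?_
  · rw [integral_sub (iu.const_mul A) (iF.const_mul ‖σ‖), integral_const_mul,
      integral_const_mul] at main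
    linarith
  filter_upwards [tendsto_cutNear (show p.rp < p.rp + δ by linarith)] with n hn
  have hχ := isCutoff_cutNear p.rp n
  set W : ℝ × S2 → ℂ := fun z => I * conj σ * ((cutNear p.rp n z.1 : ℂ) *
      p.energyBulk l q u F du z + ((deriv (cutNear p.rp n) z.1 : ℝ) : ℂ) *
      (p.fluxRad l q u du z * conj (u (pol z)))) with hWd
  have hint : Integrable W (polMeasure p.rp) :=
    (hW.identity hχ).1.const_mul (I * conj σ)
  have hid : ∫ z, W z ∂polMeasure p.rp = 0 := by
    rw [hWd, integral_const_mul]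
    exact mul_eq_zero_of_right _ (hW.identity hχ).2
  have hre : ∫ z, (W z).re ∂polMeasure p.rp = 0 := by
    refine (integral_re hint).trans ?_
    rw [hid]; simp
  rw [← hre]
  refine integral_mono_ae ?_ hint.re ?_
  · refine (((iu.const_mul A).sub (iF.const_mul ‖σ‖)).bdd_mul (c := 1)
      (hχ.smooth.continuous.comp continuous_fst).aestronglyMeasurable
      (.of_forall fun z => ?_)).sub
      (((iV.add iu).const_mul _).bdd_mul (c := 1) ((measurable_const.indicator
        measurableSet_Iio).comp measurable_fst).aestronglyMeasurable
        (.of_forall fun z => ?_))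
    · simp only [Function.comp]
      rw [Real.norm_of_nonneg (hχ.nonneg _)]; exact hχ.le_one _
    · by_cases hz : z.1 ∈ Iio (p.rp + 3 / ((n : ℝ) + 1)) <;> simp [hz]
  · filter_upwards [ae_fst_mem p.rp, hk] with z hz hkz
    have h1 := mul_le_mul_of_nonneg_left (hb z hz hkz) (hχ.nonneg z.1)
    have e : (W z).re =
        cutNear p.rp n z.1 * (I * conj σ * p.energyBulk l q u F du z).re +
        deriv (cutNear p.rp n) z.1 * (I * conj σ *
          (p.fluxRad l q u du z * conj (u (pol z)))).re := by
      rw [← re_ofReal_mul, ← re_ofReal_mul, ← add_re]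
      congr 1; simp only [hWd]; ring
    refine le_of_le_of_eq ?_ e.symm
    rw [sub_eq_add_neg]
    refine add_le_add h1 ?_
    rcases le_or_gt z.1 (p.rp + 2 / (n + 1)) with h2 | h2
    · have h3 : z.1 ∈ Iio (p.rp + 3 / ((n : ℝ) + 1)) := by
        refine lt_of_le_of_lt h2 ?_
        have : 2 / ((n : ℝ) + 1) < 3 / ((n : ℝ) + 1) := by gcongr; norm_num
        linarith
      rw [indicator_of_mem h3, one_mul]
      have h4 := mul_le_mul_of_nonneg_left (hf z hz (h2.trans hn.le) hkz)
        (deriv_cutNear_nonneg p.rp n z.1)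
      refine le_trans ?_ h4
      have h5 := mul_le_mul_of_nonneg_right (hcut n z.1 hz)
        (show 0 ≤ C' * ‖σ‖ * (‖V z‖ * ‖u (pol z)‖ + ‖u (pol z)‖ ^ 2) by positivity)
      linarith
    · rw [deriv_cutNear_eq_zero h2, zero_mul]
      have : 0 ≤ (Iio (p.rp + 3 / ((n : ℝ) + 1))).indicator (fun _ => (1 : ℝ)) z.1 :=
        indicator_nonneg (fun _ _ => zero_le_one) _
      have h6 : 0 ≤ K * (C' * ‖σ‖) * (‖V z‖ * ‖u (pol z)‖ + ‖u (pol z)‖ ^ 2) := by positivity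
      nlinarith [mul_nonneg this h6]

end Params

lemma norm_vecR {x : E3} (hx : x ≠ 0) : ‖vecR x‖ = 1 := by
  rw [vecR, norm_smul, norm_inv, norm_norm, inv_mul_cancel₀ (norm_ne_zero_iff.2 hx)]

lemma norm_smul_vecR {x : E3} (hx : x ≠ 0) : ‖x‖ • vecR x = x := by
  rw [vecR, smul_smul, mul_inv_cancel₀ (norm_ne_zero_iff.2 hx), one_smul]

lemma hasDerivAt_ray {G : E3 → ℝ} {x : E3} (hx : x ≠ 0) (hG : DifferentiableAt ℝ G x) :
    HasDerivAt (fun r : ℝ => G (r • vecR x)) (fderiv ℝ G x (vecR x)) ‖x‖ := by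
  have h1 : HasDerivAt (fun r : ℝ => r • vecR x) (vecR x) ‖x‖ := by
    simpa using (hasDerivAt_id ‖x‖).smul_const (vecR x)
  have h2 : HasFDerivAt G (fderiv ℝ G x) (‖x‖ • vecR x) := by
    rw [norm_smul_vecR hx]; exact hG.hasFDerivAt
  exact h2.comp_hasDerivAt _ h1

lemma fderiv_vecR_eq {G : E3 → ℝ} {x : E3} (hx : x ≠ 0) (hG : DifferentiableAt ℝ G x) {g : ℝ → ℝ}
    {g' : ℝ} (hg : (fun r : ℝ => G (r • vecR x)) =ᶠ[𝓝 ‖x‖] g) (h : HasDerivAt g g' ‖x‖) :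
    fderiv ℝ G x (vecR x) = g' :=
  (hasDerivAt_ray hx hG).unique (h.congr_of_eventuallyEq hg)

namespace Params

variable (p : Params) {q : E3 → ℝ}

lemma contDiffOn_twist (hq : ContDiffOn ℝ ∞ q (ext p.rp)) : ContDiffOn ℝ ∞
    (fun x : E3 => p.D ‖x‖ * ((3 / 2 - p.ν) / ‖x‖ + q x)) (ext p.rp) :=
  p.contDiffOn_D.mul ((contDiffOn_const.div (contDiffOn_norm p.rp_pos) fun _ hx =>
    norm_ne_zero_iff.2 (ne_zero_of_mem_ext p.rp_pos hx)).add hq)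

lemma continuousOn_pot (hq : ContDiffOn ℝ ∞ q (ext p.rp)) : ContinuousOn (p.pot q) (ext p.rp) := by
  have h0 := p.rp_pos
  have hn : ContinuousOn (fun x : E3 => ‖x‖) (ext p.rp) := continuous_norm.continuousOn
  have hn0 : ∀ x ∈ ext p.rp, ‖x‖ ≠ 0 := fun x hx => (h0.trans hx).ne'
  have h1 : ContinuousOn (fun x : E3 => fderiv ℝ
      (fun x => p.D ‖x‖ * ((3 / 2 - p.ν) / ‖x‖ + q x)) x (vecR x)) (ext p.rp) :=
    ((p.contDiffOn_twist hq).continuousOn_fderiv_of_isOpen (isOpen_ext _) (by simp)).clm_apply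
      (continuousOn_vecR h0)
  exact (h1.sub (p.contDiffOn_D.continuousOn.mul (((continuousOn_const.div hn hn0).add
    hq.continuousOn).pow 2))).add (continuousOn_const.mul p.contDiffOn_rho.continuousOn)

lemma pot_eq {x : E3} (hx : x ∈ ext p.rp) (hq : ContDiffOn ℝ ∞ q (ext p.rp))
    (h : fderiv ℝ q x (vecR x) = (2 * (3 / 2 - p.ν) - 4) * q x / ‖x‖ + q x ^ 2) :
    p.pot q x = (‖x‖ * q x) * (-2 * (1 + p.a ^ 2) + 6 * p.M * ‖x‖⁻¹ - 4 * p.a ^ 2 * ‖x‖⁻¹ ^ 2) +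
      (2 * (1 + p.a ^ 2) * (3 / 2 - p.ν) - 2 * p.M * (3 / 2 - p.ν) * ‖x‖⁻¹ -
        ((3 / 2 - p.ν) + (3 / 2 - p.ν) ^ 2) *
          ((1 + p.a ^ 2) - 2 * p.M * ‖x‖⁻¹ + p.a ^ 2 * ‖x‖⁻¹ ^ 2) +
        (p.ν ^ 2 - 9 / 4) * (p.a ^ 2 * (x 2 / ‖x‖) ^ 2)) := by
  have hx0 := ne_zero_of_mem_ext p.rp_pos hx
  have hn := norm_ne_zero_iff.2 hx0
  have hd : DifferentiableAt ℝ (fun x : E3 => p.D ‖x‖ * ((3 / 2 - p.ν) / ‖x‖ + q x)) x :=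
    ((p.contDiffOn_twist hq).contDiffAt ((isOpen_ext _).mem_nhds hx)).differentiableAt (by simp)
  have hq := (hq.contDiffAt ((isOpen_ext _).mem_nhds hx)).differentiableAt (by simp)
  have h1 := hasDerivAt_ray hx0 hq
  rw [h] at h1
  have h2 := (p.hasDerivAt_D ‖x‖).mul ((((hasDerivAt_inv hn).const_mul (3 / 2 - p.ν))).add h1)
  have h3 := fderiv_vecR_eq hx0 hd (g := p.D * ((fun r => (3 / 2 - p.ν) * r⁻¹) +
    fun r => q (r • vecR x))) (by
      filter_upwards [Ioi_mem_nhds (norm_pos_iff.2 hx0)] with r hr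
      have : ‖r • vecR x‖ = r := by
        rw [norm_smul, norm_vecR hx0, mul_one, Real.norm_of_nonneg (le_of_lt hr)]
      simp only [this, Pi.mul_apply, Pi.add_apply, div_eq_mul_inv]) h2
  rw [pot, h3, rho]
  simp only [Pi.add_apply, norm_smul_vecR hx0, D, deltaR]
  field_simp
  ring

/-- A sufficient condition for an admissible twist: `q` solves a Riccati equation away from a
compact set. -/
lemma isTwist_of_riccati (hq : ContDiffOn ℝ ∞ q (ext p.rp))
    (hb : ∃ C, 0 ≤ C ∧ ∀ x ∈ ext p.rp, |q x| ≤ C * ‖x‖ ^ (-1 - 2 * p.ν)) {R₀ R₁ : ℝ}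
    (hR : p.rp < R₀) (h : ∀ x ∈ ext p.rp, ‖x‖ < R₀ ∨ R₁ < ‖x‖ →
      fderiv ℝ q x (vecR x) = (2 * (3 / 2 - p.ν) - 4) * q x / ‖x‖ + q x ^ 2) : p.IsTwist q := by
  refine ⟨hq, hb, ?_⟩
  have h0 := p.rp_pos
  obtain ⟨C, hC, hb⟩ := hb
  have hK : IsCompact {x : E3 | R₀ ≤ ‖x‖ ∧ ‖x‖ ≤ R₁} := by
    refine (isCompact_closedBall (0 : E3) R₁).of_isClosed_subset
      ((isClosed_le continuous_const continuous_norm).inter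
        (isClosed_le continuous_norm continuous_const)) fun x hx => ?_
    simpa using hx.2
  obtain ⟨C₁, hC₁⟩ := hK.exists_bound_of_continuousOn
    ((p.continuousOn_pot hq).mono fun x hx => hR.trans_le hx.1)
  set B := C * p.rp ^ (-(2 * p.ν))
  obtain ⟨C₂, hC₂⟩ := ((isCompact_Icc (a := -B) (b := B)).prod ((isCompact_Icc (a := 0)
      (b := p.rp⁻¹)).prod (isCompact_Icc (a := (0 : ℝ)) (b := 1)))).exists_bound_of_continuousOn
    (f := fun w : ℝ × ℝ × ℝ =>
      w.1 * (-2 * (1 + p.a ^ 2) + 6 * p.M * w.2.1 - 4 * p.a ^ 2 * w.2.1 ^ 2) +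
      (2 * (1 + p.a ^ 2) * (3 / 2 - p.ν) - 2 * p.M * (3 / 2 - p.ν) * w.2.1 -
        ((3 / 2 - p.ν) + (3 / 2 - p.ν) ^ 2) *
          ((1 + p.a ^ 2) - 2 * p.M * w.2.1 + p.a ^ 2 * w.2.1 ^ 2) +
        (p.ν ^ 2 - 9 / 4) * (p.a ^ 2 * w.2.2))) (by fun_prop)
  refine ⟨max C₁ C₂, fun x hx => ?_⟩
  have hx0 := ne_zero_of_mem_ext h0 hx
  have hn : 0 < ‖x‖ := h0.trans hx
  by_cases hxK : R₀ ≤ ‖x‖ ∧ ‖x‖ ≤ R₁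
  · exact (hC₁ x hxK).trans (le_max_left _ _)
  rw [not_and_or, not_le, not_le] at hxK
  rw [p.pot_eq hx hq (h x hx hxK)]
  refine le_trans ?_ (le_max_right C₁ C₂)
  refine hC₂ (‖x‖ * q x, ‖x‖⁻¹, (x 2 / ‖x‖) ^ 2) ⟨?_, ⟨by positivity, ?_⟩, by positivity, ?_⟩
  · rw [mem_Icc, ← abs_le, abs_mul, abs_of_pos hn]
    calc ‖x‖ * |q x| ≤ ‖x‖ * (C * ‖x‖ ^ (-1 - 2 * p.ν)) :=
          mul_le_mul_of_nonneg_left (hb x hx) hn.le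
      _ = C * (‖x‖ ^ (1 : ℝ) * ‖x‖ ^ (-1 - 2 * p.ν)) := by rw [Real.rpow_one]; ring
      _ = C * ‖x‖ ^ (-(2 * p.ν)) := by rw [← Real.rpow_add hn]; ring_nf
      _ ≤ B := mul_le_mul_of_nonneg_left
        (Real.rpow_le_rpow_of_nonpos h0 (le_of_lt hx) (by linarith [p.ν_pos])) hC
  · exact inv_anti₀ h0 (le_of_lt hx)
  · rw [div_pow, div_le_one (by positivity), norm_sq_E3 x]
    nlinarith [sq_nonneg (x 0), sq_nonneg (x 1)]

lemma isTwist_zero : p.IsTwist 0 := by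
  refine p.isTwist_of_riccati contDiffOn_const ⟨0, le_rfl, fun x _ => by simp⟩
    (R₀ := p.rp + 1) (R₁ := 0) (by linarith) fun x _ _ => ?_
  simp

/-- The correction of the twist adapted to the Robin condition with function `2νb`, cut off to
`r ≥ R`. -/
def robinTwist (b : E3 → ℝ) (R : ℝ) (x : E3) : ℝ :=
  2 * p.ν * (Real.smoothTransition (‖x‖ - R) * rayExt b x) /
    (‖x‖ * (‖x‖ ^ (2 * p.ν) + Real.smoothTransition (‖x‖ - R) * rayExt b x))

lemma rayExt_smul_vecR (b : E3 → ℝ) {x : E3} (hx : x ≠ 0) {r : ℝ} (hr : 0 < r) :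
    rayExt b (r • vecR x) = rayExt b x := by
  rw [rayExt, norm_smul, norm_vecR hx, mul_one, Real.norm_of_nonneg hr.le, smul_smul,
    inv_mul_cancel₀ hr.ne', one_smul]
  rfl

lemma half_le_robin_den {b : E3 → ℝ} {B R : ℝ} (hR0 : 0 < R) (hB : ∀ y, ‖y‖ = 1 → |b y| ≤ B)
    (hR : 2 * B ≤ R ^ (2 * p.ν)) {x : E3} (hx : x ≠ 0) :
    ‖x‖ ^ (2 * p.ν) / 2 ≤ ‖x‖ ^ (2 * p.ν) + Real.smoothTransition (‖x‖ - R) * rayExt b x ∧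
      |Real.smoothTransition (‖x‖ - R) * rayExt b x| ≤ B := by
  have hb := hB (‖x‖⁻¹ • x) (norm_vecR hx)
  have hB0 := (abs_nonneg _).trans hb
  have h1 : |Real.smoothTransition (‖x‖ - R) * rayExt b x| ≤ B := by
    rw [abs_mul, abs_of_nonneg (Real.smoothTransition.nonneg _)]
    exact (mul_le_of_le_one_left (abs_nonneg _) (Real.smoothTransition.le_one _)).trans hb
  refine ⟨?_, h1⟩
  have hn : 0 < ‖x‖ := norm_pos_iff.2 hx
  rcases le_or_gt ‖x‖ R with h | h
  · rw [Real.smoothTransition.zero_of_nonpos (by linarith), zero_mul, add_zero]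
    have : 0 < ‖x‖ ^ (2 * p.ν) := by positivity
    linarith
  · have h2 : R ^ (2 * p.ν) ≤ ‖x‖ ^ (2 * p.ν) :=
      Real.rpow_le_rpow hR0.le h.le (by linarith [p.ν_pos])
    linarith [(abs_le.1 h1).1]

lemma isTwist_robinTwist {b : E3 → ℝ} (hb : ContDiff ℝ ∞ b) {B R : ℝ} (hRp : p.rp < R)
    (hB : ∀ y, ‖y‖ = 1 → |b y| ≤ B) (hR : 2 * B ≤ R ^ (2 * p.ν)) :
    p.IsTwist (p.robinTwist b R) := by
  have h0 := p.rp_pos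
  have hν := p.ν_pos
  have hR0 := h0.trans hRp
  have hden : ∀ x ∈ ext p.rp, 0 < ‖x‖ ^ (2 * p.ν) +
      Real.smoothTransition (‖x‖ - R) * rayExt b x := fun x hx => by
    have hx0 := ne_zero_of_mem_ext h0 hx
    have : 0 < ‖x‖ ^ (2 * p.ν) := Real.rpow_pos_of_pos (norm_pos_iff.2 hx0) _
    linarith [(p.half_le_robin_den hR0 hB hR hx0).1]
  have hs : ContDiffOn ℝ ∞ (fun x : E3 => Real.smoothTransition (‖x‖ - R) * rayExt b x)
      (ext p.rp) :=
    (p.contDiffOn_radial_comp (g := fun r => Real.smoothTransition (r - R)) fun r _ =>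
      (Real.smoothTransition.contDiff.comp (contDiff_id.sub contDiff_const)).contDiffAt).mul
      (contDiffOn_rayExt h0 hb)
  have hq : ContDiffOn ℝ ∞ (p.robinTwist b R) (ext p.rp) :=
    (contDiffOn_const.mul hs).div ((contDiffOn_norm h0).mul
      ((contDiffOn_norm_rpow h0 _).add hs)) fun x hx =>
      mul_ne_zero (h0.trans hx).ne' (hden x hx).ne'
  refine p.isTwist_of_riccati hq ⟨4 * p.ν * B, ?_, fun x hx => ?_⟩ hRp (R₁ := R + 1)
    fun x hx hxR => ?_
  · have := (abs_nonneg _).trans (hB (basisVec 0) (by simp))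
    exact mul_nonneg (by linarith) this
  · have hx0 := ne_zero_of_mem_ext h0 hx
    have hn : 0 < ‖x‖ := h0.trans hx
    obtain ⟨h1, h2⟩ := p.half_le_robin_den hR0 hB hR hx0
    have h3 := hden x hx
    have h4 : 0 < ‖x‖ ^ (2 * p.ν) := by positivity
    have hB0 := (abs_nonneg _).trans h2
    rw [robinTwist, abs_div, abs_mul (2 * p.ν), abs_of_pos (by positivity : 0 < 2 * p.ν),
      abs_of_pos (mul_pos hn h3), div_le_iff₀ (mul_pos hn h3)]
    have e : ‖x‖ ^ (-1 - 2 * p.ν) * (‖x‖ * ‖x‖ ^ (2 * p.ν)) = 1 := by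
      nth_rewrite 2 [← Real.rpow_one ‖x‖]
      rw [← Real.rpow_add hn, ← Real.rpow_add hn]
      ring_nf; simp
    have h5 : 0 < ‖x‖ ^ (-1 - 2 * p.ν) := by positivity
    calc 2 * p.ν * |Real.smoothTransition (‖x‖ - R) * rayExt b x| ≤ 2 * p.ν * B := by gcongr
      _ = 4 * p.ν * B * (‖x‖ ^ (-1 - 2 * p.ν) * (‖x‖ * ‖x‖ ^ (2 * p.ν))) / 2 := by rw [e]; ring
      _ = 4 * p.ν * B * ‖x‖ ^ (-1 - 2 * p.ν) * (‖x‖ * (‖x‖ ^ (2 * p.ν) / 2)) := by ring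
      _ ≤ _ := by gcongr
  · have hx0 := ne_zero_of_mem_ext h0 hx
    have hn : 0 < ‖x‖ := h0.trans hx
    have hqd : DifferentiableAt ℝ (p.robinTwist b R) x :=
      (hq.contDiffAt ((isOpen_ext _).mem_nhds hx)).differentiableAt (by simp)
    have hray : ∀ r, 0 < r → ‖r • vecR x‖ = r := fun r hr => by
      rw [norm_smul, norm_vecR hx0, mul_one, Real.norm_of_nonneg hr.le]
    rcases hxR with hlt | hgt
    · have e0 : p.robinTwist b R x = 0 := by
        rw [robinTwist, Real.smoothTransition.zero_of_nonpos (by linarith)]; simp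
      rw [e0, fderiv_vecR_eq hx0 hqd (g := fun _ => 0) (g' := 0) ?_ (hasDerivAt_const _ _)]
      · simp
      · filter_upwards [Ioo_mem_nhds hn hlt] with r hr
        rw [robinTwist, hray r hr.1, Real.smoothTransition.zero_of_nonpos (by linarith [hr.2])]
        simp
    · set y := rayExt b x with hy
      have hone : ∀ r, R + 1 < r → Real.smoothTransition (r - R) = 1 := fun r hr =>
        Real.smoothTransition.one_of_one_le (by linarith)
      have h3 := hden x hx
      rw [hone _ hgt, one_mul] at h3
      have hd : HasDerivAt (fun r : ℝ => 2 * p.ν * y / (r * (r ^ (2 * p.ν) + y)))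
          ((0 * (‖x‖ * (‖x‖ ^ (2 * p.ν) + y)) - 2 * p.ν * y * (1 * (‖x‖ ^ (2 * p.ν) + y) +
            ‖x‖ * (2 * p.ν * ‖x‖ ^ (2 * p.ν - 1)))) / (‖x‖ * (‖x‖ ^ (2 * p.ν) + y)) ^ 2) ‖x‖ :=
        (hasDerivAt_const _ _).div ((hasDerivAt_id _).mul
          ((Real.hasDerivAt_rpow_const (Or.inl hn.ne')).add_const y)) (by
            exact (mul_pos hn h3).ne')
      rw [fderiv_vecR_eq hx0 hqd ?_ hd, robinTwist, hone _ hgt, ← hy, Real.rpow_sub_one hn.ne']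
      · generalize ‖x‖ ^ (2 * p.ν) = Y at *
        field_simp
        ring
      · filter_upwards [Ioi_mem_nhds hgt] with r hr
        have hr0 : 0 < r := by linarith [mem_Ioi.1 hr]
        rw [robinTwist, hray r hr0, hone r hr, rayExt_smul_vecR b hx0 hr0, one_mul]

end Params

namespace Params

variable {p : Params} {l : ℂ} {q : E3 → ℝ} {u F : E3 → ℂ} {du : E3 → E3 →L[ℝ] ℂ}

lemma twistFull_zero (κ : ℝ) (u : E3 → ℂ) (du : E3 → E3 →L[ℝ] ℂ) :
    twistFull κ 0 u du = twistRad κ u du := by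
  funext z; simp [twistFull]

lemma tendsto_of_dirichlet (h : TendsToZeroOnSphere (p.preTraceMinus u)) (n : ℕ)
    (j : Fin (angDim n)) :
    Tendsto (fun r => ((r ^ (3 / 2 - p.ν) : ℝ) : ℂ) * coef n j (fun z => u (pol z)) r) essAtTop
      (𝓝 0) := by
  refine (h (fun y => (angFun n j y : ℂ))
    (ofRealCLM.contDiff.comp (angFun_contDiff n j))).congr fun r => ?_
  rw [coef, fib, ← integral_const_mul]
  refine integral_congr_ae (.of_forall fun y => ?_)
  simp only [preTraceMinus, pol]
  ring

lemma flux_twist_zero (h : IsWeakDeriv p.X u du)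
    (hu : MemLp (fun z => u (pol z)) 2 (polMeasure p.rp))
    (hr : MemLp (twistRad (3 / 2 - p.ν) u du) 2 (polMeasure p.rp)) {k : ℤ}
    (hk : ∀ᵐ z ∂polMeasure p.rp, angD 2 du z = I * (k : ℂ) * u (pol z)) (l : ℂ)
    (h0 : 1 ≤ p.ν ∨ TendsToZeroOnSphere (p.preTraceMinus u)) (n : ℕ) (j : Fin (angDim n)) :
    Tendsto (fun N : ℕ => (N : ℝ)⁻¹ * ∫ r in Icc (N : ℝ) (2 * N),
      ‖coef n j (p.fluxRad l 0 u du) r‖ * ‖coef n j (fun z => u (pol z)) r‖) atTop (𝓝 0) := by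
  obtain ⟨C, hC, hA⟩ := exists_coef_fluxRad_le p.isTwist_zero h hu hr hk l
  have hA' := hA n j
  rw [twistFull_zero] at hA'
  refine flux_of_trace_zero p.ν_pos rfl p.rp_pos h hu hr (fun B ℓ hB hℓ => ?_) hA' hC
  rcases h0 with h1 | h1
  · exact trace_eq_zero_of_one_le h1 rfl p.rp_pos hu hB hℓ
  · exact trace_eq_zero_of_tendsto hB hℓ (tendsto_of_dirichlet h1 n j)

lemma abs_robinTwist_sub_le {b : E3 → ℝ} {B R : ℝ} (hR0 : 0 < R) (hB : ∀ y, ‖y‖ = 1 → |b y| ≤ B)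
    (hR : 2 * B ≤ R ^ (2 * p.ν)) {z : ℝ × S2} (hz : R + 1 < z.1) :
    |z.1 ^ (2 * p.ν + 1) * p.robinTwist b R (pol z) - 2 * p.ν * b z.2| ≤
      4 * p.ν * B ^ 2 * z.1 ^ (-(2 * p.ν)) := by
  have hz0 : 0 < z.1 := by linarith
  have hx0 : pol z ≠ 0 := by
    rw [← norm_pos_iff, norm_pol hz0.le]; exact hz0
  have h1 := (p.half_le_robin_den hR0 hB hR hx0).1
  have hν := p.ν_pos
  rw [robinTwist]
  rw [norm_pol hz0.le, Real.smoothTransition.one_of_one_le (by linarith), one_mul,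
    rayExt_pol b hz0] at h1 ⊢
  have hb := hB z.2 (by simp)
  rw [Real.rpow_add_one hz0.ne', Real.rpow_neg hz0.le]
  have hY : 0 < z.1 ^ (2 * p.ν) := by positivity
  generalize z.1 ^ (2 * p.ν) = Y at *
  have hd : 0 < Y + b z.2 := by linarith
  have e : Y * z.1 * (2 * p.ν * b z.2 / (z.1 * (Y + b z.2))) - 2 * p.ν * b z.2 =
      -(2 * p.ν * b z.2 ^ 2 / (Y + b z.2)) := by
    field_simp; ring
  rw [e, abs_neg, abs_of_nonneg (by positivity), div_le_iff₀ hd]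
  have hb2 : b z.2 ^ 2 ≤ B ^ 2 := by
    rw [← sq_abs]; exact pow_le_pow_left₀ (abs_nonneg _) hb 2
  calc 2 * p.ν * b z.2 ^ 2 ≤ 2 * p.ν * B ^ 2 := by gcongr
    _ = 4 * p.ν * B ^ 2 * Y⁻¹ * (Y / 2) := by field_simp; ring
    _ ≤ _ := by gcongr

lemma tendsto_of_robin {β b : E3 → ℝ} (hβ : ContDiff ℝ ∞ β) {B R : ℝ} (hRp : p.rp < R)
    (hB : ∀ y, ‖y‖ = 1 → |b y| ≤ B) (hR : 2 * B ≤ R ^ (2 * p.ν)) (hb : ∀ y, β y = 2 * p.ν * b y)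
    (hq : p.IsTwist (p.robinTwist b R)) (h : IsWeakDeriv p.X u du)
    (hu : MemLp (fun z => u (pol z)) 2 (polMeasure p.rp))
    (hr : MemLp (twistRad (3 / 2 - p.ν) u du) 2 (polMeasure p.rp))
    (h0 : TendsToZeroOnSphere
      fun r y => p.preTracePlus u du r y + (β y : ℂ) * p.preTraceMinus u r y)
    (n : ℕ) (j : Fin (angDim n)) :
    Tendsto (fun r => ((r ^ (2 * p.ν + 1 + (3 / 2 - p.ν)) : ℝ) : ℂ) * ((((r ^ 2)⁻¹ : ℝ) : ℂ) *
      coef n j (twistFull (3 / 2 - p.ν) (p.robinTwist b R) u du) r)) essAtTop (𝓝 0) := by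
  have hν := p.ν_pos
  have hrp := p.rp_pos
  obtain ⟨K, hK, hKb⟩ := exists_sphere_bound p.ν_pos rfl hrp h hu hr
  have hang := memLp_sphere_of_continuous (angFun_contDiff n j).continuous
  have hβang := memLp_sphere_of_continuous (hβ.continuous.mul (angFun_contDiff n j).continuous)
  set S := Real.sqrt (K * ∫ y, ‖((angFun n j (y : E3) : ℝ) : ℂ)‖ ^ 2 ∂sphereMeasure)
  have hB0 : 0 ≤ B := (abs_nonneg _).trans (hB (basisVec 0) (by simp))
  have hW := h0 (fun y => (angFun n j y : ℂ))
    (ofRealCLM.contDiff.comp (angFun_contDiff n j))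
  have hlim : Tendsto (fun r : ℝ => 4 * p.ν * B ^ 2 * r ^ (-(2 * p.ν)) * S) essAtTop (𝓝 0) := by
    have h1 := ((tendsto_rpow_neg_atTop (y := 2 * p.ν) (by linarith)).const_mul
      (4 * p.ν * B ^ 2)).mul_const S
    rw [mul_zero, zero_mul] at h1
    exact h1.mono_left inf_le_left
  have hsum := hW.norm.add hlim
  rw [norm_zero, add_zero] at hsum
  refine squeeze_zero_norm' ?_ hsum
  have a1 : ∀ᵐ r ∂(volume : Measure ℝ), r ∈ Ioi p.rp →
      MemLp (fun y => twistRad (3 / 2 - p.ν) u du (r, y)) 2 sphereMeasure :=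
    (ae_restrict_iff' measurableSet_Ioi).1 (ae_memLp_slice hr)
  have a2 : ∀ᵐ r ∂(volume : Measure ℝ), r ∈ Ioi p.rp →
      MemLp (fun y => u (pol (r, y))) 2 sphereMeasure :=
    (ae_restrict_iff' measurableSet_Ioi).1 (ae_memLp_slice hu)
  have a3 : ∀ᵐ r ∂(volume : Measure ℝ), r ∈ Ioi p.rp →
      MemLp (fun y => twistFull (3 / 2 - p.ν) (p.robinTwist b R) u du (r, y)) 2 sphereMeasure :=
    (ae_restrict_iff' measurableSet_Ioi).1 (ae_memLp_slice (memLp_twistFull hq h hu hr))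
  filter_upwards [a1.filter_mono inf_le_right, a2.filter_mono inf_le_right,
    a3.filter_mono inf_le_right, hKb.filter_mono inf_le_right,
    (eventually_gt_atTop (R + 1)).filter_mono inf_le_left] with r b1 b2 b3 b4 hrR
  have hrc : r ∈ Ioi p.rp := by simp only [mem_Ioi]; linarith
  have hr0 : 0 < r := hrp.trans hrc
  have hrc' : (r : ℂ) ≠ 0 := by exact_mod_cast hr0.ne'
  replace b1 := b1 hrc
  replace b2 := b2 hrc
  replace b3 := b3 hrc
  replace b4 := b4 (show r ∈ Ioi (p.rp + 1) by simp only [mem_Ioi]; linarith)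
  set f₁ : S2 → ℂ := fun y => (p.preTracePlus u du r y + (β y : ℂ) * p.preTraceMinus u r y) *
    (angFun n j y : ℂ) with hf₁
  set f₀ : S2 → ℂ := fun y => ((r ^ (2 * p.ν + 1 + (3 / 2 - p.ν)) : ℝ) : ℂ) *
    ((((r ^ 2)⁻¹ : ℝ) : ℂ) * ((angFun n j y : ℂ) *
      twistFull (3 / 2 - p.ν) (p.robinTwist b R) u du (r, y))) with hf₀
  have e₀ : ((r ^ (2 * p.ν + 1 + (3 / 2 - p.ν)) : ℝ) : ℂ) * ((((r ^ 2)⁻¹ : ℝ) : ℂ) *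
      coef n j (twistFull (3 / 2 - p.ν) (p.robinTwist b R) u du) r) = ∫ y, f₀ y ∂sphereMeasure := by
    rw [hf₀, coef, fib, integral_const_mul, integral_const_mul]
  have hpp : ∀ y : S2, p.preTracePlus u du r y =
      ((r ^ (2 * p.ν + 1) * r ^ (3 / 2 - p.ν) : ℝ) : ℂ) * ((((r ^ 2)⁻¹ : ℝ) : ℂ) *
        twistRad (3 / 2 - p.ν) u du (r, y)) := fun y => by
    rw [twistRad_eq (z := (r, y)) hr0, preTracePlus, norm_pol (z := (r, y)) hr0.le]
    simp only [pol]
    push_cast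
    field_simp
  have i₀ : Integrable f₀ sphereMeasure := by
    have := ((integrable_mul_of_memLp hang b3).const_mul (((r ^ 2)⁻¹ : ℝ) : ℂ)).const_mul
      ((r ^ (2 * p.ν + 1 + (3 / 2 - p.ν)) : ℝ) : ℂ)
    refine this.congr (.of_forall fun y => ?_)
    simp only [hf₀]; ring
  have i₁ : Integrable f₁ sphereMeasure := by
    have t1 := ((integrable_mul_of_memLp hang b1).const_mul (((r ^ 2)⁻¹ : ℝ) : ℂ)).const_mul
      ((r ^ (2 * p.ν + 1) * r ^ (3 / 2 - p.ν) : ℝ) : ℂ)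
    have t2 := (integrable_mul_of_memLp hβang b2).const_mul ((r ^ (3 / 2 - p.ν) : ℝ) : ℂ)
    refine (t1.add t2).congr (.of_forall fun y => ?_)
    simp only [hf₁, Pi.add_apply, Pi.mul_apply, hpp, preTraceMinus, pol, ofReal_mul]
    ring
  have hdiff : ∀ y, ‖f₀ y - f₁ y‖ ≤ 4 * p.ν * B ^ 2 * r ^ (-(2 * p.ν)) * (r ^ (3 / 2 - p.ν) *
      (‖u (pol (r, y))‖ * ‖((angFun n j (y : E3) : ℝ) : ℂ)‖)) := fun y => by
    have e : f₀ y - f₁ y = ((r ^ (2 * p.ν + 1) * p.robinTwist b R (pol (r, y)) -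
        2 * p.ν * b y : ℝ) : ℂ) * (((r ^ (3 / 2 - p.ν) : ℝ) : ℂ) *
        (u (pol (r, y)) * (angFun n j y : ℂ))) := by
      simp only [hf₀, hf₁, hpp, twistFull, preTraceMinus, hb, Real.rpow_add hr0 (2 * p.ν + 1), pol]
      push_cast
      field_simp
      ring
    rw [e, norm_mul, norm_mul, norm_mul, norm_real, norm_real, Real.norm_eq_abs,
      Real.norm_of_nonneg (Real.rpow_nonneg hr0.le _)]
    exact mul_le_mul_of_nonneg_right (abs_robinTwist_sub_le (z := (r, y)) (hrp.trans hRp) hB hR hrR)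
      (by positivity)
  rw [e₀, show ∫ y, f₀ y ∂sphereMeasure = ∫ y, f₁ y ∂sphereMeasure +
    ∫ y, (f₀ y - f₁ y) ∂sphereMeasure by rw [integral_sub i₀ i₁]; ring]
  refine (norm_add_le _ _).trans (add_le_add le_rfl ?_)
  have iun : Integrable (fun y => ‖u (pol (r, y))‖ * ‖((angFun n j (y : E3) : ℝ) : ℂ)‖)
      sphereMeasure := b2.norm.integrable_mul hang.ofReal.norm
  refine (norm_integral_le_of_norm_le ((iun.const_mul _).const_mul _)
    (Eventually.of_forall hdiff)).trans ?_
  rw [integral_const_mul, integral_const_mul]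
  refine mul_le_mul_of_nonneg_left (Real.le_sqrt_of_sq_le ?_) (by positivity)
  rw [mul_pow]
  have hcs := sq_integral_mul_norm_le b2 (hang.ofReal (K := ℂ))
  calc _ ≤ (r ^ (3 / 2 - p.ν)) ^ 2 * ((∫ y, ‖u (pol (r, y))‖ ^ 2 ∂sphereMeasure) *
        ∫ y, ‖((angFun n j (y : E3) : ℝ) : ℂ)‖ ^ 2 ∂sphereMeasure) :=
        mul_le_mul_of_nonneg_left hcs (by positivity)
    _ = (r ^ (2 * (3 / 2 - p.ν)) * ∫ y, ‖u (pol (r, y))‖ ^ 2 ∂sphereMeasure) *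
        ∫ y, ‖((angFun n j (y : E3) : ℝ) : ℂ)‖ ^ 2 ∂sphereMeasure := by
      rw [← Real.rpow_natCast, ← Real.rpow_mul hr0.le]
      push_cast; ring_nf
    _ ≤ _ := mul_le_mul_of_nonneg_right b4 (integral_nonneg fun y => by positivity)

lemma flux_robinTwist {β b : E3 → ℝ} (hβ : ContDiff ℝ ∞ β) {B R : ℝ} (hRp : p.rp < R)
    (hB : ∀ y, ‖y‖ = 1 → |b y| ≤ B) (hR : 2 * B ≤ R ^ (2 * p.ν)) (hb : ∀ y, β y = 2 * p.ν * b y)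
    (hq : p.IsTwist (p.robinTwist b R)) (h : IsWeakDeriv p.X u du)
    (hu : MemLp (fun z => u (pol z)) 2 (polMeasure p.rp))
    (hr : MemLp (twistRad (3 / 2 - p.ν) u du) 2 (polMeasure p.rp)) {k : ℤ}
    (hk : ∀ᵐ z ∂polMeasure p.rp, angD 2 du z = I * (k : ℂ) * u (pol z)) (l : ℂ)
    (h0 : TendsToZeroOnSphere
      fun r y => p.preTracePlus u du r y + (β y : ℂ) * p.preTraceMinus u r y)
    (n : ℕ) (j : Fin (angDim n)) :
    Tendsto (fun N : ℕ => (N : ℝ)⁻¹ * ∫ r in Icc (N : ℝ) (2 * N),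
      ‖coef n j (p.fluxRad l (p.robinTwist b R) u du) r‖ *
        ‖coef n j (fun z => u (pol z)) r‖) atTop (𝓝 0) := by
  obtain ⟨C, hC, hA⟩ := exists_coef_fluxRad_le hq h hu hr hk l
  refine flux_of_tendsto p.ν_pos rfl p.rp_pos h hu hr ?_ hC
    (tendsto_of_robin hβ hRp hB hR hb hq h hu hr h0 n j)
  filter_upwards [hA n j, ae_restrict_mem measurableSet_Ioi] with r h1 h2
  have hr0 : 0 < r := p.rp_pos.trans h2
  refine h1.trans (le_of_eq ?_)
  rw [norm_mul, norm_real, Real.norm_of_nonneg (by positivity)]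
  field_simp

end Params

/-- The twist adapted to a boundary operator. -/
lemma BoundaryOp.exists_twist {B : BoundaryOp} (hB : B.Admissible) (p : Params) :
    ∃ q, p.IsTwist q ∧ ∀ (u : E3 → ℂ) (du : E3 → E3 →L[ℝ] ℂ) (k : ℤ) (l : ℂ), IsWeakDeriv p.X u du →
      MemLp (fun z => u (pol z)) 2 (polMeasure p.rp) →
      MemLp (twistRad (3 / 2 - p.ν) u du) 2 (polMeasure p.rp) →
      (∀ᵐ z ∂polMeasure p.rp, angD 2 du z = I * (k : ℂ) * u (pol z)) →
      (p.ν < 1 → B.Holds p u du) → ∀ n j,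
      Tendsto (fun N : ℕ => (N : ℝ)⁻¹ * ∫ r in Icc (N : ℝ) (2 * N),
        ‖coef n j (p.fluxRad l q u du) r‖ * ‖coef n j (fun z => u (pol z)) r‖) atTop (𝓝 0) := by
  by_cases hν : p.ν < 1
  · cases B with
    | dirichlet => exact ⟨0, p.isTwist_zero, fun u du k l h hu hr hk hbc n j =>
        Params.flux_twist_zero h hu hr hk l (Or.inr (hbc hν)) n j⟩
    | robin β =>
      obtain ⟨hβ, -⟩ : ContDiff ℝ ∞ β ∧ _ := hB
      have hν0 := p.ν_pos
      obtain ⟨C, hC⟩ := (isCompact_sphere (0 : E3) 1).exists_bound_of_continuousOn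
        hβ.continuous.continuousOn
      set b : E3 → ℝ := fun y => (2 * p.ν)⁻¹ * β y
      have hbB : ∀ y, ‖y‖ = 1 → |b y| ≤ (2 * p.ν)⁻¹ * |C| := fun y hy => by
        rw [abs_mul, abs_of_pos (by positivity)]
        exact mul_le_mul_of_nonneg_left ((hC y (by simpa using hy)).trans (le_abs_self C))
          (by positivity)
      set K := (2 * p.ν)⁻¹ * |C|
      obtain ⟨R, hRK, hRp⟩ := ((tendsto_rpow_atTop (y := 2 * p.ν)
        (by positivity)).eventually_ge_atTop (2 * K) |>.and (eventually_gt_atTop p.rp)).exists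
      have hq := p.isTwist_robinTwist (contDiff_const.mul hβ) hRp hbB hRK
      exact ⟨_, hq, fun u du k l h hu hr hk hbc n j => Params.flux_robinTwist hβ hRp hbB hRK
        (fun y => by simp only [b]; field_simp) hq h hu hr hk l (hbc hν) n j⟩
  · exact ⟨0, p.isTwist_zero, fun u du k l h hu hr hk _ n j =>
      Params.flux_twist_zero h hu hr hk l (Or.inl (not_lt.1 hν)) n j⟩

/-- From the energy inequality to the resolvent bound, for the norms. -/
lemma norm_le_of_energy_le {c C A U N s t K : ℝ} (hc : 0 < c) (hs : 1 ≤ s) (hsC : 2 * C / c ≤ s)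
    (ht : 0 < t) (hU : 0 ≤ U) (hN : 0 ≤ N) (hA : K ^ 2 ≤ N * U)
    (h : t * (c * s ^ 2 - C) * U ≤ s * K) (hAs : A ≤ 2 * s) :
    t * c * A * Real.sqrt U ≤ 4 * Real.sqrt N := by
  have hs0 : 0 < s := by linarith
  have h1 : c * s ^ 2 / 2 ≤ c * s ^ 2 - C := by
    rw [div_le_iff₀ hc] at hsC
    nlinarith [mul_le_mul_of_nonneg_left hs (mul_nonneg hc.le hs0.le)]
  have h2 : K ≤ Real.sqrt N * Real.sqrt U := by
    rw [← Real.sqrt_mul hN]; exact (le_abs_self K).trans (Real.abs_le_sqrt hA)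
  set x := Real.sqrt U
  set y := Real.sqrt N
  have hx : U = x ^ 2 := (Real.sq_sqrt hU).symm
  have hx0 : 0 ≤ x := Real.sqrt_nonneg _
  have hy0 : 0 ≤ y := Real.sqrt_nonneg _
  rcases hx0.eq_or_lt with hx1 | hx1
  · rw [← hx1]; simpa using hy0
  have h3 : t * (c * s ^ 2 / 2) * x ^ 2 ≤ s * (y * x) := by
    rw [← hx]
    exact (mul_le_mul_of_nonneg_right (mul_le_mul_of_nonneg_left h1 ht.le) hU).trans
      (h.trans (mul_le_mul_of_nonneg_left h2 hs0.le))
  have h4 : t * c * s * x ≤ 2 * y := by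
    have h5 : (s * x) * (t * c * s * x) ≤ (s * x) * (2 * y) := by nlinarith
    exact le_of_mul_le_mul_left h5 (by positivity)
  have h6 : t * c * A * x ≤ t * c * (2 * s) * x := by gcongr
  linarith

namespace Params

variable {p : Params}

lemma exists_resolvent_le {B : BoundaryOp} (hB : B.Admissible) (k : ℤ) :
    ∃ C₀ : ℝ, 0 < C₀ ∧ ∃ C : ℝ, 0 < C ∧ ∀ l : ℂ, C₀ < |l.re| → 0 < l.im → ∀ u : E3 → ℂ,
      p.MemDomain B u → p.InMode k u → ∀ F, p.MemL2 F → p.IsP l u F →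
        p.normL2 u ≤ C / (‖l‖ * l.im) * p.normL2 F := by
  obtain ⟨q, hq, hflux⟩ := B.exists_twist hB p
  obtain ⟨c, C, hc, hC, hen⟩ := exists_energy_le hq k
  obtain ⟨c₁, C₁, hc₁, hC₁, hnorm⟩ := p.exists_norm_bounds
  set b : ℝ := k * p.Ω
  refine ⟨2 * |b| + 2 * (2 * C / c + 1), by positivity, 4 * Real.sqrt C₁ * Real.sqrt c₁ / c,
    by positivity, fun l hl hli u hu hk F hF hP => ?_⟩
  obtain ⟨du, hH, -, hbc⟩ := hu
  obtain ⟨hr, ha⟩ := hH.memLp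
  have hup := hH.memL2.pol
  have hka := hk.angD_eq hH.weakDeriv
  have hW := weakSystem hq hH.weakDeriv hup hr ha hF hP
    (hflux u du k l hH.weakDeriv hup hr hka hbc)
  have hE := hen l hli u F du hW hF.pol hka
  have hcs := sq_integral_mul_norm_le hF.pol hup
  have hlre := abs_re_le_norm l
  have hσ : ‖l‖ ≤ ‖l - (b : ℂ)‖ + |b| := by
    have := norm_add_le (l - (b : ℂ)) (b : ℂ)
    rwa [sub_add_cancel, norm_real, Real.norm_eq_abs] at this
  have hCc : 0 ≤ 2 * C / c := by positivity
  have hb0 := abs_nonneg b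
  have hmain := norm_le_of_energy_le hc (s := ‖l - (b : ℂ)‖) (A := ‖l‖) (by linarith) (by linarith)
    hli (integral_nonneg fun z => by positivity) (integral_nonneg fun z => by positivity) hcs hE
    (by linarith)
  obtain ⟨hu1, -⟩ := hnorm u hH.memL2
  obtain ⟨-, hF2⟩ := hnorm F hF
  set U := ∫ z, ‖u (pol z)‖ ^ 2 ∂polMeasure p.rp
  set N := ∫ z, ‖F (pol z)‖ ^ 2 ∂polMeasure p.rp
  have hu0 : 0 ≤ p.normL2 u := ENNReal.toReal_nonneg
  have hF0 : 0 ≤ p.normL2 F := ENNReal.toReal_nonneg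
  have g1 : p.normL2 u ≤ Real.sqrt C₁ * Real.sqrt U := by
    rw [← Real.sqrt_mul hC₁.le]; exact Real.le_sqrt_of_sq_le hu1
  have g2 : Real.sqrt N ≤ Real.sqrt c₁ * p.normL2 F := by
    refine (Real.sqrt_le_sqrt hF2).trans (le_of_eq ?_)
    rw [Real.sqrt_mul hc₁.le, Real.sqrt_sq hF0]
  have hl0 : 0 < ‖l‖ := by linarith
  refine g1.trans ?_
  rw [div_mul_eq_mul_div, le_div_iff₀ (by positivity), div_mul_eq_mul_div, le_div_iff₀ hc]
  calc Real.sqrt C₁ * Real.sqrt U * (‖l‖ * l.im) * c =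
        Real.sqrt C₁ * (l.im * c * ‖l‖ * Real.sqrt U) := by ring
    _ ≤ Real.sqrt C₁ * (4 * (Real.sqrt c₁ * p.normL2 F)) := by
      refine mul_le_mul_of_nonneg_left (hmain.trans ?_) (Real.sqrt_nonneg _)
      linarith
    _ = _ := by ring

end Params

end KerrAdS

end

theorem proposition2p1 (p : KerrAdS.Params) (B : KerrAdS.BoundaryOp) (hB : B.Admissible) (k : ℤ) :
    ∃ C₀ : ℝ, 0 < C₀ ∧ ∃ C : ℝ, 0 < C ∧
      ∀ l : ℂ, C₀ < |l.re| → 0 < l.im →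
        ∀ u : KerrAdS.E3 → ℂ, p.MemDomain B u → p.InMode k u →
          (∃ F, p.MemL2 F ∧ p.IsP l u F) ∧
          ∀ F, p.MemL2 F → p.IsP l u F →
            p.normL2 u ≤ C / (‖l‖ * l.im) * p.normL2 F := by
  obtain ⟨C₀, hC₀, C, hC, h⟩ := KerrAdS.Params.exists_resolvent_le (p := p) hB k
  refine ⟨C₀, hC₀, C, hC, fun l hl hli u hu hk => ⟨?_, h l hl hli u hu hk⟩⟩
  obtain ⟨du, hH, ⟨F, hF, hP⟩, -⟩ := hu
  exact KerrAdS.Params.exists_isP hH.weakDeriv hH.memL2 hH.memLp.1 hH.memLp.2 hF hP l
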